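/- **Setting.** Let $M$ be a smooth (Hausdorff) 4-manifold with a hyper-Kähler structure given by a smooth triple of closed 2-forms $\Sigma^i$, $i=1,2,3$, which is perfect: $\Sigma^i\wedge\Sigma^j=2\delta^{ij}v_\Sigma$, where $v_\Sigma=\frac16\Sigma^k\wedge\Sigma^k$ vanishes nowhere and the metric defined by $g_{\mu\nu}v_\Sigma=-\frac1{12}\epsilon^{ijk}\tilde\epsilon^{\alpha\beta\gamma\delta}\Sigma^i_{\mu\alpha}\Sigma^j_{\nu\beta}\Sigma^k_{\gamma\delta}$ is positive definite (so that $\Sigma^i{}_\mu{}^\alpha\Sigma^j{}_\alpha{}^\nu=-\delta^{ij}\delta_\mu^\nu+\epsilon^{ijk}\Sigma^k{}_\mu{}^\nu$). Indices are moved with $g$, $\nabla$ is its Levi-Civita connection, $\star$ its Hodge star, and $TM$ is identified with $\Lambda^1$. Let $E=\mathbb R^3$ be the trivial bundle and let $S\subset E\otimes\Lambda^2$ be the tangent space at $\Sigma$ to the perfect triples, i.e. the triples $\sigma^i$ with $\Sigma^i\wedge\sigma^j+\sigma^i\wedge\Sigma^j=\frac23\delta^{ij}\,\Sigma^k\wedge\sigma^k$.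 The formula $$\sigma^i=2\epsilon^{ijk}\Sigma^jh^k+2h_{[\mu}{}^{\alpha}\Sigma^i_{|\alpha|\nu]},\qquad h_{\mu\nu}=\tilde h_{\mu\nu}+\tfrac14 g_{\mu\nu}h,$$ identifies $S$ with $\Lambda^0\oplus E\oplus{\rm Sym}^2_0(\Lambda^1)\ni(h,h^i,\tilde h)$ (this is part of the claim, smooth sections corresponding to smooth components). Define $$\begin{aligned}&d_1\xi=d(\xi\lrcorner\Sigma^i),\qquad d_2\sigma=J_1^{-1}(\star d\sigma),\qquad d_3a=\epsilon^{ijk}\Sigma^j\wedge da^k/v_\Sigma,\\ &\Phi(a)_\mu=\Sigma^i{}_\mu{}^\alpha a^i_\alpha,\qquad \Phi^*(\xi)^i_\mu=\tfrac12\Sigma^i{}_\mu{}^\alpha\xi_\alpha,\qquad J_1(a)^i_\mu=\epsilon^{ijk}\Sigma^j{}_\mu{}^\alpha a^k_\alpha,\end{aligned}$$ with $(\star d\sigma)^i_\mu=\frac12\epsilon_\mu{}^{\alpha\beta\gamma}\partial_\alpha\sigma^i_{\beta\gamma}$. Formal adjoints are taken with respect to the pairings $$\begin{aligned}&\langle\xi,\xi\rangle=\int|\xi|^2\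 \text{on }TM,\qquad \langle\sigma,\sigma\rangle=\int\tfrac14(\sigma^i_{\mu\nu})^2-\tfrac1{72}(\Sigma^{i\mu\nu}\sigma^i_{\mu\nu})^2\ \text{on }S,\\ &\langle a,a\rangle=\int\epsilon^{ijk}\Sigma^i\wedge a^j\wedge a^k\ \text{on }E\otimes\Lambda^1\ \text{(indefinite)},\qquad \langle\chi,\chi\rangle=\int\chi^i\chi^i\ \text{on }E,\end{aligned}$$ integrals of functions being against the Riemannian volume. Let $\Delta$ act on $S\oplus E$ as minus the Hodge Laplacian $d\delta+\delta d$ on each 2-form $\sigma^i$ and as the Laplace–Beltrami operator on each function $\chi^i$ (so $\Delta=\partial^\mu\partial_\mu$ in flat space). **Theorem.** (1) The form $\frac14(\sigma^i_{\mu\nu})^2-\frac1{72}(\Sigma^{i\mu\nu}\sigma^i_{\mu\nu})^2$ is a (positive definite) inner product on $S$. The operators $d_1,d_2,d_3$ take values in $S$, $E\otimes\Lambda^1$, $E$ and have first-order formal adjoints; explicitly $d_1^*\sigma=\frac12\Phi(\delta\sigma')$ with $\sigma'=\sigma-\frac1{18}(\Sigma^{j\mu\nu}\sigma^j_{\mu\nu})\Sigma$,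 $d_2^*a=-2(P+2P_1)(\star da)$ with $P$, $P_1$ the orthogonal projections of $E\otimes\Lambda^2$ onto $S$ and onto the multiples of $\Sigma$, and $d_3^*\chi=d\chi$. The operators $$\tilde d_1=\tfrac1{\sqrt2}(d_1-d_2^*\Phi^*),\qquad \tilde d_3=\tfrac1{\sqrt2}d_3J_1,\qquad \tilde d_4=-\Phi d_3^*$$ have formal adjoints $\tilde d_1^*=\frac1{\sqrt2}(d_1^*-\Phi d_2)$, $\tilde d_3^*=\frac1{\sqrt2}J_1d_3^*$, $\tilde d_4^*=-d_3\Phi^*$. (2) The first-order operator $$\tilde D=\begin{pmatrix}\tilde d_1^*&\tilde d_4\\ d_2&\tilde d_3^*\end{pmatrix}=\begin{pmatrix}\frac1{\sqrt2}(d_1^*-\Phi d_2)&-\Phi d_3^*\\ d_2&\frac1{\sqrt2}J_1d_3^*\end{pmatrix}:\ S\oplus E\to TM\oplus(E\otimes\Lambda^1)$$ has the formal adjoint $$\tilde D^*=\begin{pmatrix}\tilde d_1&d_2^*\\ \tilde d_4^*&\tilde d_3\end{pmatrix}.$$ (3) In the components $(h,h^i,\chi^i,\tilde h)$ of $S\oplus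 E$ let $$T_1(h,h_+,h_-,\tilde h)=\bigl(h,\tfrac14(h_++h_-),\tfrac1{\sqrt2}(h_+-h_-),\tilde h\bigr),$$ and on $TM\oplus(E\otimes\Lambda^1)$ let $T_2(\xi,a)=(\xi+\sqrt2\,\Phi(a),\,a-\sqrt2\,\Phi^*(\xi))$. These are invertible linear bundle maps, and for all smooth $(h,h_+,h_-,\tilde h)$ $$\tilde D^*\tilde D\,T_1(h,h_+,h_-,\tilde h)=\Delta\,T_1(h,h_+,-h_-,-\tilde h);$$ that is, $\tilde D^*\tilde D=\pm\Delta$, with $+$ on $T_1(\Lambda^0\oplus E)\ni T_1(h,h_+,0,0)$ and $-$ on $T_1(E\oplus{\rm Sym}^2_0)\ni T_1(0,0,h_-,\tilde h)$. (4) $T_2\tilde DT_1=D_4\oplus D_{12}$, where $D_4:\Lambda^0\oplus E\to\Lambda^1$ and $D_{12}:E\oplus{\rm Sym}^2_0(\Lambda^1)\to E\otimes\Lambda^1$ are $$D_4(h,h_+)_\mu=-\tfrac1{\sqrt2}\bigl(\partial_\mu h-2\Sigma^i{}_\mu{}^\alpha\partial_\alpha h_+^i\bigr),$$ $$D_{12}(h_-,\tilde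 h)^i_\mu=\partial_\mu h_-^i+\Sigma^i{}_\mu{}^\alpha\nabla^\beta\tilde h_{\alpha\beta}-\Sigma^{i\alpha\beta}\nabla_\alpha\tilde h_{\mu\beta}.$$ (5) $D_4$ and $D_{12}$ are Dirac operators. Near every point there are local frames $\theta^a$ in which $\Sigma^i=\theta^0\wedge\theta^i-\frac12\epsilon^{ijk}\theta^j\wedge\theta^k$. In any such frame, let $S_\pm$ be the two-component spinors with Clifford matrices $S_-\to S_+$ equal to $(1,\mathrm i\tau^1,\mathrm i\tau^2,\mathrm i\tau^3)$, $\tau^i$ the Pauli matrices, and adjoint matrices $S_+\to S_-$, and with the Levi-Civita spin connection. The standard isomorphisms given by these matrices and the invariant spinor $\epsilon^{AB}$ (after complexification), $$\begin{aligned}&\Lambda^0\oplus E\cong S_+\otimes S_+,&&\Lambda^1\cong S_-\otimes S_+,\\&E\oplus{\rm Sym}^2_0(\Lambda^1)\cong S_-\otimes S_-\otimes S_+^2,&&E\otimes\Lambda^1\cong S_+\otimes S_-\otimes S_+^2,\end{aligned}$$ carry $D_4$, applied to $(h,h_+)$, to $-\frac1{\sqrt2}$ times the Dirac operator $S_+\otimes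 S_+\to S_-\otimes S_+$ applied to the spinor of $(h,-2h_+)$, and carry $D_{12}$ to the Dirac operator $S_-\otimes(S_-\otimes S_+^2)\to S_+\otimes(S_-\otimes S_+^2)$. -/

import Mathlib

open scoped Manifold ContDiff Kronecker Matrix

noncomputable section

namespace Plebanski

/-! ### Pointwise algebra

Each tangent space `T_x M` of a 4-manifold is modelled on `V4`.  Tensors are handled through their
components in the standard basis of `V4`; all expressions below are full tensor contractions. -/

/-- The model space of a 4-manifold. -/
abbrev V4 : Type := EuclideanSpace ℝ (Fin 4)

/-- Alternating `k`-forms on `V4`. -/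
abbrev Alt (k : ℕ) : Type := V4 [⋀^Fin k]→L[ℝ] ℝ

/-- Bilinear forms on `V4`. -/
abbrev Bil : Type := V4 →L[ℝ] V4 →L[ℝ] ℝ

/-- The standard basis vectors. -/
def bv (μ : Fin 4) : V4 := EuclideanSpace.single μ 1

/-- Components `α_μ` of a 1-form. -/
def c1 (α : Alt 1) (μ : Fin 4) : ℝ := α ![bv μ]

/-- Components `η_{μν}` of a 2-form. -/
def c2 (η : Alt 2) (μ ν : Fin 4) : ℝ := η ![bv μ, bv ν]

/-- Components `Ω_{μνρ}` of a 3-form. -/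
def c3 (Ω : Alt 3) (μ ν ρ : Fin 4) : ℝ := Ω ![bv μ, bv ν, bv ρ]

/-- The 1-form attached to a linear functional. -/
def ofLin (l : V4 →L[ℝ] ℝ) : Alt 1 := ContinuousAlternatingMap.ofSubsingleton ℝ V4 ℝ (0 : Fin 1) l

/-- The coordinate functional `dx^μ`. -/
def dx (μ : Fin 4) : V4 →L[ℝ] ℝ := EuclideanSpace.proj μ

/-- The 1-form with components `c_μ`. -/
def mk1 (c : Fin 4 → ℝ) : Alt 1 := ∑ μ, c μ • ofLin (dx μ)

/-- The 2-form `dx^μ ∧ dx^ν`. -/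
def dx2 (μ ν : Fin 4) : Alt 2 :=
  ContinuousAlternatingMap.alternatizeUncurryFin ((dx μ).smulRight (ofLin (dx ν)))

/-- The 2-form `(1/2) c_{μν} dx^μ ∧ dx^ν`; its components are the antisymmetric part of `c`. -/
def mk2 (c : Fin 4 → Fin 4 → ℝ) : Alt 2 := (1 / 2 : ℝ) • ∑ μ, ∑ ν, c μ ν • dx2 μ ν

/-- The Levi-Civita symbol in three dimensions. -/
def eps3 (i j k : Fin 3) : ℝ :=
  Matrix.det (Matrix.of fun m n : Fin 3 => if ![i, j, k] m = n then (1 : ℝ) else 0)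

/-- The Levi-Civita symbol in four dimensions (components `0, 1, -1` in any basis). -/
def eps4 (μ ν ρ σ : Fin 4) : ℝ :=
  Matrix.det (Matrix.of fun m n : Fin 4 => if ![μ, ν, ρ, σ] m = n then (1 : ℝ) else 0)

/-- The component `0123` of the 4-form `α ∧ β`, for 2-forms `α`, `β`. -/
def wedge22 (α β : Alt 2) : ℝ :=
  (1 / 4) * ∑ μ, ∑ ν, ∑ ρ, ∑ σ, eps4 μ ν ρ σ * c2 α μ ν * c2 β ρ σ

/-- The component `0123` of the 4-form `η ∧ α ∧ β`, for a 2-form `η` and 1-forms `α`, `β`. -/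
def wedge211 (η : Alt 2) (α β : Alt 1) : ℝ :=
  (1 / 2) * ∑ μ, ∑ ν, ∑ ρ, ∑ σ, eps4 μ ν ρ σ * c2 η μ ν * c1 α ρ * c1 β σ

/-- A triple of 2-forms at a point, or an element of `E ⊗ Λ²`, where `E = ℝ³`. -/
abbrev Trip : Type := Fin 3 → Alt 2

/-- An element of `E ⊗ Λ¹`. -/
abbrev ELam : Type := Fin 3 → Alt 1

/-- The component `0123` of the volume form `v_Σ = (1/6) Σ^i ∧ Σ^i`. -/
def vol (S : Trip) : ℝ := (1 / 6) * ∑ i, wedge22 (S i) (S i)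

/-- The metric `g_{μν}` of a perfect triple,
`g_{μν} v_Σ = -(1/12) ε^{ijk} ε^{αβγδ} Σ^i_{μα} Σ^j_{νβ} Σ^k_{γδ}`.
The factor is the one for which the endomorphisms `Σ^i_μ^α` obey
`Σ^i_μ^α Σ^j_α^ν = -δ^{ij} δ_μ^ν + ε^{ijk} Σ^k_μ^ν`. -/
def gm (S : Trip) : Matrix (Fin 4) (Fin 4) ℝ := Matrix.of fun μ ν =>
  -(1 / 12) * (∑ i, ∑ j, ∑ k, ∑ α, ∑ β, ∑ γ, ∑ δ,
    eps3 i j k * eps4 α β γ δ * c2 (S i) μ α * c2 (S j) ν β * c2 (S k) γ δ) / vol S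

/-- The inverse metric `g^{μν}`. -/
def gi (S : Trip) : Matrix (Fin 4) (Fin 4) ℝ := (gm S)⁻¹

/-- The endomorphisms `Σ^i_μ^α = Σ^i_{μβ} g^{βα}`. -/
def sgEnd (S : Trip) (i : Fin 3) : Matrix (Fin 4) (Fin 4) ℝ := (Matrix.of (c2 (S i))) * gi S

/-- A perfect triple, with positive definite metric:
`Σ^i ∧ Σ^j = 2 δ^{ij} v_Σ`, with `v_Σ` nonzero. -/
structure IsPerfect (S : Trip) : Prop where
  wedge : ∀ i j, wedge22 (S i) (S j) = if i = j then 2 * vol S else 0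
  vol_ne : vol S ≠ 0
  pos : (gm S).PosDef

/-- The space `S ⊂ E ⊗ Λ²`: the tangent space at `S` to the space of perfect triples, i.e. the
solutions of the linearisation of `Σ^i ∧ Σ^j = (1/3) δ^{ij} Σ^k ∧ Σ^k`. -/
def MemS (S : Trip) (s : Trip) : Prop :=
  ∀ i j, wedge22 (S i) (s j) + wedge22 (s i) (S j) =
    if i = j then (2 / 3) * ∑ k, wedge22 (S k) (s k) else 0

/-- `Φ(a)_μ = Σ^i_μ^α a^i_α`. -/
def Phi (S : Trip) (a : ELam) : Alt 1 :=
  mk1 fun μ => ∑ i, ∑ α, sgEnd S i μ α * c1 (a i) α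

/-- `Φ^*(ξ)^i_μ = (1/2) Σ^i_μ^α ξ_α`. -/
def PhiStar (S : Trip) (ξ : Alt 1) : ELam := fun i =>
  mk1 fun μ => (1 / 2) * ∑ α, sgEnd S i μ α * c1 ξ α

/-- `J₁(a)^i_μ = ε^{ijk} Σ^j_μ^α a^k_α`. -/
def J1 (S : Trip) (a : ELam) : ELam := fun i =>
  mk1 fun μ => ∑ j, ∑ k, ∑ α, eps3 i j k * sgEnd S j μ α * c1 (a k) α

/-- The inverse of `J₁`; since `J₁² = 2 + J₁`, it equals `(1/2)(J₁ - 1)`. -/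
def J1inv (S : Trip) (a : ELam) : ELam := (1 / 2 : ℝ) • (J1 S a - a)

/-- The `E`-valued 1-form `ξ^α Σ^i_{αμ}` (a vector being identified with a 1-form by the
metric). -/
def hook (S : Trip) (ξ : Alt 1) : ELam := fun i =>
  mk1 fun μ => ∑ α, ∑ β, gi S α β * c1 ξ β * c2 (S i) α μ

/-- Hodge star on 2-forms, `(⋆η)_{μν} = (1/2) ε_{μν}^{ρσ} η_{ρσ}`, where
`ε^{αβγδ} = eps4 α β γ δ / vol` is the volume tensor with raised indices. -/
def star2 (S : Trip) (η : Alt 2) : Alt 2 := mk2 fun μ ν =>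
  (1 / (2 * vol S)) * ∑ α, ∑ β, ∑ ρ, ∑ σ,
    gm S μ α * gm S ν β * eps4 α β ρ σ * c2 η ρ σ

/-- Hodge star on 3-forms, `(⋆Ω)_μ = (1/6) ε_μ^{αβγ} Ω_{αβγ}`. -/
def star3 (S : Trip) (Ω : Alt 3) : Alt 1 := mk1 fun μ =>
  (1 / (6 * vol S)) * ∑ l, ∑ α, ∑ β, ∑ γ, gm S μ l * eps4 l α β γ * c3 Ω α β γ

/-- The metric pairing on `Λ¹` (and, by the metric, on `TM`). -/
def ip1 (S : Trip) (ξ η : Alt 1) : ℝ := ∑ μ, ∑ ν, gi S μ ν * c1 ξ μ * c1 η ν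

/-- The full contraction `η_{μν} τ^{μν}`. -/
def contr2 (S : Trip) (η τ : Alt 2) : ℝ :=
  ∑ μ, ∑ ν, ∑ ρ, ∑ σ, gi S μ ρ * gi S ν σ * c2 η μ ν * c2 τ ρ σ

/-- The inner product on `S`, with quadratic form
`(1/4) (σ^i_{μν})² - (1/72) (Σ^{iμν} σ^i_{μν})²`. -/
def ipS (S : Trip) (s t : Trip) : ℝ :=
  (1 / 4) * ∑ i, contr2 S (s i) (t i)
    - (1 / 72) * (∑ i, contr2 S (S i) (s i)) * (∑ i, contr2 S (S i) (t i))

/-- The (indefinite) inner product on `E ⊗ Λ¹`, `ε^{ijk} Σ^i ∧ a^j ∧ b^k / v_Σ`. -/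
def ipA (S : Trip) (a b : ELam) : ℝ :=
  (∑ i, ∑ j, ∑ k, eps3 i j k * wedge211 (S i) (a j) (b k)) / vol S

/-- The inner product on `E`. -/
def ipE (x y : Fin 3 → ℝ) : ℝ := ∑ i, x i * y i

/-- `Sym²₀(Λ¹)`: symmetric bilinear forms with vanishing metric trace. -/
def IsSym0 (S : Trip) (k : Bil) : Prop :=
  (∀ u w, k u w = k w u) ∧ ∑ μ, ∑ ν, gi S μ ν * k (bv μ) (bv ν) = 0

/-- `(k ⋄ Σ^i)_{μν} = k_μ^α Σ^i_{αν} - k_ν^α Σ^i_{αμ}`. -/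
def diamond (S : Trip) (k : Bil) : Trip := fun i => mk2 fun μ ν =>
  ∑ α, ∑ β, (k (bv μ) (bv β) * gi S β α * c2 (S i) α ν
    - k (bv ν) (bv β) * gi S β α * c2 (S i) α μ)

/-- The element of `S` with components `(h, h^i, k) ∈ Λ⁰ ⊕ E ⊕ Sym²₀(Λ¹)`:
`σ^i = 2 ε^{ijk} Σ^j h^k + 2 h_{[μ}^α Σ^i_{|α|ν]}` with `h_{μν} = k_{μν} + (1/4) g_{μν} h`. -/
def param (S : Trip) (h : ℝ) (u : Fin 3 → ℝ) (k : Bil) : Trip := fun i =>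
  (h / 2) • S i + (∑ j, ∑ l, (2 * eps3 i j l * u l) • S j) + diamond S k i

/-- The fibre of `Λ⁰ ⊕ E ⊕ E ⊕ Sym²₀(Λ¹)`, written as `(h, h^i, χ^i, k)`. -/
abbrev Quad : Type := ℝ × (Fin 3 → ℝ) × (Fin 3 → ℝ) × Bil

/-- The identification of `Λ⁰ ⊕ E ⊕ E ⊕ Sym²₀(Λ¹)` with `S ⊕ E`. -/
def iota (S : Trip) (q : Quad) : Trip × (Fin 3 → ℝ) := (param S q.1 q.2.1 q.2.2.2, q.2.2.1)

/-- The linear map `T₁` on `S ⊕ E`, in the components `(h, h^i, χ^i, k)`: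
`(h, h₊, h₋, k) ↦ (h, (h₊ + h₋)/4, (h₊ - h₋)/√2, k)`. -/
def T1 (q : Quad) : Quad :=
  (q.1, (1 / 4 : ℝ) • (q.2.1 + q.2.2.1), (1 / √2 : ℝ) • (q.2.1 - q.2.2.1), q.2.2.2)

/-- The linear map `T₂` on `TM ⊕ E ⊗ Λ¹`: `(ξ, a) ↦ (ξ + √2 Φ(a), a - √2 Φ^*(ξ))`. -/
def T2 (S : Trip) (p : Alt 1 × ELam) : Alt 1 × ELam :=
  (p.1 + √2 • Phi S p.2, p.2 - √2 • PhiStar S p.1)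

/-! ### Fields on a 4-manifold -/

section Fields

universe u

variable {M : Type u} [TopologicalSpace M] [ChartedSpace V4 M]

variable (M) in
/-- Differential `k`-forms on `M`. -/
abbrev Form (k : ℕ) : Type u := ∀ x : M, TangentSpace (𝓡 4) x [⋀^Fin k]→L[ℝ] ℝ

variable (M) in
/-- Covariant 2-tensors on `M`. -/
abbrev Ten2 : Type u := ∀ x : M, TangentSpace (𝓡 4) x →L[ℝ] TangentSpace (𝓡 4) x →L[ℝ] ℝ

/-- The derivative at `z` of the inverse of the chart at `x₀`. -/
def chartD (x₀ : M) (z : V4) : V4 →L[ℝ] V4 :=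
  mfderiv 𝓘(ℝ, V4) (𝓡 4) (extChartAt (𝓡 4) x₀).symm z

/-- The coordinate expression of a form in the chart at `x₀`. -/
def pull {k : ℕ} (η : Form M k) (x₀ : M) (z : V4) : Alt k :=
  ContinuousAlternatingMap.compContinuousLinearMap
    (show Alt k from η ((extChartAt (𝓡 4) x₀).symm z)) (chartD x₀ z)

/-- The coordinate expression of a covariant 2-tensor in the chart at `x₀`. -/
def pullTen (k : Ten2 M) (x₀ : M) (z : V4) : Bil :=
  ContinuousLinearMap.bilinearComp (show Bil from k ((extChartAt (𝓡 4) x₀).symm z))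
    (chartD x₀ z) (chartD x₀ z)

/-- The form `η` is smooth on the set `W`. -/
def SmoothForm {k : ℕ} (η : Form M k) (W : Set M) : Prop :=
  ∀ x₀ : M, ContDiffOn ℝ ∞ (pull η x₀)
    ((extChartAt (𝓡 4) x₀).target ∩ (extChartAt (𝓡 4) x₀).symm ⁻¹' W)

/-- The covariant 2-tensor `k` is smooth. -/
def SmoothTen (k : Ten2 M) : Prop :=
  ∀ x₀ : M, ContDiffOn ℝ ∞ (pullTen k x₀) (extChartAt (𝓡 4) x₀).target

/-- The exterior derivative of a form. -/
def ext {k : ℕ} (η : Form M k) : Form M (k + 1) := fun x =>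
  show Alt (k + 1) from extDeriv (pull η x) (extChartAt (𝓡 4) x x)

/-- The differential of a function, as a 1-form. -/
def extFun (f : M → ℝ) : Form M 1 := fun x =>
  ofLin (show V4 →L[ℝ] ℝ from mfderiv (𝓡 4) 𝓘(ℝ, ℝ) f x)

/-- The differential of a section of the trivial bundle `E = ℝ³`. -/
def extE (χ : M → Fin 3 → ℝ) : Fin 3 → Form M 1 := fun i => extFun fun x => χ x i

/-- The value at `x` of an `E`-valued form. -/
def val {k : ℕ} (s : Fin 3 → Form M k) (x : M) : Fin 3 → Alt k := fun i => s i x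

/-- A hyper-Kähler structure on a 4-manifold: a smooth closed perfect triple. -/
structure IsHyperkahlerTriple (Sg : Fin 3 → Form M 2) : Prop where
  smooth : ∀ i, SmoothForm (Sg i) Set.univ
  closed : ∀ i x, ext (Sg i) x = 0
  perfect : ∀ x, IsPerfect (val Sg x)

/-- The codifferential of a 2-form, `(δη)_ν = -∇^μ η_{μν}`, as `⋆ d ⋆ η` with the stars above. -/
def codiff (Sg : Fin 3 → Form M 2) (η : Form M 2) : Form M 1 := fun x =>
  star3 (val Sg x) (ext (fun y => star2 (val Sg y) (η y)) x)

/-- The Hodge Laplacian `dδ + δd` on 2-forms, with `δd` written as `⋆ d δ ⋆`. -/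
def hodgeLap (Sg : Fin 3 → Form M 2) (η : Form M 2) : Form M 2 := fun x =>
  (show Alt 2 from ext (codiff Sg η) x) +
    star2 (val Sg x) (ext (codiff Sg fun y => star2 (val Sg y) (η y)) x)

/-- The Laplace–Beltrami operator `|g|^{-1/2} ∂_μ (|g|^{1/2} g^{μν} ∂_ν f)` on functions. -/
def beltrami (Sg : Fin 3 → Form M 2) (f : M → ℝ) (x : M) : ℝ :=
  (1 / vol (val Sg x)) * ∑ μ, fderiv ℝ
    (fun z : V4 => vol (fun i => pull (Sg i) x z) *
      ∑ ν, gi (fun i => pull (Sg i) x z) μ ν *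
        fderiv ℝ (fun y => f ((extChartAt (𝓡 4) x).symm y)) z (bv ν))
    (extChartAt (𝓡 4) x x) (bv μ)

/-- The Laplacian `Δ` on `S ⊕ E` (a negative operator, `∂^μ ∂_μ` in the flat case): minus the Hodge
Laplacian on the `E`-valued 2-form, and the Laplace–Beltrami operator on the functions `χ^i`. -/
def Lap (Sg : Fin 3 → Form M 2) (p : (Fin 3 → Form M 2) × (M → Fin 3 → ℝ)) :
    (Fin 3 → Form M 2) × (M → Fin 3 → ℝ) :=
  (fun i x => -hodgeLap Sg (p.1 i) x, fun x i => beltrami Sg (fun y => p.2 y i) x)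

/-! ### The Plebański complex and its adjoints -/

/-- `d₁ ξ = d(ξ ⌟ Σ^i)`. -/
def d1 (Sg : Fin 3 → Form M 2) (ξ : Form M 1) : Fin 3 → Form M 2 := fun i =>
  ext fun x => hook (val Sg x) (ξ x) i

/-- `d₂ σ = J₁⁻¹(⋆ dσ) = (1/2) J₁⁻¹(ε_μ^{αβγ} ∂_α σ^i_{βγ})`. -/
def d2 (Sg : Fin 3 → Form M 2) (s : Fin 3 → Form M 2) : Fin 3 → Form M 1 := fun i x =>
  J1inv (val Sg x) (fun j => star3 (val Sg x) (ext (s j) x)) i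

/-- `d₃ a = ε^{ijk} Σ^j ∧ da^k / v_Σ`. -/
def d3 (Sg : Fin 3 → Form M 2) (a : Fin 3 → Form M 1) : M → Fin 3 → ℝ := fun x i =>
  (∑ j, ∑ k, eps3 i j k * wedge22 (Sg j x) (ext (a k) x)) / vol (val Sg x)

/-- The adjoint of `d₁`:
`d₁^* σ = (1/2) Φ(δσ')` with `σ' = σ - (1/18) (Σ^{jμν} σ^j_{μν}) Σ`. -/
def d1s (Sg : Fin 3 → Form M 2) (s : Fin 3 → Form M 2) : Form M 1 := fun x =>
  (1 / 2 : ℝ) • Phi (val Sg x) fun i => codiff Sg (fun y =>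
    (show Alt 2 from s i y) -
      ((1 / 18) * ∑ j, contr2 (val Sg y) (Sg j y) (s j y)) • (show Alt 2 from Sg i y)) x

/-- The map `-2 (P + 2 P₁)` on `E ⊗ Λ²`, where `P` is the orthogonal projection onto `S` and `P₁`
the one onto the multiples of `Σ`. -/
def liftS (S : Trip) (s : Trip) : Trip := fun i =>
  (-2 : ℝ) • (s i
    - (∑ j, ((1 / 8) * (contr2 S (s i) (S j) + contr2 S (s j) (S i))) • S j)
    + ((1 / 4) * ∑ j, contr2 S (s j) (S j)) • S i)

/-- The adjoint of `d₂`, for the inner product `ipA` on `E ⊗ Λ¹`. -/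
def d2s (Sg : Fin 3 → Form M 2) (a : Fin 3 → Form M 1) : Fin 3 → Form M 2 := fun i x =>
  liftS (val Sg x) (fun j => star2 (val Sg x) (ext (a j) x)) i

/-- The adjoint of `d₃`: `d₃^* χ = dχ`. -/
def d3s (χ : M → Fin 3 → ℝ) : Fin 3 → Form M 1 := extE χ

/-- `Φ` on fields. -/
def PhiF (Sg : Fin 3 → Form M 2) (a : Fin 3 → Form M 1) : Form M 1 := fun x =>
  Phi (val Sg x) (val a x)

/-- `Φ^*` on fields. -/
def PhiStarF (Sg : Fin 3 → Form M 2) (ξ : Form M 1) : Fin 3 → Form M 1 := fun i x =>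
  PhiStar (val Sg x) (ξ x) i

/-- `J₁` on fields. -/
def J1F (Sg : Fin 3 → Form M 2) (a : Fin 3 → Form M 1) : Fin 3 → Form M 1 := fun i x =>
  J1 (val Sg x) (val a x) i

/-! ### The twisted operator -/

/-- `d̃₁ = (d₁ - d₂^* Φ^*)/√2`. -/
def dt1 (Sg : Fin 3 → Form M 2) (ξ : Form M 1) : Fin 3 → Form M 2 :=
  (1 / √2 : ℝ) • (d1 Sg ξ - d2s Sg (PhiStarF Sg ξ))

/-- `d̃₁^* = (d₁^* - Φ d₂)/√2`. -/
def dt1s (Sg : Fin 3 → Form M 2) (s : Fin 3 → Form M 2) : Form M 1 :=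
  (1 / √2 : ℝ) • (d1s Sg s - PhiF Sg (d2 Sg s))

/-- `d̃₃ = d₃ J₁/√2`. -/
def dt3 (Sg : Fin 3 → Form M 2) (a : Fin 3 → Form M 1) : M → Fin 3 → ℝ :=
  (1 / √2 : ℝ) • d3 Sg (J1F Sg a)

/-- `d̃₃^* = J₁ d₃^*/√2`. -/
def dt3s (Sg : Fin 3 → Form M 2) (χ : M → Fin 3 → ℝ) : Fin 3 → Form M 1 :=
  (1 / √2 : ℝ) • J1F Sg (d3s χ)

/-- `d̃₄ = -Φ d₃^*`. -/
def dt4 (Sg : Fin 3 → Form M 2) (χ : M → Fin 3 → ℝ) : Form M 1 := -PhiF Sg (d3s χ)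

/-- `d̃₄^* = -d₃ Φ^*`. -/
def dt4s (Sg : Fin 3 → Form M 2) (ξ : Form M 1) : M → Fin 3 → ℝ := -d3 Sg (PhiStarF Sg ξ)

/-- `D̃(σ, χ) = (d̃₁^* σ + d̃₄ χ, d₂ σ + d̃₃^* χ)`. -/
def Dt (Sg : Fin 3 → Form M 2) (p : (Fin 3 → Form M 2) × (M → Fin 3 → ℝ)) :
    Form M 1 × (Fin 3 → Form M 1) :=
  (dt1s Sg p.1 + dt4 Sg p.2, d2 Sg p.1 + dt3s Sg p.2)

/-- `D̃^*(ξ, a) = (d̃₁ ξ + d₂^* a, d̃₄^* ξ + d̃₃ a)`. -/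
def Dts (Sg : Fin 3 → Form M 2) (p : Form M 1 × (Fin 3 → Form M 1)) :
    (Fin 3 → Form M 2) × (M → Fin 3 → ℝ) :=
  (dt1 Sg p.1 + d2s Sg p.2, dt4s Sg p.1 + dt3 Sg p.2)

/-- `D₄(h, h₊) = -(1/√2) (dh - 2 Φ(dh₊))`, i.e. `-(1/√2) (∂_μ h - 2 Σ^i_μ^α ∂_α h₊^i)`. -/
def D4 (Sg : Fin 3 → Form M 2) (h : M → ℝ) (u : M → Fin 3 → ℝ) : Form M 1 :=
  (-(1 / √2) : ℝ) • (extFun h - (2 : ℝ) • PhiF Sg (extE u))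

/-- `D₁₂(h₋, k)^i_ν = ∂_ν h₋^i - ∇^μ (k ⋄ Σ^i)_{μν}`, i.e.
`∂_μ h₋^i + Σ^i_μ^α ∇^β k_{αβ} - Σ^{iαβ} ∇_α k_{μβ}`. -/
def D12 (Sg : Fin 3 → Form M 2) (w : M → Fin 3 → ℝ) (k : Ten2 M) : Fin 3 → Form M 1 :=
  extE w + fun i => codiff Sg fun x => diamond (val Sg x) (k x) i

/-- The field on `S ⊕ E` with components `T₁(h, h₊, h₋, k)`. -/
def quadField (Sg : Fin 3 → Form M 2) (h : M → ℝ) (u w : M → Fin 3 → ℝ) (k : Ten2 M) :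
    (Fin 3 → Form M 2) × (M → Fin 3 → ℝ) :=
  (fun i x => (iota (val Sg x) (T1 (h x, u x, w x, k x))).1 i,
    fun x => (iota (val Sg x) (T1 (h x, u x, w x, k x))).2)

/-- `T₂` on fields. -/
def T2F (Sg : Fin 3 → Form M 2) (p : Form M 1 × (Fin 3 → Form M 1)) :
    Form M 1 × (Fin 3 → Form M 1) :=
  (fun x => (T2 (val Sg x) (p.1 x, val p.2 x)).1, fun i x => (T2 (val Sg x) (p.1 x, val p.2 x)).2 i)

/-! ### Formal adjoints -/

variable (M) in
/-- The data of a bundle with a fibre pairing that enter the definition of a formal adjoint: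
the type of (not necessarily smooth) fields, those which take values in the bundle, the smooth
ones, those which vanish at a point, and the pointwise pairing. -/
structure SecSpace where
  Fld : Type u
  mem : Fld → Prop
  smooth : Fld → Prop
  zeroAt : Fld → M → Prop
  ip : Fld → Fld → M → ℝ

/-- Sections of `TM`, identified with `Λ¹`. -/
def secT (Sg : Fin 3 → Form M 2) : SecSpace M where
  Fld := Form M 1
  mem _ := True
  smooth ξ := SmoothForm ξ Set.univ
  zeroAt ξ x := ξ x = 0
  ip ξ η x := ip1 (val Sg x) (ξ x) (η x)

/-- Sections of `S`. -/
def secS (Sg : Fin 3 → Form M 2) : SecSpace M where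
  Fld := Fin 3 → Form M 2
  mem s := ∀ x, MemS (val Sg x) (val s x)
  smooth s := ∀ i, SmoothForm (s i) Set.univ
  zeroAt s x := ∀ i, s i x = 0
  ip s t x := ipS (val Sg x) (val s x) (val t x)

/-- Sections of `E ⊗ Λ¹`. -/
def secA (Sg : Fin 3 → Form M 2) : SecSpace M where
  Fld := Fin 3 → Form M 1
  mem _ := True
  smooth a := ∀ i, SmoothForm (a i) Set.univ
  zeroAt a x := ∀ i, a i x = 0
  ip a b x := ipA (val Sg x) (val a x) (val b x)

variable (M) in
/-- Sections of `E`. -/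
def secE : SecSpace M where
  Fld := M → Fin 3 → ℝ
  mem _ := True
  smooth χ := ContMDiff (𝓡 4) 𝓘(ℝ, Fin 3 → ℝ) ∞ χ
  zeroAt χ x := χ x = 0
  ip χ η x := ipE (χ x) (η x)

/-- Sections of a direct sum. -/
def SecSpace.prod (X Y : SecSpace M) : SecSpace M where
  Fld := X.Fld × Y.Fld
  mem p := X.mem p.1 ∧ Y.mem p.2
  smooth p := X.smooth p.1 ∧ Y.smooth p.2
  zeroAt p x := X.zeroAt p.1 x ∧ Y.zeroAt p.2 x
  ip p q x := X.ip p.1 q.1 x + Y.ip p.2 q.2 x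

/-- The integral, against the Riemannian volume, of a function over the domain of the chart at
`x₀`. -/
def chartInt (Sg : Fin 3 → Form M 2) (x₀ : M) (f : M → ℝ) : ℝ :=
  ∫ z in (extChartAt (𝓡 4) x₀).target,
    f ((extChartAt (𝓡 4) x₀).symm z) * |vol (fun i => pull (Sg i) x₀ z)|

/-- `Q` is the formal adjoint of `P`: `∫ ⟨P s, t⟩ = ∫ ⟨s, Q t⟩` for all smooth sections `s`, `t`,
where `s` vanishes outside a compact subset of a coordinate domain (by a partition of unity, the
same identity then holds over `M` for every compactly supported `s`). -/
def IsFormalAdjoint (Sg : Fin 3 → Form M 2) (X Y : SecSpace M)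
    (P : X.Fld → Y.Fld) (Q : Y.Fld → X.Fld) : Prop :=
  (∀ s, X.smooth s → X.mem s → Y.mem (P s)) ∧
  (∀ t, Y.smooth t → Y.mem t → X.mem (Q t)) ∧
  ∀ (x₀ : M) (K : Set M), IsCompact K → K ⊆ (extChartAt (𝓡 4) x₀).source →
    ∀ s t, X.smooth s → X.mem s → Y.smooth t → Y.mem t → (∀ x, x ∉ K → X.zeroAt s x) →
      chartInt Sg x₀ (Y.ip (P s) t) = chartInt Sg x₀ (X.ip s (Q t))

/-! ### Spinors and Dirac operators -/

/-- The standard triple `Σ^i = θ⁰ ∧ θ^i - (1/2) ε^{ijk} θ^j ∧ θ^k`, in components. -/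
def eta : Fin 3 → Matrix (Fin 4) (Fin 4) ℝ :=
  ![!![0, 1, 0, 0; -1, 0, 0, 0; 0, 0, 0, -1; 0, 0, 1, 0],
    !![0, 0, 1, 0; 0, 0, 0, 1; -1, 0, 0, 0; 0, -1, 0, 0],
    !![0, 0, 0, 1; 0, 0, -1, 0; 0, 1, 0, 0; -1, 0, 0, 0]]

/-- A local frame `e_a` on the open set `W`, with dual coframe `θ^a`, in which `Σ^i` has its
standard form (such a frame is orthonormal for the metric of the triple). -/
structure AdaptedFrame (Sg : Fin 3 → Form M 2) (W : Set M) where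
  e : Fin 4 → ∀ x : M, TangentSpace (𝓡 4) x
  θ : Fin 4 → Form M 1
  isOpen : IsOpen W
  smooth : ∀ a, SmoothForm (θ a) W
  dual : ∀ x ∈ W, ∀ a b, θ a x ![e b x] = if a = b then 1 else 0
  std : ∀ x ∈ W, ∀ i a b, Sg i x ![e a x, e b x] = eta i a b

variable {Sg : Fin 3 → Form M 2} {W : Set M}

/-- `dθ^a(e_b, e_c)`. -/
def AdaptedFrame.str (F : AdaptedFrame Sg W) (x : M) (a b c : Fin 4) : ℝ :=
  ext (F.θ a) x ![F.e b x, F.e c x]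

/-- The Levi-Civita connection coefficients `A_{ab}(e_c) = g(e_a, ∇_{e_c} e_b)`: the solution of
`dθ^a + A_{ab} ∧ θ^b = 0`, `A_{ab} = -A_{ba}`. -/
def AdaptedFrame.conn (F : AdaptedFrame Sg W) (x : M) (c a b : Fin 4) : ℝ :=
  (1 / 2) * (F.str x a b c - F.str x b a c - F.str x c a b)

/-- The Pauli matrices. -/
def pauli : Fin 3 → Matrix (Fin 2) (Fin 2) ℂ :=
  ![!![0, 1; 1, 0], !![0, -Complex.I; Complex.I, 0], !![1, 0; 0, -1]]

/-- Clifford multiplication by `e_a`, as a map `S₋ → S₊`: `1` for `a = 0`, and `i` times the Pauli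
matrices. -/
def cl : Fin 4 → Matrix (Fin 2) (Fin 2) ℂ := Fin.cons 1 fun i => Complex.I • pauli i

/-- Clifford multiplication by `e_a`, as a map `S₊ → S₋`: the adjoint of `cl a`, so that
`cl a * clBar b + cl b * clBar a = 2 δ_{ab}`. -/
def clBar (a : Fin 4) : Matrix (Fin 2) (Fin 2) ℂ := (cl a)ᴴ

/-- The spin connection on `S₊`, along `e_c`: `(1/4) A_{ab}(e_c) γ^a γ^b`. -/
def AdaptedFrame.connP (F : AdaptedFrame Sg W) (x : M) (c : Fin 4) : Matrix (Fin 2) (Fin 2) ℂ :=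
  ∑ a, ∑ b, ((1 / 4 * F.conn x c a b : ℝ) : ℂ) • (cl a * clBar b)

/-- The spin connection on `S₋`, along `e_c`. -/
def AdaptedFrame.connM (F : AdaptedFrame Sg W) (x : M) (c : Fin 4) : Matrix (Fin 2) (Fin 2) ℂ :=
  ∑ a, ∑ b, ((1 / 4 * F.conn x c a b : ℝ) : ℂ) • (clBar a * cl b)

/-- The entrywise derivative of a matrix-valued function along `e_a`. -/
def AdaptedFrame.deriv (F : AdaptedFrame Sg W) {m n : Type} (Ψ : M → Matrix m n ℂ) (x : M)
    (a : Fin 4) : Matrix m n ℂ :=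
  Matrix.of fun i j => (show V4 →L[ℝ] ℂ from mfderiv (𝓡 4) 𝓘(ℝ, ℂ) (fun y => Ψ y i j) x) (F.e a x)

/-- The Dirac operator `γ^a ∇_a : S₊ ⊗ W → S₋ ⊗ W`, where the connection of `W` has the matrices `Γ`
along the frame. -/
def AdaptedFrame.diracP (F : AdaptedFrame Sg W) {n : Type} [Fintype n]
    (Γ : M → Fin 4 → Matrix n n ℂ) (Ψ : M → Matrix (Fin 2) n ℂ) (x : M) : Matrix (Fin 2) n ℂ :=
  ∑ a, clBar a * (F.deriv Ψ x a + F.connP x a * Ψ x + Ψ x * (Γ x a)ᵀ)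

/-- The Dirac operator `γ^a ∇_a : S₋ ⊗ W → S₊ ⊗ W`. -/
def AdaptedFrame.diracM (F : AdaptedFrame Sg W) {n : Type} [Fintype n]
    (Γ : M → Fin 4 → Matrix n n ℂ) (Ψ : M → Matrix (Fin 2) n ℂ) (x : M) : Matrix (Fin 2) n ℂ :=
  ∑ a, cl a * (F.deriv Ψ x a + F.connM x a * Ψ x + Ψ x * (Γ x a)ᵀ)

/-- The spin connection on `S₋ ⊗ S₊ ⊗ S₊`, which preserves `S₋ ⊗ S₊²`. -/
def AdaptedFrame.connW (F : AdaptedFrame Sg W) (x : M) (a : Fin 4) :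
    Matrix (Fin 2 × Fin 2 × Fin 2) (Fin 2 × Fin 2 × Fin 2) ℂ :=
  F.connM x a ⊗ₖ (1 : Matrix (Fin 2 × Fin 2) (Fin 2 × Fin 2) ℂ) +
    (1 : Matrix (Fin 2) (Fin 2) ℂ) ⊗ₖ
      (F.connP x a ⊗ₖ (1 : Matrix (Fin 2) (Fin 2) ℂ) +
        (1 : Matrix (Fin 2) (Fin 2) ℂ) ⊗ₖ F.connP x a)

/-- The invariant spinor `ε^{AB}`. -/
def epsS : Matrix (Fin 2) (Fin 2) ℂ := !![0, 1; -1, 0]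

/-- The isomorphism `E → S₊²` (complexified). -/
def spinE (u : Fin 3 → ℂ) : Matrix (Fin 2) (Fin 2) ℂ := ∑ i, u i • (Complex.I • pauli i * epsS)

/-- The isomorphism `Λ⁰ ⊕ E → S₊ ⊗ S₊` (complexified). -/
def spin4 (p : ℂ × (Fin 3 → ℂ)) : Matrix (Fin 2) (Fin 2) ℂ := p.1 • epsS + spinE p.2

/-- The isomorphism `Λ¹ → S₋ ⊗ S₊` (complexified), in the components along the frame. -/
def spinV (α : Fin 4 → ℂ) : Matrix (Fin 2) (Fin 2) ℂ := ∑ a, α a • (clBar a * epsS)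

/-- The isomorphism `E ⊕ Sym²₀(Λ¹) → S₋ ⊗ S₋ ⊗ S₊²` (complexified), in the components along the
frame. -/
def spin12 (p : (Fin 3 → ℂ) × Matrix (Fin 4) (Fin 4) ℂ) :
    Matrix (Fin 2) (Fin 2 × Fin 2 × Fin 2) ℂ :=
  Matrix.of fun A q => epsS A q.1 * spinE p.1 q.2.1 q.2.2 -
    ∑ a, ∑ b, p.2 a b * (clBar a * epsS) A q.2.1 * (clBar b * epsS) q.1 q.2.2

/-- The isomorphism `E ⊗ Λ¹ → S₊ ⊗ S₋ ⊗ S₊²` (complexified), in the components along the frame. -/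
def spinA (O : Fin 3 → Fin 4 → ℂ) : Matrix (Fin 2) (Fin 2 × Fin 2 × Fin 2) ℂ :=
  Matrix.of fun A q => ∑ i, ∑ a,
    O i a * (cl a * epsS) A q.1 * (Complex.I • pauli i * epsS) q.2.1 q.2.2

/-- Tensors `Ψ^{A B C D}` symmetric in the last two indices. -/
def SymLast : Set (Matrix (Fin 2) (Fin 2 × Fin 2 × Fin 2) ℂ) :=
  {Ψ | ∀ A B C D, Ψ A (B, C, D) = Ψ A (B, D, C)}

/-- The components of a 1-form along the frame. -/
def AdaptedFrame.comp (F : AdaptedFrame Sg W) (α : Form M 1) (x : M) (a : Fin 4) : ℂ :=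
  ((α x ![F.e a x] : ℝ) : ℂ)

/-- The spinor field of `(h, u) ∈ Λ⁰ ⊕ E`. -/
def spinField4 (h : M → ℝ) (u : M → Fin 3 → ℝ) (x : M) : Matrix (Fin 2) (Fin 2) ℂ :=
  spin4 ((h x : ℂ), fun i => (u x i : ℂ))

/-- The spinor field of `(w, k) ∈ E ⊕ Sym²₀(Λ¹)`. -/
def AdaptedFrame.spinField12 (F : AdaptedFrame Sg W) (w : M → Fin 3 → ℝ) (k : Ten2 M) (x : M) :
    Matrix (Fin 2) (Fin 2 × Fin 2 × Fin 2) ℂ :=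
  spin12 (fun i => (w x i : ℂ), Matrix.of fun a b => ((k x (F.e a x) (F.e b x) : ℝ) : ℂ))

end Fields

end Plebanski

end

/-!
At each point a perfect triple `Σ^i` satisfies the quaternion relations (`sgEnd_mul`), because of a
Clifford-type identity between antisymmetric `4 × 4` matrices and their duals (`mul_til_add`). Thus
`Λ¹` carries three anticommuting orthogonal complex structures `J_i`, the self-dual 2-forms are
spanned by the `Σ^i`, and the anti-self-dual ones commute with the `J_i`. For `k` in `Sym²₀(Λ¹)` the
forms `k ⋄ Σ^i` are, as endomorphisms, the anticommutators of `k` with `J_i`; they are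
anti-self-dual, and `k ↦ k ⋄ Σ` is a bijection onto the anti-self-dual triples (`diamond_compK`).
This gives the components of the sections of `S`.

*Adjoints.* For each of `d₁`, `d₂`, `d₃` the difference of the two sides of the adjunction is
pointwise a combination of densities `dα ∧ η - α ∧ dη` (`adj_d1`, `adj_d2`, `adj_d3`), whose
integrals vanish (`null_stokes`). The adjoints of the twisted operators follow by composition with
the pointwise adjoints of `Φ` and `J₁`.

*The square.* The operator `D̃^*` depends on `(ξ, a)` only through the twisted components
`p = ξ + √2 Φ(a)` and `b = a - √2 Φ^*(ξ)`: the anti-self-dual part of `D̃^*(ξ, a)` is that of `db`,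
and everything else is a divergence of some `J_i p`, of `p`, or of some `b_i` (`asd_dtsForm`,
`contr2_dtsForm`, `divS_twist`). On the other hand, for `D̃ T₁(h, u, w, k)` these components are, up
to constants, `dh - 2 Σ_i J_i du_i` and `dw_i - ⋆d(k ⋄ Σ^i)` (`twist_q`). This is the splitting into
`D₄` and `D₁₂`; it only needs the algebra of the `J_i` (`twist_algebra`) and `⋆d(f Σ^j) = J_j df`,
which holds since `Σ^j` is closed. The same closedness makes the fields `J_i df` divergence-free
(`divA_Jl_dfA`), so that in the composition only Laplace–Beltrami operators of the coefficients and
the anti-self-dual part of `d⋆d(k ⋄ Σ^i)` are left, and these are the two parts of the Hodge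
Laplacian. Hence neither the Levi-Civita connection nor a curvature identity enters here.

*Dirac operators.* An adapted frame is obtained from a unit 1-form `θ⁰` by applying the complex
structures (`exists_adaptedFrame`). In such a frame `dΣ^i = 0` says that the connection form is
anti-self-dual (`conn_asd`); therefore the spin connection on `S₊` vanishes, and the one on `S₋`
carries the whole connection. The isomorphisms with spinors are explicit finite-dimensional maps,
and the identification of `D₄` and `D₁₂` with Dirac operators amounts to identities of symbols
(`spinV_symbol`, `spinA_symbol`), once `⋆d(k ⋄ Σ^i)` has been written with the covariant derivative
of `k` (`vec_diamond`, `codiff_diamond`).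
-/

open scoped Topology

noncomputable section

namespace Plebanski

/-! ### Components of alternating forms -/

lemma bv_apply (μ ν : Fin 4) : bv μ ν = if μ = ν then 1 else 0 := by
  simp [bv, eq_comm]

lemma sum_bv (v : V4) : v = ∑ μ, v μ • bv μ := by
  ext ν
  simp [bv_apply]

@[simp] lemma dx_bv (μ ν : Fin 4) : dx μ (bv ν) = if ν = μ then 1 else 0 := by
  simp [dx, bv_apply]

@[simp] lemma ofLin_apply (l : V4 →L[ℝ] ℝ) (v : Fin 1 → V4) : ofLin l v = l (v 0) := by
  simp [ofLin]

@[simp] lemma c1_add (α β : Alt 1) : c1 (α + β) = c1 α + c1 β := rfl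
@[simp] lemma c1_neg (α : Alt 1) : c1 (-α) = -c1 α := rfl
@[simp] lemma c1_smul (r : ℝ) (α : Alt 1) : c1 (r • α) = r • c1 α := rfl
@[simp] lemma c1_zero : c1 0 = 0 := rfl

/-- The components of a 1-form, as a linear map. -/
def c1L : Alt 1 →ₗ[ℝ] (Fin 4 → ℝ) where
  toFun := c1
  map_add' _ _ := rfl
  map_smul' _ _ := rfl

@[simp] lemma c1_sum {ι : Type*} (s : Finset ι) (f : ι → Alt 1) :
    c1 (∑ i ∈ s, f i) = ∑ i ∈ s, c1 (f i) := map_sum c1L f s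

lemma c1_ofLin (l : V4 →L[ℝ] ℝ) (μ : Fin 4) : c1 (ofLin l) μ = l (bv μ) := by simp [c1]

@[simp] lemma c1_mk1 (c : Fin 4 → ℝ) : c1 (mk1 c) = c := by
  ext μ
  simp [mk1, c1_ofLin]

/-- Expansion of a form along the basis in one of its slots. -/
lemma alt_expand {k : ℕ} (η : Alt k) (v : Fin k → V4) (i : Fin k) :
    η v = ∑ μ, v i μ * η (Function.update v i (bv μ)) := by
  let L : V4 →ₗ[ℝ] ℝ := η.toMultilinearMap.toLinearMap v i
  have hL : ∀ u, L u = η (Function.update v i u) := fun u => rfl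
  have h : η v = L (v i) := by rw [hL, Function.update_eq_self]
  rw [h]
  conv_lhs => rw [sum_bv (v i)]
  rw [map_sum]
  refine Finset.sum_congr rfl fun μ _ => ?_
  rw [map_smul, hL, smul_eq_mul]

lemma alt1_apply (α : Alt 1) (v : Fin 1 → V4) : α v = ∑ μ, (v 0) μ * c1 α μ := by
  rw [alt_expand α v 0]
  refine Finset.sum_congr rfl fun μ _ => ?_
  have e : Function.update v 0 (bv μ) = ![bv μ] := by ext i; fin_cases i; simp
  rw [e]
  rfl

lemma alt1_ext {α β : Alt 1} (h : c1 α = c1 β) : α = β := by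
  ext v
  rw [alt1_apply, alt1_apply, h]

@[simp] lemma mk1_c1 (α : Alt 1) : mk1 (c1 α) = α := alt1_ext (c1_mk1 _)

/-- The matrix of components of a 2-form. -/
def m2 (η : Alt 2) : Matrix (Fin 4) (Fin 4) ℝ := Matrix.of (c2 η)

lemma m2_apply (η : Alt 2) (μ ν : Fin 4) : m2 η μ ν = c2 η μ ν := rfl

@[simp] lemma c2_smul (r : ℝ) (α : Alt 2) : c2 (r • α) = r • c2 α := rfl

/-- The components of a 2-form, as a linear map. -/
def m2L : Alt 2 →ₗ[ℝ] Matrix (Fin 4) (Fin 4) ℝ where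
  toFun := m2
  map_add' _ _ := rfl
  map_smul' _ _ := rfl

@[simp] lemma m2_add (α β : Alt 2) : m2 (α + β) = m2 α + m2 β := rfl
@[simp] lemma m2_neg (α : Alt 2) : m2 (-α) = -m2 α := rfl
@[simp] lemma m2_smul (r : ℝ) (α : Alt 2) : m2 (r • α) = r • m2 α := rfl
@[simp] lemma m2_zero : m2 0 = 0 := rfl

@[simp] lemma m2_sum {ι : Type*} (s : Finset ι) (f : ι → Alt 2) :
    m2 (∑ i ∈ s, f i) = ∑ i ∈ s, m2 (f i) := map_sum m2L f s

@[simp] lemma c2_sum {ι : Type*} (s : Finset ι) (f : ι → Alt 2) :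
    c2 (∑ i ∈ s, f i) = ∑ i ∈ s, c2 (f i) := map_sum m2L f s

lemma alt2_swap (η : Alt 2) (v w : V4) : η ![v, w] = -η ![w, v] := by
  have h := η.toAlternatingMap.map_swap ![w, v] (i := 0) (j := 1) (by decide)
  have e : ![w, v] ∘ (Equiv.swap (0 : Fin 2) 1) = ![v, w] := by
    ext i
    fin_cases i <;> simp
  rw [e] at h
  exact h

lemma c2_swap (η : Alt 2) (μ ν : Fin 4) : c2 η μ ν = -c2 η ν μ := alt2_swap _ _ _

lemma m2_transpose (η : Alt 2) : (m2 η)ᵀ = -m2 η := by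
  ext μ ν
  exact c2_swap η ν μ

lemma dx2_apply (μ ν : Fin 4) (v w : V4) : dx2 μ ν ![v, w] = v μ * w ν - w μ * v ν := by
  simp [dx2, ContinuousAlternatingMap.alternatizeUncurryFin_apply, Fin.sum_univ_two,
    Fin.removeNth_apply, dx]
  ring

lemma c2_mk2 (c : Fin 4 → Fin 4 → ℝ) (μ ν : Fin 4) :
    c2 (mk2 c) μ ν = (c μ ν - c ν μ) / 2 := by
  have h : ∀ ρ σ, c2 (dx2 ρ σ) μ ν =
      (if μ = ρ then 1 else 0) * (if ν = σ then 1 else 0) -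
        (if ν = ρ then 1 else 0) * (if μ = σ then 1 else 0) := by
    intro ρ σ
    simp [c2, dx2_apply, bv_apply]
  simp only [mk2, c2_smul, c2_sum, Pi.smul_apply, Finset.sum_apply, smul_eq_mul, h]
  simp [mul_sub, Finset.sum_sub_distrib]
  ring

lemma m2_mk2 (c : Matrix (Fin 4) (Fin 4) ℝ) (hc : cᵀ = -c) : m2 (mk2 c) = c := by
  ext μ ν
  have h : c ν μ = -c μ ν := congrFun (congrFun hc μ) ν
  have h2 := c2_mk2 (fun μ ν => c μ ν) μ ν
  rw [h] at h2
  exact h2.trans (by ring)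

lemma alt2_apply (η : Alt 2) (v w : V4) : η ![v, w] = ∑ μ, ∑ ν, v μ * w ν * c2 η μ ν := by
  rw [alt_expand η ![v, w] 0]
  refine Finset.sum_congr rfl fun μ _ => ?_
  rw [alt_expand η _ 1, Finset.mul_sum]
  refine Finset.sum_congr rfl fun ν _ => ?_
  have e : Function.update (Function.update ![v, w] 0 (bv μ)) 1 (bv ν) = ![bv μ, bv ν] := by
    ext i; fin_cases i <;> simp
  rw [e]
  simp [c2, mul_assoc]

lemma alt2_ext {α β : Alt 2} (h : m2 α = m2 β) : α = β := by
  ext v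
  have hv : v = ![v 0, v 1] := by ext i; fin_cases i <;> rfl
  rw [hv, alt2_apply, alt2_apply]
  simp only [← m2_apply, h]

lemma mk2_m2 (η : Alt 2) : mk2 (m2 η) = η := alt2_ext (m2_mk2 _ (m2_transpose η))

lemma mk2_c2 (η : Alt 2) : mk2 (c2 η) = η := mk2_m2 η

/-! ### Pull-back by a linear map -/

/-- The matrix of a linear map of `V4`. -/
def lmat (A : V4 →L[ℝ] V4) : Matrix (Fin 4) (Fin 4) ℝ := Matrix.of fun μ ν => A (bv ν) μ

/-- Pull-back of forms by a linear map. -/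
abbrev pb {k : ℕ} (A : V4 →L[ℝ] V4) (η : Alt k) : Alt k := η.compContinuousLinearMap A

lemma c1_pb (A : V4 →L[ℝ] V4) (α : Alt 1) : c1 (pb A α) = (lmat A)ᵀ *ᵥ c1 α := by
  ext ν
  simp only [c1, Matrix.mulVec, dotProduct, Matrix.transpose_apply, lmat, Matrix.of_apply]
  rw [ContinuousAlternatingMap.compContinuousLinearMap_apply, alt1_apply]
  rfl

lemma m2_pb (A : V4 →L[ℝ] V4) (η : Alt 2) : m2 (pb A η) = (lmat A)ᵀ * m2 η * lmat A := by
  ext μ ν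
  have e : A ∘ ![bv μ, bv ν] = ![A (bv μ), A (bv ν)] := by ext i; fin_cases i <;> rfl
  rw [m2_apply, c2, ContinuousAlternatingMap.compContinuousLinearMap_apply, e, alt2_apply,
    Finset.sum_comm]
  simp only [Matrix.mul_apply, Matrix.transpose_apply, lmat, Matrix.of_apply, Finset.sum_mul,
    m2_apply]
  refine Finset.sum_congr rfl fun ρ _ => Finset.sum_congr rfl fun σ _ => by ring

lemma c3_apply_perm (Ω : Alt 3) : ∀ μ ν ρ, c3 Ω μ ν ρ = -c3 Ω ν μ ρ ∧ c3 Ω μ ν ρ = -c3 Ω μ ρ ν := by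
  intro μ ν ρ
  constructor
  · have h := Ω.toAlternatingMap.map_swap ![bv ν, bv μ, bv ρ] (i := 0) (j := 1) (by decide)
    have e : ![bv ν, bv μ, bv ρ] ∘ (Equiv.swap (0 : Fin 3) 1) = ![bv μ, bv ν, bv ρ] := by
      ext i
      fin_cases i <;> simp [Equiv.swap_apply_of_ne_of_ne]
    rw [e] at h
    exact h
  · have h := Ω.toAlternatingMap.map_swap ![bv μ, bv ρ, bv ν] (i := 1) (j := 2) (by decide)
    have e : ![bv μ, bv ρ, bv ν] ∘ (Equiv.swap (1 : Fin 3) 2) = ![bv μ, bv ν, bv ρ] := by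
      ext i
      fin_cases i <;> simp [Equiv.swap_apply_of_ne_of_ne]
    rw [e] at h
    exact h

lemma alt3_apply (Ω : Alt 3) (u v w : V4) :
    Ω ![u, v, w] = ∑ μ, ∑ ν, ∑ ρ, u μ * v ν * w ρ * c3 Ω μ ν ρ := by
  rw [alt_expand Ω ![u, v, w] 0]
  refine Finset.sum_congr rfl fun μ _ => ?_
  rw [alt_expand Ω _ 1, Finset.mul_sum]
  refine Finset.sum_congr rfl fun ν _ => ?_
  rw [alt_expand Ω _ 2, Finset.mul_sum, Finset.mul_sum]
  refine Finset.sum_congr rfl fun ρ _ => ?_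
  have e : Function.update (Function.update (Function.update ![u, v, w] 0 (bv μ)) 1 (bv ν)) 2 (bv ρ)
      = ![bv μ, bv ν, bv ρ] := by
    ext i; fin_cases i <;> simp
  rw [e]
  simp [c3, mul_assoc]

lemma c3_pb (A : V4 →L[ℝ] V4) (Ω : Alt 3) (μ ν ρ : Fin 4) :
    c3 (pb A Ω) μ ν ρ =
      ∑ μ', ∑ ν', ∑ ρ', lmat A μ' μ * lmat A ν' ν * lmat A ρ' ρ * c3 Ω μ' ν' ρ' := by
  have e : A ∘ ![bv μ, bv ν, bv ρ] = ![A (bv μ), A (bv ν), A (bv ρ)] := by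
    ext i; fin_cases i <;> rfl
  rw [c3, ContinuousAlternatingMap.compContinuousLinearMap_apply, e, alt3_apply]
  rfl

/-! ### Exterior derivatives in components -/

lemma differentiableAt_c1 {θ : V4 → Alt 1} {z : V4} (h : DifferentiableAt ℝ θ z) (μ : Fin 4) :
    DifferentiableAt ℝ (fun y => c1 (θ y) μ) z :=
  ((ContinuousAlternatingMap.apply ℝ V4 ℝ ![bv μ]).differentiableAt).comp z h

lemma differentiableAt_c2 {θ : V4 → Alt 2} {z : V4} (h : DifferentiableAt ℝ θ z) (μ ν : Fin 4) :
    DifferentiableAt ℝ (fun y => c2 (θ y) μ ν) z :=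
  ((ContinuousAlternatingMap.apply ℝ V4 ℝ ![bv μ, bv ν]).differentiableAt).comp z h

lemma extDeriv_apply_one {θ : V4 → Alt 1} {z : V4} (h : DifferentiableAt ℝ θ z) (u v : V4) :
    extDeriv θ z ![u, v] =
      fderiv ℝ (fun y => θ y ![v]) z u - fderiv ℝ (fun y => θ y ![u]) z v := by
  have e0 : (0 : Fin 2).removeNth ![u, v] = ![v] := by ext i; fin_cases i; rfl
  have e1 : (1 : Fin 2).removeNth ![u, v] = ![u] := by ext i; fin_cases i; rfl
  rw [extDeriv_apply h, Fin.sum_univ_two, e0, e1]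
  simp
  ring

lemma extDeriv_apply_two {θ : V4 → Alt 2} {z : V4} (h : DifferentiableAt ℝ θ z) (u v w : V4) :
    extDeriv θ z ![u, v, w] =
      fderiv ℝ (fun y => θ y ![v, w]) z u - fderiv ℝ (fun y => θ y ![u, w]) z v
        + fderiv ℝ (fun y => θ y ![u, v]) z w := by
  have e0 : (0 : Fin 3).removeNth ![u, v, w] = ![v, w] := by ext i; fin_cases i <;> rfl
  have e1 : (1 : Fin 3).removeNth ![u, v, w] = ![u, w] := by ext i; fin_cases i <;> rfl
  have e2 : (2 : Fin 3).removeNth ![u, v, w] = ![u, v] := by ext i; fin_cases i <;> rfl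
  rw [extDeriv_apply h, Fin.sum_univ_three, e0, e1, e2]
  simp
  ring

lemma c2_extDeriv {θ : V4 → Alt 1} {z : V4} (h : DifferentiableAt ℝ θ z) (μ ν : Fin 4) :
    c2 (extDeriv θ z) μ ν =
      fderiv ℝ (fun y => c1 (θ y) ν) z (bv μ) - fderiv ℝ (fun y => c1 (θ y) μ) z (bv ν) :=
  extDeriv_apply_one h _ _

lemma c3_extDeriv {θ : V4 → Alt 2} {z : V4} (h : DifferentiableAt ℝ θ z) (l μ ν : Fin 4) :
    c3 (extDeriv θ z) l μ ν =
      fderiv ℝ (fun y => c2 (θ y) μ ν) z (bv l) - fderiv ℝ (fun y => c2 (θ y) l ν) z (bv μ)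
        + fderiv ℝ (fun y => c2 (θ y) l μ) z (bv ν) :=
  extDeriv_apply_two h _ _ _

lemma contDiffOn_of_c1 {θ : V4 → Alt 1} {U : Set V4}
    (h : ∀ μ, ContDiffOn ℝ ∞ (fun y => c1 (θ y) μ) U) : ContDiffOn ℝ ∞ θ U := by
  have e : θ = fun y => ∑ μ, c1 (θ y) μ • ofLin (dx μ) := by
    funext y
    exact (mk1_c1 (θ y)).symm
  rw [e]
  exact ContDiffOn.sum fun μ _ => (h μ).smul (contDiffOn_const (c := ofLin (dx μ)))

lemma contDiffOn_of_c2 {θ : V4 → Alt 2} {U : Set V4}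
    (h : ∀ μ ν, ContDiffOn ℝ ∞ (fun y => c2 (θ y) μ ν) U) : ContDiffOn ℝ ∞ θ U := by
  have e : θ = fun y => (1 / 2 : ℝ) • ∑ μ, ∑ ν, c2 (θ y) μ ν • dx2 μ ν := by
    funext y
    exact (mk2_c2 (θ y)).symm
  rw [e]
  exact (contDiffOn_const (c := (1 / 2 : ℝ))).smul
    (ContDiffOn.sum fun μ _ => ContDiffOn.sum fun ν _ =>
    (h μ ν).smul (contDiffOn_const (c := dx2 μ ν)))

lemma contDiffOn_c1 {θ : V4 → Alt 1} {U : Set V4} (h : ContDiffOn ℝ ∞ θ U) (μ : Fin 4) :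
    ContDiffOn ℝ ∞ (fun y => c1 (θ y) μ) U :=
  (ContinuousAlternatingMap.apply ℝ V4 ℝ ![bv μ]).contDiff.comp_contDiffOn h

lemma contDiffOn_c2 {θ : V4 → Alt 2} {U : Set V4} (h : ContDiffOn ℝ ∞ θ U) (μ ν : Fin 4) :
    ContDiffOn ℝ ∞ (fun y => c2 (θ y) μ ν) U :=
  (ContinuousAlternatingMap.apply ℝ V4 ℝ ![bv μ, bv ν]).contDiff.comp_contDiffOn h

lemma contDiffOn_c3 {θ : V4 → Alt 3} {U : Set V4} (h : ContDiffOn ℝ ∞ θ U) (l μ ν : Fin 4) :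
    ContDiffOn ℝ ∞ (fun y => c3 (θ y) l μ ν) U :=
  (ContinuousAlternatingMap.apply ℝ V4 ℝ ![bv l, bv μ, bv ν]).contDiff.comp_contDiffOn h

/-! ### Levi-Civita symbols and antisymmetric matrices -/

/-- The Levi-Civita symbol as a quotient of Vandermonde determinants. -/
lemma eps4_eq (μ ν ρ σ : Fin 4) : eps4 μ ν ρ σ =
    ((ν : ℕ) - (μ : ℕ) : ℝ) * ((ρ : ℕ) - (μ : ℕ)) * ((σ : ℕ) - (μ : ℕ)) * ((ρ : ℕ) - (ν : ℕ)) *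
      ((σ : ℕ) - (ν : ℕ)) * ((σ : ℕ) - (ρ : ℕ)) / 12 := by
  let v : Fin 4 → ℝ := fun i => ((i : ℕ) : ℝ)
  have h : (Matrix.of fun m n : Fin 4 => if ![μ, ν, ρ, σ] m = n then (1 : ℝ) else 0) *
      Matrix.vandermonde v = Matrix.vandermonde (v ∘ ![μ, ν, ρ, σ]) := by
    ext m n
    simp [Matrix.mul_apply, Matrix.vandermonde]
  have h2 := congrArg Matrix.det h
  rw [Matrix.det_mul, Matrix.det_vandermonde, Matrix.det_vandermonde] at h2
  have e0 : Finset.Ioi (0 : Fin 4) = {1, 2, 3} := by decide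
  have e1 : Finset.Ioi (1 : Fin 4) = {2, 3} := by decide
  have e2 : Finset.Ioi (2 : Fin 4) = {3} := by decide
  have e3 : Finset.Ioi (3 : Fin 4) = ∅ := by decide
  simp [Fin.prod_univ_four, e0, e1, e2, e3, v] at h2
  norm_num at h2
  change eps4 μ ν ρ σ * _ = _ at h2
  rw [eq_div_iff (by norm_num), h2]
  ring

lemma eps3_eq (i j k : Fin 3) : eps3 i j k =
    ((j : ℕ) - (i : ℕ) : ℝ) * ((k : ℕ) - (i : ℕ)) * ((k : ℕ) - (j : ℕ)) / 2 := by
  let v : Fin 3 → ℝ := fun i => ((i : ℕ) : ℝ)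
  have h : (Matrix.of fun m n : Fin 3 => if ![i, j, k] m = n then (1 : ℝ) else 0) *
      Matrix.vandermonde v = Matrix.vandermonde (v ∘ ![i, j, k]) := by
    ext m n
    simp [Matrix.mul_apply, Matrix.vandermonde]
  have h2 := congrArg Matrix.det h
  rw [Matrix.det_mul, Matrix.det_vandermonde, Matrix.det_vandermonde] at h2
  have e0 : Finset.Ioi (0 : Fin 3) = {1, 2} := by decide
  have e1 : Finset.Ioi (1 : Fin 3) = {2} := by decide
  have e2 : Finset.Ioi (2 : Fin 3) = ∅ := by decide
  simp [Fin.prod_univ_three, e0, e1, e2, v] at h2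
  norm_num at h2
  change eps3 i j k * _ = _ at h2
  rw [eq_div_iff (by norm_num), h2]

lemma det_row_expand (A : Matrix (Fin 4) (Fin 4) ℝ) (i : Fin 4) :
    A.det = ∑ μ, A i μ * (A.updateRow i (Pi.single μ 1)).det := by
  let L : (Fin 4 → ℝ) →ₗ[ℝ] ℝ :=
    { toFun := fun u => (A.updateRow i u).det
      map_add' := fun u v => Matrix.det_updateRow_add A i u v
      map_smul' := fun r u => Matrix.det_updateRow_smul A i r u }
  have hL : ∀ u, L u = (A.updateRow i u).det := fun u => rfl
  have h : A.det = L (A i) := by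
    rw [hL, Matrix.updateRow_eq_self]
  have hv : A i = ∑ μ, A i μ • (Pi.single μ (1 : ℝ) : Fin 4 → ℝ) := by
    ext ν
    simp [Pi.single_apply]
  rw [h]
  conv_lhs => rw [hv]
  rw [map_sum]
  refine Finset.sum_congr rfl fun μ _ => ?_
  rw [map_smul, hL, smul_eq_mul]

/-- Invariance of the Levi-Civita symbol as a tensor density. -/
lemma eps4_equivariance (G : Matrix (Fin 4) (Fin 4) ℝ) (a b c d : Fin 4) :
    ∑ μ, ∑ ν, ∑ ρ, ∑ σ, eps4 μ ν ρ σ * (G a μ * G b ν * G c ρ * G d σ) =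
      G.det * eps4 a b c d := by
  have h1 : eps4 a b c d * G.det = (Matrix.of fun m n => G (![a, b, c, d] m) n).det := by
    rw [eps4, ← Matrix.det_mul]
    congr 1
    ext m n
    simp [Matrix.mul_apply]
  rw [mul_comm G.det, h1, det_row_expand _ 0]
  refine Finset.sum_congr rfl fun μ _ => ?_
  rw [det_row_expand _ 1, Finset.mul_sum]
  refine Finset.sum_congr rfl fun ν _ => ?_
  rw [det_row_expand _ 2, Finset.mul_sum, Finset.mul_sum]
  refine Finset.sum_congr rfl fun ρ _ => ?_
  rw [det_row_expand _ 3, Finset.mul_sum, Finset.mul_sum, Finset.mul_sum]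
  refine Finset.sum_congr rfl fun σ _ => ?_
  have e : (((((Matrix.of fun m n => G (![a, b, c, d] m) n).updateRow 0 (Pi.single μ 1)).updateRow 1
      (Pi.single ν 1)).updateRow 2 (Pi.single ρ 1)).updateRow 3 (Pi.single σ 1)) =
      (Matrix.of fun m n : Fin 4 => if ![μ, ν, ρ, σ] m = n then (1 : ℝ) else 0) := by
    ext m n
    fin_cases m <;> simp [Matrix.updateRow_apply, Pi.single_apply, eq_comm]
  rw [e, eps4]
  simp [Matrix.updateRow_apply]
  ring

/-- The contravariant dual `(1/2) ε^{μνρσ} A_{ρσ}` of an antisymmetric matrix. -/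
def til (A : Matrix (Fin 4) (Fin 4) ℝ) : Matrix (Fin 4) (Fin 4) ℝ :=
  Matrix.of fun μ ν => (1 / 2) * ∑ ρ, ∑ σ, eps4 μ ν ρ σ * A ρ σ

/-- The antisymmetric matrix with the given entries above the diagonal. -/
def asm (a b c d e f : ℝ) : Matrix (Fin 4) (Fin 4) ℝ :=
  !![0, a, b, c; -a, 0, d, e; -b, -d, 0, f; -c, -e, -f, 0]

lemma exists_asm {A : Matrix (Fin 4) (Fin 4) ℝ} (h : Aᵀ = -A) :
    ∃ a b c d e f, A = asm a b c d e f := by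
  refine ⟨A 0 1, A 0 2, A 0 3, A 1 2, A 1 3, A 2 3, ?_⟩
  have h' : ∀ i j, A j i = -A i j := fun i j => congrFun (congrFun h i) j
  have h0 : ∀ i, A i i = 0 := fun i => by linarith [h' i i]
  ext i j
  fin_cases i <;> fin_cases j <;> simp [asm, h0] <;> exact h' _ _

/-- The dual exchanges complementary entries, up to sign. -/
lemma til_asm (a b c d e f : ℝ) : til (asm a b c d e f) = asm f (-e) d c (-b) a := by
  ext i j
  fin_cases i <;> fin_cases j <;>
    (simp [til, asm, Fin.sum_univ_four, eps4_eq]; try norm_num; try ring)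

lemma til_add (A B : Matrix (Fin 4) (Fin 4) ℝ) : til (A + B) = til A + til B := by
  ext i j
  simp [til, mul_add, Finset.sum_add_distrib]

lemma til_smul (r : ℝ) (A : Matrix (Fin 4) (Fin 4) ℝ) : til (r • A) = r • til A := by
  ext i j
  simp only [til, Matrix.of_apply, Matrix.smul_apply, smul_eq_mul, Finset.mul_sum]
  refine Finset.sum_congr rfl fun _ _ => Finset.sum_congr rfl fun _ _ => by ring

lemma asm_transpose (a b c d e f : ℝ) : (asm a b c d e f)ᵀ = -asm a b c d e f := by
  ext i j
  fin_cases i <;> fin_cases j <;> simp [asm]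

lemma til_transpose {A : Matrix (Fin 4) (Fin 4) ℝ} (h : Aᵀ = -A) : (til A)ᵀ = -til A := by
  obtain ⟨a, b, c, d, e, f, rfl⟩ := exists_asm h
  rw [til_asm, asm_transpose]

lemma til_til {A : Matrix (Fin 4) (Fin 4) ℝ} (h : Aᵀ = -A) : til (til A) = A := by
  obtain ⟨a, b, c, d, e, f, rfl⟩ := exists_asm h
  rw [til_asm, til_asm]
  simp

/-- The pairing of antisymmetric matrices given by the wedge product of 2-forms. -/
def wd (A B : Matrix (Fin 4) (Fin 4) ℝ) : ℝ := -(1 / 2) * (A * til B).trace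

lemma wedge22_eq (α β : Alt 2) : wedge22 α β = wd (m2 α) (m2 β) := by
  rw [wd, ← Matrix.trace_transpose, Matrix.transpose_mul, m2_transpose]
  simp only [wedge22, Matrix.trace, Matrix.diag, Matrix.mul_apply, Matrix.transpose_apply,
    Matrix.neg_apply, m2_apply, til, Matrix.of_apply, Finset.mul_sum, Finset.sum_mul]
  rw [Finset.sum_comm]
  refine Finset.sum_congr rfl fun _ _ => Finset.sum_congr rfl fun _ _ =>
    Finset.sum_congr rfl fun _ _ => Finset.sum_congr rfl fun _ _ => ?_
  ring

lemma wd_asm (a b c d e f a' b' c' d' e' f' : ℝ) :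
    wd (asm a b c d e f) (asm a' b' c' d' e' f') =
      a * f' - b * e' + c * d' + d * c' - e * b' + f * a' := by
  rw [wd, til_asm]
  simp [asm, Matrix.trace, Fin.sum_univ_four]
  ring

lemma wd_comm {A B : Matrix (Fin 4) (Fin 4) ℝ} (hA : Aᵀ = -A) (hB : Bᵀ = -B) :
    wd A B = wd B A := by
  obtain ⟨a, b, c, d, e, f, rfl⟩ := exists_asm hA
  obtain ⟨a', b', c', d', e', f', rfl⟩ := exists_asm hB
  rw [wd_asm, wd_asm]
  ring

lemma wd_add_right (A B C : Matrix (Fin 4) (Fin 4) ℝ) : wd A (B + C) = wd A B + wd A C := by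
  simp [wd, til_add, mul_add]

lemma wd_smul_right (r : ℝ) (A B : Matrix (Fin 4) (Fin 4) ℝ) : wd A (r • B) = r * wd A B := by
  simp only [wd, til_smul, Matrix.mul_smul, Matrix.trace_smul, smul_eq_mul]
  ring

/-- The Clifford-type relation between antisymmetric `4 × 4` matrices and their duals. -/
lemma mul_til_add {A B : Matrix (Fin 4) (Fin 4) ℝ} (hA : Aᵀ = -A) (hB : Bᵀ = -B) :
    A * til B + B * til A = (-wd A B) • (1 : Matrix (Fin 4) (Fin 4) ℝ) := by
  obtain ⟨a, b, c, d, e, f, rfl⟩ := exists_asm hA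
  obtain ⟨a', b', c', d', e', f', rfl⟩ := exists_asm hB
  rw [wd_asm, til_asm, til_asm]
  ext i j
  fin_cases i <;> fin_cases j <;>
    (simp [asm]; try ring)

/-- The determinant of an antisymmetric matrix is the square of its Pfaffian. -/
lemma det_eq_wd_sq {A : Matrix (Fin 4) (Fin 4) ℝ} (hA : Aᵀ = -A) :
    A.det = (wd A A / 2) ^ 2 := by
  obtain ⟨a, b, c, d, e, f, rfl⟩ := exists_asm hA
  rw [wd_asm]
  simp [asm, Matrix.det_succ_row_zero, Fin.sum_univ_succ, Fin.succAbove]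
  ring

lemma sum4_comm {ι : Type*} [Fintype ι] (F : ι → ι → ι → ι → ι → ℝ) :
    ∑ a, ∑ b, ∑ c, ∑ d, ∑ r, F a b c d r = ∑ r, ∑ a, ∑ b, ∑ c, ∑ d, F a b c d r := by
  have h1 : ∀ a b c, ∑ d, ∑ r, F a b c d r = ∑ r, ∑ d, F a b c d r :=
    fun a b c => Finset.sum_comm
  have h2 : ∀ a b, ∑ c, ∑ r, ∑ d, F a b c d r = ∑ r, ∑ c, ∑ d, F a b c d r :=
    fun a b => Finset.sum_comm
  have h3 : ∀ a, ∑ b, ∑ r, ∑ c, ∑ d, F a b c d r = ∑ r, ∑ b, ∑ c, ∑ d, F a b c d r :=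
    fun a => Finset.sum_comm
  simp only [h1, h2, h3]
  exact Finset.sum_comm

/-- The dual is natural, as a bivector density, under linear maps, invertible or not. -/
lemma til_equivariance (G A : Matrix (Fin 4) (Fin 4) ℝ) :
    G * til (Gᵀ * A * G) * Gᵀ = G.det • til A := by
  ext m n
  have h : ∀ r s, ∑ ν, ∑ μ, ∑ ρ, ∑ σ,
      G m μ * ((1 / 2) * (eps4 μ ν ρ σ * (G r ρ * A r s * G s σ))) * G n ν =
      (1 / 2) * (G.det * eps4 m n r s * A r s) := by
    intro r s
    rw [← eps4_equivariance, Finset.sum_comm]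
    simp only [Finset.sum_mul, Finset.mul_sum]
    refine Finset.sum_congr rfl fun _ _ => Finset.sum_congr rfl fun _ _ =>
      Finset.sum_congr rfl fun _ _ => Finset.sum_congr rfl fun _ _ => by ring
  have h2 : (G.det • til A) m n = ∑ r, ∑ s, (1 / 2) * (G.det * eps4 m n r s * A r s) := by
    simp only [til, Matrix.smul_apply, Matrix.of_apply, smul_eq_mul, Finset.mul_sum]
    refine Finset.sum_congr rfl fun _ _ => Finset.sum_congr rfl fun _ _ => by ring
  rw [h2]
  simp only [til, Matrix.mul_apply, Matrix.transpose_apply, Matrix.of_apply, Finset.mul_sum,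
    Finset.sum_mul]
  rw [sum4_comm, Finset.sum_comm (f := fun r s => 1 / 2 * (G.det * eps4 m n r s * A r s))]
  refine Finset.sum_congr rfl fun s _ => ?_
  rw [sum4_comm]
  exact Finset.sum_congr rfl fun r _ => h r s

/-! ### The quaternion algebra of a perfect triple -/

lemma m2_antisymm (S : Trip) (i : Fin 3) : (m2 (S i))ᵀ = -m2 (S i) := m2_transpose _

lemma gm_eq_sum (S : Trip) : gm S = (1 / (6 * vol S)) •
    ∑ i, ∑ j, ∑ k, eps3 i j k • (m2 (S i) * til (m2 (S k)) * m2 (S j)) := by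
  ext μ ν
  have h : ∀ i j k, ∑ α, ∑ β, ∑ γ, ∑ δ,
      eps3 i j k * eps4 α β γ δ * c2 (S i) μ α * c2 (S j) ν β * c2 (S k) γ δ =
      -2 * (eps3 i j k * (m2 (S i) * til (m2 (S k)) * m2 (S j)) μ ν) := by
    intro i j k
    simp only [Matrix.mul_apply, til, Matrix.of_apply, Finset.mul_sum, Finset.sum_mul]
    rw [Finset.sum_comm]
    refine Finset.sum_congr rfl fun _ _ => Finset.sum_congr rfl fun _ _ =>
      Finset.sum_congr rfl fun _ _ => Finset.sum_congr rfl fun _ _ => ?_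
    rw [c2_swap (S j) ν]
    simp only [m2_apply]
    ring
  simp only [gm, Matrix.of_apply, h, Matrix.smul_apply, smul_eq_mul, Matrix.sum_apply,
    ← Finset.mul_sum]
  ring

lemma eps3_values : eps3 0 1 2 = 1 ∧ eps3 1 2 0 = 1 ∧ eps3 2 0 1 = 1 ∧ eps3 0 2 1 = -1 ∧
    eps3 1 0 2 = -1 ∧ eps3 2 1 0 = -1 := by
  simp [eps3_eq]
  norm_num

lemma eps3_self_left (i j : Fin 3) : eps3 i i j = 0 := by simp [eps3_eq]
lemma eps3_self_right (i j : Fin 3) : eps3 i j j = 0 := by simp [eps3_eq]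
lemma eps3_self_mid (i j : Fin 3) : eps3 i j i = 0 := by simp [eps3_eq]

lemma eps3_swap (i j k : Fin 3) : eps3 i j k = -eps3 j i k := by
  rw [eps3_eq, eps3_eq]; ring

namespace IsPerfect

variable {S : Trip}

lemma wd_eq (hS : IsPerfect S) (i j : Fin 3) :
    wd (m2 (S i)) (m2 (S j)) = if i = j then 2 * vol S else 0 := by
  rw [← wedge22_eq, hS.wedge]

lemma mul_til_self (hS : IsPerfect S) (i : Fin 3) :
    m2 (S i) * til (m2 (S i)) = (-vol S) • (1 : Matrix (Fin 4) (Fin 4) ℝ) := by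
  have h := mul_til_add (m2_antisymm S i) (m2_antisymm S i)
  rw [hS.wd_eq, if_pos rfl, ← two_smul ℝ, neg_mul_eq_mul_neg, mul_smul] at h
  exact smul_right_injective _ (two_ne_zero' ℝ) h

lemma til_mul_self (hS : IsPerfect S) (i : Fin 3) :
    til (m2 (S i)) * m2 (S i) = (-vol S) • (1 : Matrix (Fin 4) (Fin 4) ℝ) := by
  have h := congrArg Matrix.transpose (hS.mul_til_self i)
  rwa [Matrix.transpose_mul, til_transpose (m2_antisymm S i), m2_transpose, neg_mul_neg,
    Matrix.transpose_smul, Matrix.transpose_one] at h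

lemma mul_til_swap (hS : IsPerfect S) {i j : Fin 3} (h : i ≠ j) :
    m2 (S i) * til (m2 (S j)) = -(m2 (S j) * til (m2 (S i))) := by
  have h1 := mul_til_add (m2_antisymm S i) (m2_antisymm S j)
  rw [hS.wd_eq, if_neg h, neg_zero, zero_smul] at h1
  exact eq_neg_of_add_eq_zero_left h1

lemma til_mul_swap (hS : IsPerfect S) {i j : Fin 3} (h : i ≠ j) :
    til (m2 (S i)) * m2 (S j) = -(til (m2 (S j)) * m2 (S i)) := by
  have h1 := congrArg Matrix.transpose (hS.mul_til_swap h.symm)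
  rwa [Matrix.transpose_mul, Matrix.transpose_neg, Matrix.transpose_mul,
    til_transpose (m2_antisymm S i), til_transpose (m2_antisymm S j), m2_transpose, m2_transpose,
    neg_mul_neg, neg_mul_neg] at h1

/-- The three matrices `Σ^i` enter the metric through a single product: the six terms of the
antisymmetrization agree by the Clifford-type relations. -/
lemma gm_eq (hS : IsPerfect S) :
    gm S = (-(1 / vol S)) • (m2 (S 0) * til (m2 (S 1)) * m2 (S 2)) := by
  have h01 := hS.mul_til_swap (i := 0) (j := 1) (by decide)
  have h02 := hS.mul_til_swap (i := 0) (j := 2) (by decide)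
  have h12 := hS.mul_til_swap (i := 1) (j := 2) (by decide)
  have k12 := hS.til_mul_swap (i := 1) (j := 2) (by decide)
  have k02 := hS.til_mul_swap (i := 0) (j := 2) (by decide)
  have k01 := hS.til_mul_swap (i := 0) (j := 1) (by decide)
  set X := m2 (S 0) * til (m2 (S 1)) * m2 (S 2) with hX
  have e1 : m2 (S 0) * til (m2 (S 2)) * m2 (S 1) = -X := by
    rw [hX, mul_assoc, mul_assoc, k12, mul_neg, neg_neg]
  have e2 : m2 (S 1) * til (m2 (S 0)) * m2 (S 2) = -X := by
    rw [hX, h01, neg_mul, neg_neg]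
  have e3 : m2 (S 1) * til (m2 (S 2)) * m2 (S 0) = X := by
    rw [← neg_neg X, ← e2, mul_assoc, mul_assoc, k02, mul_neg, neg_neg]
  have e4 : m2 (S 2) * til (m2 (S 1)) * m2 (S 0) = -X := by
    rw [← e3, h12, neg_mul, neg_neg]
  have e5 : m2 (S 2) * til (m2 (S 0)) * m2 (S 1) = X := by
    rw [← neg_neg X, ← e4, mul_assoc, mul_assoc, k01, mul_neg]
  obtain ⟨a1, a2, a3, a4, a5, a6⟩ := eps3_values
  rw [gm_eq_sum]
  simp only [Fin.sum_univ_three, eps3_self_left, eps3_self_right, eps3_self_mid, zero_smul,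
    a1, a2, a3, a4, a5, a6, e1, e2, e3, e4, e5, ← hX]
  have hv := hS.vol_ne
  have : (1 / (6 * vol S)) * (-6) = -(1 / vol S) := by field_simp
  rw [← this, mul_smul]
  congr 1
  module

lemma gi_eq (hS : IsPerfect S) :
    gi S = (1 / vol S ^ 2) • (til (m2 (S 2)) * m2 (S 1) * til (m2 (S 0))) := by
  have hv := hS.vol_ne
  refine Matrix.inv_eq_right_inv ?_
  rw [hS.gm_eq, Matrix.smul_mul, Matrix.mul_smul, smul_smul]
  have e : m2 (S 0) * til (m2 (S 1)) * m2 (S 2) * (til (m2 (S 2)) * m2 (S 1) * til (m2 (S 0))) =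
      m2 (S 0) * (til (m2 (S 1)) * (m2 (S 2) * til (m2 (S 2))) * m2 (S 1)) * til (m2 (S 0)) := by
    simp only [mul_assoc]
  rw [e, hS.mul_til_self, Matrix.mul_smul, mul_one, Matrix.smul_mul, hS.til_mul_self,
    Matrix.mul_smul, Matrix.mul_smul, mul_one, Matrix.smul_mul, Matrix.smul_mul, hS.mul_til_self,
    smul_smul, smul_smul, smul_smul]
  convert one_smul ℝ _
  field_simp

lemma gm_transpose (hS : IsPerfect S) : (gm S)ᵀ = gm S := by
  simpa using hS.pos.isHermitian.eq

lemma gi_transpose (hS : IsPerfect S) : (gi S)ᵀ = gi S := by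
  rw [gi, Matrix.transpose_nonsing_inv, hS.gm_transpose]

lemma det_gm_ne (hS : IsPerfect S) : IsUnit (gm S).det := hS.pos.det_pos.ne'.isUnit

lemma gm_mul_gi (hS : IsPerfect S) : gm S * gi S = 1 := Matrix.mul_nonsing_inv _ hS.det_gm_ne

lemma gi_mul_gm (hS : IsPerfect S) : gi S * gm S = 1 := Matrix.nonsing_inv_mul _ hS.det_gm_ne

lemma sgEnd_eq (hS : IsPerfect S) :
    sgEnd S 0 = (1 / vol S) • (m2 (S 1) * til (m2 (S 2))) ∧
    sgEnd S 1 = (1 / vol S) • (m2 (S 2) * til (m2 (S 0))) ∧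
    sgEnd S 2 = (1 / vol S) • (m2 (S 0) * til (m2 (S 1))) := by
  have hv := hS.vol_ne
  have h01 := hS.mul_til_swap (i := 0) (j := 1) (by decide)
  have h12 := hS.mul_til_swap (i := 1) (j := 2) (by decide)
  have k02 := hS.til_mul_swap (i := 2) (j := 0) (by decide)
  have k12 := hS.til_mul_swap (i := 2) (j := 1) (by decide)
  have s : ∀ i, sgEnd S i =
      (1 / vol S ^ 2) • (m2 (S i) * (til (m2 (S 2)) * m2 (S 1) * til (m2 (S 0)))) := by
    intro i
    rw [sgEnd, hS.gi_eq, Matrix.mul_smul]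
    rfl
  refine ⟨?_, ?_, ?_⟩
  · rw [s, mul_assoc (til _), ← neg_neg (m2 (S 1) * til (m2 (S 0))), ← h01, mul_neg, mul_neg,
      ← mul_assoc (til _), k02, neg_mul, mul_neg, neg_neg, mul_assoc (til _), ← mul_assoc,
      hS.mul_til_self, Matrix.smul_mul, one_mul, h12, smul_neg, smul_smul, ← neg_smul]
    congr 1
    field_simp
  · rw [s, k12, neg_mul, mul_neg, mul_assoc (til _), ← mul_assoc,
      hS.mul_til_self, Matrix.smul_mul, one_mul, smul_neg, smul_smul, ← neg_smul]
    congr 1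
    field_simp
  · rw [s, mul_assoc (til _), ← mul_assoc, hS.mul_til_self, Matrix.smul_mul, one_mul, smul_smul,
      h01, smul_neg, ← neg_smul]
    congr 1
    field_simp

lemma sgEnd_sq (hS : IsPerfect S) (i : Fin 3) : sgEnd S i * sgEnd S i = -1 := by
  have hv := hS.vol_ne
  obtain ⟨s0, s1, s2⟩ := hS.sgEnd_eq
  have key : ∀ i j, i ≠ j → ((1 / vol S) • (m2 (S i) * til (m2 (S j)))) *
      ((1 / vol S) • (m2 (S i) * til (m2 (S j)))) = -1 := by
    intro i j h
    rw [Matrix.smul_mul, Matrix.mul_smul, mul_assoc, ← mul_assoc (til _),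
      hS.til_mul_swap h.symm, neg_mul, mul_neg, mul_assoc (til _), hS.mul_til_self,
      ← mul_assoc, hS.mul_til_self, Matrix.mul_smul, mul_one]
    simp only [smul_neg, smul_smul, neg_inj]
    convert one_smul ℝ _
    field_simp
  fin_cases i
  · exact (congrArg₂ _ s0 s0).trans (key _ _ (by decide))
  · exact (congrArg₂ _ s1 s1).trans (key _ _ (by decide))
  · exact (congrArg₂ _ s2 s2).trans (key _ _ (by decide))

lemma sgEnd_mul_aux (hS : IsPerfect S) :
    sgEnd S 0 * sgEnd S 1 = sgEnd S 2 ∧ sgEnd S 1 * sgEnd S 2 = sgEnd S 0 ∧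
      sgEnd S 2 * sgEnd S 0 = sgEnd S 1 := by
  have hv := hS.vol_ne
  obtain ⟨s0, s1, s2⟩ := hS.sgEnd_eq
  have key : ∀ i j k, i ≠ k → ((1 / vol S) • (m2 (S i) * til (m2 (S j)))) *
      ((1 / vol S) • (m2 (S j) * til (m2 (S k)))) = (1 / vol S) • (m2 (S k) * til (m2 (S i))) := by
    intro i j k h
    rw [Matrix.smul_mul, Matrix.mul_smul, mul_assoc, ← mul_assoc (til _), hS.til_mul_self,
      Matrix.smul_mul, one_mul, Matrix.mul_smul, hS.mul_til_swap h, smul_neg, smul_neg, smul_neg,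
      smul_smul, smul_smul, ← neg_smul]
    congr 1
    field_simp
  rw [s0, s1, s2]
  exact ⟨key _ _ _ (by decide), key _ _ _ (by decide), key _ _ _ (by decide)⟩

/-- The quaternion relations `Σ^i_μ^α Σ^j_α^ν = -δ^{ij} δ_μ^ν + ε^{ijk} Σ^k_μ^ν`. -/
lemma sgEnd_mul (hS : IsPerfect S) (i j : Fin 3) : sgEnd S i * sgEnd S j =
    (-(if i = j then 1 else 0) : ℝ) • (1 : Matrix (Fin 4) (Fin 4) ℝ) +
      ∑ k, eps3 i j k • sgEnd S k := by
  obtain ⟨h01, h12, h20⟩ := hS.sgEnd_mul_aux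
  have q := hS.sgEnd_sq
  obtain ⟨a1, a2, a3, a4, a5, a6⟩ := eps3_values
  have h10 : sgEnd S 1 * sgEnd S 0 = -sgEnd S 2 := by
    rw [← h12, ← mul_assoc, q, neg_mul, one_mul]
  have h21 : sgEnd S 2 * sgEnd S 1 = -sgEnd S 0 := by
    rw [← h20, ← mul_assoc, q, neg_mul, one_mul]
  have h02 : sgEnd S 0 * sgEnd S 2 = -sgEnd S 1 := by
    rw [← h01, ← mul_assoc, q, neg_mul, one_mul]
  fin_cases i <;> fin_cases j <;>
    simp [Fin.sum_univ_three, eps3_self_left, eps3_self_right, eps3_self_mid, *]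

/-- Raising both indices of `Σ^i` gives its dual bivector, that is, `Σ^i` is self-dual. -/
lemma gi_mul_gi (hS : IsPerfect S) (i : Fin 3) :
    gi S * m2 (S i) * gi S = (1 / vol S) • til (m2 (S i)) := by
  have hv := hS.vol_ne
  have h : m2 (S i) * gi S * (m2 (S i) * gi S) = -1 := hS.sgEnd_sq i
  have h2 := congrArg (fun X => til (m2 (S i)) * X) h
  simp only [← mul_assoc, hS.til_mul_self, Matrix.smul_mul, one_mul, mul_neg, mul_one] at h2
  rw [← neg_neg (til _), ← h2, smul_neg, neg_smul, smul_neg, neg_neg, smul_smul,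
    one_div_mul_cancel hv, one_smul]

/-- The volume form of the triple is, up to sign, the Riemannian one. -/
lemma det_gm (hS : IsPerfect S) : (gm S).det = vol S ^ 2 := by
  have hv := hS.vol_ne
  have d : ∀ i, (m2 (S i)).det = vol S ^ 2 := by
    intro i
    rw [det_eq_wd_sq (m2_antisymm S i), hS.wd_eq, if_pos rfl]
    ring
  have dt : ∀ i, (til (m2 (S i))).det = vol S ^ 2 := by
    intro i
    have h := congrArg Matrix.det (hS.mul_til_self i)
    rw [Matrix.det_mul, d, Matrix.det_smul, Matrix.det_one] at h
    simp at h
    have : vol S ^ 2 ≠ 0 := pow_ne_zero _ hv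
    apply mul_left_cancel₀ this
    rw [h]; ring
  rw [hS.gm_eq, Matrix.det_smul, Matrix.det_mul, Matrix.det_mul, d, d, dt]
  simp
  field_simp

end IsPerfect

/-! ### Pointwise operations of a perfect triple -/

@[simp] lemma eps3_012 : eps3 0 1 2 = 1 := eps3_values.1
@[simp] lemma eps3_120 : eps3 1 2 0 = 1 := eps3_values.2.1
@[simp] lemma eps3_201 : eps3 2 0 1 = 1 := eps3_values.2.2.1
@[simp] lemma eps3_021 : eps3 0 2 1 = -1 := eps3_values.2.2.2.1
@[simp] lemma eps3_102 : eps3 1 0 2 = -1 := eps3_values.2.2.2.2.1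
@[simp] lemma eps3_210 : eps3 2 1 0 = -1 := eps3_values.2.2.2.2.2

attribute [simp] eps3_self_left eps3_self_right eps3_self_mid

/-- The endomorphism `α_μ ↦ Σ^i_μ^α α_α` of `Λ¹`. -/
def Jl (S : Trip) (i : Fin 3) : Alt 1 →ₗ[ℝ] Alt 1 where
  toFun α := mk1 (sgEnd S i *ᵥ c1 α)
  map_add' α β := alt1_ext (by simp [Matrix.mulVec_add])
  map_smul' r α := alt1_ext (by simp [Matrix.mulVec_smul])

lemma c1_Jl (S : Trip) (i : Fin 3) (α : Alt 1) : c1 (Jl S i α) = sgEnd S i *ᵥ c1 α := c1_mk1 _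

lemma Phi_eq (S : Trip) (a : ELam) : Phi S a = ∑ i, Jl S i (a i) := by
  refine alt1_ext ?_
  ext μ
  simp [Phi, c1_Jl, Matrix.mulVec, dotProduct]

lemma PhiStar_eq (S : Trip) (ξ : Alt 1) (i : Fin 3) : PhiStar S ξ i = (1 / 2 : ℝ) • Jl S i ξ := by
  refine alt1_ext ?_
  ext μ
  simp [PhiStar, c1_Jl, Matrix.mulVec, dotProduct]

lemma J1_eq (S : Trip) (a : ELam) (i : Fin 3) :
    J1 S a i = ∑ j, ∑ k, eps3 i j k • Jl S j (a k) := by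
  refine alt1_ext ?_
  ext μ
  simp [J1, c1_Jl, Matrix.mulVec, dotProduct, mul_assoc, Finset.mul_sum]

lemma J1inv_eq (S : Trip) (a : ELam) (i : Fin 3) :
    J1inv S a i = (1 / 2 : ℝ) • (J1 S a i - a i) := rfl

lemma ip1_eq (S : Trip) (ξ η : Alt 1) : ip1 S ξ η = c1 ξ ⬝ᵥ (gi S *ᵥ c1 η) := by
  simp only [ip1, Matrix.mulVec, dotProduct, Finset.mul_sum]
  refine Finset.sum_congr rfl fun _ _ => Finset.sum_congr rfl fun _ _ => by ring

/-- The metric pairing on `Λ¹`, as a bilinear map. -/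
def ip1L (S : Trip) : Alt 1 →ₗ[ℝ] Alt 1 →ₗ[ℝ] ℝ := LinearMap.mk₂ ℝ (ip1 S)
  (fun a b c => by simp [ip1_eq, add_dotProduct])
  (fun r a b => by simp [ip1_eq])
  (fun a b c => by simp [ip1_eq, Matrix.mulVec_add, dotProduct_add])
  (fun r a b => by simp [ip1_eq, Matrix.mulVec_smul])

lemma ip1L_apply (S : Trip) (ξ η : Alt 1) : ip1L S ξ η = ip1 S ξ η := rfl

@[simp] lemma c3_add (α β : Alt 3) : c3 (α + β) = c3 α + c3 β := rfl
@[simp] lemma c3_smul (r : ℝ) (α : Alt 3) : c3 (r • α) = r • c3 α := rfl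

lemma eps4_pair (μ ν ρ σ : Fin 4) : eps4 μ ν ρ σ = eps4 ρ σ μ ν := by
  rw [eps4_eq, eps4_eq]; ring

lemma sum4_reorder {ι : Type*} [Fintype ι] (F : ι → ι → ι → ι → ℝ) :
    ∑ a, ∑ b, ∑ c, ∑ d, F a b c d = ∑ c, ∑ d, ∑ a, ∑ b, F a b c d := by
  have h1 : ∀ a, ∑ b, ∑ c, ∑ d, F a b c d = ∑ c, ∑ d, ∑ b, F a b c d := fun a => by
    rw [Finset.sum_comm]
    exact Finset.sum_congr rfl fun c _ => Finset.sum_comm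
  simp only [h1]
  rw [Finset.sum_comm]
  exact Finset.sum_congr rfl fun c _ => Finset.sum_comm

lemma wedge211_eq (η : Alt 2) (α β : Alt 1) :
    wedge211 η α β = c1 α ⬝ᵥ (til (m2 η) *ᵥ c1 β) := by
  simp only [wedge211, Matrix.mulVec, dotProduct, Finset.mul_sum, til, Matrix.of_apply,
    Finset.sum_mul, m2_apply]
  rw [sum4_reorder]
  refine Finset.sum_congr rfl fun _ _ => Finset.sum_congr rfl fun _ _ =>
    Finset.sum_congr rfl fun _ _ => Finset.sum_congr rfl fun _ _ => ?_
  rw [eps4_pair]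
  ring

/-- The component `0123` of `α ∧ Ω`, for a 1-form `α` and a 3-form `Ω`. -/
def wedge13 (α : Alt 1) (Ω : Alt 3) : ℝ :=
  (1 / 6) * ∑ l, ∑ μ, ∑ ν, ∑ ρ, eps4 l μ ν ρ * c1 α l * c3 Ω μ ν ρ

/-- The vector density `(1/6) ε^{lμνρ} Ω_{μνρ}` of a 3-form. -/
def vec3 (Ω : Alt 3) (l : Fin 4) : ℝ := (1 / 6) * ∑ μ, ∑ ν, ∑ ρ, eps4 l μ ν ρ * c3 Ω μ ν ρ

lemma wedge13_eq (α : Alt 1) (Ω : Alt 3) : wedge13 α Ω = c1 α ⬝ᵥ vec3 Ω := by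
  simp only [wedge13, vec3, dotProduct, Finset.mul_sum]
  refine Finset.sum_congr rfl fun _ _ => Finset.sum_congr rfl fun _ _ =>
    Finset.sum_congr rfl fun _ _ => Finset.sum_congr rfl fun _ _ => by ring

lemma c1_star3 (S : Trip) (Ω : Alt 3) : c1 (star3 S Ω) = (1 / vol S) • (gm S *ᵥ vec3 Ω) := by
  ext μ
  simp only [star3, c1_mk1, Pi.smul_apply, smul_eq_mul, Matrix.mulVec, dotProduct, vec3,
    Finset.mul_sum]
  refine Finset.sum_congr rfl fun _ _ => Finset.sum_congr rfl fun _ _ =>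
    Finset.sum_congr rfl fun _ _ => Finset.sum_congr rfl fun _ _ => by ring

lemma contr2_eq (S : Trip) (η τ : Alt 2) :
    contr2 S η τ = ((gi S)ᵀ * m2 η * gi S * (m2 τ)ᵀ).trace := by
  simp only [contr2, Matrix.trace, Matrix.diag, Matrix.mul_apply, Matrix.transpose_apply,
    Finset.sum_mul, m2_apply]
  rw [sum4_reorder]
  refine Finset.sum_congr rfl fun _ _ => Finset.sum_congr rfl fun _ _ => ?_
  rw [Finset.sum_comm]
  refine Finset.sum_congr rfl fun _ _ => Finset.sum_congr rfl fun _ _ => by ring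

lemma m2_star2 (S : Trip) (η : Alt 2) :
    m2 (star2 S η) = (1 / vol S) • (gm S * til (m2 η) * (gm S)ᵀ) := by
  have e : star2 S η = mk2 ((1 / vol S) • (gm S * til (m2 η) * (gm S)ᵀ)) := by
    rw [star2]
    congr 1
    funext μ ν
    simp only [Matrix.mul_apply, Matrix.transpose_apply, til, Matrix.of_apply, m2_apply,
      Matrix.smul_apply, smul_eq_mul, Finset.mul_sum, Finset.sum_mul]
    rw [Finset.sum_comm]
    refine Finset.sum_congr rfl fun _ _ => Finset.sum_congr rfl fun _ _ =>
      Finset.sum_congr rfl fun _ _ => Finset.sum_congr rfl fun _ _ => by ring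
  rw [e]
  refine m2_mk2 _ ?_
  rw [Matrix.transpose_smul, Matrix.transpose_mul, Matrix.transpose_mul, Matrix.transpose_transpose,
    til_transpose (m2_transpose η)]
  simp [mul_assoc]

/-- The matrix `k_{μν}` of a bilinear form. -/
def kmat (k : Bil) : Matrix (Fin 4) (Fin 4) ℝ := Matrix.of fun μ ν => k (bv μ) (bv ν)

lemma m2_diamond (S : Trip) (k : Bil) (i : Fin 3) : m2 (diamond S k i) =
    kmat k * gi S * m2 (S i) - (kmat k * gi S * m2 (S i))ᵀ := by
  have e : diamond S k i =
      mk2 (kmat k * gi S * m2 (S i) - (kmat k * gi S * m2 (S i))ᵀ : Matrix _ _ ℝ) := by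
    rw [diamond]
    congr 1
    funext μ ν
    simp only [Matrix.sub_apply, Matrix.transpose_apply, Matrix.mul_apply, kmat, Matrix.of_apply,
      Finset.sum_mul, m2_apply, Finset.sum_sub_distrib]
  rw [e]
  refine m2_mk2 _ ?_
  simp

namespace IsPerfect

variable {S : Trip}

lemma Jl_Jl (hS : IsPerfect S) (i j : Fin 3) (α : Alt 1) : Jl S i (Jl S j α) =
    (-(if i = j then 1 else 0) : ℝ) • α + ∑ k, eps3 i j k • Jl S k α := by
  refine alt1_ext ?_
  rw [c1_Jl, c1_Jl, Matrix.mulVec_mulVec, hS.sgEnd_mul, Matrix.add_mulVec, Matrix.smul_mulVec,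
    Matrix.one_mulVec, Matrix.sum_mulVec]
  simp [c1_Jl, Matrix.smul_mulVec]

lemma ip1_comm (hS : IsPerfect S) (ξ η : Alt 1) : ip1 S ξ η = ip1 S η ξ := by
  rw [ip1_eq, ip1_eq, dotProduct_comm, ← Matrix.vecMul_transpose, hS.gi_transpose,
    Matrix.dotProduct_mulVec]

lemma ip1_Jl (hS : IsPerfect S) (i : Fin 3) (ξ η : Alt 1) :
    ip1 S (Jl S i ξ) η = -ip1 S ξ (Jl S i η) := by
  rw [ip1_eq, ip1_eq, c1_Jl, c1_Jl, ← Matrix.vecMul_transpose, ← Matrix.dotProduct_mulVec,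
    sgEnd, Matrix.transpose_mul, hS.gi_transpose]
  change c1 ξ ⬝ᵥ ((gi S * (m2 (S i))ᵀ) *ᵥ (gi S *ᵥ c1 η)) =
    -(c1 ξ ⬝ᵥ (gi S *ᵥ ((m2 (S i) * gi S) *ᵥ c1 η)))
  simp [m2_transpose, Matrix.mulVec_mulVec, mul_assoc, Matrix.neg_mulVec]

lemma _root_.Plebanski.hook_eq (ξ : Alt 1) (i : Fin 3) : hook S ξ i = -Jl S i ξ := by
  refine alt1_ext ?_
  rw [c1_neg, c1_Jl, sgEnd]
  change _ = -((m2 (S i) * gi S) *ᵥ c1 ξ)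
  rw [← Matrix.neg_mulVec, ← neg_mul, ← m2_transpose]
  ext μ
  simp only [hook, c1_mk1, Matrix.mulVec, dotProduct, Matrix.mul_apply, Matrix.transpose_apply,
    Finset.sum_mul, m2_apply]
  rw [Finset.sum_comm]
  refine Finset.sum_congr rfl fun _ _ => Finset.sum_congr rfl fun _ _ => by ring

/-- Wedging with `Σ^i` is the metric pairing twisted by the complex structure. -/
lemma wedge211_perfect (hS : IsPerfect S) (i : Fin 3) (α β : Alt 1) :
    wedge211 (S i) α β = vol S * ip1 S α (Jl S i β) := by
  have hv := hS.vol_ne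
  rw [wedge211_eq, ip1_eq, c1_Jl, Matrix.mulVec_mulVec, sgEnd]
  change _ = vol S * (c1 α ⬝ᵥ ((gi S * (m2 (S i) * gi S)) *ᵥ c1 β))
  rw [← mul_assoc, hS.gi_mul_gi, Matrix.smul_mulVec, dotProduct_smul, smul_eq_mul]
  field_simp

/-- The defining property of the Hodge star on 3-forms. -/
lemma ip1_star3 (hS : IsPerfect S) (α : Alt 1) (Ω : Alt 3) :
    ip1 S α (star3 S Ω) = wedge13 α Ω / vol S := by
  rw [ip1_eq, c1_star3, wedge13_eq, Matrix.mulVec_smul, Matrix.mulVec_mulVec, hS.gi_mul_gm,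
    Matrix.one_mulVec, dotProduct_smul, smul_eq_mul]
  ring

lemma ip1_ext (hS : IsPerfect S) {ξ η : Alt 1} (h : ∀ α, ip1 S α ξ = ip1 S α η) : ξ = η := by
  refine alt1_ext ?_
  have h1 : gi S *ᵥ c1 ξ = gi S *ᵥ c1 η := by
    ext μ
    have := h (mk1 (Pi.single μ 1))
    rw [ip1_eq, ip1_eq, c1_mk1] at this
    simpa using this
  have h2 := congrArg (fun v => gm S *ᵥ v) h1
  simpa [Matrix.mulVec_mulVec, hS.gm_mul_gi] using h2

lemma ip1_pos (hS : IsPerfect S) {ξ : Alt 1} (h : ξ ≠ 0) : 0 < ip1 S ξ ξ := by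
  rw [ip1_eq]
  have := (hS.pos.inv).dotProduct_mulVec_pos (x := c1 ξ) (fun h0 => h (alt1_ext h0))
  exact this

lemma contr2_trace (hS : IsPerfect S) (η τ : Alt 2) :
    contr2 S η τ = -((m2 η * gi S) * (m2 τ * gi S)).trace := by
  rw [contr2_eq, hS.gi_transpose, m2_transpose, mul_neg, Matrix.trace_neg, mul_assoc, mul_assoc,
    Matrix.trace_mul_comm]
  simp only [mul_assoc]

lemma contr2_comm (hS : IsPerfect S) (η τ : Alt 2) : contr2 S η τ = contr2 S τ η := by
  rw [hS.contr2_trace, hS.contr2_trace, Matrix.trace_mul_comm]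

/-- Up to powers of the volume, the dual bivector of `⋆η` is `η` with raised indices. -/
lemma til_star (hS : IsPerfect S) (η : Alt 2) :
    til (gm S * til (m2 η) * gm S) = (vol S ^ 2) • (gi S * m2 η * gi S) := by
  have h := til_equivariance (gm S) (til (m2 η))
  rw [hS.gm_transpose, til_til (m2_transpose η), hS.det_gm] at h
  calc til (gm S * til (m2 η) * gm S)
      = gi S * gm S * til (gm S * til (m2 η) * gm S) * (gm S * gi S) := by
        rw [hS.gi_mul_gm, hS.gm_mul_gi, one_mul, mul_one]
    _ = gi S * (gm S * til (gm S * til (m2 η) * gm S) * gm S) * gi S := by simp only [mul_assoc]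
    _ = _ := by rw [h, Matrix.mul_smul, Matrix.smul_mul]

lemma star2_star2 (hS : IsPerfect S) (η : Alt 2) : star2 S (star2 S η) = η := by
  have hv := hS.vol_ne
  refine alt2_ext ?_
  rw [m2_star2, m2_star2, hS.gm_transpose, til_smul, hS.til_star, Matrix.mul_smul, Matrix.smul_mul,
    Matrix.mul_smul, Matrix.smul_mul, smul_smul, smul_smul]
  have : gm S * (gi S * m2 η * gi S) * gm S = (gm S * gi S) * m2 η * (gi S * gm S) := by
    simp only [mul_assoc]
  rw [this, hS.gi_mul_gm, hS.gm_mul_gi, one_mul, mul_one]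
  convert one_smul ℝ _
  field_simp

/-- The defining property of the Hodge star on 2-forms. -/
lemma wedge22_star2 (hS : IsPerfect S) (η τ : Alt 2) :
    wedge22 η (star2 S τ) = (1 / 2) * vol S * contr2 S η τ := by
  have hv := hS.vol_ne
  rw [wedge22_eq, m2_star2, hS.gm_transpose, wd_smul_right, wd, hS.til_star, hS.contr2_trace,
    Matrix.mul_smul, Matrix.trace_smul, smul_eq_mul]
  simp only [mul_assoc]
  field_simp

lemma star2_self (hS : IsPerfect S) (i : Fin 3) : star2 S (S i) = S i := by
  have hv := hS.vol_ne
  refine alt2_ext ?_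
  rw [m2_star2, hS.gm_transpose]
  have h : til (m2 (S i)) = vol S • (gi S * m2 (S i) * gi S) := by
    rw [hS.gi_mul_gi, smul_smul, mul_one_div_cancel hv, one_smul]
  have e : gm S * (gi S * m2 (S i) * gi S) * gm S = (gm S * gi S) * m2 (S i) * (gi S * gm S) := by
    simp only [mul_assoc]
  rw [h, Matrix.mul_smul, Matrix.smul_mul, smul_smul, one_div_mul_cancel hv, one_smul, e,
    hS.gi_mul_gm, hS.gm_mul_gi, one_mul, mul_one]

end IsPerfect

lemma wedge22_comm (α β : Alt 2) : wedge22 α β = wedge22 β α := by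
  rw [wedge22_eq, wedge22_eq, wd_comm (m2_transpose α) (m2_transpose β)]

/-- The wedge product of 2-forms, as a bilinear map. -/
def wedge22L : Alt 2 →ₗ[ℝ] Alt 2 →ₗ[ℝ] ℝ := LinearMap.mk₂ ℝ wedge22
  (fun a b c => by rw [wedge22_comm, wedge22_eq, m2_add, wd_add_right, ← wedge22_eq, ← wedge22_eq,
    wedge22_comm c a, wedge22_comm c b])
  (fun r a b => by rw [wedge22_comm, wedge22_eq, m2_smul, wd_smul_right, ← wedge22_eq,
    wedge22_comm b a, smul_eq_mul])
  (fun a b c => by rw [wedge22_eq, m2_add, wd_add_right, ← wedge22_eq, ← wedge22_eq])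
  (fun r a b => by rw [wedge22_eq, m2_smul, wd_smul_right, ← wedge22_eq, smul_eq_mul])

/-- The full contraction of 2-forms, as a bilinear map. -/
def contr2L (S : Trip) : Alt 2 →ₗ[ℝ] Alt 2 →ₗ[ℝ] ℝ := LinearMap.mk₂ ℝ (contr2 S)
  (fun a b c => by simp [contr2_eq, Matrix.mul_add, Matrix.add_mul])
  (fun r a b => by simp [contr2_eq])
  (fun a b c => by simp [contr2_eq, Matrix.mul_add])
  (fun r a b => by simp [contr2_eq])

lemma contr2L_apply (S : Trip) (α β : Alt 2) : contr2L S α β = contr2 S α β := rfl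

/-- The Hodge star on 2-forms, as a linear map. -/
def star2L (S : Trip) : Alt 2 →ₗ[ℝ] Alt 2 where
  toFun := star2 S
  map_add' a b := alt2_ext (by simp [m2_star2, til_add, Matrix.mul_add, Matrix.add_mul])
  map_smul' r a := alt2_ext (by
    rw [m2_star2, m2_smul, til_smul, Matrix.mul_smul, Matrix.smul_mul, smul_comm, ← m2_star2]
    rfl)

/-- The Hodge star on 3-forms, as a linear map. -/
def star3L (S : Trip) : Alt 3 →ₗ[ℝ] Alt 1 where
  toFun := star3 S
  map_add' a b := by
    refine alt1_ext ?_
    have : vec3 (a + b) = vec3 a + vec3 b := by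
      ext l
      simp [vec3, mul_add, Finset.sum_add_distrib]
    rw [c1_add, c1_star3, c1_star3, c1_star3, this, Matrix.mulVec_add, smul_add]
  map_smul' r a := by
    refine alt1_ext ?_
    have : vec3 (r • a) = r • vec3 a := by
      ext l
      simp only [vec3, c3_smul, Pi.smul_apply, smul_eq_mul, Finset.mul_sum]
      refine Finset.sum_congr rfl fun _ _ => Finset.sum_congr rfl fun _ _ =>
        Finset.sum_congr rfl fun _ _ => by ring
    rw [RingHom.id_apply, c1_smul, c1_star3, c1_star3, this, Matrix.mulVec_smul, smul_comm]

/-! ### Self-dual and anti-self-dual parts -/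

/-- The anti-self-dual part (without the factor `1/2`) of a 2-form. -/
def asd (S : Trip) : Alt 2 →ₗ[ℝ] Alt 2 := LinearMap.id - star2L S

lemma asd_apply (S : Trip) (η : Alt 2) : asd S η = η - star2 S η := rfl

namespace IsPerfect

variable {S : Trip}

lemma wedge22_self (hS : IsPerfect S) (i : Fin 3) (η : Alt 2) :
    wedge22 (S i) η = (1 / 2) * vol S * contr2 S (S i) η := by
  rw [wedge22_comm, ← hS.star2_self i, hS.wedge22_star2, hS.star2_self, hS.contr2_comm]

lemma contr2_star2 (hS : IsPerfect S) (η τ : Alt 2) :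
    contr2 S (star2 S η) τ = contr2 S η (star2 S τ) := by
  have hv := hS.vol_ne
  have h1 := hS.wedge22_star2 η (star2 S τ)
  have h2 := hS.wedge22_star2 τ (star2 S η)
  rw [hS.star2_star2] at h1 h2
  rw [wedge22_comm, h1, hS.contr2_comm τ] at h2
  have : (1 / 2) * vol S ≠ 0 := by positivity
  exact (mul_left_cancel₀ this h2).symm

lemma contr2_self_star2 (hS : IsPerfect S) (i : Fin 3) (η : Alt 2) :
    contr2 S (S i) (star2 S η) = contr2 S (S i) η := by
  rw [← hS.contr2_star2, hS.star2_self]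

lemma contr2_self_self (hS : IsPerfect S) (i j : Fin 3) :
    contr2 S (S i) (S j) = if i = j then 4 else 0 := by
  have hv := hS.vol_ne
  have h := hS.wedge22_self i (S j)
  rw [hS.wedge] at h
  split_ifs at h ⊢ with hij
  · have : vol S * contr2 S (S i) (S j) = vol S * 4 := by linarith
    exact mul_left_cancel₀ hv this
  · have : vol S * contr2 S (S i) (S j) = vol S * 0 := by linarith
    exact mul_left_cancel₀ hv this

lemma alt2_ext_right (hS : IsPerfect S) {η τ : Alt 2} (h : m2 η * gi S = m2 τ * gi S) : η = τ := by
  refine alt2_ext ?_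
  have := congrArg (· * gm S) h
  simpa only [mul_assoc, hS.gi_mul_gm, mul_one] using this

/-- The Hodge star of a 2-form, as an endomorphism, in terms of conjugation by one of the complex
structures. -/
lemma xm_star2 (hS : IsPerfect S) (i : Fin 3) (η : Alt 2) : m2 (star2 S η) * gi S =
    (1 / 2 * contr2 S (S i) η) • sgEnd S i + sgEnd S i * (m2 η * gi S) * sgEnd S i := by
  have hv := hS.vol_ne
  have h := mul_til_add (m2_antisymm S i) (m2_transpose η)
  rw [← wedge22_eq, hS.wedge22_self] at h
  have ht : til (m2 (S i)) = vol S • (gi S * sgEnd S i) := by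
    rw [sgEnd, ← mul_assoc]
    change _ = vol S • (gi S * m2 (S i) * gi S)
    rw [hS.gi_mul_gi, smul_smul, mul_one_div_cancel hv, one_smul]
  have h1 : m2 (S i) * til (m2 η) =
      (-(1 / 2 * vol S * contr2 S (S i) η)) • 1 - m2 η * (vol S • (gi S * sgEnd S i)) := by
    rw [← h, ← ht, add_sub_cancel_right]
  have h2 : gm S * til (m2 η) = -(sgEnd S i * (m2 (S i) * til (m2 η))) := by
    have e : sgEnd S i * gm S = m2 (S i) := by
      rw [sgEnd, mul_assoc, hS.gi_mul_gm, mul_one]; rfl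
    rw [← e, ← mul_assoc, ← mul_assoc, hS.sgEnd_sq]
    simp
  rw [m2_star2, hS.gm_transpose, Matrix.smul_mul, mul_assoc _ (gm S), hS.gm_mul_gi, mul_one, h2, h1,
    mul_sub, Matrix.mul_smul, Matrix.mul_smul, Matrix.mul_smul, mul_one, neg_sub, smul_sub,
    smul_smul, smul_smul, one_div_mul_cancel hv, one_smul]
  simp only [mul_assoc]
  rw [sub_eq_add_neg, ← neg_smul, add_comm]
  congr 2
  field_simp

/-- The self-dual forms are spanned by the triple. -/
lemma add_star2 (hS : IsPerfect S) (η : Alt 2) :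
    η + star2 S η = ∑ j, (1 / 2 * contr2 S (S j) η) • S j := by
  refine hS.alt2_ext_right ?_
  obtain ⟨h01, h12, h20⟩ := hS.sgEnd_mul_aux
  have q := hS.sgEnd_sq
  have h10 : sgEnd S 1 * sgEnd S 0 = -sgEnd S 2 := by
    rw [← h12, ← mul_assoc, q, neg_mul, one_mul]
  have e0 := hS.xm_star2 0 η
  have e2 := hS.xm_star2 2 η
  have e1 := hS.xm_star2 1 (star2 S η)
  rw [hS.star2_star2, hS.contr2_self_star2, e0] at e1
  have e3 : sgEnd S 1 * (sgEnd S 0 * (m2 η * gi S) * sgEnd S 0) * sgEnd S 1 =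
      (1 / 2 * contr2 S (S 2) η) • sgEnd S 2 - m2 (star2 S η) * gi S := by
    calc _ = (sgEnd S 1 * sgEnd S 0) * (m2 η * gi S) * (sgEnd S 0 * sgEnd S 1) := by
          simp only [mul_assoc]
      _ = _ := by rw [h10, h01, e2]; simp
  have e4 : sgEnd S 1 * sgEnd S 0 * sgEnd S 1 = sgEnd S 0 := by
    rw [mul_assoc, h01, h12]
  rw [mul_add, add_mul, e3, Matrix.mul_smul, Matrix.smul_mul, e4] at e1
  rw [m2_add, add_mul, e1]
  have e5 : m2 (∑ j, (1 / 2 * contr2 S (S j) η) • S j) * gi S =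
      ∑ j, (1 / 2 * contr2 S (S j) η) • sgEnd S j := by
    rw [m2_sum, Finset.sum_mul]
    refine Finset.sum_congr rfl fun j _ => ?_
    rw [m2_smul, Matrix.smul_mul]
    rfl
  rw [e5, Fin.sum_univ_three]
  abel

lemma asd_self (hS : IsPerfect S) (i : Fin 3) : asd S (S i) = 0 := by
  rw [asd_apply, hS.star2_self, sub_self]

lemma contr2_asd (hS : IsPerfect S) (i : Fin 3) (η : Alt 2) : contr2 S (S i) (asd S η) = 0 := by
  rw [asd_apply, ← contr2L_apply, map_sub, contr2L_apply, contr2L_apply, hS.contr2_self_star2,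
    sub_self]

/-- The decomposition into the self-dual and the anti-self-dual part. -/
lemma two_smul_eq (hS : IsPerfect S) (η : Alt 2) :
    (2 : ℝ) • η = ∑ j, (1 / 2 * contr2 S (S j) η) • S j + asd S η := by
  rw [← hS.add_star2, asd_apply, two_smul]
  abel

lemma alt2_ext_asd (hS : IsPerfect S) {η τ : Alt 2}
    (h : ∀ j, contr2 S (S j) η = contr2 S (S j) τ) (h' : asd S η = asd S τ) : η = τ := by
  have h1 := hS.two_smul_eq η
  simp only [h', h] at h1
  rw [← hS.two_smul_eq] at h1
  exact smul_right_injective _ (two_ne_zero' ℝ) h1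

lemma star2_of_contr2 (hS : IsPerfect S) {η : Alt 2} (h : ∀ j, contr2 S (S j) η = 0) :
    star2 S η = -η := by
  have := hS.add_star2 η
  simp only [h, mul_zero, zero_smul, Finset.sum_const_zero] at this
  rw [eq_neg_iff_add_eq_zero, add_comm, this]

/-- Anti-self-dual forms commute with the endomorphisms `Σ^i_μ^α`. -/
lemma asd_commute (hS : IsPerfect S) {η : Alt 2} (h : ∀ j, contr2 S (S j) η = 0) (i : Fin 3) :
    m2 η * gi S * sgEnd S i = sgEnd S i * (m2 η * gi S) := by
  have e := hS.xm_star2 i η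
  rw [hS.star2_of_contr2 h, h, mul_zero, zero_smul, zero_add, m2_neg] at e
  have e2 := congrArg (fun X => sgEnd S i * X) e
  simp only [← mul_assoc, hS.sgEnd_sq] at e2
  simp only [neg_mul, mul_neg, one_mul] at e2
  simpa only [mul_assoc, neg_inj] using e2.symm

/-- Membership in `S` only concerns the self-dual parts: their coefficient matrix has no symmetric
traceless part. -/
lemma memS_iff (hS : IsPerfect S) (s : Trip) : MemS S s ↔ ∀ i j,
    contr2 S (S i) (s j) + contr2 S (S j) (s i) =
      if i = j then (2 / 3) * ∑ k, contr2 S (S k) (s k) else 0 := by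
  have hv := hS.vol_ne
  have hv2 : (1 / 2) * vol S ≠ 0 := by positivity
  refine forall_congr' fun i => forall_congr' fun j => ?_
  rw [wedge22_comm (s i)]
  simp only [hS.wedge22_self, ← Finset.mul_sum]
  constructor
  · intro h
    apply mul_left_cancel₀ hv2
    rw [mul_add, h]
    split_ifs <;> ring
  · intro h
    rw [← mul_add, h]
    split_ifs <;> ring

lemma contr2_liftS (hS : IsPerfect S) (s : Trip) (k i : Fin 3) : contr2 S (S k) (liftS S s i) =
    contr2 S (S i) (s k) - contr2 S (S k) (s i) -
      if k = i then 2 * ∑ j, contr2 S (S j) (s j) else 0 := by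
  rw [liftS, ← contr2L_apply]
  simp only [map_smul, map_add, map_sub, map_sum, contr2L_apply, hS.contr2_self_self, smul_eq_mul,
    hS.contr2_comm (s _)]
  simp
  split_ifs with h
  · subst h; ring
  · ring

lemma asd_liftS (hS : IsPerfect S) (s : Trip) (i : Fin 3) :
    asd S (liftS S s i) = (-2 : ℝ) • asd S (s i) := by
  simp only [liftS, map_smul, map_add, map_sub, map_sum, hS.asd_self, smul_zero,
    Finset.sum_const_zero, sub_zero, add_zero]

lemma memS_liftS (hS : IsPerfect S) (s : Trip) : MemS S (liftS S s) := by
  rw [hS.memS_iff]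
  intro i j
  simp only [hS.contr2_liftS]
  by_cases h : i = j
  · subst h
    simp [Fin.sum_univ_three]
    ring
  · simp [h, Ne.symm h]

/-- On `S`, the pairing with the lift of a triple is a multiple of the metric pairing with the
triple itself; this is where the projections `P` and `P₁` in `d₂^*` come from. -/
lemma ipS_liftS (hS : IsPerfect S) {s : Trip} (hs : MemS S s) (t : Trip) :
    ipS S s (liftS S t) = -(1 / 2) * ∑ i, contr2 S (s i) (t i) := by
  rw [hS.memS_iff] at hs
  have h1 : ∀ i, contr2 S (s i) (liftS S t i) = -2 * (contr2 S (s i) (t i)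
      - ∑ j, (1 / 8) * (contr2 S (S j) (t i) + contr2 S (S i) (t j)) * contr2 S (S j) (s i)
      + (1 / 4) * (∑ j, contr2 S (S j) (t j)) * contr2 S (S i) (s i)) := by
    intro i
    rw [liftS, ← contr2L_apply]
    simp only [map_smul, map_add, map_sub, map_sum, contr2L_apply, smul_eq_mul,
      hS.contr2_comm (t _), hS.contr2_comm (s _) (S _)]
  simp only [ipS, h1, hS.contr2_liftS]
  have s00 := hs 0 0
  have s11 := hs 1 1
  have s01 := hs 0 1
  have s02 := hs 0 2
  have s12 := hs 1 2
  simp [Fin.sum_univ_three] at s00 s11 s01 s02 s12 ⊢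
  have r10 : contr2 S (S 1) (s 0) = -contr2 S (S 0) (s 1) := by linarith
  have r20 : contr2 S (S 2) (s 0) = -contr2 S (S 0) (s 2) := by linarith
  have r21 : contr2 S (S 2) (s 1) = -contr2 S (S 1) (s 2) := by linarith
  have r11 : contr2 S (S 1) (s 1) = contr2 S (S 0) (s 0) := by linarith
  have r22 : contr2 S (S 2) (s 2) = contr2 S (S 0) (s 0) := by linarith
  rw [r10, r20, r21, r11, r22]
  ring

open scoped MatrixOrder in
lemma contr2_pos (hS : IsPerfect S) {η : Alt 2} (h : η ≠ 0) : 0 < contr2 S η η := by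
  have hg : (gi S).PosDef := hS.pos.inv
  obtain ⟨B, hB⟩ := CStarAlgebra.nonneg_iff_eq_star_mul_self.mp hg.posSemidef.nonneg
  rw [Matrix.star_eq_conjTranspose, Matrix.conjTranspose_eq_transpose_of_trivial] at hB
  have hdet : IsUnit B.det := by
    have h1 := hg.det_pos
    rw [hB, Matrix.det_mul, Matrix.det_transpose] at h1
    exact isUnit_iff_ne_zero.mpr fun h0 => by simp [h0] at h1
  have e : contr2 S η η = ((B * m2 η * Bᵀ) * (B * m2 η * Bᵀ)ᴴ).trace := by
    rw [contr2_eq, hS.gi_transpose, hB, Matrix.conjTranspose_eq_transpose_of_trivial]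
    simp only [Matrix.transpose_mul, Matrix.transpose_transpose, mul_assoc]
    rw [Matrix.trace_mul_comm]
    simp only [mul_assoc]
  rw [e]
  refine lt_of_le_of_ne (Matrix.posSemidef_self_mul_conjTranspose _).trace_nonneg (Ne.symm ?_)
  rw [Ne, Matrix.trace_mul_conjTranspose_self_eq_zero_iff]
  intro h0
  apply h
  refine alt2_ext ?_
  have h1 := congrArg (fun X => B⁻¹ * X * (Bᵀ)⁻¹) h0
  have h2 : B⁻¹ * (B * m2 η * Bᵀ) * (Bᵀ)⁻¹ = (B⁻¹ * B) * m2 η * (Bᵀ * (Bᵀ)⁻¹) := by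
    simp only [mul_assoc]
  simp only [h2, Matrix.nonsing_inv_mul _ hdet,
    Matrix.mul_nonsing_inv _ ((Matrix.det_transpose B).symm ▸ hdet)] at h1
  simpa using h1

lemma contr2_nonneg (hS : IsPerfect S) (η : Alt 2) : 0 ≤ contr2 S η η := by
  by_cases h : η = 0
  · rw [h, ← contr2L_apply, map_zero]
  · exact (hS.contr2_pos h).le

/-- The subtracted square is dominated by the norm, by the Cauchy–Schwarz inequality. -/
lemma ipS_pos (hS : IsPerfect S) {s : Trip} (hs : s ≠ 0) : 0 < ipS S s s := by
  have h1 : ∀ i, contr2 S (S i) (s i) ^ 2 ≤ 4 * contr2 S (s i) (s i) := by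
    intro i
    have := hS.contr2_nonneg (s i - (1 / 4 * contr2 S (S i) (s i)) • S i)
    rw [← contr2L_apply] at this
    simp only [map_sub, map_smul, LinearMap.sub_apply, LinearMap.smul_apply, contr2L_apply,
      smul_eq_mul, hS.contr2_self_self, if_pos, hS.contr2_comm (s i) (S i)] at this
    nlinarith
  have h2 : 0 < ∑ i, contr2 S (s i) (s i) := by
    obtain ⟨i, hi⟩ := Function.ne_iff.mp hs
    exact Finset.sum_pos' (fun j _ => hS.contr2_nonneg _) ⟨i, Finset.mem_univ _, hS.contr2_pos hi⟩
  have a := h1 0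
  have b := h1 1
  have c := h1 2
  simp only [ipS, Fin.sum_univ_three] at *
  nlinarith [sq_nonneg (contr2 S (S 0) (s 0) - contr2 S (S 1) (s 1)),
    sq_nonneg (contr2 S (S 0) (s 0) - contr2 S (S 2) (s 2)),
    sq_nonneg (contr2 S (S 1) (s 1) - contr2 S (S 2) (s 2))]

end IsPerfect

/-! ### The components of a section of `S ⊕ E` -/

lemma bil_apply (k : Bil) (u w : V4) : k u w = ∑ μ, ∑ ν, u μ * w ν * kmat k μ ν := by
  conv_lhs => rw [sum_bv u, sum_bv w]
  simp only [map_sum, map_smul, sum_apply, smul_apply,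
    smul_eq_mul, kmat, Matrix.of_apply, Finset.mul_sum]
  rw [Finset.sum_comm]
  refine Finset.sum_congr rfl fun _ _ => Finset.sum_congr rfl fun _ _ => by ring

lemma bil_ext {k l : Bil} (h : kmat k = kmat l) : k = l := by
  ext u w
  rw [bil_apply, bil_apply, h]

/-- The bilinear form with a given matrix. -/
def mkBil (K : Matrix (Fin 4) (Fin 4) ℝ) : Bil :=
  ∑ μ, ∑ ν, K μ ν • (dx μ).smulRight (dx ν)

lemma kmat_mkBil (K : Matrix (Fin 4) (Fin 4) ℝ) : kmat (mkBil K) = K := by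
  ext μ ν
  simp [kmat, mkBil]

@[simp] lemma kmat_add (k l : Bil) : kmat (k + l) = kmat k + kmat l := rfl
@[simp] lemma kmat_smul (r : ℝ) (k : Bil) : kmat (r • k) = r • kmat k := rfl

lemma isSym0_iff (S : Trip) (k : Bil) :
    IsSym0 S k ↔ (kmat k)ᵀ = kmat k ∧ (gi S * (kmat k)ᵀ).trace = 0 := by
  refine and_congr ⟨fun h => ?_, fun h u w => ?_⟩ ?_
  · ext μ ν
    exact h _ _
  · rw [bil_apply, bil_apply, Finset.sum_comm]
    refine Finset.sum_congr rfl fun μ _ => Finset.sum_congr rfl fun ν _ => ?_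
    have := congrFun (congrFun h μ) ν
    rw [Matrix.transpose_apply] at this
    rw [this]
    ring
  · simp only [Matrix.trace, Matrix.diag, Matrix.mul_apply, Matrix.transpose_apply]
    rfl

/-- The map `k ↦ k ⋄ Σ^i`, as a linear map. -/
def diamondL (S : Trip) (i : Fin 3) : Bil →ₗ[ℝ] Alt 2 where
  toFun k := diamond S k i
  map_add' k l := alt2_ext (by
    rw [m2_add, m2_diamond, m2_diamond, m2_diamond, kmat_add, add_mul, add_mul,
      Matrix.transpose_add]
    abel)
  map_smul' r k := alt2_ext (by
    rw [RingHom.id_apply, m2_smul, m2_diamond, m2_diamond, kmat_smul, Matrix.smul_mul,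
      Matrix.smul_mul, Matrix.transpose_smul, smul_sub])

lemma diamondL_apply (S : Trip) (i : Fin 3) (k : Bil) : diamondL S i k = diamond S k i := rfl

lemma isLinearMap_iota (S : Trip) : IsLinearMap ℝ (iota S) where
  map_add p q := by
    refine Prod.ext (funext fun i => ?_) rfl
    simp only [iota, param, Prod.fst_add, Prod.snd_add, Pi.add_apply, ← diamondL_apply, map_add,
      mul_add, add_smul, add_div, Finset.sum_add_distrib]
    abel
  map_smul r p := by
    refine Prod.ext (funext fun i => ?_) rfl
    simp only [iota, param, Prod.smul_fst, Prod.smul_snd, Pi.smul_apply, ← diamondL_apply, map_smul,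
      smul_add, smul_eq_mul, Finset.smul_sum, smul_smul]
    congr 2
    · ring_nf
    · refine Finset.sum_congr rfl fun j _ => ?_
      refine Finset.sum_congr rfl fun l _ => ?_
      congr 1
      ring

namespace IsPerfect

variable {S : Trip}

/-- As an endomorphism, `k ⋄ Σ^i` is the anticommutator of `k` with the complex structure. -/
lemma xm_diamond (hS : IsPerfect S) {k : Bil} (hk : IsSym0 S k) (i : Fin 3) :
    m2 (diamond S k i) * gi S =
      kmat k * gi S * sgEnd S i + sgEnd S i * (kmat k * gi S) := by
  have h := ((isSym0_iff S k).mp hk).1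
  rw [m2_diamond, Matrix.transpose_mul, Matrix.transpose_mul, h, hS.gi_transpose, m2_transpose,
    neg_mul, sub_neg_eq_add, add_mul]
  change _ = kmat k * gi S * (m2 (S i) * gi S) + (m2 (S i) * gi S) * (kmat k * gi S)
  simp only [mul_assoc]

lemma _root_.Plebanski.trace_kmat {k : Bil} (hk : IsSym0 S k) : (kmat k * gi S).trace = 0 := by
  have h := (isSym0_iff S k).mp hk
  rw [h.1] at h
  rw [Matrix.trace_mul_comm, h.2]

/-- As `k` is symmetric and traceless, `k ⋄ Σ^i` is anti-self-dual. -/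
lemma contr2_diamond (hS : IsPerfect S) {k : Bil} (hk : IsSym0 S k) (i j : Fin 3) :
    contr2 S (S j) (diamond S k i) = 0 := by
  rw [hS.contr2_trace, hS.xm_diamond hk, mul_add]
  change -((sgEnd S j * _ + sgEnd S j * _).trace) = 0
  have e0 : (sgEnd S j * (kmat k * gi S * sgEnd S i)).trace =
      (sgEnd S i * sgEnd S j * (kmat k * gi S)).trace := by
    rw [← mul_assoc, Matrix.trace_mul_comm, ← mul_assoc]
  rw [Matrix.trace_add, e0, ← mul_assoc (sgEnd S j), ← Matrix.trace_add, ← add_mul,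
    hS.sgEnd_mul, hS.sgEnd_mul]
  have e : ((-(if i = j then 1 else 0) : ℝ) • (1 : Matrix (Fin 4) (Fin 4) ℝ) +
      ∑ k, eps3 i j k • sgEnd S k) + ((-(if j = i then 1 else 0) : ℝ) • 1 +
      ∑ k, eps3 j i k • sgEnd S k) = (-2 * (if i = j then 1 else 0) : ℝ) • 1 := by
    simp only [eps3_swap j i, neg_smul, Finset.sum_neg_distrib, eq_comm (a := j)]
    module
  rw [e, Matrix.smul_mul, one_mul, Matrix.trace_smul, trace_kmat hk, smul_zero, neg_zero]

lemma star2_diamond (hS : IsPerfect S) {k : Bil} (hk : IsSym0 S k) (i : Fin 3) :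
    star2 S (diamond S k i) = -diamond S k i :=
  hS.star2_of_contr2 fun j => hS.contr2_diamond hk i j

lemma asd_diamond (hS : IsPerfect S) {k : Bil} (hk : IsSym0 S k) (i : Fin 3) :
    asd S (diamond S k i) = (2 : ℝ) • diamond S k i := by
  rw [asd_apply, hS.star2_diamond hk, sub_neg_eq_add, two_smul]

/-- The inverse of `k ↦ k ⋄ Σ^i` on anti-self-dual triples. -/
lemma sum_xm_diamond (hS : IsPerfect S) {k : Bil} (hk : IsSym0 S k) :
    ∑ i, m2 (diamond S k i) * gi S * sgEnd S i = (-2 : ℝ) • (kmat k * gi S) := by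
  obtain ⟨h01, h12, h20⟩ := hS.sgEnd_mul_aux
  have q := hS.sgEnd_sq
  have h10 : sgEnd S 1 * sgEnd S 0 = -sgEnd S 2 := by
    rw [← h12, ← mul_assoc, q, neg_mul, one_mul]
  have h02 : sgEnd S 0 * sgEnd S 2 = -sgEnd S 1 := by
    rw [← h01, ← mul_assoc, q, neg_mul, one_mul]
  have c := hS.asd_commute (fun j => hS.contr2_diamond hk 0 j) 1
  rw [hS.xm_diamond hk] at c
  set Y := kmat k * gi S with hY
  have c2 := congrArg (fun X => X * sgEnd S 2) c
  simp only [add_mul, mul_add] at c2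
  have r1 : Y * sgEnd S 0 * sgEnd S 1 * sgEnd S 2 = -Y := by
    rw [mul_assoc Y, h01, mul_assoc, q, mul_neg, mul_one]
  have r2 : sgEnd S 0 * Y * sgEnd S 1 * sgEnd S 2 = sgEnd S 0 * Y * sgEnd S 0 := by
    rw [mul_assoc _ (sgEnd S 1), h12]
  have r3 : sgEnd S 1 * (Y * sgEnd S 0) * sgEnd S 2 = -(sgEnd S 1 * Y * sgEnd S 1) := by
    rw [← mul_assoc, mul_assoc _ (sgEnd S 0), h02, mul_neg]
  have r4 : sgEnd S 1 * (sgEnd S 0 * Y) * sgEnd S 2 = -(sgEnd S 2 * Y * sgEnd S 2) := by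
    rw [← mul_assoc, h10, neg_mul, neg_mul]
  rw [r1, r2, r3, r4] at c2
  have s : ∀ i, m2 (diamond S k i) * gi S * sgEnd S i = -Y + sgEnd S i * Y * sgEnd S i := by
    intro i
    rw [hS.xm_diamond hk, add_mul, mul_assoc, q, mul_neg, mul_one]
  rw [Fin.sum_univ_three, s, s, s]
  have c3 : sgEnd S 0 * Y * sgEnd S 0 =
      Y - sgEnd S 1 * Y * sgEnd S 1 - sgEnd S 2 * Y * sgEnd S 2 := by
    have : sgEnd S 0 * Y * sgEnd S 0 = (-Y + sgEnd S 0 * Y * sgEnd S 0) + Y := by abel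
    rw [this, c2]
    abel
  rw [c3]
  module

end IsPerfect

/-- The scalar component of an element of `S`. -/
def compH (S : Trip) (s : Trip) : ℝ := (1 / 6) * ∑ i, contr2 S (S i) (s i)

/-- The component in `E` of an element of `S`. -/
def compU (S : Trip) (s : Trip) (l : Fin 3) : ℝ :=
  (1 / 16) * ∑ i, ∑ j, eps3 i j l * contr2 S (S j) (s i)

/-- The component in `Sym²₀(Λ¹)` of an element of `S`. -/
def compK (S : Trip) (s : Trip) : Bil :=
  mkBil ((-(1 / 4) : ℝ) • ∑ i, m2 (asd S (s i)) * gi S * m2 (S i))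

namespace IsPerfect

variable {S : Trip}

lemma contr2_param (hS : IsPerfect S) (h : ℝ) (u : Fin 3 → ℝ) {k : Bil} (hk : IsSym0 S k)
    (i j : Fin 3) : contr2 S (S j) (param S h u k i) =
      (if i = j then 2 * h else 0) + 8 * ∑ l, eps3 i j l * u l := by
  rw [param, ← contr2L_apply]
  simp only [map_add, map_smul, map_sum, contr2L_apply, hS.contr2_diamond hk, hS.contr2_self_self,
    smul_eq_mul, eq_comm (a := j), mul_ite, mul_zero, add_zero]
  rw [Finset.mul_sum, Finset.sum_comm]
  simp only [Finset.sum_ite_eq', Finset.mem_univ, if_true]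
  congr 1
  · split_ifs <;> ring
  · refine Finset.sum_congr rfl fun l _ => by ring

lemma asd_param (hS : IsPerfect S) (h : ℝ) (u : Fin 3 → ℝ) {k : Bil} (hk : IsSym0 S k)
    (i : Fin 3) : asd S (param S h u k i) = (2 : ℝ) • diamond S k i := by
  rw [param]
  simp only [map_add, map_smul, map_sum, hS.asd_self, hS.asd_diamond hk, smul_zero,
    Finset.sum_const_zero, zero_add]

lemma memS_param (hS : IsPerfect S) (h : ℝ) (u : Fin 3 → ℝ) {k : Bil} (hk : IsSym0 S k) :
    MemS S (param S h u k) := by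
  rw [hS.memS_iff]
  intro i j
  simp only [hS.contr2_param h u hk]
  fin_cases i <;> fin_cases j <;> simp [Fin.sum_univ_three] <;> ring

lemma isSym0_compK (hS : IsPerfect S) (s : Trip) : IsSym0 S (compK S s) := by
  rw [isSym0_iff, compK, kmat_mkBil]
  have c : ∀ i, m2 (asd S (s i)) * gi S * sgEnd S i = sgEnd S i * (m2 (asd S (s i)) * gi S) :=
    fun i => hS.asd_commute (fun j => hS.contr2_asd j _) i
  have e : ∀ i, (m2 (asd S (s i)) * gi S * m2 (S i))ᵀ = m2 (asd S (s i)) * gi S * m2 (S i) := by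
    intro i
    have h1 := congrArg (· * gm S) (c i)
    change m2 (asd S (s i)) * gi S * (m2 (S i) * gi S) * gm S =
      m2 (S i) * gi S * (m2 (asd S (s i)) * gi S) * gm S at h1
    simp only [mul_assoc, hS.gi_mul_gm, mul_one] at h1
    rw [Matrix.transpose_mul, Matrix.transpose_mul, m2_transpose, m2_transpose, hS.gi_transpose,
      mul_neg, neg_mul, mul_neg, neg_neg, ← h1, mul_assoc]
  have e2 : ((-(1 / 4) : ℝ) • ∑ i, m2 (asd S (s i)) * gi S * m2 (S i))ᵀ =
      (-(1 / 4) : ℝ) • ∑ i, m2 (asd S (s i)) * gi S * m2 (S i) := by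
    rw [Matrix.transpose_smul, Matrix.transpose_sum]
    simp only [e]
  refine ⟨e2, ?_⟩
  rw [e2, Matrix.trace_mul_comm, Matrix.smul_mul, Finset.sum_mul, Matrix.trace_smul,
    Matrix.trace_sum]
  have z : ∀ i, (m2 (asd S (s i)) * gi S * m2 (S i) * gi S).trace = 0 := by
    intro i
    have h1 := hS.contr2_asd i (s i)
    rw [hS.contr2_comm, hS.contr2_trace, neg_eq_zero] at h1
    rw [mul_assoc, h1]
  simp [z]

/-- Since anti-self-dual forms commute with the complex structures, the anticommutators with `Σ^j`
in `k ⋄ Σ^j` collapse, and `k ↦ k ⋄ Σ` reaches every anti-self-dual triple. -/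
lemma diamond_compK (hS : IsPerfect S) (s : Trip) (j : Fin 3) :
    (2 : ℝ) • diamond S (compK S s) j = asd S (s j) := by
  refine hS.alt2_ext_right ?_
  have c : ∀ i, m2 (asd S (s i)) * gi S * sgEnd S j = sgEnd S j * (m2 (asd S (s i)) * gi S) :=
    fun i => hS.asd_commute (fun j => hS.contr2_asd j _) j
  have hK : kmat (compK S s) * gi S =
      (-(1 / 4) : ℝ) • ∑ i, m2 (asd S (s i)) * gi S * sgEnd S i := by
    rw [compK, kmat_mkBil, Matrix.smul_mul, Finset.sum_mul]
    simp only [mul_assoc]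
    rfl
  rw [m2_smul, Matrix.smul_mul, hS.xm_diamond (hS.isSym0_compK s), hK]
  have e : ∀ i, sgEnd S j * (m2 (asd S (s i)) * gi S * sgEnd S i) =
      m2 (asd S (s i)) * gi S * (sgEnd S j * sgEnd S i) := by
    intro i
    rw [← mul_assoc, ← c, mul_assoc]
  simp only [Matrix.smul_mul, Matrix.mul_smul, Finset.sum_mul, Finset.mul_sum, e]
  rw [← smul_add, ← Finset.sum_add_distrib]
  -- By the Clifford relations, only the term `i = j` survives.
  have e2 : ∀ i, m2 (asd S (s i)) * gi S * sgEnd S i * sgEnd S j +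
      m2 (asd S (s i)) * gi S * (sgEnd S j * sgEnd S i) =
      (if i = j then (-2 : ℝ) else 0) • (m2 (asd S (s i)) * gi S) := by
    intro i
    rw [mul_assoc _ (sgEnd S i), ← mul_add, hS.sgEnd_mul, hS.sgEnd_mul]
    have e3 : ((-(if i = j then 1 else 0) : ℝ) • (1 : Matrix (Fin 4) (Fin 4) ℝ) +
        ∑ k, eps3 i j k • sgEnd S k) + ((-(if j = i then 1 else 0) : ℝ) • 1 +
        ∑ k, eps3 j i k • sgEnd S k) = (if i = j then (-2 : ℝ) else 0) • 1 := by
      simp only [eps3_swap j i, neg_smul, Finset.sum_neg_distrib, eq_comm (a := j)]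
      split_ifs <;> module
    rw [e3, Matrix.mul_smul, mul_one]
  simp only [e2, ite_smul, zero_smul, Finset.sum_ite_eq', Finset.mem_univ, if_true, smul_smul]
  norm_num

/-- Every element of `S` is recovered from its components. -/
lemma param_comp (hS : IsPerfect S) {s : Trip} (hs : MemS S s) :
    param S (compH S s) (compU S s) (compK S s) = s := by
  funext i
  refine hS.alt2_ext_asd (fun j => ?_) ?_
  · rw [hS.contr2_param _ _ (hS.isSym0_compK s)]
    rw [hS.memS_iff] at hs
    have s00 := hs 0 0
    have s11 := hs 1 1
    have s22 := hs 2 2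
    have s01 := hs 0 1
    have s02 := hs 0 2
    have s12 := hs 1 2
    simp [Fin.sum_univ_three] at s00 s11 s22 s01 s02 s12
    fin_cases i <;> fin_cases j <;> simp [Fin.sum_univ_three, compH, compU] <;> linarith
  · rw [hS.asd_param _ _ (hS.isSym0_compK s), hS.diamond_compK]

lemma comp_param (hS : IsPerfect S) (h : ℝ) (u : Fin 3 → ℝ) {k : Bil} (hk : IsSym0 S k) :
    compH S (param S h u k) = h ∧ compU S (param S h u k) = u ∧ compK S (param S h u k) = k := by
  refine ⟨?_, ?_, ?_⟩
  · simp only [compH, hS.contr2_param h u hk]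
    simp
    ring
  · ext l
    simp only [compU, hS.contr2_param h u hk]
    fin_cases l <;> simp [Fin.sum_univ_three] <;> ring
  · refine bil_ext ?_
    rw [compK, kmat_mkBil]
    simp only [hS.asd_param h u hk, m2_smul, Matrix.smul_mul, ← Finset.smul_sum]
    have h1 := congrArg (· * gm S) (hS.sum_xm_diamond hk)
    have e : ∀ i, m2 (diamond S k i) * gi S * sgEnd S i * gm S =
        m2 (diamond S k i) * gi S * m2 (S i) := by
      intro i
      change m2 (diamond S k i) * gi S * (m2 (S i) * gi S) * gm S = _
      simp only [mul_assoc, hS.gi_mul_gm, mul_one]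
    simp only [Finset.sum_mul, e, Matrix.smul_mul, mul_assoc _ (gi S) (gm S), hS.gi_mul_gm,
      mul_one] at h1
    rw [h1, smul_smul, smul_smul]
    norm_num

lemma bijOn_iota (hS : IsPerfect S) :
    Set.BijOn (iota S) {q | IsSym0 S q.2.2.2} {p | MemS S p.1} := by
  refine ⟨fun q hq => hS.memS_param _ _ hq, fun q hq q' hq' h => ?_, fun p hp => ?_⟩
  · obtain ⟨a1, a2, a3⟩ := hS.comp_param q.1 q.2.1 hq
    obtain ⟨b1, b2, b3⟩ := hS.comp_param q'.1 q'.2.1 hq'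
    have h1 := congrArg Prod.fst h
    have h2 := congrArg Prod.snd h
    simp only [iota] at h1 h2
    rw [h1] at a1 a2 a3
    exact Prod.ext (a1.symm.trans b1) (Prod.ext (a2.symm.trans b2)
      (Prod.ext h2 (a3.symm.trans b3)))
  · exact ⟨(compH S p.1, compU S p.1, p.2, compK S p.1), hS.isSym0_compK _,
      Prod.ext (hS.param_comp hp) rfl⟩

end IsPerfect

/-! ### The linear maps `T₁`, `T₂` and `J₁` -/

lemma sqrt_two_sq : √(2 : ℝ) * √2 = 2 := Real.mul_self_sqrt (by norm_num)

lemma isLinearMap_T1 : IsLinearMap ℝ T1 where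
  map_add p q := by
    refine Prod.ext rfl (Prod.ext ?_ (Prod.ext ?_ rfl)) <;>
      simp only [T1, Prod.fst_add, Prod.snd_add] <;> module
  map_smul r p := by
    refine Prod.ext rfl (Prod.ext ?_ (Prod.ext ?_ rfl)) <;>
      simp only [T1, Prod.smul_fst, Prod.smul_snd] <;> module

lemma bijective_T1 : Function.Bijective T1 := by
  have h2 := sqrt_two_sq
  have h0 : √(2 : ℝ) ≠ 0 := by positivity
  refine Function.bijective_iff_has_inverse.mpr
    ⟨fun q => (q.1, (2 : ℝ) • q.2.1 + (√2 / 2) • q.2.2.1, (2 : ℝ) • q.2.1 - (√2 / 2) • q.2.2.1,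
      q.2.2.2), fun q => ?_, fun q => ?_⟩
  · refine Prod.ext rfl (Prod.ext ?_ (Prod.ext ?_ rfl)) <;>
    · ext i
      simp [T1]
      field_simp
      ring
  · refine Prod.ext rfl (Prod.ext ?_ (Prod.ext ?_ rfl))
    · ext i
      simp [T1]
      ring
    · ext i
      simp [T1]
      field_simp
      ring_nf

lemma isLinearMap_T2 (S : Trip) : IsLinearMap ℝ (T2 S) where
  map_add p q := by
    refine Prod.ext ?_ (funext fun i => ?_)
    · simp only [T2, Phi_eq, Prod.fst_add, Prod.snd_add, Pi.add_apply, map_add,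
        Finset.sum_add_distrib]
      module
    · simp only [T2, Prod.fst_add, Prod.snd_add, Pi.add_apply, Pi.sub_apply, Pi.smul_apply,
        PhiStar_eq, map_add]
      module
  map_smul r p := by
    refine Prod.ext ?_ (funext fun i => ?_)
    · simp only [T2, Phi_eq, Prod.smul_fst, Prod.smul_snd, Pi.smul_apply, map_smul,
        ← Finset.smul_sum]
      module
    · simp only [T2, Prod.smul_fst, Prod.smul_snd, Pi.smul_apply, Pi.sub_apply,
        PhiStar_eq, map_smul]
      module

namespace IsPerfect

variable {S : Trip}

lemma Jl_self (hS : IsPerfect S) (i : Fin 3) (α : Alt 1) : Jl S i (Jl S i α) = -α := by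
  rw [hS.Jl_Jl]
  simp
  module

lemma Jl_table (hS : IsPerfect S) (α : Alt 1) :
    Jl S 0 (Jl S 1 α) = Jl S 2 α ∧ Jl S 1 (Jl S 2 α) = Jl S 0 α ∧ Jl S 2 (Jl S 0 α) = Jl S 1 α ∧
    Jl S 1 (Jl S 0 α) = -Jl S 2 α ∧ Jl S 2 (Jl S 1 α) = -Jl S 0 α ∧
      Jl S 0 (Jl S 2 α) = -Jl S 1 α := by
  refine ⟨?_, ?_, ?_, ?_, ?_, ?_⟩ <;> · rw [hS.Jl_Jl]; simp [Fin.sum_univ_three]; try module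

lemma Phi_PhiStar (hS : IsPerfect S) (ξ : Alt 1) : Phi S (PhiStar S ξ) = (-(3 / 2) : ℝ) • ξ := by
  simp only [Phi_eq, PhiStar_eq, map_smul, hS.Jl_self, Fin.sum_univ_three]
  module

lemma bijective_T2 (hS : IsPerfect S) : Function.Bijective (T2 S) := by
  have h2 := sqrt_two_sq
  have lin : ∀ (a b : ELam) (r : ℝ), Phi S (a + r • b) = Phi S a + r • Phi S b := by
    intro a b r
    simp only [Phi_eq, Pi.add_apply, Pi.smul_apply, map_add, map_smul, Finset.sum_add_distrib,
      Finset.smul_sum]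
  have lin' : ∀ (a b : ELam) (r : ℝ), Phi S (a - r • b) = Phi S a - r • Phi S b := by
    intro a b r
    simp only [Phi_eq, Pi.sub_apply, Pi.smul_apply, map_sub, map_smul, Finset.sum_sub_distrib,
      Finset.smul_sum]
  let inv1 : Alt 1 × ELam → Alt 1 := fun p => (-(1 / 2) : ℝ) • (p.1 - √2 • Phi S p.2)
  have e1 : ∀ p, inv1 (T2 S p) = p.1 := by
    intro p
    simp only [inv1, T2]
    rw [lin', hS.Phi_PhiStar]
    match_scalars
    · linear_combination (3 / 4) * h2
    · ring
  refine Function.bijective_iff_has_inverse.mpr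
    ⟨fun p => (inv1 p, p.2 + √2 • PhiStar S (inv1 p)), fun p => ?_, fun p => ?_⟩
  · refine Prod.ext (e1 p) ?_
    change (T2 S p).2 + √2 • PhiStar S (inv1 (T2 S p)) = p.2
    rw [e1]
    simp [T2]
  · refine Prod.ext ?_ ?_
    · change inv1 p + √2 • Phi S (p.2 + √2 • PhiStar S (inv1 p)) = p.1
      rw [lin, hS.Phi_PhiStar, smul_add, smul_smul, smul_smul]
      rw [show √2 * √2 * -(3 / 2) = (-3 : ℝ) by linear_combination (-3 / 2) * h2]
      simp only [inv1]
      module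
    · simp [T2]

/-- The indefinite pairing on `E ⊗ Λ¹` is the metric pairing twisted by `-J₁`. -/
lemma ipA_eq (hS : IsPerfect S) (a b : ELam) : ipA S a b = -∑ k, ip1 S (J1 S a k) (b k) := by
  have hv := hS.vol_ne
  simp only [ipA, hS.wedge211_perfect, J1_eq, Fin.sum_univ_three]
  simp [← ip1L_apply]
  simp only [ip1L_apply, hS.ip1_Jl]
  field_simp
  ring

lemma J1_J1inv (hS : IsPerfect S) (a : ELam) : J1 S (J1inv S a) = a := by
  obtain h := hS.Jl_table
  funext i
  fin_cases i <;> simp [J1_eq, J1inv_eq, Fin.sum_univ_three, h, hS.Jl_self] <;> module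

lemma ipA_J1inv (hS : IsPerfect S) (a b : ELam) :
    ipA S (J1inv S a) b = -∑ k, ip1 S (a k) (b k) := by
  rw [hS.ipA_eq, hS.J1_J1inv]

lemma ip1_J1_comm (hS : IsPerfect S) (a b : ELam) :
    ∑ k, ip1 S (J1 S a k) (b k) = ∑ k, ip1 S (a k) (J1 S b k) := by
  simp only [J1_eq, Fin.sum_univ_three]
  simp [← ip1L_apply]
  simp only [ip1L_apply, hS.ip1_Jl]
  ring

lemma ipA_J1 (hS : IsPerfect S) (a b : ELam) : ipA S (J1 S a) b = ipA S a (J1 S b) := by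
  rw [hS.ipA_eq, hS.ipA_eq, hS.ip1_J1_comm]

lemma ipA_comm (hS : IsPerfect S) (a b : ELam) : ipA S a b = ipA S b a := by
  rw [hS.ipA_eq, hS.ipA_eq, hS.ip1_J1_comm]
  simp only [hS.ip1_comm]

lemma ipA_PhiStar (hS : IsPerfect S) (a : ELam) (ξ : Alt 1) :
    ipA S a (PhiStar S ξ) = ip1 S (Phi S a) ξ := by
  obtain h := hS.Jl_table
  rw [hS.ipA_eq]
  have e : ∀ k, ip1 S (J1 S a k) (PhiStar S ξ k) = -(1 / 2) * ip1 S (Jl S k (J1 S a k)) ξ := by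
    intro k
    rw [PhiStar_eq, ← ip1L_apply, map_smul, ip1L_apply, smul_eq_mul, hS.ip1_Jl]
    ring
  rw [Fin.sum_univ_three, e, e, e]
  simp only [Phi_eq, J1_eq, Fin.sum_univ_three]
  simp [h, ← ip1L_apply]
  ring

end IsPerfect

/-! ### Naturality of the pointwise operations -/

/-- Pull-back of a triple by a linear map. -/
abbrev pbT {k : ℕ} (A : V4 →L[ℝ] V4) (s : Fin 3 → Alt k) : Fin 3 → Alt k := fun i => pb A (s i)

/-- Pull-back of a bilinear form by a linear map. -/
abbrev pbB (A : V4 →L[ℝ] V4) (k : Bil) : Bil := k.bilinearComp A A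

lemma kmat_pbB (A : V4 →L[ℝ] V4) (k : Bil) : kmat (pbB A k) = (lmat A)ᵀ * kmat k * lmat A := by
  ext μ ν
  change k (A (bv μ)) (A (bv ν)) = _
  rw [bil_apply, Finset.sum_comm]
  simp only [Matrix.mul_apply, Matrix.transpose_apply, lmat, Matrix.of_apply, Finset.sum_mul]
  refine Finset.sum_congr rfl fun _ _ => Finset.sum_congr rfl fun _ _ => by ring

lemma wd_equivariance (G A B : Matrix (Fin 4) (Fin 4) ℝ) :
    wd (Gᵀ * A * G) (Gᵀ * B * G) = G.det * wd A B := by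
  have h := til_equivariance G B
  rw [wd, wd]
  have e : (Gᵀ * A * G * til (Gᵀ * B * G)).trace = (A * (G * til (Gᵀ * B * G) * Gᵀ)).trace := by
    rw [mul_assoc, mul_assoc, Matrix.trace_mul_comm]
    simp only [mul_assoc]
  rw [e, h, Matrix.mul_smul, Matrix.trace_smul, smul_eq_mul]
  ring

lemma wedge22_pb (A : V4 →L[ℝ] V4) (α β : Alt 2) :
    wedge22 (pb A α) (pb A β) = (lmat A).det * wedge22 α β := by
  rw [wedge22_eq, wedge22_eq, m2_pb, m2_pb, wd_equivariance]

lemma vol_pb (A : V4 →L[ℝ] V4) (S : Trip) : vol (pbT A S) = (lmat A).det * vol S := by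
  simp only [vol, wedge22_pb, ← Finset.mul_sum]
  ring

lemma vec3_pb (A : V4 →L[ℝ] V4) (Ω : Alt 3) :
    lmat A *ᵥ vec3 (pb A Ω) = (lmat A).det • vec3 Ω := by
  ext m
  simp only [Matrix.mulVec, dotProduct, vec3, c3_pb, Pi.smul_apply, smul_eq_mul, Finset.mul_sum]
  have h : ∀ a b c, (lmat A).det * (1 / 6 * (eps4 m a b c * c3 Ω a b c)) =
      ∑ l, ∑ μ, ∑ ν, ∑ ρ, lmat A m l * (1 / 6 * (eps4 l μ ν ρ *
        (lmat A a μ * lmat A b ν * lmat A c ρ * c3 Ω a b c))) := by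
    intro a b c
    have := eps4_equivariance (lmat A) m a b c
    have e : (lmat A).det * (1 / 6 * (eps4 m a b c * c3 Ω a b c)) =
      (lmat A).det * eps4 m a b c * (1 / 6 * c3 Ω a b c) := by ring
    rw [e, ← this]
    simp only [Finset.sum_mul]
    refine Finset.sum_congr rfl fun _ _ => Finset.sum_congr rfl fun _ _ =>
      Finset.sum_congr rfl fun _ _ => Finset.sum_congr rfl fun _ _ => by ring
  simp only [h]
  rw [sum4_comm]
  refine Finset.sum_congr rfl fun a _ => ?_
  rw [sum4_comm]
  refine Finset.sum_congr rfl fun b _ => ?_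
  rw [sum4_comm]

lemma wedge13_pb (A : V4 →L[ℝ] V4) (α : Alt 1) (Ω : Alt 3) :
    wedge13 (pb A α) (pb A Ω) = (lmat A).det * wedge13 α Ω := by
  rw [wedge13_eq, wedge13_eq, c1_pb, ← Matrix.vecMul_transpose, Matrix.transpose_transpose,
    ← Matrix.dotProduct_mulVec, vec3_pb, dotProduct_smul, smul_eq_mul]

section Invertible

variable {A : V4 →L[ℝ] V4} (hA : (lmat A).det ≠ 0) (S : Trip)
include hA

lemma gm_pb : gm (pbT A S) = (lmat A)ᵀ * gm S * lmat A := by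
  have h : ∀ i j k, m2 (pb A (S i)) * til (m2 (pb A (S k))) * m2 (pb A (S j)) =
      (lmat A).det • ((lmat A)ᵀ * (m2 (S i) * til (m2 (S k)) * m2 (S j)) * lmat A) := by
    intro i j k
    have e := til_equivariance (lmat A) (m2 (S k))
    rw [m2_pb, m2_pb, m2_pb]
    calc _ = (lmat A)ᵀ * (m2 (S i) * (lmat A * til ((lmat A)ᵀ * m2 (S k) * lmat A) * (lmat A)ᵀ) *
          m2 (S j)) * lmat A := by simp only [mul_assoc]
      _ = _ := by rw [e]; simp only [Matrix.mul_smul, Matrix.smul_mul]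
  rw [gm_eq_sum, gm_eq_sum, vol_pb]
  simp only [h, Matrix.mul_smul, Matrix.smul_mul, Finset.mul_sum, Finset.sum_mul, Finset.smul_sum,
    smul_smul]
  refine Finset.sum_congr rfl fun i _ => Finset.sum_congr rfl fun j _ =>
    Finset.sum_congr rfl fun k _ => ?_
  congr 1
  by_cases hv : vol S = 0
  · simp [hv]
  · field_simp

lemma isPerfect_pb {S : Trip} (hS : IsPerfect S) : IsPerfect (pbT A S) where
  wedge i j := by
    rw [wedge22_pb, hS.wedge, vol_pb]
    split_ifs <;> ring
  vol_ne := by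
    rw [vol_pb]
    exact mul_ne_zero hA hS.vol_ne
  pos := by
    rw [gm_pb hA, ← Matrix.conjTranspose_eq_transpose_of_trivial]
    refine hS.pos.conjTranspose_mul_mul_same ?_
    exact Matrix.mulVec_injective_of_isUnit ((Matrix.isUnit_iff_isUnit_det _).mpr hA.isUnit)

lemma gi_pb : gi (pbT A S) = (lmat A)⁻¹ * gi S * ((lmat A)ᵀ)⁻¹ := by
  rw [gi, gm_pb hA, Matrix.mul_inv_rev, Matrix.mul_inv_rev, gi, mul_assoc]

lemma lmat_mul_inv : lmat A * (lmat A)⁻¹ = 1 := Matrix.mul_nonsing_inv _ hA.isUnit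

lemma lmat_transpose_inv_mul : ((lmat A)ᵀ)⁻¹ * (lmat A)ᵀ = 1 :=
  Matrix.nonsing_inv_mul _ (by rw [Matrix.det_transpose]; exact hA.isUnit)

lemma Jl_pb (i : Fin 3) (α : Alt 1) : Jl (pbT A S) i (pb A α) = pb A (Jl S i α) := by
  refine alt1_ext ?_
  rw [c1_Jl, c1_pb, c1_pb, c1_Jl, Matrix.mulVec_mulVec, Matrix.mulVec_mulVec, sgEnd]
  congr 1
  change m2 (pb A (S i)) * gi (pbT A S) * _ = (lmat A)ᵀ * (m2 (S i) * gi S)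
  rw [m2_pb, gi_pb hA]
  calc _ = (lmat A)ᵀ * m2 (S i) * (lmat A * (lmat A)⁻¹) * gi S * (((lmat A)ᵀ)⁻¹ * (lmat A)ᵀ) := by
        simp only [mul_assoc]
    _ = _ := by
        rw [lmat_mul_inv hA, lmat_transpose_inv_mul hA, mul_one, mul_one, mul_assoc]

lemma ip1_pb (α β : Alt 1) : ip1 (pbT A S) (pb A α) (pb A β) = ip1 S α β := by
  rw [ip1_eq, ip1_eq, c1_pb, c1_pb, gi_pb hA, ← Matrix.vecMul_transpose,
    Matrix.transpose_transpose, ← Matrix.dotProduct_mulVec, Matrix.mulVec_mulVec,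
    Matrix.mulVec_mulVec]
  have e : lmat A * ((lmat A)⁻¹ * gi S * ((lmat A)ᵀ)⁻¹) * (lmat A)ᵀ =
      (lmat A * (lmat A)⁻¹) * gi S * (((lmat A)ᵀ)⁻¹ * (lmat A)ᵀ) := by simp only [mul_assoc]
  rw [e, lmat_mul_inv hA, lmat_transpose_inv_mul hA, one_mul, mul_one]

lemma contr2_pb (η τ : Alt 2) : contr2 (pbT A S) (pb A η) (pb A τ) = contr2 S η τ := by
  have hi : (lmat A)ᵀ⁻¹ = ((lmat A)⁻¹)ᵀ := (Matrix.transpose_nonsing_inv _).symm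
  have h1 : (lmat A)⁻¹ᵀ * (lmat A)ᵀ = 1 := by rw [← hi, lmat_transpose_inv_mul hA]
  rw [contr2_eq, contr2_eq, gi_pb hA, m2_pb, m2_pb, hi]
  simp only [Matrix.transpose_mul, Matrix.transpose_transpose]
  rw [mul_assoc ((lmat A)⁻¹), mul_assoc ((lmat A)⁻¹), mul_assoc ((lmat A)⁻¹), Matrix.trace_mul_comm]
  have e : (gi S)ᵀ * (lmat A)⁻¹ᵀ * ((lmat A)ᵀ * m2 η * lmat A) *
      ((lmat A)⁻¹ * gi S * (lmat A)⁻¹ᵀ) * ((lmat A)ᵀ * ((m2 τ)ᵀ * lmat A)) * (lmat A)⁻¹ =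
      (gi S)ᵀ * ((lmat A)⁻¹ᵀ * (lmat A)ᵀ) * m2 η * (lmat A * (lmat A)⁻¹) * gi S *
      ((lmat A)⁻¹ᵀ * (lmat A)ᵀ) * (m2 τ)ᵀ * (lmat A * (lmat A)⁻¹) := by simp only [mul_assoc]
  rw [e, h1, lmat_mul_inv hA]
  simp only [mul_one]

lemma star2_pb (η : Alt 2) : star2 (pbT A S) (pb A η) = pb A (star2 S η) := by
  refine alt2_ext ?_
  have e := til_equivariance (lmat A) (m2 η)
  rw [m2_star2, m2_pb, m2_pb, m2_star2, gm_pb hA, vol_pb]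
  have e2 : (lmat A)ᵀ * gm S * lmat A * til ((lmat A)ᵀ * m2 η * lmat A) *
      ((lmat A)ᵀ * gm S * lmat A)ᵀ = (lmat A)ᵀ * (gm S *
        (lmat A * til ((lmat A)ᵀ * m2 η * lmat A) * (lmat A)ᵀ) * (gm S)ᵀ) * lmat A := by
    simp only [Matrix.transpose_mul, Matrix.transpose_transpose, mul_assoc]
  rw [e2, e]
  simp only [Matrix.mul_smul, Matrix.smul_mul, smul_smul]
  congr 1
  by_cases hv : vol S = 0
  · simp [hv]
  · field_simp

lemma star3_pb (Ω : Alt 3) : star3 (pbT A S) (pb A Ω) = pb A (star3 S Ω) := by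
  refine alt1_ext ?_
  rw [c1_star3, c1_pb, c1_star3, gm_pb hA, vol_pb, mul_assoc, ← Matrix.mulVec_mulVec,
    ← Matrix.mulVec_mulVec, vec3_pb, Matrix.mulVec_smul, Matrix.mulVec_smul, Matrix.mulVec_smul,
    smul_smul]
  congr 1
  by_cases hv : vol S = 0
  · simp [hv]
  · field_simp

lemma diamond_pb (k : Bil) (i : Fin 3) :
    diamond (pbT A S) (pbB A k) i = pb A (diamond S k i) := by
  refine alt2_ext ?_
  rw [m2_diamond, m2_pb, m2_pb, m2_diamond, kmat_pbB, gi_pb hA]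
  have e : (lmat A)ᵀ * kmat k * lmat A * ((lmat A)⁻¹ * gi S * (lmat A)ᵀ⁻¹) *
      ((lmat A)ᵀ * m2 (S i) * lmat A) = (lmat A)ᵀ * kmat k * (lmat A * (lmat A)⁻¹) * gi S *
      ((lmat A)ᵀ⁻¹ * (lmat A)ᵀ) * m2 (S i) * lmat A := by simp only [mul_assoc]
  rw [e, lmat_mul_inv hA, lmat_transpose_inv_mul hA]
  simp only [mul_one, mul_sub, sub_mul, Matrix.transpose_mul, Matrix.transpose_transpose, mul_assoc]

end Invertible

/-! ### Coordinate expressions -/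

lemma two_le_infty : minSmoothness ℝ 2 ≤ (∞ : WithTop ℕ∞) := by
  rw [minSmoothness_of_isRCLikeNormedField]
  exact WithTop.coe_le_coe.2 (le_top : (2 : ℕ∞) ≤ ⊤)

section Charts

variable {M : Type*} [TopologicalSpace M] [ChartedSpace V4 M]

/-- The part of the chart domain at `x₀` which lies in `W`, in coordinates. -/
def dom (x₀ : M) (W : Set M) : Set V4 :=
  (extChartAt (𝓡 4) x₀).target ∩ (extChartAt (𝓡 4) x₀).symm ⁻¹' W

lemma dom_univ (x₀ : M) : dom x₀ Set.univ = (extChartAt (𝓡 4) x₀).target := by simp [dom]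

lemma isOpen_dom (x₀ : M) {W : Set M} (hW : IsOpen W) : IsOpen (dom x₀ W) :=
  (continuousOn_extChartAt_symm x₀).isOpen_inter_preimage (isOpen_extChartAt_target x₀) hW

lemma center_mem_dom {x : M} {W : Set M} (hx : x ∈ W) : extChartAt (𝓡 4) x x ∈ dom x W :=
  ⟨mem_extChartAt_target x, by simpa using hx⟩

lemma pull_eq_pb {k : ℕ} (η : Form M k) (x₀ : M) (z : V4) :
    pull η x₀ z = pb (chartD x₀ z) (show Alt k from η ((extChartAt (𝓡 4) x₀).symm z)) := rfl

lemma lmat_id : lmat (ContinuousLinearMap.id ℝ V4) = 1 := by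
  ext μ ν
  simp [lmat, bv_apply, Matrix.one_apply, eq_comm]

lemma lmat_comp (A B : V4 →L[ℝ] V4) : lmat (A.comp B) = lmat A * lmat B := by
  ext μ ν
  simp only [lmat, Matrix.mul_apply, Matrix.of_apply, ContinuousLinearMap.comp_apply]
  conv_lhs => rw [sum_bv (B (bv ν))]
  rw [map_sum]
  simp [mul_comm]

/-- The coordinate change from the chart at `x₁` to the chart at `x₀`. -/
def trans (x₀ x₁ : M) (z : V4) : V4 := extChartAt (𝓡 4) x₀ ((extChartAt (𝓡 4) x₁).symm z)

lemma trans_mem {x₀ x₁ : M} {z : V4} (hz : z ∈ dom x₁ (extChartAt (𝓡 4) x₀).source) :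
    trans x₀ x₁ z ∈ (extChartAt (𝓡 4) x₀).target := (extChartAt (𝓡 4) x₀).map_source hz.2

lemma symm_trans {x₀ x₁ : M} {z : V4} (hz : z ∈ dom x₁ (extChartAt (𝓡 4) x₀).source) :
    (extChartAt (𝓡 4) x₀).symm (trans x₀ x₁ z) = (extChartAt (𝓡 4) x₁).symm z :=
  (extChartAt (𝓡 4) x₀).left_inv hz.2

lemma SmoothForm.differentiableAt {k : ℕ} {η : Form M k} {W : Set M} (hη : SmoothForm η W)
    (hW : IsOpen W) {x₀ : M} {z : V4} (hz : z ∈ dom x₀ W) : DifferentiableAt ℝ (pull η x₀) z :=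
  ((hη x₀).contDiffAt ((isOpen_dom x₀ hW).mem_nhds hz)).differentiableAt (by simp)

/-- The function `f` is smooth on `W`. -/
def SmoothFn (f : M → ℝ) (W : Set M) : Prop :=
  ∀ x₀ : M, ContDiffOn ℝ ∞ (fun z => f ((extChartAt (𝓡 4) x₀).symm z)) (dom x₀ W)

lemma SmoothFn.differentiableAt {f : M → ℝ} {W : Set M} (hf : SmoothFn f W) (hW : IsOpen W)
    {x₀ : M} {z : V4} (hz : z ∈ dom x₀ W) :
    DifferentiableAt ℝ (fun z => f ((extChartAt (𝓡 4) x₀).symm z)) z :=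
  ((hf x₀).contDiffAt ((isOpen_dom x₀ hW).mem_nhds hz)).differentiableAt (by simp)

variable [IsManifold (𝓡 4) ∞ M]

lemma isManifold_one : IsManifold (𝓡 4) 1 M := IsManifold.of_le (n := ∞) (by simp)

lemma chartD_self (x : M) : chartD x (extChartAt (𝓡 4) x x) = ContinuousLinearMap.id ℝ V4 := by
  have : IsManifold (𝓡 4) 1 M := isManifold_one
  have h := mfderivWithin_range_extChartAt_symm (I := 𝓡 4) (x := x)
  rw [ModelWithCorners.Boundaryless.range_eq_univ, mfderivWithin_univ] at h
  exact h

lemma pull_self {k : ℕ} (η : Form M k) (x : M) : pull η x (extChartAt (𝓡 4) x x) = η x := by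
  have h := chartD_self x
  rw [pull, h, extChartAt_to_inv]
  ext v
  rfl

lemma mdifferentiableAt_symm {x₀ : M} {z : V4} (hz : z ∈ (extChartAt (𝓡 4) x₀).target) :
    MDifferentiableAt 𝓘(ℝ, V4) (𝓡 4) (extChartAt (𝓡 4) x₀).symm z := by
  have : IsManifold (𝓡 4) 1 M := isManifold_one
  have h := mdifferentiableWithinAt_extChartAt_symm (I := 𝓡 4) hz
  rwa [ModelWithCorners.Boundaryless.range_eq_univ, mdifferentiableWithinAt_univ] at h

lemma det_chartD {x₀ : M} {z : V4} (hz : z ∈ (extChartAt (𝓡 4) x₀).target) :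
    (lmat (chartD x₀ z)).det ≠ 0 := by
  have : IsManifold (𝓡 4) 1 M := isManifold_one
  have h := mfderiv_extChartAt_comp_mfderivWithin_extChartAt_symm (I := 𝓡 4) hz
  rw [ModelWithCorners.Boundaryless.range_eq_univ, mfderivWithin_univ] at h
  have h2 := congrArg (fun B : V4 →L[ℝ] V4 => (lmat B).det) h
  have h3 : (lmat ((show V4 →L[ℝ] V4 from mfderiv (𝓡 4) 𝓘(ℝ, V4) (extChartAt (𝓡 4) x₀)
      ((extChartAt (𝓡 4) x₀).symm z)).comp (chartD x₀ z))).det = 1 := by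
    refine Eq.trans h2 ?_
    change (lmat (ContinuousLinearMap.id ℝ V4)).det = 1
    rw [lmat_id, Matrix.det_one]
  rw [lmat_comp, Matrix.det_mul] at h3
  exact right_ne_zero_of_mul_eq_one h3

lemma contDiffAt_trans {x₀ x₁ : M} {z : V4} (hz : z ∈ dom x₁ (extChartAt (𝓡 4) x₀).source) :
    ContDiffAt ℝ ∞ (trans x₀ x₁) z := by
  have h := contDiffOn_ext_coord_change (n := ∞) (I := 𝓡 4) x₀ x₁
  have e : ((extChartAt (𝓡 4) x₁).symm ≫ extChartAt (𝓡 4) x₀).source =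
      dom x₁ (extChartAt (𝓡 4) x₀).source := by
    rw [PartialEquiv.trans_source, PartialEquiv.symm_source]; rfl
  rw [e] at h
  exact h.contDiffAt ((isOpen_dom x₁ (isOpen_extChartAt_source x₀)).mem_nhds hz)

lemma chartD_trans {x₀ x₁ : M} {z : V4} (hz : z ∈ dom x₁ (extChartAt (𝓡 4) x₀).source) :
    chartD x₁ z = (chartD x₀ (trans x₀ x₁ z)).comp (fderiv ℝ (trans x₀ x₁) z) := by
  have e : (extChartAt (𝓡 4) x₁).symm =ᶠ[𝓝 z] (extChartAt (𝓡 4) x₀).symm ∘ trans x₀ x₁ := by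
    filter_upwards [(isOpen_dom x₁ (isOpen_extChartAt_source x₀)).mem_nhds hz] with w hw
    exact (symm_trans hw).symm
  have h1 : MDifferentiableAt 𝓘(ℝ, V4) 𝓘(ℝ, V4) (trans x₀ x₁) z :=
    ((contDiffAt_trans hz).differentiableAt (by simp)).mdifferentiableAt
  have h := mfderiv_comp z (mdifferentiableAt_symm (trans_mem hz)) h1
  rw [chartD, e.mfderiv_eq, h, mfderiv_eq_fderiv]
  rfl

lemma pull_trans {k : ℕ} (η : Form M k) {x₀ x₁ : M} {z : V4}
    (hz : z ∈ dom x₁ (extChartAt (𝓡 4) x₀).source) :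
    pull η x₁ z = pb (fderiv ℝ (trans x₀ x₁) z) (pull η x₀ (trans x₀ x₁ z)) := by
  have h := symm_trans hz
  rw [pull_eq_pb, pull_eq_pb, chartD_trans hz, h]
  ext v
  rfl

/-! ### Smooth forms and functions -/

/-- The exterior derivative is computed by the coordinate expression in any chart. -/
lemma pull_ext {k : ℕ} {η : Form M k} {W : Set M} (hη : SmoothForm η W) (hW : IsOpen W) {x₀ : M}
    {z : V4} (hz : z ∈ dom x₀ W) : pull (ext η) x₀ z = extDeriv (pull η x₀) z := by
  set y := (extChartAt (𝓡 4) x₀).symm z with hy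
  have hz' : z ∈ dom x₀ (extChartAt (𝓡 4) y).source := ⟨hz.1, mem_extChartAt_source y⟩
  have e : pull η x₀ =ᶠ[𝓝 z] fun w =>
      (pull η y (trans y x₀ w)).compContinuousLinearMap (fderiv ℝ (trans y x₀) w) := by
    filter_upwards [(isOpen_dom x₀ (isOpen_extChartAt_source y)).mem_nhds hz'] with w hw
    exact pull_trans η hw
  have hd : DifferentiableAt ℝ (pull η y) (trans y x₀ z) :=
    hη.differentiableAt hW (center_mem_dom (x := y) hz.2)
  rw [e.extDeriv_eq, extDeriv_pullback hd (contDiffAt_trans hz') two_le_infty]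
  have h1 := chartD_trans hz'
  have h2 : trans y x₀ z = extChartAt (𝓡 4) y y := rfl
  have h3 := chartD_self y
  rw [h2, h3] at h1
  rw [pull_eq_pb, h1]
  rfl

lemma contDiffOn_extDeriv {k : ℕ} {θ : V4 → Alt k} {U : Set V4} (hU : IsOpen U)
    (h : ContDiffOn ℝ ∞ θ U) : ContDiffOn ℝ ∞ (extDeriv θ) U :=
  (ContinuousAlternatingMap.alternatizeUncurryFinCLM ℝ V4 ℝ).contDiff.comp_contDiffOn
    (h.fderiv_of_isOpen hU (by simp))

lemma SmoothForm.ext {k : ℕ} {η : Form M k} {W : Set M} (hη : SmoothForm η W) (hW : IsOpen W) :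
    SmoothForm (ext η) W := fun x₀ =>
  (contDiffOn_extDeriv (isOpen_dom x₀ hW) (hη x₀)).congr fun _ hz => pull_ext hη hW hz

lemma ext_ext {k : ℕ} {η : Form M k} {W : Set M} (hη : SmoothForm η W) (hW : IsOpen W) {x : M}
    (hx : x ∈ W) : ext (ext η) x = 0 := by
  have hz := center_mem_dom hx
  have e : pull (Plebanski.ext η) x =ᶠ[𝓝 (extChartAt (𝓡 4) x x)] extDeriv (pull η x) := by
    filter_upwards [(isOpen_dom x hW).mem_nhds hz] with w hw
    exact pull_ext hη hW hw
  rw [Plebanski.ext, e.extDeriv_eq]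
  exact extDeriv_extDeriv_apply ((hη x).contDiffAt ((isOpen_dom x hW).mem_nhds hz))
    two_le_infty

lemma contMDiff_iff_smoothFn (f : M → ℝ) :
    ContMDiff (𝓡 4) 𝓘(ℝ, ℝ) ∞ f ↔ SmoothFn f Set.univ := by
  constructor
  · intro h x₀
    rw [dom_univ]
    have := h.comp_contMDiffOn (contMDiffOn_extChartAt_symm (n := ∞) (I := 𝓡 4) x₀)
    exact this.contDiffOn
  · intro h x₀
    have h0 := h x₀
    rw [dom_univ] at h0
    have h1 := h0.contMDiffOn.comp (contMDiffOn_extChartAt (n := ∞) (I := 𝓡 4) (x := x₀))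
      (fun y hy => (extChartAt (𝓡 4) x₀).map_source (by rwa [extChartAt_source]))
    have h2 : ContMDiffOn (𝓡 4) 𝓘(ℝ, ℝ) ∞ f (chartAt V4 x₀).source := by
      refine h1.congr fun y hy => ?_
      have : (extChartAt (𝓡 4) x₀).symm (extChartAt (𝓡 4) x₀ y) = y :=
        (extChartAt (𝓡 4) x₀).left_inv (by rwa [extChartAt_source])
      change f y = f ((extChartAt (𝓡 4) x₀).symm (extChartAt (𝓡 4) x₀ y))
      rw [this]
    exact h2.contMDiffAt ((chartAt V4 x₀).open_source.mem_nhds (mem_chart_source V4 x₀))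

lemma contMDiff_pi_iff (χ : M → Fin 3 → ℝ) : ContMDiff (𝓡 4) 𝓘(ℝ, Fin 3 → ℝ) ∞ χ ↔
    ∀ i, SmoothFn (fun x => χ x i) Set.univ := by
  rw [contMDiff_pi_space]
  exact forall_congr' fun i => contMDiff_iff_smoothFn _

lemma SmoothFn.mdifferentiableAt {f : M → ℝ} {W : Set M} (hf : SmoothFn f W) (hW : IsOpen W)
    {x : M} (hx : x ∈ W) : MDifferentiableAt (𝓡 4) 𝓘(ℝ, ℝ) f x := by
  have h := (hf.differentiableAt hW (center_mem_dom hx)).mdifferentiableAt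
  have : IsManifold (𝓡 4) 1 M := isManifold_one
  have h2 := h.comp x (mdifferentiableAt_extChartAt (I := 𝓡 4) (mem_chart_source V4 x))
  refine h2.congr_of_eventuallyEq ?_
  filter_upwards [extChartAt_source_mem_nhds (I := 𝓡 4) x] with y hy
  change f y = f ((extChartAt (𝓡 4) x).symm (extChartAt (𝓡 4) x y))
  rw [(extChartAt (𝓡 4) x).left_inv hy]

lemma pull_extFun {f : M → ℝ} {W : Set M} (hf : SmoothFn f W) (hW : IsOpen W) {x₀ : M} {z : V4}
    (hz : z ∈ dom x₀ W) : pull (extFun f) x₀ z =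
      ofLin (fderiv ℝ (fun z => f ((extChartAt (𝓡 4) x₀).symm z)) z) := by
  have h := mfderiv_comp z (hf.mdifferentiableAt hW hz.2) (mdifferentiableAt_symm hz.1)
  rw [mfderiv_eq_fderiv] at h
  change pull (extFun f) x₀ z = ofLin (fderiv ℝ (f ∘ (extChartAt (𝓡 4) x₀).symm) z)
  rw [h]
  ext v
  rfl

lemma SmoothFn.extFun {f : M → ℝ} {W : Set M} (hf : SmoothFn f W) (hW : IsOpen W) :
    SmoothForm (extFun f) W := fun x₀ => by
  refine ContDiffOn.congr (f := fun z =>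
    ofLin (fderiv ℝ (fun z => f ((extChartAt (𝓡 4) x₀).symm z)) z)) (contDiffOn_of_c1 fun μ => ?_)
    fun z hz => pull_extFun hf hW hz
  simp only [c1_ofLin]
  exact ((hf x₀).fderiv_of_isOpen (isOpen_dom x₀ hW) (m := ∞) (by simp)).clm_apply contDiffOn_const

lemma ext_extFun {f : M → ℝ} {W : Set M} (hf : SmoothFn f W) (hW : IsOpen W) {x : M}
    (hx : x ∈ W) : ext (extFun f) x = 0 := by
  have hz := center_mem_dom hx
  set F := fun z => f ((extChartAt (𝓡 4) x).symm z) with hF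
  have e : pull (extFun f) x =ᶠ[𝓝 (extChartAt (𝓡 4) x x)]
      extDeriv fun z => ContinuousAlternatingMap.constOfIsEmpty ℝ V4 (Fin 0) (F z) := by
    filter_upwards [(isOpen_dom x hW).mem_nhds hz] with w hw
    rw [pull_extFun hf hW hw, extDeriv_constOfIsEmpty]
    rfl
  rw [Plebanski.ext, e.extDeriv_eq]
  refine extDeriv_extDeriv_apply (r := ∞) ?_ two_le_infty
  exact (ContinuousAlternatingMap.constOfIsEmptyLIE ℝ V4 ℝ (Fin 0)).toContinuousLinearEquiv
    |>.toContinuousLinearMap.contDiff.contDiffAt.comp _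
      ((hf x).contDiffAt ((isOpen_dom x hW).mem_nhds hz))

end Charts

/-! ### Smoothness of the pointwise operations -/

/-- The matrix-valued function `A` has smooth entries on `U`. -/
def SmoothMat (U : Set V4) (A : V4 → Matrix (Fin 4) (Fin 4) ℝ) : Prop :=
  ∀ μ ν, ContDiffOn ℝ ∞ (fun z => A z μ ν) U

/-- The vector-valued function `v` has smooth entries on `U`. -/
def SmoothVec (U : Set V4) (v : V4 → Fin 4 → ℝ) : Prop := ∀ μ, ContDiffOn ℝ ∞ (fun z => v z μ) U

section SmoothMat

variable {U : Set V4} {A B : V4 → Matrix (Fin 4) (Fin 4) ℝ} {v w : V4 → Fin 4 → ℝ} {f : V4 → ℝ}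

lemma SmoothMat.mul (hA : SmoothMat U A) (hB : SmoothMat U B) : SmoothMat U fun z => A z * B z :=
  fun μ ν => by
    simp only [Matrix.mul_apply]
    exact ContDiffOn.sum fun l _ => (hA μ l).mul (hB l ν)

lemma SmoothMat.smul (hf : ContDiffOn ℝ ∞ f U) (hA : SmoothMat U A) :
    SmoothMat U fun z => f z • A z := fun μ ν => hf.mul (hA μ ν)

lemma SmoothMat.sub (hA : SmoothMat U A) (hB : SmoothMat U B) : SmoothMat U fun z => A z - B z :=
  fun μ ν => (hA μ ν).sub (hB μ ν)

lemma SmoothMat.sum {ι : Type*} [Fintype ι] {A : ι → V4 → Matrix (Fin 4) (Fin 4) ℝ}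
    (hA : ∀ i, SmoothMat U (A i)) : SmoothMat U fun z => ∑ i, A i z := fun μ ν => by
  simp only [Matrix.sum_apply]
  exact ContDiffOn.sum fun i _ => hA i μ ν

lemma SmoothMat.transpose (hA : SmoothMat U A) : SmoothMat U fun z => (A z)ᵀ := fun μ ν => hA ν μ

lemma SmoothMat.trace (hA : SmoothMat U A) : ContDiffOn ℝ ∞ (fun z => (A z).trace) U :=
  ContDiffOn.sum fun l _ => hA l l

lemma SmoothMat.til (hA : SmoothMat U A) : SmoothMat U fun z => til (A z) := fun μ ν => by
  simp only [Plebanski.til, Matrix.of_apply]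
  exact contDiffOn_const.mul (ContDiffOn.sum fun ρ _ => ContDiffOn.sum fun σ _ =>
    contDiffOn_const.mul (hA ρ σ))

lemma SmoothMat.mulVec (hA : SmoothMat U A) (hv : SmoothVec U v) :
    SmoothVec U fun z => A z *ᵥ v z := fun μ =>
  ContDiffOn.sum (s := Finset.univ) (f := fun l z => A z μ l * v z l)
    fun l _ => (hA μ l).mul (hv l)

lemma SmoothMat.congr (hA : SmoothMat U A) (h : ∀ z ∈ U, B z = A z) : SmoothMat U B :=
  fun μ ν => (hA μ ν).congr fun z hz => by rw [h z hz]

lemma SmoothVec.smul (hf : ContDiffOn ℝ ∞ f U) (hv : SmoothVec U v) :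
    SmoothVec U fun z => f z • v z := fun μ => hf.mul (hv μ)

lemma SmoothVec.dotProduct (hv : SmoothVec U v) (hw : SmoothVec U w) :
    ContDiffOn ℝ ∞ (fun z => v z ⬝ᵥ w z) U := ContDiffOn.sum fun l _ => (hv l).mul (hw l)

end SmoothMat

section Fields

variable {M : Type*} [TopologicalSpace M] [ChartedSpace V4 M]

/-- Smoothness of a form, for forms typed as maps to the alternating forms on the model space (to
which the ones on the tangent spaces are equal by definition). -/
def SmoothA {k : ℕ} (η : M → Alt k) (W : Set M) : Prop := SmoothForm (M := M) η W

/-- The exterior derivative, for forms typed as maps to the alternating forms on the model space. -/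
def extA {k : ℕ} (η : M → Alt k) : M → Alt (k + 1) := ext (M := M) η

/-- The coordinate expression of a form, for forms typed as maps to the alternating forms on the
model space. -/
def coord {k : ℕ} (η : M → Alt k) (x₀ : M) (z : V4) : Alt k :=
  pb (chartD x₀ z) (η ((extChartAt (𝓡 4) x₀).symm z))

lemma smoothA_one_iff {α : M → Alt 1} {W : Set M} :
    SmoothA α W ↔ ∀ x₀, SmoothVec (dom x₀ W) fun z => c1 (coord α x₀ z) :=
  forall_congr' fun _ => ⟨fun h μ => contDiffOn_c1 h μ, fun h => contDiffOn_of_c1 h⟩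

lemma smoothA_two_iff {η : M → Alt 2} {W : Set M} :
    SmoothA η W ↔ ∀ x₀, SmoothMat (dom x₀ W) fun z => m2 (coord η x₀ z) :=
  forall_congr' fun _ => ⟨fun h μ ν => contDiffOn_c2 h μ ν, fun h => contDiffOn_of_c2 h⟩

lemma smoothVec_vec3 {Ω : M → Alt 3} {W : Set M} (h : SmoothA Ω W) (x₀ : M) :
    SmoothVec (dom x₀ W) fun z => vec3 (coord Ω x₀ z) := fun μ => by
  simp only [vec3]
  exact contDiffOn_const.mul (ContDiffOn.sum fun a _ => ContDiffOn.sum fun b _ =>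
    ContDiffOn.sum fun c _ => contDiffOn_const.mul (contDiffOn_c3 (h x₀) a b c))

section Linear

variable {k : ℕ} {η τ : M → Alt k} {W : Set M} {f : M → ℝ}

lemma SmoothA.mono (hη : SmoothA η Set.univ) (W : Set M) : SmoothA η W := fun x₀ =>
  (hη x₀).mono fun _ hz => ⟨hz.1, trivial⟩

lemma SmoothFn.mono (hf : SmoothFn f Set.univ) (W : Set M) : SmoothFn f W := fun x₀ =>
  (hf x₀).mono fun _ hz => ⟨hz.1, trivial⟩

lemma SmoothA.add (hη : SmoothA η W) (hτ : SmoothA τ W) : SmoothA (η + τ) W :=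
  fun x₀ => (hη x₀).add (hτ x₀)

lemma SmoothA.sub (hη : SmoothA η W) (hτ : SmoothA τ W) : SmoothA (η - τ) W :=
  fun x₀ => (hη x₀).sub (hτ x₀)

lemma SmoothA.neg (hη : SmoothA η W) : SmoothA (-η) W := fun x₀ => (hη x₀).neg

lemma SmoothA.smul (hf : SmoothFn f W) (hη : SmoothA η W) :
    SmoothA (fun x => f x • η x) W := fun x₀ => (hf x₀).smul (hη x₀)

lemma SmoothA.const_smul (r : ℝ) (hη : SmoothA η W) : SmoothA (r • η) W :=
  fun x₀ => (hη x₀).const_smul r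

lemma SmoothA.zero : SmoothA (0 : M → Alt k) W := fun x₀ => by
  have h : coord (0 : M → Alt k) x₀ = fun _ => 0 := rfl
  change ContDiffOn ℝ ∞ (coord (0 : M → Alt k) x₀) _
  rw [h]
  exact contDiffOn_const

lemma SmoothFn.add {f g : M → ℝ} (hf : SmoothFn f W) (hg : SmoothFn g W) :
    SmoothFn (fun x => f x + g x) W := fun x₀ => (hf x₀).add (hg x₀)

lemma SmoothFn.const_mul {f : M → ℝ} (r : ℝ) (hf : SmoothFn f W) :
    SmoothFn (fun x => r * f x) W := fun x₀ => contDiffOn_const.mul (hf x₀)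

lemma SmoothFn.sum {ι : Type*} {s : Finset ι} {f : ι → M → ℝ} (h : ∀ i, SmoothFn (f i) W) :
    SmoothFn (fun x => ∑ i ∈ s, f i x) W := fun x₀ => ContDiffOn.sum fun i _ => h i x₀

end Linear

lemma SmoothMat.restrict {x₀ : M} {A : V4 → Matrix (Fin 4) (Fin 4) ℝ}
    (h : SmoothMat (extChartAt (𝓡 4) x₀).target A) (W : Set M) : SmoothMat (dom x₀ W) A :=
  fun μ ν => (h μ ν).mono fun _ hz => hz.1

/-- The coordinate expression of the triple. -/
def pullT (Sg : Fin 3 → Form M 2) (x₀ : M) (z : V4) : Trip :=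
  pbT (chartD x₀ z) (val Sg ((extChartAt (𝓡 4) x₀).symm z))

variable {Sg : Fin 3 → Form M 2}

section Manifold

variable [IsManifold (𝓡 4) ∞ M]

lemma pullT_self (x : M) : pullT Sg x (extChartAt (𝓡 4) x x) = val Sg x :=
  funext fun i => pull_self (Sg i) x

lemma isPerfect_pullT (hSg : IsHyperkahlerTriple Sg) {x₀ : M} {z : V4}
    (hz : z ∈ (extChartAt (𝓡 4) x₀).target) : IsPerfect (pullT Sg x₀ z) :=
  isPerfect_pb (det_chartD hz) (hSg.perfect _)

variable {x₀ : M} {z : V4} (hz : z ∈ (extChartAt (𝓡 4) x₀).target)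
include hz

lemma coord_Jl (i : Fin 3) (α : M → Alt 1) : coord (fun x => Jl (val Sg x) i (α x)) x₀ z =
    Jl (pullT Sg x₀ z) i (coord α x₀ z) := (Jl_pb (det_chartD hz) _ i _).symm

lemma coord_star2 (η : M → Alt 2) : coord (fun x => star2 (val Sg x) (η x)) x₀ z =
    star2 (pullT Sg x₀ z) (coord η x₀ z) := (star2_pb (det_chartD hz) _ _).symm

lemma coord_star3 (Ω : M → Alt 3) : coord (fun x => star3 (val Sg x) (Ω x)) x₀ z =
    star3 (pullT Sg x₀ z) (coord Ω x₀ z) := (star3_pb (det_chartD hz) _ _).symm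

lemma coord_diamond (k : Ten2 M) (i : Fin 3) :
    coord (fun x => diamond (val Sg x) (k x) i) x₀ z =
      diamond (pullT Sg x₀ z) (pullTen k x₀ z) i := (diamond_pb (det_chartD hz) _ _ i).symm

lemma coord_contr2 (η τ : M → Alt 2) :
    contr2 (val Sg ((extChartAt (𝓡 4) x₀).symm z)) (η ((extChartAt (𝓡 4) x₀).symm z))
      (τ ((extChartAt (𝓡 4) x₀).symm z)) =
    contr2 (pullT Sg x₀ z) (coord η x₀ z) (coord τ x₀ z) := (contr2_pb (det_chartD hz) _ _ _).symm

end Manifold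

namespace IsHyperkahlerTriple

variable (hSg : IsHyperkahlerTriple Sg)
include hSg

lemma smoothMat_m2 (x₀ : M) (i : Fin 3) :
    SmoothMat (extChartAt (𝓡 4) x₀).target fun z => m2 (pullT Sg x₀ z i) := by
  rw [← dom_univ]
  exact smoothA_two_iff.1 (hSg.smooth i) x₀

lemma contDiffOn_vol (x₀ : M) :
    ContDiffOn ℝ ∞ (fun z => vol (pullT Sg x₀ z)) (extChartAt (𝓡 4) x₀).target := by
  simp only [vol, wedge22_eq, wd]
  exact contDiffOn_const.mul (ContDiffOn.sum fun i _ => contDiffOn_const.mul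
    ((hSg.smoothMat_m2 x₀ i).mul (hSg.smoothMat_m2 x₀ i).til).trace)

variable [IsManifold (𝓡 4) ∞ M]

lemma contDiffOn_inv_vol (x₀ : M) :
    ContDiffOn ℝ ∞ (fun z => 1 / vol (pullT Sg x₀ z)) (extChartAt (𝓡 4) x₀).target :=
  contDiffOn_const.div (hSg.contDiffOn_vol x₀) fun _ hz => (isPerfect_pullT hSg hz).vol_ne

lemma smoothMat_gm (x₀ : M) :
    SmoothMat (extChartAt (𝓡 4) x₀).target fun z => gm (pullT Sg x₀ z) :=
  (SmoothMat.smul (hSg.contDiffOn_inv_vol x₀).neg (((hSg.smoothMat_m2 x₀ 0).mul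
    (hSg.smoothMat_m2 x₀ 1).til).mul (hSg.smoothMat_m2 x₀ 2))).congr
    fun _ hz => (isPerfect_pullT hSg hz).gm_eq

lemma smoothMat_gi (x₀ : M) :
    SmoothMat (extChartAt (𝓡 4) x₀).target fun z => gi (pullT Sg x₀ z) :=
  (SmoothMat.smul ((hSg.contDiffOn_inv_vol x₀).mul (hSg.contDiffOn_inv_vol x₀))
    (((hSg.smoothMat_m2 x₀ 2).til.mul (hSg.smoothMat_m2 x₀ 1)).mul
      (hSg.smoothMat_m2 x₀ 0).til)).congr
    fun _ hz => by rw [(isPerfect_pullT hSg hz).gi_eq]; congr 1; ring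

lemma smoothMat_sgEnd (x₀ : M) (i : Fin 3) :
    SmoothMat (extChartAt (𝓡 4) x₀).target fun z => sgEnd (pullT Sg x₀ z) i :=
  (hSg.smoothMat_m2 x₀ i).mul (hSg.smoothMat_gi x₀)

variable {W : Set M}

lemma smooth_Jl {α : M → Alt 1} (hα : SmoothA α W) (i : Fin 3) :
    SmoothA (fun x => Jl (val Sg x) i (α x)) W := smoothA_one_iff.2 fun x₀ μ =>
  (((hSg.smoothMat_sgEnd x₀ i).restrict W).mulVec (smoothA_one_iff.1 hα x₀) μ).congr
    fun z hz => by simp only [coord_Jl hz.1, c1_Jl]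

lemma smooth_star2 {η : M → Alt 2} (hη : SmoothA η W) :
    SmoothA (fun x => star2 (val Sg x) (η x)) W := smoothA_two_iff.2 fun x₀ =>
  (SmoothMat.smul ((hSg.contDiffOn_inv_vol x₀).mono fun _ hz => hz.1)
    ((((hSg.smoothMat_gm x₀).restrict W).mul (smoothA_two_iff.1 hη x₀).til).mul
      ((hSg.smoothMat_gm x₀).restrict W).transpose)).congr
    fun z hz => by rw [coord_star2 hz.1, m2_star2]

lemma smooth_star3 {Ω : M → Alt 3} (hΩ : SmoothA Ω W) :
    SmoothA (fun x => star3 (val Sg x) (Ω x)) W := smoothA_one_iff.2 fun x₀ μ =>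
  (SmoothVec.smul ((hSg.contDiffOn_inv_vol x₀).mono fun _ hz => hz.1)
    (((hSg.smoothMat_gm x₀).restrict W).mulVec (smoothVec_vec3 hΩ x₀)) μ).congr
    fun z hz => by simp only [coord_star3 hz.1, c1_star3]

lemma smooth_asd {η : M → Alt 2} (hη : SmoothA η W) :
    SmoothA (fun x => asd (val Sg x) (η x)) W := hη.sub (hSg.smooth_star2 hη)

lemma smooth_contr2 {η τ : M → Alt 2} (hη : SmoothA η W) (hτ : SmoothA τ W) :
    SmoothFn (fun x => contr2 (val Sg x) (η x) (τ x)) W := fun x₀ =>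
  (((((hSg.smoothMat_gi x₀).restrict W).transpose.mul (smoothA_two_iff.1 hη x₀)).mul
    ((hSg.smoothMat_gi x₀).restrict W)).mul (smoothA_two_iff.1 hτ x₀).transpose).trace.congr
    fun z hz => by simp only [coord_contr2 hz.1, contr2_eq]

lemma smooth_diamond {k : Ten2 M} (hk : SmoothTen k) (i : Fin 3) :
    SmoothA (fun x => diamond (val Sg x) (k x) i) Set.univ := smoothA_two_iff.2 fun x₀ => by
  have h : SmoothMat (extChartAt (𝓡 4) x₀).target fun z => kmat (pullTen k x₀ z) := fun μ ν =>
    ((hk x₀).clm_apply contDiffOn_const).clm_apply contDiffOn_const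
  have h2 := (h.mul (hSg.smoothMat_gi x₀)).mul (hSg.smoothMat_m2 x₀ i)
  exact SmoothMat.congr ((h2.sub h2.transpose).restrict _) fun z hz => by
    rw [coord_diamond hz.1, m2_diamond]

end IsHyperkahlerTriple

/-! ### Linearity of the exterior derivative -/

section ExtLinear

variable {k : ℕ} {η τ : M → Alt k}

lemma SmoothA.diffAt (hη : SmoothA η Set.univ) (x : M) :
    DifferentiableAt ℝ (coord η x) (extChartAt (𝓡 4) x x) :=
  hη.differentiableAt isOpen_univ (center_mem_dom trivial)

lemma extA_add (hη : SmoothA η Set.univ) (hτ : SmoothA τ Set.univ) :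
    extA (η + τ) = extA η + extA τ := funext fun x => extDeriv_add (hη.diffAt x) (hτ.diffAt x)

lemma extA_smul (r : ℝ) (η : M → Alt k) : extA (r • η) = r • extA η :=
  funext fun x => extDeriv_smul r (coord η x)

lemma extA_neg (η : M → Alt k) : extA (-η) = -extA η := by
  rw [← neg_one_smul ℝ η, extA_smul]
  exact funext fun x => neg_one_smul ℝ (extA η x)

end ExtLinear

end Fields

/-! ### The divergence -/

lemma vec3_apply (Ω : Alt 3) : vec3 Ω 0 = c3 Ω 1 2 3 ∧ vec3 Ω 1 = -c3 Ω 0 2 3 ∧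
    vec3 Ω 2 = c3 Ω 0 1 3 ∧ vec3 Ω 3 = -c3 Ω 0 1 2 := by
  have h1 := fun a b c => (c3_apply_perm Ω a b c).1
  have h2 := fun a b c => (c3_apply_perm Ω a b c).2
  refine ⟨?_, ?_, ?_, ?_⟩ <;> simp [vec3, Fin.sum_univ_four, eps4_eq]
  · rw [h2 1 3 2, h1 2 1 3, h2 2 3 1, h1 2 1 3, h1 3 1 2, h2 1 3 2, h1 3 2 1, h2 2 3 1, h1 2 1 3]
    norm_num; ring
  · rw [h2 0 3 2, h1 2 0 3, h2 2 3 0, h1 2 0 3, h1 3 0 2, h2 0 3 2, h1 3 2 0, h2 2 3 0, h1 2 0 3]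
    norm_num; ring
  · rw [h2 0 3 1, h1 1 0 3, h2 1 3 0, h1 1 0 3, h1 3 0 1, h2 0 3 1, h1 3 1 0, h2 1 3 0, h1 1 0 3]
    norm_num; ring
  · rw [h2 0 2 1, h1 1 0 2, h2 1 2 0, h1 1 0 2, h1 2 0 1, h2 0 2 1, h1 2 1 0, h2 1 2 0, h1 1 0 2]
    norm_num; ring

lemma differentiableAt_til {η : V4 → Alt 2} {z : V4} (h : DifferentiableAt ℝ η z) (μ ν : Fin 4) :
    DifferentiableAt ℝ (fun y => til (m2 (η y)) μ ν) z := by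
  simp only [til, Matrix.of_apply, m2_apply]
  exact (DifferentiableAt.fun_sum fun ρ _ => DifferentiableAt.fun_sum fun σ _ =>
    (differentiableAt_c2 h ρ σ).const_mul _).const_mul _

lemma fderiv_til {η : V4 → Alt 2} {z : V4} (h : DifferentiableAt ℝ η z) (μ ν : Fin 4) (v : V4) :
    fderiv ℝ (fun y => til (m2 (η y)) μ ν) z v =
      (1 / 2) * ∑ ρ, ∑ σ, eps4 μ ν ρ σ * fderiv ℝ (fun y => c2 (η y) ρ σ) z v := by
  have h1 := fun ρ σ => differentiableAt_c2 h ρ σ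
  simp only [til, Matrix.of_apply, m2_apply]
  rw [fderiv_const_mul (DifferentiableAt.fun_sum fun ρ _ => DifferentiableAt.fun_sum fun σ _ =>
      (h1 ρ σ).const_mul _),
    fderiv_fun_sum fun ρ _ => DifferentiableAt.fun_sum fun σ _ => (h1 ρ σ).const_mul _]
  simp only [FunLike.coe_smul, Pi.smul_apply, smul_eq_mul, _root_.sum_apply]
  congr 1
  refine Finset.sum_congr rfl fun ρ _ => ?_
  rw [fderiv_fun_sum fun σ _ => (h1 ρ σ).const_mul _]
  simp only [_root_.sum_apply]
  refine Finset.sum_congr rfl fun σ _ => ?_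
  rw [fderiv_const_mul (h1 ρ σ)]
  rfl

/-- The exterior derivative of a 2-form as a divergence. -/
lemma vec3_extDeriv {η : V4 → Alt 2} {z : V4} (h : DifferentiableAt ℝ η z) (l : Fin 4) :
    vec3 (extDeriv η z) l = ∑ ρ, fderiv ℝ (fun y => til (m2 (η y)) l ρ) z (bv ρ) := by
  simp only [fderiv_til h, vec3, c3_extDeriv h]
  fin_cases l <;> simp [Fin.sum_univ_four, eps4_eq] <;> ring

/-- The density `(η ∧ α)^ρ` dual to the 3-form `α ∧ η`. -/
def dens (α : Alt 1) (η : Alt 2) : Fin 4 → ℝ := til (m2 η) *ᵥ c1 α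

/-- The formula `d(α ∧ η) = dα ∧ η - α ∧ dη`, with the left side written as a divergence. -/
lemma wedge22_sub_wedge13 {α : V4 → Alt 1} {η : V4 → Alt 2} {z : V4}
    (hα : DifferentiableAt ℝ α z) (hη : DifferentiableAt ℝ η z) :
    wedge22 (extDeriv α z) (η z) - wedge13 (α z) (extDeriv η z) =
      ∑ ρ, fderiv ℝ (fun y => dens (α y) (η y) ρ) z (bv ρ) := by
  have h1 := differentiableAt_c1 hα
  have h2 := differentiableAt_til hη
  have h3 : ∀ ρ, fderiv ℝ (fun y => dens (α y) (η y) ρ) z (bv ρ) =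
      ∑ l, (til (m2 (η z)) ρ l * fderiv ℝ (fun y => c1 (α y) l) z (bv ρ) +
        c1 (α z) l * fderiv ℝ (fun y => til (m2 (η y)) ρ l) z (bv ρ)) := by
    intro ρ
    have e : (fun y => dens (α y) (η y) ρ) =
        fun y => ∑ l, til (m2 (η y)) ρ l * c1 (α y) l := rfl
    rw [e, fderiv_fun_sum fun l _ => (h2 ρ l).fun_mul (h1 l)]
    simp only [_root_.sum_apply]
    refine Finset.sum_congr rfl fun l _ => ?_
    rw [fderiv_fun_mul (h2 ρ l) (h1 l)]
    rfl
  have ht : ∀ y μ ν, til (m2 (η y)) μ ν = -til (m2 (η y)) ν μ := fun y μ ν =>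
    congrFun (congrFun (til_transpose (m2_transpose (η y))) ν) μ
  have h4 : wedge13 (α z) (extDeriv η z) =
      -∑ ρ, ∑ l, c1 (α z) l * fderiv ℝ (fun y => til (m2 (η y)) ρ l) z (bv ρ) := by
    rw [wedge13_eq, dotProduct, Finset.sum_comm, ← Finset.sum_neg_distrib]
    refine Finset.sum_congr rfl fun l _ => ?_
    rw [vec3_extDeriv hη, Finset.mul_sum, ← Finset.sum_neg_distrib]
    refine Finset.sum_congr rfl fun ρ _ => ?_
    have e : (fun y => til (m2 (η y)) l ρ) = fun y => -til (m2 (η y)) ρ l :=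
      funext fun y => ht y l ρ
    rw [e, fderiv_fun_neg]
    simp
  have h5 : wedge22 (extDeriv α z) (η z) =
      ∑ ρ, ∑ l, til (m2 (η z)) ρ l * fderiv ℝ (fun y => c1 (α y) l) z (bv ρ) := by
    rw [wedge22_eq, wd, Matrix.trace]
    simp only [Matrix.diag_apply, Matrix.mul_apply, m2_apply, c2_extDeriv hα]
    have e : ∀ i j, (fderiv ℝ (fun y => c1 (α y) j) z (bv i) -
        fderiv ℝ (fun y => c1 (α y) i) z (bv j)) * til (m2 (η z)) j i =
        -(til (m2 (η z)) i j * fderiv ℝ (fun y => c1 (α y) j) z (bv i)) -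
          til (m2 (η z)) j i * fderiv ℝ (fun y => c1 (α y) i) z (bv j) := by
      intro i j
      rw [ht z i j]
      ring
    simp only [e, Finset.sum_sub_distrib, Finset.sum_neg_distrib]
    rw [Finset.sum_comm (f := fun i j =>
      til (m2 (η z)) j i * fderiv ℝ (fun y => c1 (α y) i) z (bv j))]
    ring
  simp only [h3, h4, h5, Finset.sum_add_distrib]
  ring

lemma fderiv_mul_dens {f : V4 → ℝ} {η : V4 → Alt 2} {z : V4} (hf : DifferentiableAt ℝ f z)
    (hη : DifferentiableAt ℝ η z) (α : Alt 1) :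
    wedge13 α (extDeriv (fun y => f y • η y) z) =
      f z * wedge13 α (extDeriv η z) - wedge211 (η z) (ofLin (fderiv ℝ f z)) α := by
  have hα : DifferentiableAt ℝ (fun _ : V4 => α) z := differentiableAt_const _
  have h0 : extDeriv (fun _ : V4 => α) z = 0 := by
    rw [extDeriv, fderiv_const_apply]
    exact map_zero (ContinuousAlternatingMap.alternatizeUncurryFinCLM ℝ V4 ℝ)
  have w0 : ∀ β, wedge22 0 β = 0 := fun β => (wedge22L.map_zero₂ β)
  have h1 := wedge22_sub_wedge13 hα hη
  have h2 := wedge22_sub_wedge13 hα (hf.smul hη)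
  simp only [h0, w0, zero_sub] at h1 h2
  have hd : ∀ ρ, DifferentiableAt ℝ (fun y => dens α (η y) ρ) z := fun ρ =>
    (DifferentiableAt.fun_sum (u := Finset.univ) fun l _ =>
      (differentiableAt_til hη ρ l).mul_const (c1 α l))
  have e : ∀ ρ, fderiv ℝ (fun y => dens α (f y • η y) ρ) z (bv ρ) =
      f z * fderiv ℝ (fun y => dens α (η y) ρ) z (bv ρ) +
        dens α (η z) ρ * fderiv ℝ f z (bv ρ) := by
    intro ρ
    have e1 : (fun y => dens α (f y • η y) ρ) = fun y => f y * dens α (η y) ρ := by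
      funext y
      rw [dens, m2_smul, til_smul, Matrix.smul_mulVec]
      rfl
    rw [e1, fderiv_fun_mul hf (hd ρ)]
    rfl
  have e2 : wedge211 (η z) (ofLin (fderiv ℝ f z)) α =
      ∑ ρ, dens α (η z) ρ * fderiv ℝ f z (bv ρ) := by
    rw [wedge211_eq, dotProduct]
    refine Finset.sum_congr rfl fun ρ _ => ?_
    rw [c1_ofLin, mul_comm]
    rfl
  have h3 : -wedge13 α (extDeriv (fun y => f y • η y) z) =
      f z * -wedge13 α (extDeriv η z) + wedge211 (η z) (ofLin (fderiv ℝ f z)) α := by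
    rw [h1, e2, Finset.mul_sum, ← Finset.sum_add_distrib, ← Finset.sum_congr rfl fun ρ _ => e ρ]
    exact h2
  linarith

lemma sum_fderiv_vec3 {Ω : V4 → Alt 3} {z : V4} (h : DifferentiableAt ℝ Ω z)
    (h0 : extDeriv Ω z = 0) : ∑ l, fderiv ℝ (fun y => vec3 (Ω y) l) z (bv l) = 0 := by
  have e := DFunLike.congr_fun h0 ![bv 0, bv 1, bv 2, bv 3]
  rw [extDeriv_apply h, Fin.sum_univ_four] at e
  have r0 : (0 : Fin 4).removeNth ![bv 0, bv 1, bv 2, bv 3] = ![bv 1, bv 2, bv 3] := by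
    ext i; fin_cases i <;> rfl
  have r1 : (1 : Fin 4).removeNth ![bv 0, bv 1, bv 2, bv 3] = ![bv 0, bv 2, bv 3] := by
    ext i; fin_cases i <;> rfl
  have r2 : (2 : Fin 4).removeNth ![bv 0, bv 1, bv 2, bv 3] = ![bv 0, bv 1, bv 3] := by
    ext i; fin_cases i <;> rfl
  have r3 : (3 : Fin 4).removeNth ![bv 0, bv 1, bv 2, bv 3] = ![bv 0, bv 1, bv 2] := by
    ext i; fin_cases i <;> rfl
  rw [r0, r1, r2, r3] at e
  simp only [Fin.sum_univ_four, (vec3_apply _).1, (vec3_apply _).2.1, (vec3_apply _).2.2.1,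
    (vec3_apply _).2.2.2, fderiv_fun_neg, c3, _root_.neg_apply]
  simp at e
  linarith

/-! ### First-order identities on a hyper-Kähler 4-manifold -/

section Fields

variable {M : Type*} [TopologicalSpace M] [ChartedSpace V4 M]
variable {Sg : Fin 3 → Form M 2}

/-- The differential of a function, as a map to the 1-forms on the model space. -/
def dfA (f : M → ℝ) : M → Alt 1 := extFun f

lemma SmoothA.differentiableAt {k : ℕ} {η : M → Alt k} (hη : SmoothA η Set.univ) {x₀ : M} {z : V4}
    (hz : z ∈ (extChartAt (𝓡 4) x₀).target) : DifferentiableAt ℝ (coord η x₀) z :=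
  SmoothForm.differentiableAt (M := M) hη isOpen_univ ⟨hz, trivial⟩

lemma eventually_target {x₀ : M} {z : V4} (hz : z ∈ (extChartAt (𝓡 4) x₀).target) :
    ∀ᶠ w in 𝓝 z, w ∈ (extChartAt (𝓡 4) x₀).target :=
  (isOpen_extChartAt_target x₀).mem_nhds hz

/-- The scalar `(dα ∧ η - α ∧ dη) / v_Σ`, which is a divergence. -/
def stokes (Sg : Fin 3 → Form M 2) (α : M → Alt 1) (η : M → Alt 2) (x : M) : ℝ :=
  (wedge22 (extA α x) (η x) - wedge13 (α x) (extA η x)) / vol (val Sg x)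

lemma vol_pullT (x₀ : M) (z : V4) : vol (pullT Sg x₀ z) =
    (lmat (chartD x₀ z)).det * vol (val Sg ((extChartAt (𝓡 4) x₀).symm z)) := vol_pb _ _

lemma IsHyperkahlerTriple.smoothA (hSg : IsHyperkahlerTriple Sg) (i : Fin 3) :
    SmoothA (fun x => val Sg x i) Set.univ :=
  hSg.smooth i

lemma IsHyperkahlerTriple.extA_eq (hSg : IsHyperkahlerTriple Sg) (i : Fin 3) (x : M) :
    extA (fun x => val Sg x i) x = 0 :=
  hSg.closed i x

variable [IsManifold (𝓡 4) ∞ M]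

lemma coord_self {k : ℕ} (η : M → Alt k) (x : M) : coord η x (extChartAt (𝓡 4) x x) = η x :=
  pull_self (M := M) η x

lemma coord_extA {k : ℕ} {η : M → Alt k} (hη : SmoothA η Set.univ) {x₀ : M} {z : V4}
    (hz : z ∈ (extChartAt (𝓡 4) x₀).target) : coord (extA η) x₀ z = extDeriv (coord η x₀) z :=
  pull_ext (M := M) hη isOpen_univ ⟨hz, trivial⟩

lemma SmoothA.extA {k : ℕ} {η : M → Alt k} (hη : SmoothA η Set.univ) :
    SmoothA (extA η) Set.univ := SmoothForm.ext (M := M) hη isOpen_univ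

lemma extA_extA {k : ℕ} {η : M → Alt k} (hη : SmoothA η Set.univ) (x : M) :
    extA (extA η) x = 0 := ext_ext (M := M) hη isOpen_univ trivial

lemma SmoothFn.dfA {f : M → ℝ} (hf : SmoothFn f Set.univ) : SmoothA (dfA f) Set.univ :=
  hf.extFun isOpen_univ

lemma extA_dfA {f : M → ℝ} (hf : SmoothFn f Set.univ) (x : M) : extA (Plebanski.dfA f) x = 0 :=
  ext_extFun hf isOpen_univ trivial

lemma coord_dfA {f : M → ℝ} (hf : SmoothFn f Set.univ) {x₀ : M} {z : V4}
    (hz : z ∈ (extChartAt (𝓡 4) x₀).target) : coord (Plebanski.dfA f) x₀ z =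
      ofLin (fderiv ℝ (fun z => f ((extChartAt (𝓡 4) x₀).symm z)) z) :=
  pull_extFun hf isOpen_univ ⟨hz, trivial⟩

/-- In a chart, `stokes` is a coordinate divergence divided by the density. -/
lemma stokes_coord (hSg : IsHyperkahlerTriple Sg) {α : M → Alt 1} {η : M → Alt 2}
    (hα : SmoothA α Set.univ) (hη : SmoothA η Set.univ) {x₀ : M} {z : V4}
    (hz : z ∈ (extChartAt (𝓡 4) x₀).target) :
    stokes Sg α η ((extChartAt (𝓡 4) x₀).symm z) * vol (pullT Sg x₀ z) =
      ∑ ρ, fderiv ℝ (fun y => dens (coord α x₀ y) (coord η x₀ y) ρ) z (bv ρ) := by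
  rw [← wedge22_sub_wedge13 (hα.differentiableAt hz) (hη.differentiableAt hz),
    ← coord_extA hα hz, ← coord_extA hη hz]
  have e1 : wedge22 (coord (extA α) x₀ z) (coord η x₀ z) = _ := wedge22_pb _ _ _
  have e2 : wedge13 (coord α x₀ z) (coord (extA η) x₀ z) = _ := wedge13_pb _ _ _
  rw [e1, e2, vol_pullT, stokes]
  have := (hSg.perfect ((extChartAt (𝓡 4) x₀).symm z)).vol_ne
  field_simp

/-- The divergence of a 1-form, `|g|^{-1/2} ∂_μ (|g|^{1/2} g^{μν} β_ν)`. -/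
def divA (Sg : Fin 3 → Form M 2) (β : M → Alt 1) (x : M) : ℝ :=
  (1 / vol (val Sg x)) * ∑ μ, fderiv ℝ
    (fun z => vol (pullT Sg x z) * (gi (pullT Sg x z) *ᵥ c1 (coord β x z)) μ)
    (extChartAt (𝓡 4) x x) (bv μ)

lemma beltrami_eq {f : M → ℝ} (hf : SmoothFn f Set.univ) (x : M) :
    beltrami Sg f x = divA Sg (dfA f) x := by
  rw [beltrami, divA]
  congr 1
  refine Finset.sum_congr rfl fun μ _ => ?_
  refine congrArg (fun l : V4 →L[ℝ] ℝ => l (bv μ)) (Filter.EventuallyEq.fderiv_eq ?_)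
  filter_upwards [eventually_target (mem_extChartAt_target x)] with z hz
  rw [coord_dfA hf hz]
  rfl

section Hyperkahler

variable (hSg : IsHyperkahlerTriple Sg)
include hSg

/-- The component `0123` of `Σ^i ∧ dα` is the divergence of `Σ^i(α)`. -/
lemma wedge22_extA {α : M → Alt 1} (hα : SmoothA α Set.univ) (i : Fin 3) (x : M) :
    wedge22 (extA α x) (val Sg x i) =
      vol (val Sg x) * divA Sg (fun y => Jl (val Sg y) i (α y)) x := by
  have hx := mem_extChartAt_target (I := 𝓡 4) x
  have hv := (hSg.perfect x).vol_ne
  have h := stokes_coord hSg hα (hSg.smoothA i) hx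
  rw [pullT_self, extChartAt_to_inv, stokes, hSg.extA_eq, wedge13_eq] at h
  have e : vec3 (0 : Alt 3) = 0 := by
    funext l
    simp [vec3, c3]
  rw [e, dotProduct_zero, sub_zero, div_mul_cancel₀ _ hv] at h
  rw [h, divA, ← mul_assoc, mul_one_div_cancel hv, one_mul]
  refine Finset.sum_congr rfl fun μ _ => ?_
  refine congrArg (fun l : V4 →L[ℝ] ℝ => l (bv μ)) (Filter.EventuallyEq.fderiv_eq ?_)
  filter_upwards [eventually_target hx] with z hz
  have hP := isPerfect_pullT hSg hz
  rw [coord_Jl hz, c1_Jl, Matrix.mulVec_mulVec, sgEnd, ← mul_assoc]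
  have e2 := hP.gi_mul_gi i
  rw [m2] at e2
  rw [e2, Matrix.smul_mulVec]
  simp only [Pi.smul_apply, smul_eq_mul]
  rw [← mul_assoc, mul_one_div_cancel hP.vol_ne, one_mul]
  rfl

/-- The self-dual part of `dα` consists of the divergences of the `Σ^i(α)`. -/
lemma contr2_extA {α : M → Alt 1} (hα : SmoothA α Set.univ) (i : Fin 3) (x : M) :
    contr2 (val Sg x) (val Sg x i) (extA α x) =
      2 * divA Sg (fun y => Jl (val Sg y) i (α y)) x := by
  have hv := (hSg.perfect x).vol_ne
  have h := wedge22_extA hSg hα i x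
  rw [wedge22_comm, (hSg.perfect x).wedge22_self] at h
  have := mul_left_cancel₀ hv (a := vol (val Sg x))
    (b := 1 / 2 * contr2 (val Sg x) (val Sg x i) (extA α x))
    (c := divA Sg (fun y => Jl (val Sg y) i (α y)) x) (by linarith)
  linarith

/-- The divergence as the component of an exterior derivative along `Σ^0`. -/
lemma divA_eq {β : M → Alt 1} (hβ : SmoothA β Set.univ) (x : M) : divA Sg β x =
    -(1 / 2) * contr2 (val Sg x) (val Sg x 0) (extA (fun y => Jl (val Sg y) 0 (β y)) x) := by
  rw [contr2_extA hSg (hSg.smooth_Jl hβ 0)]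
  have e : (fun y => Jl (val Sg y) 0 (Jl (val Sg y) 0 (-β y))) = β := funext fun y => by
    rw [(hSg.perfect y).Jl_self, neg_neg]
  have h := contr2_extA hSg (hSg.smooth_Jl hβ.neg 0) 0 x
  have e2 : (fun y => Jl (val Sg y) 0 ((-β) y)) = -fun y => Jl (val Sg y) 0 (β y) := funext fun y =>
    map_neg _ _
  have h3 := contr2_extA hSg (hSg.smooth_Jl hβ 0) 0 x
  have e4 : (fun y => Jl (val Sg y) 0 ((fun y => Jl (val Sg y) 0 ((-β) y)) y)) = β := e
  rw [e4, e2, extA_neg] at h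
  have h5 : contr2 (val Sg x) (val Sg x 0) ((-extA fun y => Jl (val Sg y) 0 (β y)) x) =
      -contr2 (val Sg x) (val Sg x 0) (extA (fun y => Jl (val Sg y) 0 (β y)) x) :=
    (contr2L (val Sg x) (val Sg x 0)).map_neg _
  rw [h5, h3] at h
  linarith

lemma divA_add {β γ : M → Alt 1} (hβ : SmoothA β Set.univ) (hγ : SmoothA γ Set.univ) (x : M) :
    divA Sg (fun y => β y + γ y) x = divA Sg β x + divA Sg γ x := by
  rw [divA_eq hSg hβ, divA_eq hSg hγ, divA_eq hSg (β := fun y => β y + γ y) (hβ.add hγ)]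
  have e : (fun y => Jl (val Sg y) 0 (β y + γ y)) =
      (fun y => Jl (val Sg y) 0 (β y)) + fun y => Jl (val Sg y) 0 (γ y) :=
    funext fun y => map_add _ _ _
  rw [e, extA_add (hSg.smooth_Jl hβ 0) (hSg.smooth_Jl hγ 0)]
  have h := (contr2L (val Sg x) (val Sg x 0)).map_add (extA (fun y => Jl (val Sg y) 0 (β y)) x)
    (extA (fun y => Jl (val Sg y) 0 (γ y)) x)
  simp only [contr2L_apply] at h
  rw [Pi.add_apply, h]
  ring

lemma divA_smul (r : ℝ) {β : M → Alt 1} (hβ : SmoothA β Set.univ) (x : M) :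
    divA Sg (fun y => r • β y) x = r * divA Sg β x := by
  rw [divA_eq hSg hβ, divA_eq hSg (β := fun y => r • β y) (hβ.const_smul r)]
  have e : (fun y => Jl (val Sg y) 0 (r • β y)) = r • (fun y => Jl (val Sg y) 0 (β y)) :=
    funext fun y => map_smul _ _ _
  rw [e, extA_smul]
  have h := (contr2L (val Sg x) (val Sg x 0)).map_smul r (extA (fun y => Jl (val Sg y) 0 (β y)) x)
  simp only [contr2L_apply] at h
  rw [Pi.smul_apply, h, smul_eq_mul]
  ring

lemma divA_neg {β : M → Alt 1} (hβ : SmoothA β Set.univ) (x : M) :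
    divA Sg (fun y => -β y) x = -divA Sg β x := by
  have := divA_smul hSg (-1) hβ x
  have e : (fun y => (-1 : ℝ) • β y) = fun y => -β y := funext fun y => neg_one_smul ℝ (β y)
  rwa [e, neg_one_mul] at this

/-- By `d² = 0`, the complex structures turn gradients into divergence-free fields. -/
lemma divA_Jl_dfA {f : M → ℝ} (hf : SmoothFn f Set.univ) (i : Fin 3) (x : M) :
    divA Sg (fun y => Jl (val Sg y) i (dfA f y)) x = 0 := by
  have h := contr2_extA hSg hf.dfA i x
  rw [extA_dfA hf] at h
  have h0 : contr2 (val Sg x) (val Sg x i) 0 = 0 := (contr2L (val Sg x) (val Sg x i)).map_zero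
  rw [h0] at h
  linarith

/-- The codifferential of a 2-form is divergence-free. -/
lemma divA_star3 {η : M → Alt 2} (hη : SmoothA η Set.univ) (x : M) :
    divA Sg (fun y => star3 (val Sg y) (extA η y)) x = 0 := by
  have hx := mem_extChartAt_target (I := 𝓡 4) x
  have e : ∀ μ, fderiv ℝ (fun z => vol (pullT Sg x z) * (gi (pullT Sg x z) *ᵥ
        c1 (coord (fun y => star3 (val Sg y) (extA η y)) x z)) μ) (extChartAt (𝓡 4) x x) =
      fderiv ℝ (fun z => vec3 (coord (extA η) x z) μ) (extChartAt (𝓡 4) x x) := by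
    intro μ
    refine Filter.EventuallyEq.fderiv_eq ?_
    filter_upwards [eventually_target hx] with z hz
    have hP := isPerfect_pullT hSg hz
    rw [coord_star3 hz, c1_star3, Matrix.mulVec_smul, Matrix.mulVec_mulVec, hP.gi_mul_gm,
      Matrix.one_mulVec, Pi.smul_apply, smul_eq_mul, ← mul_assoc, mul_one_div_cancel hP.vol_ne,
      one_mul]
  rw [divA]
  simp only [e]
  rw [sum_fderiv_vec3 (hη.extA.differentiableAt hx), mul_zero]
  rw [← coord_extA hη.extA hx, coord_self, extA_extA hη]

/-- As `Σ^j` is closed, `⋆d(f Σ^j) = ⋆(df ∧ Σ^j)` is the complex structure applied to `df`. -/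
lemma star3_extA_smul {f : M → ℝ} (hf : SmoothFn f Set.univ) (j : Fin 3) (x : M) :
    star3 (val Sg x) (extA (fun y => f y • val Sg y j) x) = Jl (val Sg x) j (dfA f x) := by
  have hx := mem_extChartAt_target (I := 𝓡 4) x
  have hP := hSg.perfect x
  refine hP.ip1_ext fun α => ?_
  have h := fderiv_mul_dens (hf.differentiableAt isOpen_univ (x₀ := x) ⟨hx, trivial⟩)
    ((hSg.smoothA j).differentiableAt hx) α
  have e : coord (fun y => f y • val Sg y j) x =
      fun z => f ((extChartAt (𝓡 4) x).symm z) • coord (fun y => val Sg y j) x z := rfl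
  rw [← coord_dfA hf hx, ← coord_extA (hSg.smoothA j) hx, ← e,
    ← coord_extA ((hSg.smoothA j).smul hf) hx, coord_self, coord_self, coord_self, coord_self,
    hSg.extA_eq] at h
  have e0 : wedge13 α 0 = 0 := by simp [wedge13, c3]
  rw [hP.ip1_star3, h, e0, hP.wedge211_perfect, hP.ip1_comm α, hP.ip1_Jl]
  have := hP.vol_ne
  field_simp
  ring

end Hyperkahler

end Fields

/-! ### Operators on smooth 1-forms -/

/-- `liftS`, as a linear map. -/
def liftSL (S : Trip) (i : Fin 3) : Trip →ₗ[ℝ] Alt 2 where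
  toFun s := liftS S s i
  map_add' s t := by
    have h : ∀ η τ σ, contr2 S (η + τ) σ = contr2 S η σ + contr2 S τ σ := fun η τ σ =>
      (contr2L S).map_add₂ η τ σ
    simp only [liftS, Pi.add_apply, h, Fin.sum_univ_three]
    module
  map_smul' r s := by
    have h : ∀ η σ, contr2 S (r • η) σ = r * contr2 S η σ := fun η σ =>
      (contr2L S).map_smul₂ r η σ
    simp only [liftS, Pi.smul_apply, h, Fin.sum_univ_three, RingHom.id_apply]
    module

lemma liftSL_apply (S : Trip) (i : Fin 3) (s : Trip) : liftSL S i s = liftS S s i := rfl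

lemma IsPerfect.asd_star2 {S : Trip} (hS : IsPerfect S) (η : Alt 2) :
    asd S (star2 S η) = -asd S η := by
  rw [asd_apply, asd_apply, hS.star2_star2, neg_sub]

section Fields

variable {M : Type*} [TopologicalSpace M] [ChartedSpace V4 M]

variable (M) in
/-- The submodule of smooth 1-forms. -/
def sm1 : Submodule ℝ (M → Alt 1) where
  carrier := {α | SmoothA α Set.univ}
  add_mem' h h' := h.add h'
  zero_mem' := SmoothA.zero
  smul_mem' r _ h := h.const_smul r

variable (M) in
/-- The smooth 1-forms. -/
def Sm1 : Type _ := sm1 M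

instance : AddCommGroup (Sm1 M) := inferInstanceAs (AddCommGroup (sm1 M))

instance : Module ℝ (Sm1 M) := inferInstanceAs (Module ℝ (sm1 M))

/-- The exterior derivative at `x`, on smooth 1-forms. -/
def dS (x : M) : Sm1 M →ₗ[ℝ] Alt 2 where
  toFun α := extA α.1 x
  map_add' α β := congrFun (extA_add α.2 β.2) x
  map_smul' r α := congrFun (extA_smul r α.1) x

@[simp] lemma dS_neg (x : M) (α : Sm1 M) : dS x (-α) = -dS x α := map_neg (dS x) α

@[simp] lemma dS_sub (x : M) (α β : Sm1 M) : dS x (α - β) = dS x α - dS x β := map_sub (dS x) α β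

variable [IsManifold (𝓡 4) ∞ M] {Sg : Fin 3 → Form M 2}

/-- The differential of a smooth function, as a smooth 1-form. -/
def dfS {f : M → ℝ} (hf : SmoothFn f Set.univ) : Sm1 M := ⟨dfA f, hf.dfA⟩

lemma dS_dfS {f : M → ℝ} (hf : SmoothFn f Set.univ) (x : M) : dS x (dfS hf) = 0 := extA_dfA hf x

section Hyperkahler

variable (hSg : IsHyperkahlerTriple Sg)

/-- The complex structure `Σ^i_μ^α`, on smooth 1-forms. -/
def JS (i : Fin 3) : Sm1 M →ₗ[ℝ] Sm1 M where
  toFun α := ⟨fun y => Jl (val Sg y) i (α.1 y), hSg.smooth_Jl α.2 i⟩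
  map_add' _ _ := Subtype.ext (funext fun _ => map_add _ _ _)
  map_smul' r α := Subtype.ext (funext fun y => map_smul (Jl (val Sg y) i) r (α.1 y))

/-- The divergence at `x`, on smooth 1-forms. -/
def divS (x : M) : Sm1 M →ₗ[ℝ] ℝ where
  toFun α := divA Sg α.1 x
  map_add' α β := divA_add hSg α.2 β.2 x
  map_smul' r α := divA_smul hSg r α.2 x

lemma JS_self (i : Fin 3) (α : Sm1 M) : JS hSg i (JS hSg i α) = -α :=
  Subtype.ext (funext fun y => (hSg.perfect y).Jl_self i (α.1 y))

lemma JS_table (α : Sm1 M) :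
    JS hSg 0 (JS hSg 1 α) = JS hSg 2 α ∧ JS hSg 1 (JS hSg 2 α) = JS hSg 0 α ∧
    JS hSg 2 (JS hSg 0 α) = JS hSg 1 α ∧ JS hSg 1 (JS hSg 0 α) = -JS hSg 2 α ∧
    JS hSg 2 (JS hSg 1 α) = -JS hSg 0 α ∧ JS hSg 0 (JS hSg 2 α) = -JS hSg 1 α := by
  have h := fun y => (hSg.perfect y).Jl_table (α.1 y)
  exact ⟨Subtype.ext (funext fun y => (h y).1), Subtype.ext (funext fun y => (h y).2.1),
    Subtype.ext (funext fun y => (h y).2.2.1), Subtype.ext (funext fun y => (h y).2.2.2.1),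
    Subtype.ext (funext fun y => (h y).2.2.2.2.1), Subtype.ext (funext fun y => (h y).2.2.2.2.2)⟩

lemma contr2_dS (x : M) (i : Fin 3) (α : Sm1 M) :
    contr2L (val Sg x) (val Sg x i) (dS x α) = 2 * divS hSg x (JS hSg i α) :=
  contr2_extA hSg α.2 i x

lemma divS_dfS {f : M → ℝ} (hf : SmoothFn f Set.univ) (x : M) :
    divS hSg x (dfS hf) = beltrami Sg f x := (beltrami_eq hf x).symm

lemma divS_JS_dfS {f : M → ℝ} (hf : SmoothFn f Set.univ) (i : Fin 3) (x : M) :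
    divS hSg x (JS hSg i (dfS hf)) = 0 := divA_Jl_dfA hSg hf i x

@[simp] lemma divS_neg (x : M) (α : Sm1 M) : divS hSg x (-α) = -divS hSg x α :=
  map_neg (divS hSg x) α

@[simp] lemma divS_sub (x : M) (α β : Sm1 M) :
    divS hSg x (α - β) = divS hSg x α - divS hSg x β := map_sub (divS hSg x) α β

@[simp] lemma JS_neg (i : Fin 3) (α : Sm1 M) : JS hSg i (-α) = -JS hSg i α :=
  map_neg (JS hSg i) α

@[simp] lemma JS_sub (i : Fin 3) (α β : Sm1 M) : JS hSg i (α - β) = JS hSg i α - JS hSg i β :=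
  map_sub (JS hSg i) α β

/-! ### The adjoint operator in terms of the twisted components -/

/-- The form part of `D̃^*(√2 ξ, a)`, at `x`. -/
def dtsForm (ξ : Sm1 M) (a : Fin 3 → Sm1 M) (x : M) (i : Fin 3) : Alt 2 :=
  -dS x (JS hSg i ξ) + liftSL (val Sg x) i fun j =>
    star2 (val Sg x) (dS x (a j - (1 / 2 : ℝ) • JS hSg j ξ))

/-- The 1-form `(1/√2) (ξ' + √2 Φ(a))` with `ξ' = √2 ξ`. -/
def twistP (ξ : Sm1 M) (a : Fin 3 → Sm1 M) : Sm1 M := ξ + ∑ j, JS hSg j (a j)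

/-- The `E`-valued 1-form `a - √2 Φ^*(ξ')` with `ξ' = √2 ξ`. -/
def twistB (ξ : Sm1 M) (a : Fin 3 → Sm1 M) (i : Fin 3) : Sm1 M := a i - JS hSg i ξ

/-- The anti-self-dual part of `D̃^*(ξ, a)` only depends on the second twisted component. -/
lemma asd_dtsForm (ξ : Sm1 M) (a : Fin 3 → Sm1 M) (x : M) (i : Fin 3) :
    asd (val Sg x) (dtsForm hSg ξ a x i) =
      (2 : ℝ) • asd (val Sg x) (dS x (twistB hSg ξ a i)) := by
  have hP := hSg.perfect x
  rw [dtsForm, map_add, liftSL_apply, hP.asd_liftS, hP.asd_star2, twistB]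
  have h1 := map_neg (asd (val Sg x)) (dS x (JS hSg i ξ))
  have h2 := map_sub (asd (val Sg x)) (dS x (a i)) (dS x (JS hSg i ξ))
  have h3 := map_sub (asd (val Sg x)) (dS x (a i)) ((1 / 2 : ℝ) • dS x (JS hSg i ξ))
  rw [h1, dS_sub, dS_sub, h2, map_smul, h3, map_smul]
  module

/-- The self-dual part of `D̃^*(ξ, a)` only contains divergences of the twisted components. -/
lemma contr2_dtsForm (ξ : Sm1 M) (a : Fin 3 → Sm1 M) (x : M) (k i : Fin 3) :
    contr2 (val Sg x) (val Sg x k) (dtsForm hSg ξ a x i) =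
      -(if k = i then 4 * divS hSg x (twistP hSg ξ a) else 0) + ∑ l, eps3 k i l *
        (2 * divS hSg x (JS hSg l (twistP hSg ξ a)) + 2 * divS hSg x (twistB hSg ξ a l)) := by
  have hP := hSg.perfect x
  have e : ∀ k (α : Sm1 M), contr2 (val Sg x) (val Sg x k) (star2 (val Sg x) (dS x α)) =
      2 * divS hSg x (JS hSg k α) := fun k α => by
    rw [hP.contr2_self_star2]
    exact contr2_dS hSg x k α
  rw [dtsForm, ← contr2L_apply, map_add, ← dS_neg, contr2_dS hSg, contr2L_apply, liftSL_apply,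
    hP.contr2_liftS]
  simp only [e]
  have t0 := fun α => JS_self hSg 0 α
  have t1 := fun α => JS_self hSg 1 α
  have t2 := fun α => JS_self hSg 2 α
  have t := JS_table hSg
  have ta := fun α => (t α).1
  have tb := fun α => (t α).2.1
  have tc := fun α => (t α).2.2.1
  have td := fun α => (t α).2.2.2.1
  have te := fun α => (t α).2.2.2.2.1
  have tf := fun α => (t α).2.2.2.2.2
  fin_cases k <;> fin_cases i <;>
    simp [Fin.sum_univ_three, eps3_self_left, eps3_self_right, eps3_self_mid, twistP, twistB,
      t0, t1, t2, ta, tb, tc, td, te, tf] <;> ring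

/-- The component of `D̃^*(ξ, a)` in `E` only contains divergences of the twisted components. -/
lemma divS_twist (ξ : Sm1 M) (a : Fin 3 → Sm1 M) (x : M) (i : Fin 3) :
    ∑ j, ∑ k, eps3 i j k * divS hSg x (JS hSg j (∑ m, ∑ n, eps3 k m n • JS hSg m (a n))) -
      2 * divS hSg x (JS hSg i ξ) =
    divS hSg x (twistB hSg ξ a i) - divS hSg x (JS hSg i (twistP hSg ξ a)) := by
  have t0 := fun α => JS_self hSg 0 α
  have t1 := fun α => JS_self hSg 1 α
  have t2 := fun α => JS_self hSg 2 α
  have t := JS_table hSg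
  have ta := fun α => (t α).1
  have tb := fun α => (t α).2.1
  have tc := fun α => (t α).2.2.1
  have td := fun α => (t α).2.2.2.1
  have te := fun α => (t α).2.2.2.2.1
  have tf := fun α => (t α).2.2.2.2.2
  fin_cases i <;>
    simp [Fin.sum_univ_three, eps3_self_left, eps3_self_right, eps3_self_mid, twistP, twistB,
      t0, t1, t2, ta, tb, tc, td, te, tf] <;> ring

end Hyperkahler

end Fields

/-! ### The twisted operator in components -/

section Quaternions

variable {V : Type*} [AddCommGroup V] [Module ℝ V] (J : Fin 3 → V →ₗ[ℝ] V)

/-- The algebra of the splitting of the twisted operator, over any real vector space with three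
anticommuting complex structures. -/
lemma twist_algebra (hself : ∀ i v, J i (J i v) = -v)
    (htable : ∀ v, J 0 (J 1 v) = J 2 v ∧ J 1 (J 2 v) = J 0 v ∧ J 2 (J 0 v) = J 1 v ∧
      J 1 (J 0 v) = -J 2 v ∧ J 2 (J 1 v) = -J 0 v ∧ J 0 (J 2 v) = -J 1 v)
    (dh X : V) (u w c t d a : Fin 3 → V)
    (ht : ∀ i, t i = (1 / 2 : ℝ) • J i dh + (∑ j, ∑ l, (1 / 2 * eps3 i j l) •
      (J j (u l) + J j (w l))) + c i)
    (hd : ∀ i, d i = (1 / 2 : ℝ) • ((∑ j, ∑ l, eps3 i j l • J j (t l)) - t i))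
    (ha : ∀ i, a i = d i + (1 / 2 : ℝ) • ∑ j, ∑ l, eps3 i j l • J j (u l - w l))
    (hX : X = (1 / 2 : ℝ) • ((1 / 2 : ℝ) • ∑ i, J i ((1 / 6 : ℝ) • J i dh +
      (∑ j, ∑ l, (1 / 2 * eps3 i j l) • (J j (u l) + J j (w l))) - c i)
        - ∑ i, J i (d i) - ∑ i, J i (u i - w i))) :
    X + ∑ j, J j (a j) = (-(1 / 2) : ℝ) • (dh - (2 : ℝ) • ∑ i, J i (u i)) ∧
      ∀ i, a i - J i X = w i - c i := by
  have t0 := hself 0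
  have t1 := hself 1
  have t2 := hself 2
  have ta := fun v => (htable v).1
  have tb := fun v => (htable v).2.1
  have tc := fun v => (htable v).2.2.1
  have td := fun v => (htable v).2.2.2.1
  have te := fun v => (htable v).2.2.2.2.1
  have tf := fun v => (htable v).2.2.2.2.2
  simp only [Fin.sum_univ_three, Fin.forall_fin_succ, Fin.succ_zero_eq_one, Fin.succ_one_eq_two,
    eps3_self_left, eps3_self_right, eps3_self_mid, eps3_012, eps3_120, eps3_201, eps3_021,
    eps3_102, eps3_210, mul_zero, zero_smul, zero_add, add_zero, one_smul, neg_smul, mul_one,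
    mul_neg, IsEmpty.forall_iff, and_true] at ht hd ha hX ⊢
  obtain ⟨ht0, ht1, ht2⟩ := ht
  obtain ⟨hd0, hd1, hd2⟩ := hd
  obtain ⟨ha0, ha1, ha2⟩ := ha
  have hd0' : d 0 = (1 / 4 : ℝ) • J 0 dh + (1 / 2 : ℝ) • (u 0 + w 0)
      + (1 / 2 : ℝ) • (J 1 (c 2) - J 2 (c 1) - c 0) := by
    rw [hd0, ht0, ht1, ht2]
    simp only [map_add, map_neg, map_smul, t1, t2, tb, tc, td, te]
    module
  have hd1' : d 1 = (1 / 4 : ℝ) • J 1 dh + (1 / 2 : ℝ) • (u 1 + w 1)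
      + (1 / 2 : ℝ) • (J 2 (c 0) - J 0 (c 2) - c 1) := by
    rw [hd1, ht0, ht1, ht2]
    simp only [map_add, map_neg, map_smul, t0, t2, ta, tc, te, tf]
    module
  have hd2' : d 2 = (1 / 4 : ℝ) • J 2 dh + (1 / 2 : ℝ) • (u 2 + w 2)
      + (1 / 2 : ℝ) • (J 0 (c 1) - J 1 (c 0) - c 2) := by
    rw [hd2, ht0, ht1, ht2]
    simp only [map_add, map_neg, map_smul, t0, t1, ta, tb, td, tf]
    module
  have hX' : X = (1 / 4 : ℝ) • dh - (1 / 2 : ℝ) • (J 0 (c 0) + J 1 (c 1) + J 2 (c 2)) -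
      (1 / 2 : ℝ) • (J 0 (u 0 - w 0) + J 1 (u 1 - w 1) + J 2 (u 2 - w 2)) := by
    rw [hX, hd0', hd1', hd2']
    simp only [map_add, map_neg, map_smul, map_sub, t0, t1, t2, ta, tb, tc, td, te, tf]
    module
  rw [ha0, ha1, ha2, hX', hd0', hd1', hd2']
  simp only [map_add, map_neg, map_smul, map_sub, t0, t1, t2, ta, tb, tc, td, te, tf]
  refine ⟨by module, by module, by module, by module⟩

end Quaternions

section Fields

variable {M : Type*} [TopologicalSpace M] [ChartedSpace V4 M]

variable (M) in
/-- The submodule of smooth 2-forms. -/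
def sm2 : Submodule ℝ (M → Alt 2) where
  carrier := {α | SmoothA α Set.univ}
  add_mem' h h' := h.add h'
  zero_mem' := SmoothA.zero
  smul_mem' r _ h := h.const_smul r

variable (M) in
/-- The smooth 2-forms. -/
def Sm2 : Type _ := sm2 M

instance : AddCommGroup (Sm2 M) := inferInstanceAs (AddCommGroup (sm2 M))

instance : Module ℝ (Sm2 M) := inferInstanceAs (Module ℝ (sm2 M))

variable [IsManifold (𝓡 4) ∞ M] {Sg : Fin 3 → Form M 2}

section Df

variable {f g : M → ℝ} (hf : SmoothFn f Set.univ) (hg : SmoothFn g Set.univ)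

include hf hg in
lemma dfA_lin (r s : ℝ) (x : M) :
    dfA (fun y => r * f y + s * g y) x = r • dfA f x + s • dfA g x := by
  have hx := mem_extChartAt_target (I := 𝓡 4) x
  have h1 := hf.differentiableAt isOpen_univ (x₀ := x) ⟨hx, trivial⟩
  have h2 := hg.differentiableAt isOpen_univ (x₀ := x) ⟨hx, trivial⟩
  rw [← coord_self (dfA f), ← coord_self (dfA g), ← coord_self (dfA fun y => r * f y + s * g y),
    coord_dfA hf hx, coord_dfA hg hx, coord_dfA ((hf.const_mul r).add (hg.const_mul s)) hx,
    fderiv_fun_add (h1.const_mul r) (h2.const_mul s), fderiv_const_mul h1, fderiv_const_mul h2]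
  rfl

end Df

section Hyperkahler

variable (hSg : IsHyperkahlerTriple Sg)

/-- The operator `⋆ d`, from smooth 2-forms to smooth 1-forms. -/
def tauS : Sm2 M →ₗ[ℝ] Sm1 M where
  toFun η := ⟨fun y => star3 (val Sg y) (extA η.1 y), hSg.smooth_star3 η.2.extA⟩
  map_add' η τ := Subtype.ext (funext fun y =>
    (congrArg (star3 (val Sg y)) (congrFun (extA_add η.2 τ.2) y)).trans
      (map_add (star3L (val Sg y)) _ _))
  map_smul' r η := Subtype.ext (funext fun y =>
    (congrArg (star3 (val Sg y)) (congrFun (extA_smul r η.1) y)).trans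
      (map_smul (star3L (val Sg y)) r _))

/-- The Hodge star, on smooth 2-forms. -/
def starS : Sm2 M →ₗ[ℝ] Sm2 M where
  toFun η := ⟨fun y => star2 (val Sg y) (η.1 y), hSg.smooth_star2 η.2⟩
  map_add' _ _ := Subtype.ext (funext fun y => map_add (star2L (val Sg y)) _ _)
  map_smul' r _ := Subtype.ext (funext fun y => map_smul (star2L (val Sg y)) r _)

/-- The 2-form `f Σ^j`. -/
def sdS {f : M → ℝ} (hf : SmoothFn f Set.univ) (j : Fin 3) : Sm2 M :=
  ⟨fun y => f y • val Sg y j, (hSg.smoothA j).smul hf⟩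

/-- The 2-form `k ⋄ Σ^i`. -/
def diaS {k : Ten2 M} (hk : SmoothTen k) (i : Fin 3) : Sm2 M :=
  ⟨fun y => diamond (val Sg y) (k y) i, hSg.smooth_diamond hk i⟩

lemma tauS_sdS {f : M → ℝ} (hf : SmoothFn f Set.univ) (j : Fin 3) :
    tauS hSg (sdS hSg hf j) = JS hSg j (dfS hf) :=
  Subtype.ext (funext fun y => star3_extA_smul hSg hf j y)

lemma starS_sdS {f : M → ℝ} (hf : SmoothFn f Set.univ) (j : Fin 3) :
    starS hSg (sdS hSg hf j) = sdS hSg hf j :=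
  Subtype.ext (funext fun y => (map_smul (star2L (val Sg y)) (f y) _).trans
    (congrArg (f y • ·) ((hSg.perfect y).star2_self j)))

lemma starS_diaS {k : Ten2 M} (hk : SmoothTen k) (h0 : ∀ x, IsSym0 (val Sg x) (k x)) (i : Fin 3) :
    starS hSg (diaS hSg hk i) = -diaS hSg hk i :=
  Subtype.ext (funext fun y => (hSg.perfect y).star2_diamond (h0 y) i)

lemma divS_tauS (η : Sm2 M) (x : M) : divS hSg x (tauS hSg η) = 0 := divA_star3 hSg η.2 x

/-- The codifferential, on smooth 2-forms. -/
def codS : Sm2 M →ₗ[ℝ] Sm1 M := tauS hSg ∘ₗ starS hSg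

section Components

variable {h : M → ℝ} {u w : M → Fin 3 → ℝ} {k : Ten2 M} (hh : SmoothFn h Set.univ)
  (hu : ∀ i, SmoothFn (fun x => u x i) Set.univ) (hw : ∀ i, SmoothFn (fun x => w x i) Set.univ)
  (hk : SmoothTen k)

/-- The 2-forms of the field with components `T₁(h, u, w, k)`. -/
def qForm (i : Fin 3) : Sm2 M :=
  (1 / 2 : ℝ) • sdS hSg hh i + (∑ j, ∑ l, (1 / 2 * eps3 i j l) •
    (sdS hSg (hu l) j + sdS hSg (hw l) j)) + diaS hSg hk i

/-- The 1-forms `d₂` of the field with components `T₁(h, u, w, k)`. -/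
def qD2 (i : Fin 3) : Sm1 M := (1 / 2 : ℝ) • ((∑ j, ∑ l, eps3 i j l •
  JS hSg j (tauS hSg (qForm hSg hh hu hw hk l))) - tauS hSg (qForm hSg hh hu hw hk i))

/-- The second component of `D̃` of the field with components `T₁(h, u, w, k)`. -/
def qA (i : Fin 3) : Sm1 M := qD2 hSg hh hu hw hk i + (1 / 2 : ℝ) • ∑ j, ∑ l, eps3 i j l •
  JS hSg j (dfS (hu l) - dfS (hw l))

/-- The vector component of `D̃` of the field with components `T₁(h, u, w, k)`, divided by `√2`. -/
def qX : Sm1 M := (1 / 2 : ℝ) • ((1 / 2 : ℝ) • ∑ i, JS hSg i (codS hSg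
    (qForm hSg hh hu hw hk i - (1 / 3 : ℝ) • sdS hSg hh i))
  - ∑ i, JS hSg i (qD2 hSg hh hu hw hk i) - ∑ i, JS hSg i (dfS (hu i) - dfS (hw i)))

lemma tauS_qForm (i : Fin 3) : tauS hSg (qForm hSg hh hu hw hk i) =
    (1 / 2 : ℝ) • JS hSg i (dfS hh) + (∑ j, ∑ l, (1 / 2 * eps3 i j l) •
      (JS hSg j (dfS (hu l)) + JS hSg j (dfS (hw l)))) + tauS hSg (diaS hSg hk i) := by
  simp only [qForm, map_add, map_smul, map_sum, tauS_sdS]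

lemma starS_qForm (h0 : ∀ x, IsSym0 (val Sg x) (k x)) (i : Fin 3) :
    starS hSg (qForm hSg hh hu hw hk i) = (1 / 2 : ℝ) • sdS hSg hh i +
      (∑ j, ∑ l, (1 / 2 * eps3 i j l) • (sdS hSg (hu l) j + sdS hSg (hw l) j)) +
        -diaS hSg hk i := by
  simp only [qForm, map_add, map_smul, map_sum, starS_sdS, starS_diaS hSg hk h0]

lemma codS_diaS (h0 : ∀ x, IsSym0 (val Sg x) (k x)) (i : Fin 3) :
    codS hSg (diaS hSg hk i) = -tauS hSg (diaS hSg hk i) := by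
  rw [codS, LinearMap.comp_apply, starS_diaS hSg hk h0]
  exact map_neg (tauS hSg) _

lemma codS_qForm (h0 : ∀ x, IsSym0 (val Sg x) (k x)) (i : Fin 3) :
    codS hSg (qForm hSg hh hu hw hk i - (1 / 3 : ℝ) • sdS hSg hh i) =
      (1 / 6 : ℝ) • JS hSg i (dfS hh) + (∑ j, ∑ l, (1 / 2 * eps3 i j l) •
        (JS hSg j (dfS (hu l)) + JS hSg j (dfS (hw l)))) - tauS hSg (diaS hSg hk i) := by
  have e : codS hSg (qForm hSg hh hu hw hk i - (1 / 3 : ℝ) • sdS hSg hh i) =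
      tauS hSg (starS hSg (qForm hSg hh hu hw hk i)) -
        (1 / 3 : ℝ) • tauS hSg (starS hSg (sdS hSg hh i)) :=
    (map_sub (codS hSg) _ _).trans (congrArg _ (map_smul (codS hSg) _ _))
  have e2 : tauS hSg (-diaS hSg hk i) = -tauS hSg (diaS hSg hk i) := map_neg (tauS hSg) _
  rw [e, starS_qForm hSg hh hu hw hk h0, starS_sdS]
  simp only [map_add, map_smul, map_sum, tauS_sdS, e2]
  module

/-- The twisted components of `D̃` applied to the field with components `T₁(h, u, w, k)`: the first
one depends only on `(h, u)`, the second one only on `(w, k)`. -/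
lemma twist_q (h0 : ∀ x, IsSym0 (val Sg x) (k x)) :
    twistP hSg (qX hSg hh hu hw hk) (qA hSg hh hu hw hk) =
      (-(1 / 2) : ℝ) • (dfS hh - (2 : ℝ) • ∑ i, JS hSg i (dfS (hu i))) ∧
    ∀ i, twistB hSg (qX hSg hh hu hw hk) (qA hSg hh hu hw hk) i =
      dfS (hw i) - tauS hSg (diaS hSg hk i) := by
  have hX : qX hSg hh hu hw hk = (1 / 2 : ℝ) • ((1 / 2 : ℝ) • ∑ i, JS hSg i
      ((1 / 6 : ℝ) • JS hSg i (dfS hh) + (∑ j, ∑ l, (1 / 2 * eps3 i j l) •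
        (JS hSg j (dfS (hu l)) + JS hSg j (dfS (hw l)))) - tauS hSg (diaS hSg hk i))
      - ∑ i, JS hSg i (qD2 hSg hh hu hw hk i) - ∑ i, JS hSg i (dfS (hu i) - dfS (hw i))) := by
    rw [qX]
    simp only [codS_qForm hSg hh hu hw hk h0]
  exact twist_algebra (V := Sm1 M) (JS hSg) (JS_self hSg) (JS_table hSg) (dfS hh)
    (qX hSg hh hu hw hk) (fun i => dfS (hu i)) (fun i => dfS (hw i))
    (fun i => tauS hSg (diaS hSg hk i)) (fun i => tauS hSg (qForm hSg hh hu hw hk i))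
    (qD2 hSg hh hu hw hk) (qA hSg hh hu hw hk)
    (tauS_qForm hSg hh hu hw hk) (fun _ => rfl) (fun _ => rfl) hX

end Components

end Hyperkahler

end Fields

/-! ### The operators of the complex on smooth fields -/

section Fields

variable {M : Type*} [TopologicalSpace M] [ChartedSpace V4 M]
  {Sg : Fin 3 → Form M 2}

lemma d2s_eq (a : Fin 3 → Sm1 M) (i : Fin 3) (x : M) : d2s Sg (fun i => (a i).1) i x =
    liftSL (val Sg x) i fun j => star2 (val Sg x) (dS x (a j)) := rfl

variable [IsManifold (𝓡 4) ∞ M] (hSg : IsHyperkahlerTriple Sg)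

lemma d1_eq (ξ : Sm1 M) (i : Fin 3) (x : M) : d1 Sg ξ.1 i x = -dS x (JS hSg i ξ) := by
  have e : (fun y => hook (val Sg y) (ξ.1 y) i) = -(JS hSg i ξ).1 := funext fun y => hook_eq _ i
  change extA (fun y => hook (val Sg y) (ξ.1 y) i) x = _
  rw [e]
  exact congrFun (extA_neg (JS hSg i ξ).1) x

lemma d2_eq (s : Fin 3 → Sm2 M) (i : Fin 3) (x : M) : d2 Sg (fun i => (s i).1) i x =
    ((1 / 2 : ℝ) • ((∑ j, ∑ l, eps3 i j l • JS hSg j (tauS hSg (s l))) -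
      tauS hSg (s i))).1 x := by
  have h := J1_eq (val Sg x) (fun j => (tauS hSg (s j)).1 x) i
  have e : (∑ j, ∑ l, eps3 i j l • JS hSg j (tauS hSg (s l))).1 x =
      J1 (val Sg x) (fun j => (tauS hSg (s j)).1 x) i := by
    rw [h]
    simp only [Fin.sum_univ_three]
    rfl
  change (1 / 2 : ℝ) • (J1 (val Sg x) (fun j => (tauS hSg (s j)).1 x) i - (tauS hSg (s i)).1 x) = _
  rw [← e]
  rfl

lemma d3_eq (a : Fin 3 → Sm1 M) (i : Fin 3) (x : M) : d3 Sg (fun i => (a i).1) x i =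
    ∑ j, ∑ k, eps3 i j k * divS hSg x (JS hSg j (a k)) := by
  have hv := (hSg.perfect x).vol_ne
  have e : ∀ j k, wedge22 (val Sg x j) (extA (a k).1 x) =
      vol (val Sg x) * divS hSg x (JS hSg j (a k)) := fun j k => by
    rw [wedge22_comm]
    exact wedge22_extA hSg (a k).2 j x
  change (∑ j, ∑ k, eps3 i j k * wedge22 (val Sg x j) (extA (a k).1 x)) / vol (val Sg x) = _
  rw [div_eq_iff hv]
  simp only [e, Fin.sum_univ_three]
  ring

lemma PhiStarF_eq (r : ℝ) (ξ : Sm1 M) : PhiStarF Sg (r • ξ).1 =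
    fun i => ((r / 2) • JS hSg i ξ).1 := by
  refine funext fun i => funext fun x => ?_
  refine (PhiStar_eq (val Sg x) ((r • ξ).1 x) i).trans ?_
  refine (congrArg ((1 / 2 : ℝ) • ·) (map_smul (Jl (val Sg x) i) r (ξ.1 x))).trans ?_
  rw [smul_smul, one_div_mul_eq_div]
  rfl

lemma J1F_eq (a : Fin 3 → Sm1 M) : J1F Sg (fun i => (a i).1) =
    fun i => (∑ j, ∑ k, eps3 i j k • JS hSg j (a k)).1 := by
  refine funext fun i => funext fun x => ?_
  refine (J1_eq (val Sg x) (fun j => (a j).1 x) i).trans ?_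
  simp only [Fin.sum_univ_three]
  rfl

lemma PhiF_eq (a : Fin 3 → Sm1 M) : PhiF Sg (fun i => (a i).1) = (∑ i, JS hSg i (a i)).1 := by
  refine funext fun x => ?_
  refine (Phi_eq (val Sg x) (fun j => (a j).1 x)).trans ?_
  simp only [Fin.sum_univ_three]
  rfl

lemma hodgeLap_eq (η : Sm2 M) (x : M) : hodgeLap Sg η.1 x =
    dS x (codS hSg η) + star2 (val Sg x) (dS x (codS hSg (starS hSg η))) := rfl

lemma inv_sqrt_two : 1 / √(2 : ℝ) = √2 / 2 := by
  rw [div_eq_div_iff (by positivity) (by positivity), one_mul, sqrt_two_sq]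

lemma Dts_fst (ξ : Sm1 M) (a : Fin 3 → Sm1 M) (i : Fin 3) (x : M) :
    (Dts Sg ((√2 • ξ).1, fun i => (a i).1)).1 i x = dtsForm hSg ξ a x i := by
  have h1 := d1_eq hSg (√2 • ξ) i x
  have h2 : d2s Sg (PhiStarF Sg (√2 • ξ).1) i x = liftSL (val Sg x) i fun j =>
      star2 (val Sg x) (dS x ((√2 / 2) • JS hSg j ξ)) := by
    rw [PhiStarF_eq hSg]
    exact d2s_eq (fun i => (√2 / 2) • JS hSg i ξ) i x
  have h3 := d2s_eq (Sg := Sg) a i x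
  have e1 : (fun j => star2 (val Sg x) (dS x ((√2 / 2) • JS hSg j ξ))) =
      √2 • fun j => star2 (val Sg x) (dS x ((1 / 2 : ℝ) • JS hSg j ξ)) := by
    funext j
    have h : (√2 / 2) • JS hSg j ξ = √2 • ((1 / 2 : ℝ) • JS hSg j ξ) := by
      rw [smul_smul, mul_one_div]
    rw [h, map_smul]
    exact map_smul (star2L (val Sg x)) (√2) (dS x ((1 / 2 : ℝ) • JS hSg j ξ))
  have e2 : (fun j => star2 (val Sg x) (dS x (a j - (1 / 2 : ℝ) • JS hSg j ξ))) =
      (fun j => star2 (val Sg x) (dS x (a j))) -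
        fun j => star2 (val Sg x) (dS x ((1 / 2 : ℝ) • JS hSg j ξ)) := by
    funext j
    rw [dS_sub]
    exact map_sub (star2L (val Sg x)) _ _
  rw [e1, map_smul] at h2
  rw [map_smul, map_smul] at h1
  rw [dtsForm, e2]
  have e3 := map_sub (liftSL (val Sg x) i) (fun j => star2 (val Sg x) (dS x (a j)))
    (fun j => star2 (val Sg x) (dS x ((1 / 2 : ℝ) • JS hSg j ξ)))
  rw [e3]
  have key : ∀ {A B C A' B' C' : Alt 2}, A = A' → B = B' → C = C' →
      (1 / √2 : ℝ) • (A - B) + C = (1 / √2 : ℝ) • (A' - B') + C' := by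
    rintro A B C _ _ _ rfl rfl rfl
    rfl
  refine (key h1 h2 h3).trans ?_
  match_scalars <;> simp

lemma Dts_snd (ξ : Sm1 M) (a : Fin 3 → Sm1 M) (i : Fin 3) (x : M) :
    (Dts Sg ((√2 • ξ).1, fun i => (a i).1)).2 x i = (1 / √2) *
      (divS hSg x (twistB hSg ξ a i) - divS hSg x (JS hSg i (twistP hSg ξ a))) := by
  have h1 : d3 Sg (PhiStarF Sg (√2 • ξ).1) x i = √2 * divS hSg x (JS hSg i ξ) := by
    rw [PhiStarF_eq hSg, d3_eq hSg]
    have t := JS_table hSg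
    have ta := fun α => (t α).1
    have tb := fun α => (t α).2.1
    have tc := fun α => (t α).2.2.1
    have td := fun α => (t α).2.2.2.1
    have te := fun α => (t α).2.2.2.2.1
    have tf := fun α => (t α).2.2.2.2.2
    fin_cases i <;>
      simp [Fin.sum_univ_three, eps3_self_left, eps3_self_right, eps3_self_mid,
        ta, tb, tc, td, te, tf] <;> ring
  have h2 : d3 Sg (J1F Sg fun i => (a i).1) x i = ∑ j, ∑ k, eps3 i j k *
      divS hSg x (JS hSg j (∑ m, ∑ n, eps3 k m n • JS hSg m (a n))) := by
    rw [J1F_eq hSg]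
    exact d3_eq hSg (fun i => ∑ j, ∑ k, eps3 i j k • JS hSg j (a k)) i x
  change -d3 Sg (PhiStarF Sg (√2 • ξ).1) x i +
    (1 / √2) * d3 Sg (J1F Sg fun i => (a i).1) x i = _
  rw [h1, h2, ← divS_twist, inv_sqrt_two]
  ring

end Fields

/-! ### The square and the splitting of the twisted operator -/

section Fields

variable {M : Type*} [TopologicalSpace M] [ChartedSpace V4 M]
  {Sg : Fin 3 → Form M 2}

lemma quadField_snd (h : M → ℝ) (u w : M → Fin 3 → ℝ) (k : Ten2 M) (x : M) :
    (quadField Sg h u w k).2 x = (1 / √2 : ℝ) • (u x - w x) := rfl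

variable [IsManifold (𝓡 4) ∞ M] (hSg : IsHyperkahlerTriple Sg)

section Components

variable {h : M → ℝ} {u w : M → Fin 3 → ℝ} {k : Ten2 M} (hh : SmoothFn h Set.univ)
  (hu : ∀ i, SmoothFn (fun x => u x i) Set.univ) (hw : ∀ i, SmoothFn (fun x => w x i) Set.univ)
  (hk : SmoothTen k)

lemma quadField_fst : (quadField Sg h u w k).1 = fun i => (qForm hSg hh hu hw hk i).1 := by
  refine funext fun i => funext fun x => ?_
  have key : ∀ (S : Trip) (a : ℝ) (b c : Fin 3 → ℝ) (l : Bil),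
      param S a ((1 / 4 : ℝ) • (b + c)) l i =
        (1 / 2 : ℝ) • (a • S i) + (∑ j, ∑ l, (1 / 2 * eps3 i j l) • (b l • S j + c l • S j)) +
          diamond S l i := by
    intro S a b c l
    simp only [param, Fin.sum_univ_three, Pi.smul_apply, Pi.add_apply, smul_eq_mul]
    module
  refine (key (val Sg x) (h x) (u x) (w x) (k x)).trans ?_
  simp only [qForm, Fin.sum_univ_three]
  rfl

include hu hw in
lemma extE_quadField : extE (quadField Sg h u w k).2 =
    fun i => ((1 / √2 : ℝ) • (dfS (hu i) - dfS (hw i))).1 := by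
  refine funext fun i => funext fun x => ?_
  have e := dfA_lin (hu i) (hw i) (1 / √2) (-(1 / √2)) x
  have e2 : (fun y => 1 / √2 * u y i + -(1 / √2) * w y i) =
      fun y => (quadField Sg h u w k).2 y i := by
    funext y
    rw [quadField_snd]
    simp only [Pi.smul_apply, Pi.sub_apply, smul_eq_mul]
    ring
  rw [e2] at e
  refine e.trans ?_
  change _ = (1 / √2 : ℝ) • (dfA (fun y => u y i) x - dfA (fun y => w y i) x)
  module

lemma sum_contr2_qForm (h0 : ∀ x, IsSym0 (val Sg x) (k x)) (x : M) :
    ∑ j, contr2 (val Sg x) (val Sg x j) ((qForm hSg hh hu hw hk j).1 x) = 6 * h x := by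
  have e := fun j => congrFun (congrFun (quadField_fst hSg hh hu hw hk) j) x
  have e2 : ∀ j, contr2 (val Sg x) (val Sg x j) ((qForm hSg hh hu hw hk j).1 x) =
      2 * h x + 8 * ∑ l, eps3 j j l * ((1 / 4 : ℝ) • (u x + w x)) l := fun j => by
    refine (congrArg (contr2 (val Sg x) (val Sg x j)) (e j).symm).trans ?_
    refine ((hSg.perfect x).contr2_param (h x) _ (h0 x) j j).trans ?_
    rw [if_pos rfl]
    rfl
  simp only [e2, eps3_self_left, zero_mul, Finset.sum_const_zero, Fin.sum_univ_three]
  ring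

lemma d1s_qForm (h0 : ∀ x, IsSym0 (val Sg x) (k x)) :
    d1s Sg (fun i => (qForm hSg hh hu hw hk i).1) = ((1 / 2 : ℝ) • ∑ i, JS hSg i (codS hSg
      (qForm hSg hh hu hw hk i - (1 / 3 : ℝ) • sdS hSg hh i))).1 := by
  refine funext fun x => ?_
  have e : ∀ i, (fun y => (qForm hSg hh hu hw hk i).1 y - ((1 / 18) * ∑ j, contr2 (val Sg y)
      (val Sg y j) ((qForm hSg hh hu hw hk j).1 y)) • val Sg y i) =
      (qForm hSg hh hu hw hk i - (1 / 3 : ℝ) • sdS hSg hh i).1 := fun i => funext fun y => by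
    rw [sum_contr2_qForm hSg hh hu hw hk h0]
    change _ = (qForm hSg hh hu hw hk i).1 y - (1 / 3 : ℝ) • (h y • val Sg y i)
    module
  refine congrArg ((1 / 2 : ℝ) • ·) (Eq.trans (congrArg (Phi (val Sg x))
    (funext fun i => congrArg (fun η : M → Alt 2 => codiff Sg η x) (e i))) ?_)
  refine (Phi_eq _ _).trans ?_
  simp only [Fin.sum_univ_three]
  rfl

lemma Dt_quadField (h0 : ∀ x, IsSym0 (val Sg x) (k x)) : Dt Sg (quadField Sg h u w k) =
    ((√2 • qX hSg hh hu hw hk).1, fun i => (qA hSg hh hu hw hk i).1) := by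
  have e1 : d2 Sg (fun i => (qForm hSg hh hu hw hk i).1) =
      fun i => (qD2 hSg hh hu hw hk i).1 :=
    funext fun i => funext fun x => d2_eq hSg (qForm hSg hh hu hw hk) i x
  have e2 : d3s (quadField Sg h u w k).2 = _ := extE_quadField hu hw
  refine Prod.ext ?_ ?_
  · change dt1s Sg (quadField Sg h u w k).1 + -PhiF Sg (d3s (quadField Sg h u w k).2) = _
    rw [quadField_fst hSg hh hu hw hk]
    change (1 / √2 : ℝ) • (d1s Sg (fun i => (qForm hSg hh hu hw hk i).1) -
      PhiF Sg (d2 Sg fun i => (qForm hSg hh hu hw hk i).1)) + _ = _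
    rw [d1s_qForm hSg hh hu hw hk h0, e1, PhiF_eq hSg, e2,
      PhiF_eq hSg]
    have e3 : (∑ i, JS hSg i ((1 / √2 : ℝ) • (dfS (hu i) - dfS (hw i)))) =
        (1 / √2 : ℝ) • ∑ i, JS hSg i (dfS (hu i) - dfS (hw i)) := by
      rw [Finset.smul_sum]
      exact Finset.sum_congr rfl fun i _ => map_smul _ _ _
    rw [e3, qX, smul_smul, mul_one_div, ← inv_sqrt_two, smul_sub _ _ (∑ i, JS hSg i (_ - _))]
    rfl
  · change d2 Sg (quadField Sg h u w k).1 + (1 / √2 : ℝ) • J1F Sg (d3s (quadField Sg h u w k).2) = _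
    rw [quadField_fst hSg hh hu hw hk, e1, e2, J1F_eq hSg]
    refine funext fun i => ?_
    have e3 : (∑ j, ∑ l, eps3 i j l • JS hSg j ((1 / √2 : ℝ) • (dfS (hu l) - dfS (hw l)))) =
        (1 / √2 : ℝ) • ∑ j, ∑ l, eps3 i j l • JS hSg j (dfS (hu l) - dfS (hw l)) := by
      rw [Finset.smul_sum]
      refine Finset.sum_congr rfl fun j _ => ?_
      rw [Finset.smul_sum]
      refine Finset.sum_congr rfl fun l _ => ?_
      rw [map_smul, smul_comm]
    have e4 : (1 / √2 : ℝ) * (1 / √2) = 1 / 2 := by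
      rw [inv_sqrt_two]
      linarith [sqrt_two_sq]
    have e5 : (1 / √2 : ℝ) • (∑ j, ∑ l, eps3 i j l •
        JS hSg j ((1 / √2 : ℝ) • (dfS (hu l) - dfS (hw l)))) =
        (1 / 2 : ℝ) • ∑ j, ∑ l, eps3 i j l • JS hSg j (dfS (hu l) - dfS (hw l)) := by
      rw [e3, smul_smul, e4]
    change _ = (qD2 hSg hh hu hw hk i + (1 / 2 : ℝ) • ∑ j, ∑ l, eps3 i j l •
      JS hSg j (dfS (hu l) - dfS (hw l))).1
    rw [← e5]
    rfl

end Components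

lemma T2F_eq (ξ : Sm1 M) (a : Fin 3 → Sm1 M) : T2F Sg ((√2 • ξ).1, fun i => (a i).1) =
    ((√2 • twistP hSg ξ a).1, fun i => (twistB hSg ξ a i).1) := by
  refine Prod.ext (funext fun x => ?_) (funext fun i => funext fun x => ?_)
  · change √2 • ξ.1 x + √2 • Phi (val Sg x) (fun i => (a i).1 x) =
      √2 • (ξ + ∑ j, JS hSg j (a j)).1 x
    rw [← smul_add, Phi_eq]
    simp only [Fin.sum_univ_three]
    rfl
  · change (a i).1 x - √2 • PhiStar (val Sg x) (√2 • ξ.1 x) i = (a i).1 x - Jl (val Sg x) i (ξ.1 x)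
    rw [PhiStar_eq, map_smul, smul_smul, smul_smul]
    have e : √2 * (1 / 2) * √2 = 1 := by linarith [sqrt_two_sq]
    rw [e, one_smul]

end Fields

section Fields

variable {M : Type*} [TopologicalSpace M] [ChartedSpace V4 M]
  {Sg : Fin 3 → Form M 2} {h : M → ℝ} {u w : M → Fin 3 → ℝ} {k : Ten2 M}

lemma SmoothTen.neg (hk : SmoothTen k) : SmoothTen (-k) := fun x₀ => (hk x₀).neg

lemma IsSym0.neg {S : Trip} {k : Bil} (hk : IsSym0 S k) : IsSym0 S (-k) :=
  ⟨fun v w => congrArg Neg.neg (hk.1 v w), by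
    have := hk.2
    simp only [_root_.neg_apply, mul_neg, Finset.sum_neg_distrib, this, neg_zero]⟩

lemma diamond_neg (S : Trip) (k : Bil) (i : Fin 3) : diamond S (-k) i = -diamond S k i :=
  map_neg (diamondL S i) k

variable [IsManifold (𝓡 4) ∞ M] (hSg : IsHyperkahlerTriple Sg) (hh : SmoothFn h Set.univ)
  (hu : ∀ i, SmoothFn (fun x => u x i) Set.univ) (hw : ∀ i, SmoothFn (fun x => w x i) Set.univ)
  (hk : SmoothTen k) (h0 : ∀ x, IsSym0 (val Sg x) (k x))

include hSg

/-- The anti-self-dual part of the Hodge Laplacian only sees `k`: a self-dual form `f Σ^j` has a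
self-dual Hodge Laplacian, as `δ(f Σ^j) = δ⋆(f Σ^j)`. -/
lemma asd_hodgeLap_qForm (h0 : ∀ x, IsSym0 (val Sg x) (k x)) (i : Fin 3) (x : M) :
    asd (val Sg x) (hodgeLap Sg (qForm hSg hh hu hw hk i).1 x) =
      (-2 : ℝ) • asd (val Sg x) (dS x (tauS hSg (diaS hSg hk i))) := by
  have hP := hSg.perfect x
  have e1 : codS hSg (qForm hSg hh hu hw hk i) = (1 / 2 : ℝ) • JS hSg i (dfS hh) +
      (∑ j, ∑ l, (1 / 2 * eps3 i j l) • (JS hSg j (dfS (hu l)) + JS hSg j (dfS (hw l)))) -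
        tauS hSg (diaS hSg hk i) := by
    have e2 : tauS hSg (-diaS hSg hk i) = -tauS hSg (diaS hSg hk i) := map_neg (tauS hSg) _
    rw [codS, LinearMap.comp_apply, starS_qForm hSg hh hu hw hk h0]
    simp only [map_add, map_smul, map_sum, tauS_sdS, e2]
    abel
  have e3 : starS hSg (starS hSg (qForm hSg hh hu hw hk i)) = qForm hSg hh hu hw hk i :=
    Subtype.ext (funext fun y => (hSg.perfect y).star2_star2 _)
  rw [hodgeLap_eq hSg, map_add, hP.asd_star2]
  have e4 : codS hSg (starS hSg (qForm hSg hh hu hw hk i)) =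
      codS hSg (qForm hSg hh hu hw hk i) + (2 : ℝ) • tauS hSg (diaS hSg hk i) := by
    rw [e1, codS, LinearMap.comp_apply, e3, tauS_qForm]
    module
  rw [e4, map_add, map_add, map_smul, map_smul]
  module

/-- The self-dual part of the Hodge Laplacian is the Laplace–Beltrami operator on the coefficients;
no curvature appears, as the `Σ^j` are closed. -/
lemma contr2_hodgeLap_qForm (h0 : ∀ x, IsSym0 (val Sg x) (k x)) (i m : Fin 3) (x : M) :
    contr2 (val Sg x) (val Sg x m) (hodgeLap Sg (qForm hSg hh hu hw hk i).1 x) =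
      -(if m = i then 2 * beltrami Sg h x else 0) + 2 * ∑ l, eps3 m i l *
        (beltrami Sg (fun y => u y l) x + beltrami Sg (fun y => w y l) x) := by
  have hP := hSg.perfect x
  have e3 : starS hSg (starS hSg (qForm hSg hh hu hw hk i)) = qForm hSg hh hu hw hk i :=
    Subtype.ext (funext fun y => (hSg.perfect y).star2_star2 _)
  have e2 : tauS hSg (-diaS hSg hk i) = -tauS hSg (diaS hSg hk i) := map_neg (tauS hSg) _
  have e5 : contr2L (val Sg x) (val Sg x m) (hodgeLap Sg (qForm hSg hh hu hw hk i).1 x) =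
      2 * divS hSg x (JS hSg m (codS hSg (qForm hSg hh hu hw hk i))) +
        2 * divS hSg x (JS hSg m (codS hSg (starS hSg (qForm hSg hh hu hw hk i)))) := by
    rw [hodgeLap_eq hSg, map_add, contr2_dS hSg, contr2L_apply, hP.contr2_self_star2,
      ← contr2L_apply, contr2_dS hSg]
  refine e5.trans ?_
  rw [codS, LinearMap.comp_apply, LinearMap.comp_apply, e3, starS_qForm hSg hh hu hw hk h0,
    tauS_qForm]
  simp only [map_add, map_smul, map_sum, tauS_sdS, e2, JS_neg, divS_neg]
  have s : ∀ j {f : M → ℝ} (hf : SmoothFn f Set.univ), divS hSg x (JS hSg j (dfS hf)) = 0 :=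
    fun j f hf => divS_JS_dfS hSg hf j x
  have t0 := fun α => JS_self hSg 0 α
  have t1 := fun α => JS_self hSg 1 α
  have t2 := fun α => JS_self hSg 2 α
  have t := JS_table hSg
  have ta := fun α => (t α).1
  have tb := fun α => (t α).2.1
  have tc := fun α => (t α).2.2.1
  have td := fun α => (t α).2.2.2.1
  have te := fun α => (t α).2.2.2.2.1
  have tf := fun α => (t α).2.2.2.2.2
  fin_cases m <;> fin_cases i <;>
    simp [Fin.sum_univ_three, eps3_self_left, eps3_self_right, eps3_self_mid, s, divS_dfS,
      t0, t1, t2, ta, tb, tc, td, te, tf] <;> ring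

/-- `D̃^* D̃` in components. -/
theorem Dts_Dt (hh : SmoothFn h Set.univ)
    (hu : ∀ i, SmoothFn (fun x => u x i) Set.univ) (hw : ∀ i, SmoothFn (fun x => w x i) Set.univ)
    (hk : SmoothTen k) (h0 : ∀ x, IsSym0 (val Sg x) (k x)) :
    Dts Sg (Dt Sg (quadField Sg h u w k)) = Lap Sg (quadField Sg h u (-w) (-k)) := by
  have hw' : ∀ i, SmoothFn (fun x => (-w) x i) Set.univ := fun i x₀ => (hw i x₀).neg
  have h0' : ∀ x, IsSym0 (val Sg x) ((-k) x) := fun x => (h0 x).neg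
  obtain ⟨hp, hb⟩ := twist_q hSg hh hu hw hk h0
  have hdia : ∀ i, diaS hSg hk.neg i = -diaS hSg hk i := fun i =>
    Subtype.ext (funext fun y => diamond_neg _ _ _)
  have hbw : ∀ l x, beltrami Sg (fun y => (-w) y l) x = -beltrami Sg (fun y => w y l) x := by
    intro l x
    rw [beltrami_eq (hw' l), beltrami_eq (hw l), ← divA_neg hSg (hw l).dfA]
    congr 1
    funext y
    have e : (fun z => -1 * w z l + 0 * w z l) = fun z => (-w) z l := by
      funext z
      simp
    have h1 := dfA_lin (hw l) (hw l) (-1) 0 y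
    rw [e] at h1
    refine h1.trans ?_
    module
  have hdf : ∀ j {f : M → ℝ} (hf : SmoothFn f Set.univ) x, divS hSg x (JS hSg j (dfS hf)) = 0 :=
    fun j f hf x => divS_JS_dfS hSg hf j x
  have hP : ∀ x, divS hSg x (twistP hSg (qX hSg hh hu hw hk) (qA hSg hh hu hw hk)) =
      -(1 / 2) * beltrami Sg h x := fun x => by
    rw [hp]
    simp [hdf, divS_dfS]
  have hJP : ∀ l x, divS hSg x
      (JS hSg l (twistP hSg (qX hSg hh hu hw hk) (qA hSg hh hu hw hk))) =
      -beltrami Sg (fun y => u y l) x := fun l x => by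
    have t := JS_table hSg
    rw [hp]
    fin_cases l <;>
      simp [Fin.sum_univ_three, hdf, divS_dfS, JS_self, fun α => (t α).1, fun α => (t α).2.1,
        fun α => (t α).2.2.1, fun α => (t α).2.2.2.1, fun α => (t α).2.2.2.2.1,
        fun α => (t α).2.2.2.2.2]
  -- The component `dw_l - ⋆d(k ⋄ Σ^l)` has divergence `Δw_l`, as a codifferential is divergence-free.
  have hB : ∀ l x, divS hSg x (twistB hSg (qX hSg hh hu hw hk) (qA hSg hh hu hw hk) l) =
      beltrami Sg (fun y => w y l) x := fun l x => by
    rw [hb, divS_sub, divS_tauS, divS_dfS, sub_zero]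
  rw [Dt_quadField hSg hh hu hw hk h0]
  refine Prod.ext (funext fun i => funext fun x => ?_) (funext fun x => funext fun i => ?_)
  · refine (Dts_fst hSg _ _ i x).trans ?_
    have e : (Lap Sg (quadField Sg h u (-w) (-k))).1 i x =
        -hodgeLap Sg (qForm hSg hh hu hw' hk.neg i).1 x := by
      rw [Lap, quadField_fst hSg hh hu hw' hk.neg]
    refine Eq.trans ?_ e.symm
    -- A 2-form is determined by its pairings with the triple and its anti-self-dual part; the first
    -- are divergences of the twisted components, the second only involves `k`, as `d(dw_i) = 0`.
    refine (hSg.perfect x).alt2_ext_asd (fun m => ?_) ?_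
    · have e2 : contr2 (val Sg x) (val Sg x m) (-hodgeLap Sg (qForm hSg hh hu hw' hk.neg i).1 x) =
          -contr2 (val Sg x) (val Sg x m) (hodgeLap Sg (qForm hSg hh hu hw' hk.neg i).1 x) :=
        map_neg (contr2L (val Sg x) (val Sg x m)) _
      refine Eq.trans ?_ e2.symm
      rw [contr2_hodgeLap_qForm hSg hh hu hw' hk.neg h0' i m x, contr2_dtsForm]
      simp only [hP, hJP, hB, hbw, Fin.sum_univ_three]
      split_ifs <;> ring
    · have e2 : asd (val Sg x) (-hodgeLap Sg (qForm hSg hh hu hw' hk.neg i).1 x) =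
          -asd (val Sg x) (hodgeLap Sg (qForm hSg hh hu hw' hk.neg i).1 x) :=
        map_neg (asd (val Sg x)) _
      refine Eq.trans ?_ e2.symm
      have e3 : tauS hSg (-diaS hSg hk i) = -tauS hSg (diaS hSg hk i) := map_neg (tauS hSg) _
      have e4 := map_neg (asd (val Sg x)) (dS x (tauS hSg (diaS hSg hk i)))
      rw [asd_hodgeLap_qForm hSg hh hu hw' hk.neg h0', asd_dtsForm, hb, hdia, e3, dS_sub,
        dS_dfS, zero_sub, dS_neg, e4]
      module
  · refine (Dts_snd hSg _ _ i x).trans ?_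
    rw [hB, hJP]
    have h1 : (Lap Sg (quadField Sg h u (-w) (-k))).2 x i =
        beltrami Sg (fun y => 1 / √2 * u y i + 1 / √2 * w y i) x := by
      have e : (fun y => (quadField Sg h u (-w) (-k)).2 y i) =
          fun y => 1 / √2 * u y i + 1 / √2 * w y i := by
        funext y
        rw [quadField_snd]
        simp only [Pi.smul_apply, Pi.sub_apply, Pi.neg_apply, smul_eq_mul]
        ring
      rw [← e]
      rfl
    have hs := ((hu i).const_mul (1 / √2)).add ((hw i).const_mul (1 / √2))
    have h2 : dfS hs = (1 / √2 : ℝ) • dfS (hu i) + (1 / √2 : ℝ) • dfS (hw i) :=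
      Subtype.ext (funext fun y => dfA_lin (hu i) (hw i) _ _ y)
    rw [h1, ← divS_dfS hSg hs, h2, map_add, map_smul, map_smul, divS_dfS, divS_dfS]
    simp only [smul_eq_mul]
    ring

/-- The splitting of `T₂ D̃ T₁`. -/
theorem T2F_Dt (hh : SmoothFn h Set.univ)
    (hu : ∀ i, SmoothFn (fun x => u x i) Set.univ) (hw : ∀ i, SmoothFn (fun x => w x i) Set.univ)
    (hk : SmoothTen k) (h0 : ∀ x, IsSym0 (val Sg x) (k x)) :
    T2F Sg (Dt Sg (quadField Sg h u w k)) = (D4 Sg h u, D12 Sg w k) := by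
  obtain ⟨hp, hb⟩ := twist_q hSg hh hu hw hk h0
  rw [Dt_quadField hSg hh hu hw hk h0]
  refine (T2F_eq hSg _ _).trans ?_
  rw [hp]
  refine Prod.ext ?_ (funext fun i => ?_)
  · have e : PhiF Sg (extE u) = (∑ i, JS hSg i (dfS (hu i))).1 :=
      PhiF_eq hSg fun i => dfS (hu i)
    rw [D4, e, smul_smul]
    have e2 : √2 * -(1 / 2) = -(1 / √2) := by rw [inv_sqrt_two]; ring
    rw [e2]
    rfl
  · change (twistB hSg _ _ i).1 = extE w i + codiff Sg (diaS hSg hk i).1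
    rw [hb, sub_eq_add_neg, ← codS_diaS hSg hk h0]
    rfl

end Fields

/-! ### Integration by parts -/

section Stokes

open MeasureTheory

/-- The divergence theorem for compactly supported vector fields on `V4`. -/
lemma integral_divergence {V : V4 → Fin 4 → ℝ} (hV : ∀ ρ, ContDiff ℝ ∞ fun z => V z ρ)
    (hc : ∀ ρ, HasCompactSupport fun z => V z ρ) :
    Integrable (fun z => ∑ ρ, fderiv ℝ (fun y => V y ρ) z (bv ρ)) ∧
      ∫ z, ∑ ρ, fderiv ℝ (fun y => V y ρ) z (bv ρ) = 0 := by
  have hi : ∀ ρ, Integrable fun z => fderiv ℝ (fun y => V y ρ) z (bv ρ) := fun ρ =>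
    (((hV ρ).continuous_fderiv
      (by simp)).clm_apply continuous_const).integrable_of_hasCompactSupport
      ((hc ρ).fderiv_apply ℝ (bv ρ))
  refine ⟨integrable_finsetSum _ fun ρ _ => hi ρ, ?_⟩
  rw [integral_finsetSum _ fun ρ _ => hi ρ]
  refine Finset.sum_eq_zero fun ρ _ => ?_
  have h := integral_mul_fderiv_eq_neg_fderiv_mul_of_integrable (μ := volume) (v := bv ρ)
    (f := fun _ : V4 => (1 : ℝ)) (g := fun y => V y ρ) (by simp) (by simpa using hi ρ)
    (by simpa using ((hV ρ).continuous.integrable_of_hasCompactSupport (hc ρ)))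
    (fun _ _ => differentiableAt_const _)
    (fun x _ => (hV ρ).differentiable (by simp) x)
  simpa using h

variable {M : Type*} [TopologicalSpace M] [ChartedSpace V4 M]

/-- The function `f` is integrable over the chart domain at `x₀`, with integral zero. -/
def Null (Sg : Fin 3 → Form M 2) (x₀ : M) (f : M → ℝ) : Prop :=
  IntegrableOn (fun z => f ((extChartAt (𝓡 4) x₀).symm z) * |vol (pullT Sg x₀ z)|)
    (extChartAt (𝓡 4) x₀).target ∧ chartInt Sg x₀ f = 0

section Null

variable {Sg : Fin 3 → Form M 2} {x₀ : M} {f g : M → ℝ}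

lemma Null.const_mul (r : ℝ) (hf : Null Sg x₀ f) : Null Sg x₀ fun x => r * f x := by
  have e : (fun z => r * f ((extChartAt (𝓡 4) x₀).symm z) * |vol (pullT Sg x₀ z)|) =
      fun z => r * (f ((extChartAt (𝓡 4) x₀).symm z) * |vol (pullT Sg x₀ z)|) :=
    funext fun z => mul_assoc _ _ _
  refine ⟨?_, ?_⟩
  · rw [e]
    exact hf.1.const_mul r
  · have h := hf.2
    change ∫ z in (extChartAt (𝓡 4) x₀).target,
      r * f ((extChartAt (𝓡 4) x₀).symm z) * |vol (pullT Sg x₀ z)| = 0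
    rw [e, integral_const_mul]
    exact mul_eq_zero_of_right r h

lemma Null.add (hf : Null Sg x₀ f) (hg : Null Sg x₀ g) : Null Sg x₀ fun x => f x + g x := by
  have e : (fun z => (f ((extChartAt (𝓡 4) x₀).symm z) + g ((extChartAt (𝓡 4) x₀).symm z)) *
      |vol (pullT Sg x₀ z)|) = fun z => f ((extChartAt (𝓡 4) x₀).symm z) * |vol (pullT Sg x₀ z)| +
        g ((extChartAt (𝓡 4) x₀).symm z) * |vol (pullT Sg x₀ z)| := funext fun z => add_mul _ _ _
  refine ⟨?_, ?_⟩
  · rw [e]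
    exact hf.1.add hg.1
  · have h1 := hf.2
    have h2 := hg.2
    change ∫ z in (extChartAt (𝓡 4) x₀).target, (f ((extChartAt (𝓡 4) x₀).symm z) +
      g ((extChartAt (𝓡 4) x₀).symm z)) * |vol (pullT Sg x₀ z)| = 0
    rw [e, integral_add hf.1 hg.1]
    exact (congrArg₂ (· + ·) h1 h2).trans (add_zero 0)

lemma Null.zero : Null Sg x₀ fun _ => 0 := by
  refine ⟨?_, ?_⟩
  · simp [IntegrableOn]
  · simp [chartInt]

lemma Null.sum {ι : Type*} {s : Finset ι} {f : ι → M → ℝ} (h : ∀ i, Null Sg x₀ (f i)) :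
    Null Sg x₀ fun x => ∑ i ∈ s, f i x := by
  classical
  induction s using Finset.induction_on with
  | empty => simpa using Null.zero
  | insert a s ha ih =>
    simp only [Finset.sum_insert ha]
    exact (h a).add ih

/-- Functions which differ by a null function have the same integral, integrable or not. -/
lemma chartInt_eq_of_null (h : Null Sg x₀ fun x => f x - g x) :
    chartInt Sg x₀ f = chartInt Sg x₀ g := by
  set F := fun z => f ((extChartAt (𝓡 4) x₀).symm z) * |vol (pullT Sg x₀ z)| with hF
  set G := fun z => g ((extChartAt (𝓡 4) x₀).symm z) * |vol (pullT Sg x₀ z)| with hG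
  have e : (fun z => (f ((extChartAt (𝓡 4) x₀).symm z) - g ((extChartAt (𝓡 4) x₀).symm z)) *
      |vol (pullT Sg x₀ z)|) = F - G := funext fun z => sub_mul _ _ _
  obtain ⟨h1, h2⟩ := h
  have h1 : IntegrableOn (F - G) (extChartAt (𝓡 4) x₀).target := e ▸ h1
  have h2 : ∫ z in (extChartAt (𝓡 4) x₀).target, (F - G) z = 0 := e ▸ h2
  change ∫ z in (extChartAt (𝓡 4) x₀).target, F z = ∫ z in (extChartAt (𝓡 4) x₀).target, G z
  -- `F` and `G` are integrable or not together; if not, both integrals are zero by convention.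
  by_cases hi : IntegrableOn G (extChartAt (𝓡 4) x₀).target
  · have hF' : IntegrableOn F (extChartAt (𝓡 4) x₀).target := by
      have := h1.add hi
      simpa using this
    rw [← sub_eq_zero, ← integral_sub hF' hi]
    exact h2
  · have hF' : ¬IntegrableOn F (extChartAt (𝓡 4) x₀).target := fun h3 => hi (by
      have := h3.sub h1
      simpa using this)
    rw [integral_undef hi, integral_undef hF']

end Null

variable [IsManifold (𝓡 4) ∞ M] {Sg : Fin 3 → Form M 2} (hSg : IsHyperkahlerTriple Sg)
include hSg

/-- Stokes' theorem in a chart domain. -/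
theorem null_stokes {α : M → Alt 1} {η : M → Alt 2} (hα : SmoothA α Set.univ)
    (hη : SmoothA η Set.univ) {x₀ : M} {K : Set M} (hK : IsCompact K)
    (hKs : K ⊆ (extChartAt (𝓡 4) x₀).source) (h0 : ∀ x ∉ K, α x = 0 ∨ η x = 0) :
    Null Sg x₀ (stokes Sg α η) := by
  classical
  set φ := extChartAt (𝓡 4) x₀ with hφ
  set K' := φ '' K with hK'
  have hKc : IsCompact K' := hK.image_of_continuousOn ((continuousOn_extChartAt x₀).mono hKs)
  have hKt : K' ⊆ φ.target := by
    rintro _ ⟨x, hx, rfl⟩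
    exact φ.map_source (hKs hx)
  have hout : ∀ z ∈ φ.target, z ∉ K' → φ.symm z ∉ K := fun z hz hz' hx =>
    hz' ⟨_, hx, φ.right_inv hz⟩
  -- the density of `α ∧ η`, with the sign of the volume form, extended by zero
  let s : V4 → ℝ := fun z => |vol (pullT Sg x₀ z)| / vol (pullT Sg x₀ z)
  let W : V4 → Fin 4 → ℝ := fun z => dens (coord α x₀ z) (coord η x₀ z)
  let V : V4 → Fin 4 → ℝ := fun z ρ => if z ∈ K' then s z * W z ρ else 0
  have hWz : ∀ z ∈ φ.target, z ∉ K' → ∀ ρ, W z ρ = 0 := by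
    intro z hz hz' ρ
    rcases h0 _ (hout z hz hz') with h | h
    · have e : coord α x₀ z = 0 := by
        change pb _ (α (φ.symm z)) = 0
        rw [h]
        rfl
      change (til (m2 (coord η x₀ z)) *ᵥ c1 (coord α x₀ z)) ρ = 0
      rw [e, c1_zero, Matrix.mulVec_zero]
      rfl
    · have e : coord η x₀ z = 0 := by
        change pb _ (η (φ.symm z)) = 0
        rw [h]
        rfl
      have e2 : til 0 = 0 := by
        have := til_smul 0 0
        rwa [zero_smul, zero_smul] at this
      change (til (m2 (coord η x₀ z)) *ᵥ c1 (coord α x₀ z)) ρ = 0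
      rw [e, m2_zero, e2, Matrix.zero_mulVec]
      rfl
  have hW : ∀ ρ, ContDiffOn ℝ ∞ (fun z => W z ρ) φ.target := fun ρ => by
    have h1 := smoothA_two_iff.1 hη x₀
    have h2 := smoothA_one_iff.1 hα x₀
    rw [dom_univ] at h1 h2
    exact h1.til.mulVec h2 ρ
  have hs : ∀ z ∈ φ.target, ∀ᶠ y in 𝓝 z, s y = s z := by
    intro z hz
    have hv := (isPerfect_pullT hSg hz).vol_ne
    have hc := ((hSg.contDiffOn_vol x₀).continuousOn).continuousAt
      ((isOpen_extChartAt_target x₀).mem_nhds hz)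
    rcases lt_or_gt_of_ne hv with h | h
    · filter_upwards [hc.eventually_lt continuousAt_const h] with y hy
      change |_| / _ = |_| / _
      rw [abs_of_neg hy, abs_of_neg h, neg_div_self hy.ne, neg_div_self h.ne]
    · filter_upwards [continuousAt_const.eventually_lt hc h] with y hy
      change |_| / _ = |_| / _
      rw [abs_of_pos hy, abs_of_pos h, div_self hy.ne', div_self h.ne']
  have hVin : ∀ z ∈ φ.target, ∀ ρ, (fun y => V y ρ) =ᶠ[𝓝 z] fun y => s z * W y ρ := by
    intro z hz ρ
    filter_upwards [hs z hz, (isOpen_extChartAt_target x₀).mem_nhds hz] with y hy hyt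
    change (if y ∈ K' then s y * W y ρ else 0) = _
    split_ifs with h
    · rw [hy]
    · rw [hWz y hyt h, mul_zero]
  have hVout : ∀ z ∉ K', ∀ ρ, (fun y => V y ρ) =ᶠ[𝓝 z] fun _ => 0 := by
    intro z hz ρ
    filter_upwards [hKc.isClosed.isOpen_compl.mem_nhds hz] with y hy
    exact if_neg hy
  have hVs : ∀ ρ, ContDiff ℝ ∞ fun z => V z ρ := fun ρ => contDiff_iff_contDiffAt.2 fun z => by
    by_cases hz : z ∈ φ.target
    · exact ((contDiffOn_const.mul (hW ρ)).contDiffAt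
        ((isOpen_extChartAt_target x₀).mem_nhds hz)).congr_of_eventuallyEq (hVin z hz ρ)
    · exact contDiffAt_const.congr_of_eventuallyEq (hVout z (fun h => hz (hKt h)) ρ)
  have hVc : ∀ ρ, HasCompactSupport fun z => V z ρ := fun ρ =>
    HasCompactSupport.intro hKc fun z hz => if_neg hz
  obtain ⟨hi, h⟩ := integral_divergence hVs hVc
  have heq : ∀ z ∈ φ.target, stokes Sg α η (φ.symm z) * |vol (pullT Sg x₀ z)| =
      ∑ ρ, fderiv ℝ (fun y => V y ρ) z (bv ρ) := by
    intro z hz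
    have hv := (isPerfect_pullT hSg hz).vol_ne
    have e1 : |vol (pullT Sg x₀ z)| = vol (pullT Sg x₀ z) * s z := by
      change _ = _ * (|_| / _)
      field_simp
    rw [e1, ← mul_assoc, stokes_coord hSg hα hη hz, Finset.sum_mul]
    refine Finset.sum_congr rfl fun ρ _ => ?_
    rw [(hVin z hz ρ).fderiv_eq, fderiv_const_mul (((hW ρ).contDiffAt
      ((isOpen_extChartAt_target x₀).mem_nhds hz)).differentiableAt (by simp)), mul_comm]
    rfl
  refine ⟨(hi.integrableOn).congr_fun (fun z hz => (heq z hz).symm)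
    (isOpen_extChartAt_target x₀).measurableSet, ?_⟩
  refine Eq.trans (setIntegral_congr_fun (isOpen_extChartAt_target x₀).measurableSet heq) ?_
  rw [setIntegral_eq_integral_of_forall_compl_eq_zero, h]
  intro z hz
  refine Finset.sum_eq_zero fun ρ _ => ?_
  rw [(hVout z (fun h => hz (hKt h)) ρ).fderiv_eq]
  simp

end Stokes

/-! ### Formal adjoints -/

section Pointwise

variable {S : Trip}

/-- `ipS`, as a bilinear map. -/
def ipSL (S : Trip) : Trip →ₗ[ℝ] Trip →ₗ[ℝ] ℝ := LinearMap.mk₂ ℝ (ipS S)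
  (fun s s' t => by
    have h : ∀ η τ σ, contr2 S (η + τ) σ = contr2 S η σ + contr2 S τ σ := fun η τ σ =>
      (contr2L S).map_add₂ η τ σ
    have h' : ∀ η τ σ, contr2 S σ (η + τ) = contr2 S σ η + contr2 S σ τ := fun η τ σ =>
      (contr2L S σ).map_add η τ
    simp only [ipS, Pi.add_apply, h, h', Fin.sum_univ_three]
    ring)
  (fun r s t => by
    have h : ∀ η σ, contr2 S (r • η) σ = r * contr2 S η σ := fun η σ =>
      (contr2L S).map_smul₂ r η σ
    have h' : ∀ η σ, contr2 S σ (r • η) = r * contr2 S σ η := fun η σ =>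
      (contr2L S σ).map_smul r η
    simp only [ipS, Pi.smul_apply, h, h', Fin.sum_univ_three, smul_eq_mul]
    ring)
  (fun t s s' => by
    have h' : ∀ η τ σ, contr2 S σ (η + τ) = contr2 S σ η + contr2 S σ τ := fun η τ σ =>
      (contr2L S σ).map_add η τ
    simp only [ipS, Pi.add_apply, h', Fin.sum_univ_three]
    ring)
  (fun r t s => by
    have h' : ∀ η σ, contr2 S σ (r • η) = r * contr2 S σ η := fun η σ =>
      (contr2L S σ).map_smul r η
    simp only [ipS, Pi.smul_apply, h', Fin.sum_univ_three, smul_eq_mul]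
    ring)

namespace IsPerfect

lemma ipS_comm (hS : IsPerfect S) (s t : Trip) : ipS S s t = ipS S t s := by
  simp only [ipS, hS.contr2_comm (s _) (t _)]
  ring

lemma memS_add (hS : IsPerfect S) {s t : Trip} (hs : MemS S s) (ht : MemS S t) :
    MemS S (s + t) := by
  rw [hS.memS_iff] at hs ht ⊢
  intro i j
  have h' : ∀ η τ σ, contr2 S σ (η + τ) = contr2 S σ η + contr2 S σ τ := fun η τ σ =>
    (contr2L S σ).map_add η τ
  have h1 := hs i j
  have h2 := ht i j
  simp only [Pi.add_apply, h', Finset.sum_add_distrib]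
  split_ifs at h1 h2 ⊢ <;> linarith

lemma memS_smul (hS : IsPerfect S) (r : ℝ) {s : Trip} (hs : MemS S s) : MemS S (r • s) := by
  rw [hS.memS_iff] at hs ⊢
  intro i j
  have h' : ∀ η σ, contr2 S σ (r • η) = r * contr2 S σ η := fun η σ =>
    (contr2L S σ).map_smul r η
  have h1 := hs i j
  simp only [Pi.smul_apply, h', ← Finset.mul_sum, ← mul_add, h1]
  split_ifs <;> ring

/-- The pairing on `S` is the metric pairing with `σ - (1/18) (Σ^{jμν} σ^j_{μν}) Σ`. -/
lemma ipS_eq_contr2 (hS : IsPerfect S) (s t : Trip) : ipS S s t = (1 / 4) * ∑ i, contr2 S (s i)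
    (t i - ((1 / 18) * ∑ j, contr2 S (S j) (t j)) • S i) := by
  have h : ∀ η τ σ, contr2 S σ (η - τ) = contr2 S σ η - contr2 S σ τ := fun η τ σ =>
    map_sub (contr2L S σ) η τ
  have h' : ∀ (r : ℝ) η σ, contr2 S σ (r • η) = r * contr2 S σ η := fun r η σ =>
    (contr2L S σ).map_smul r η
  simp only [ipS, h, h', Fin.sum_univ_three, hS.contr2_comm (s _) (S _)]
  ring

end IsPerfect

end Pointwise

section Fields

variable {M : Type*} [TopologicalSpace M] [ChartedSpace V4 M] [IsManifold (𝓡 4) ∞ M]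
  {Sg : Fin 3 → Form M 2} (hSg : IsHyperkahlerTriple Sg)

include hSg

/-- The self-dual coefficients of `d(ξ ⌟ Σ^i)` are divergences; by the quaternion relations they are
antisymmetric up to a multiple of `δ^{ij}`. -/
lemma memS_d1 (ξ : Sm1 M) (x : M) : MemS (val Sg x) (val (d1 Sg ξ.1) x) := by
  have e : val (d1 Sg ξ.1) x = fun i => -dS x (JS hSg i ξ) := funext fun i => d1_eq hSg ξ i x
  have e2 : ∀ i j, contr2 (val Sg x) (val Sg x i) (-dS x (JS hSg j ξ)) =
      -(2 * divS hSg x (JS hSg i (JS hSg j ξ))) := fun i j => by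
    have h := map_neg (contr2L (val Sg x) (val Sg x i)) (dS x (JS hSg j ξ))
    rw [contr2_dS hSg] at h
    exact h
  have t := JS_table hSg
  rw [(hSg.perfect x).memS_iff, e]
  intro i j
  simp only [e2]
  fin_cases i <;> fin_cases j <;>
    simp [JS_self, fun α => (t α).1, fun α => (t α).2.1,
        fun α => (t α).2.2.1, fun α => (t α).2.2.2.1, fun α => (t α).2.2.2.2.1,
        fun α => (t α).2.2.2.2.2] <;> ring

/-- The 2-forms `⋆(σ - (1/18) (Σ^{jμν} σ^j_{μν}) Σ)`. -/
def primeS (s : Fin 3 → Sm2 M) (i : Fin 3) : Sm2 M :=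
  starS hSg (s i - ⟨fun y => ((1 / 18) * ∑ j, contr2 (val Sg y) (val Sg y j) ((s j).1 y)) •
    val Sg y i, (hSg.smoothA i).smul
      ((SmoothFn.sum fun j => hSg.smooth_contr2 (hSg.smoothA j) (s j).2).const_mul _)⟩)

/-- The two sides of the adjunction of `d₁` differ by a divergence. -/
lemma adj_d1 (ξ : Sm1 M) (s : Fin 3 → Sm2 M) (x : M) :
    ipS (val Sg x) (val (d1 Sg ξ.1) x) (fun i => (s i).1 x) -
      ip1 (val Sg x) (ξ.1 x) (d1s Sg (fun i => (s i).1) x) =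
    ∑ i, -(1 / 2) * stokes Sg (JS hSg i ξ).1 (primeS hSg s i).1 x := by
  have hP := hSg.perfect x
  have hv := hP.vol_ne
  have e1 : d1s Sg (fun i => (s i).1) x =
      (1 / 2 : ℝ) • ∑ i, Jl (val Sg x) i ((tauS hSg (primeS hSg s i)).1 x) :=
    congrArg ((1 / 2 : ℝ) • ·) (Phi_eq (val Sg x) fun i => (tauS hSg (primeS hSg s i)).1 x)
  -- The complex structures are antisymmetric, and can be moved from `⋆dσ` to `ξ`.
  have e2 : ip1 (val Sg x) (ξ.1 x) (d1s Sg (fun i => (s i).1) x) = ∑ i, -(1 / 2) *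
      (wedge13 ((JS hSg i ξ).1 x) (extA (primeS hSg s i).1 x) / vol (val Sg x)) := by
    rw [e1, ← ip1L_apply, map_smul, map_sum, Finset.smul_sum]
    refine Finset.sum_congr rfl fun i _ => ?_
    have h1 := hP.ip1_Jl i (ξ.1 x) ((tauS hSg (primeS hSg s i)).1 x)
    have h2 := hP.ip1_star3 ((JS hSg i ξ).1 x) (extA (primeS hSg s i).1 x)
    rw [← h2, ip1L_apply, smul_eq_mul]
    have h3 : ip1 (val Sg x) (Jl (val Sg x) i (ξ.1 x)) ((tauS hSg (primeS hSg s i)).1 x) =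
      ip1 (val Sg x) ((JS hSg i ξ).1 x) (star3 (val Sg x) (extA (primeS hSg s i).1 x)) := rfl
    rw [← h3, h1]
    ring
  have e3 : ipS (val Sg x) (val (d1 Sg ξ.1) x) (fun i => (s i).1 x) = ∑ i, -(1 / 2) *
      (wedge22 (extA (JS hSg i ξ).1 x) ((primeS hSg s i).1 x) / vol (val Sg x)) := by
    rw [hP.ipS_eq_contr2, Finset.mul_sum]
    refine Finset.sum_congr rfl fun i _ => ?_
    have h1 := hP.wedge22_star2 (extA (JS hSg i ξ).1 x) ((s i).1 x - ((1 / 18) * ∑ j,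
      contr2 (val Sg x) (val Sg x j) ((s j).1 x)) • val Sg x i)
    have h2 : wedge22 (extA (JS hSg i ξ).1 x) ((primeS hSg s i).1 x) = _ := h1
    have h3 : val (d1 Sg ξ.1) x i = -extA (JS hSg i ξ).1 x := d1_eq hSg ξ i x
    have h4 := (contr2L (val Sg x)).map_neg₂ (extA (JS hSg i ξ).1 x) ((s i).1 x - ((1 / 18) * ∑ j,
      contr2 (val Sg x) (val Sg x j) ((s j).1 x)) • val Sg x i)
    simp only [contr2L_apply] at h4
    rw [h2, h3, h4]
    field_simp
    ring
  rw [e2, e3, ← Finset.sum_sub_distrib]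
  refine Finset.sum_congr rfl fun i _ => ?_
  rw [stokes]
  ring

omit [IsManifold (𝓡 4) ∞ M] in
/-- The two sides of the adjunction of `d₂` differ by a divergence. -/
lemma adj_d2 {s : Fin 3 → Sm2 M} {x : M} (hs : MemS (val Sg x) fun i => (s i).1 x)
    (a : Fin 3 → Sm1 M) :
    ipA (val Sg x) (val (d2 Sg fun i => (s i).1) x) (fun i => (a i).1 x) -
      ipS (val Sg x) (fun i => (s i).1 x) (val (d2s Sg fun i => (a i).1) x) =
    ∑ i, stokes Sg (a i).1 (s i).1 x := by
  have hP := hSg.perfect x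
  have hv := hP.vol_ne
  have e1 : ipA (val Sg x) (val (d2 Sg fun i => (s i).1) x) (fun i => (a i).1 x) =
      -∑ i, wedge13 ((a i).1 x) (extA (s i).1 x) / vol (val Sg x) := by
    refine (hP.ipA_J1inv (fun i => star3 (val Sg x) (extA (s i).1 x)) _).trans ?_
    congr 1
    refine Finset.sum_congr rfl fun i _ => ?_
    rw [hP.ip1_comm, hP.ip1_star3]
  have e2 : ipS (val Sg x) (fun i => (s i).1 x) (val (d2s Sg fun i => (a i).1) x) =
      -∑ i, wedge22 (extA (a i).1 x) ((s i).1 x) / vol (val Sg x) := by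
    -- On `σ` in `S`, the projections in `d₂^*` turn the pairing on `S` into the metric pairing.
    refine (hP.ipS_liftS hs fun j => star2 (val Sg x) (extA (a j).1 x)).trans ?_
    rw [neg_mul, Finset.mul_sum]
    congr 1
    refine Finset.sum_congr rfl fun i _ => ?_
    have h := hP.wedge22_star2 ((s i).1 x) (star2 (val Sg x) (extA (a i).1 x))
    rw [hP.star2_star2, wedge22_comm] at h
    refine Eq.trans ?_ (congrArg (· / vol (val Sg x)) h.symm)
    field_simp
  rw [e1, e2, neg_sub_neg, ← Finset.sum_sub_distrib]
  refine Finset.sum_congr rfl fun i _ => ?_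
  rw [stokes]
  ring

/-- The two sides of the adjunction of `d₃` differ by a divergence. -/
lemma adj_d3 (a : Fin 3 → Sm1 M) {χ : M → Fin 3 → ℝ}
    (hχ : ∀ i, SmoothFn (fun x => χ x i) Set.univ) (x : M) :
    ipE (d3 Sg (fun i => (a i).1) x) (χ x) -
      ipA (val Sg x) (fun i => (a i).1 x) (val (d3s χ) x) =
    ∑ i, ∑ j, ∑ k, eps3 i j k * stokes Sg (a k).1 (sdS hSg (hχ i) j).1 x := by
  have hP := hSg.perfect x
  have hv := hP.vol_ne
  have e1 : ∀ i j k, stokes Sg (a k).1 (sdS hSg (hχ i) j).1 x =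
      χ x i * divS hSg x (JS hSg j (a k)) -
        ip1 (val Sg x) ((a k).1 x) (Jl (val Sg x) j (dfA (fun y => χ y i) x)) := by
    intro i j k
    have h1 := star3_extA_smul hSg (hχ i) j x
    have h2 := hP.ip1_star3 ((a k).1 x) (extA (sdS hSg (hχ i) j).1 x)
    have h3 : wedge22 (extA (a k).1 x) ((sdS hSg (hχ i) j).1 x) =
        χ x i * wedge22 (extA (a k).1 x) (val Sg x j) :=
      (wedge22L (extA (a k).1 x)).map_smul (χ x i) (val Sg x j)
    have h4 : wedge22 (extA (a k).1 x) (val Sg x j) =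
        vol (val Sg x) * divS hSg x (JS hSg j (a k)) := wedge22_extA hSg (a k).2 j x
    have h5 : ip1 (val Sg x) ((a k).1 x) (star3 (val Sg x) (extA (sdS hSg (hχ i) j).1 x)) =
        ip1 (val Sg x) ((a k).1 x) (Jl (val Sg x) j (dfA (fun y => χ y i) x)) :=
      congrArg (ip1 (val Sg x) ((a k).1 x)) h1
    rw [stokes, sub_div, ← h2, h5, h3, h4]
    field_simp
  have e2 : ipA (val Sg x) (fun i => (a i).1 x) (val (d3s χ) x) =
      ∑ i, ∑ j, ∑ k, eps3 i j k *
        ip1 (val Sg x) ((a k).1 x) (Jl (val Sg x) j (dfA (fun y => χ y i) x)) := by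
    rw [hP.ipA_eq, hP.ip1_J1_comm]
    have h : ∀ k, J1 (val Sg x) (val (d3s χ) x) k =
        ∑ j, ∑ i, eps3 k j i • Jl (val Sg x) j (dfA (fun y => χ y i) x) := fun k =>
      J1_eq (val Sg x) (val (d3s χ) x) k
    simp only [h, ← ip1L_apply, map_sum, map_smul, smul_eq_mul]
    simp only [Fin.sum_univ_three, eps3_self_left, eps3_self_right, eps3_self_mid, eps3_012,
      eps3_120, eps3_201, eps3_021, eps3_102, eps3_210]
    ring
  have e3 : ipE (d3 Sg (fun i => (a i).1) x) (χ x) =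
      ∑ i, ∑ j, ∑ k, eps3 i j k * (χ x i * divS hSg x (JS hSg j (a k))) := by
    rw [ipE]
    simp only [d3_eq hSg, Fin.sum_univ_three]
    ring
  simp only [e1, e2, e3, mul_sub, Finset.sum_sub_distrib]

end Fields

lemma IsPerfect.ipA_smul_right {S : Trip} (hS : IsPerfect S) (a b : ELam) (r : ℝ) :
    ipA S a (r • b) = r * ipA S a b := by
  simp only [hS.ipA_eq, Pi.smul_apply, ← ip1L_apply, map_smul, smul_eq_mul, ← Finset.mul_sum,
    mul_neg]

lemma IsPerfect.ipA_add_right {S : Trip} (hS : IsPerfect S) (a b c : ELam) :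
    ipA S a (b + c) = ipA S a b + ipA S a c := by
  simp only [hS.ipA_eq, Pi.add_apply, ← ip1L_apply, map_add, Finset.sum_add_distrib]
  ring

section Fields

variable {M : Type*} [TopologicalSpace M] [ChartedSpace V4 M] [IsManifold (𝓡 4) ∞ M]
  {Sg : Fin 3 → Form M 2} (hSg : IsHyperkahlerTriple Sg)

include hSg

lemma null_d1 (ξ : Sm1 M) (s : Fin 3 → Sm2 M) {x₀ : M} {K : Set M} (hK : IsCompact K)
    (hKs : K ⊆ (extChartAt (𝓡 4) x₀).source) (h0 : ∀ x ∉ K, ξ.1 x = 0 ∨ ∀ i, (s i).1 x = 0) :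
    Null Sg x₀ fun x => ipS (val Sg x) (val (d1 Sg ξ.1) x) (fun i => (s i).1 x) -
      ip1 (val Sg x) (ξ.1 x) (d1s Sg (fun i => (s i).1) x) := by
  simp only [adj_d1 hSg]
  refine Null.sum fun i => (null_stokes hSg (JS hSg i ξ).2 (primeS hSg s i).2 hK hKs
    fun x hx => ?_).const_mul _
  rcases h0 x hx with h | h
  · refine Or.inl ?_
    change Jl (val Sg x) i (ξ.1 x) = 0
    rw [h, map_zero]
  · refine Or.inr ?_
    change star2 (val Sg x) ((s i).1 x - ((1 / 18) * ∑ j,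
      contr2 (val Sg x) (val Sg x j) ((s j).1 x)) • val Sg x i) = 0
    have e : ∀ j, contr2 (val Sg x) (val Sg x j) ((s j).1 x) = 0 := fun j => by
      rw [h]
      exact map_zero (contr2L (val Sg x) (val Sg x j))
    rw [h, Finset.sum_eq_zero fun j _ => e j, mul_zero, zero_smul, sub_zero]
    exact map_zero (star2L (val Sg x))

lemma null_d2 {s : Fin 3 → Sm2 M} (hs : ∀ x, MemS (val Sg x) fun i => (s i).1 x)
    (a : Fin 3 → Sm1 M) {x₀ : M} {K : Set M} (hK : IsCompact K)
    (hKs : K ⊆ (extChartAt (𝓡 4) x₀).source)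
    (h0 : ∀ x ∉ K, (∀ i, (a i).1 x = 0) ∨ ∀ i, (s i).1 x = 0) :
    Null Sg x₀ fun x =>
      ipA (val Sg x) (val (d2 Sg fun i => (s i).1) x) (fun i => (a i).1 x) -
        ipS (val Sg x) (fun i => (s i).1 x) (val (d2s Sg fun i => (a i).1) x) := by
  simp only [fun x => adj_d2 hSg (hs x)]
  exact Null.sum fun i => null_stokes hSg (a i).2 (s i).2 hK hKs fun x hx =>
    (h0 x hx).imp (fun h => h i) fun h => h i

lemma null_d3 (a : Fin 3 → Sm1 M) {χ : M → Fin 3 → ℝ}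
    (hχ : ∀ i, SmoothFn (fun x => χ x i) Set.univ) {x₀ : M} {K : Set M} (hK : IsCompact K)
    (hKs : K ⊆ (extChartAt (𝓡 4) x₀).source) (h0 : ∀ x ∉ K, (∀ i, (a i).1 x = 0) ∨ χ x = 0) :
    Null Sg x₀ fun x => ipE (d3 Sg (fun i => (a i).1) x) (χ x) -
      ipA (val Sg x) (fun i => (a i).1 x) (val (d3s χ) x) := by
  simp only [adj_d3 hSg a hχ]
  refine Null.sum fun i => Null.sum fun j => Null.sum fun k => (null_stokes hSg (a k).2
    (sdS hSg (hχ i) j).2 hK hKs fun x hx => (h0 x hx).imp (fun h => h k) fun h => ?_).const_mul _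
  change χ x i • val Sg x j = 0
  rw [h, Pi.zero_apply, zero_smul]

omit [IsManifold (𝓡 4) ∞ M] in
lemma memS_d2s (a : Fin 3 → Form M 1) (x : M) : MemS (val Sg x) (val (d2s Sg a) x) :=
  (hSg.perfect x).memS_liftS _

lemma memS_dt1 (ξ : Sm1 M) (x : M) : MemS (val Sg x) (val (dt1 Sg ξ.1) x) := by
  have hP := hSg.perfect x
  have e : val (dt1 Sg ξ.1) x = (1 / √2 : ℝ) • (val (d1 Sg ξ.1) x +
      (-1 : ℝ) • val (d2s Sg (PhiStarF Sg ξ.1)) x) := by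
    refine Eq.trans ?_ (congrArg (fun t : Trip => (1 / √2 : ℝ) • (val (d1 Sg ξ.1) x + t))
      (neg_one_smul ℝ (val (d2s Sg (PhiStarF Sg ξ.1)) x)).symm)
    exact congrArg ((1 / √2 : ℝ) • ·)
      (sub_eq_add_neg (val (d1 Sg ξ.1) x) (val (d2s Sg (PhiStarF Sg ξ.1)) x))
  rw [e]
  exact hP.memS_smul _ (hP.memS_add (memS_d1 hSg ξ x) (hP.memS_smul _ (memS_d2s hSg _ x)))

/-- `Φ^*`, on smooth fields. -/
def PhiStarS (ξ : Sm1 M) (i : Fin 3) : Sm1 M := (1 / 2 : ℝ) • JS hSg i ξ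

lemma PhiStarF_coe (ξ : Sm1 M) : PhiStarF Sg ξ.1 = fun i => (PhiStarS hSg ξ i).1 := by
  have h := PhiStarF_eq hSg 1 ξ
  rw [one_smul] at h
  exact h

/-- `J₁`, on smooth fields. -/
def J1S (a : Fin 3 → Sm1 M) (i : Fin 3) : Sm1 M := ∑ j, ∑ k, eps3 i j k • JS hSg j (a k)

lemma J1F_coe (a : Fin 3 → Sm1 M) : J1F Sg (fun i => (a i).1) = fun i => (J1S hSg a i).1 :=
  J1F_eq hSg a

lemma PhiStarS_zero {ξ : Sm1 M} {x : M} (h : ξ.1 x = 0) (i : Fin 3) :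
    (PhiStarS hSg ξ i).1 x = 0 := by
  change (1 / 2 : ℝ) • Jl (val Sg x) i (ξ.1 x) = 0
  rw [h, map_zero, smul_zero]

lemma J1S_zero {a : Fin 3 → Sm1 M} {x : M} (h : ∀ i, (a i).1 x = 0) (i : Fin 3) :
    (J1S hSg a i).1 x = 0 := by
  have e : (J1S hSg a i).1 x = J1 (val Sg x) (fun j => (a j).1 x) i :=
    (congrFun (congrFun (J1F_eq hSg a) i) x).symm
  rw [e, J1_eq]
  simp [h]

section Adjoint

variable {x₀ : M} {K : Set M} (hK : IsCompact K) (hKs : K ⊆ (extChartAt (𝓡 4) x₀).source)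

include hK hKs

lemma null_dt1 (ξ : Sm1 M) {s : Fin 3 → Sm2 M} (hs : ∀ x, MemS (val Sg x) fun i => (s i).1 x)
    (h0 : ∀ x ∉ K, ξ.1 x = 0 ∨ ∀ i, (s i).1 x = 0) :
    Null Sg x₀ fun x => ipS (val Sg x) (val (dt1 Sg ξ.1) x) (fun i => (s i).1 x) -
      ip1 (val Sg x) (ξ.1 x) (dt1s Sg (fun i => (s i).1) x) := by
  have n1 := null_d1 hSg ξ s hK hKs h0
  have n2 := null_d2 hSg hs (PhiStarS hSg ξ) hK hKs fun x hx =>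
    (h0 x hx).imp_left (PhiStarS_zero hSg)
  have n := (n1.add n2).const_mul (1 / √2)
  refine (congrArg (Null Sg x₀) (funext fun x => ?_)).mp n
  have hP := hSg.perfect x
  have e1 : ipS (val Sg x) (val (dt1 Sg ξ.1) x) (fun i => (s i).1 x) = (1 / √2) *
      (ipS (val Sg x) (val (d1 Sg ξ.1) x) (fun i => (s i).1 x) -
        ipS (val Sg x) (fun i => (s i).1 x) (val (d2s Sg fun i => (PhiStarS hSg ξ i).1) x)) := by
    rw [hP.ipS_comm (fun i => (s i).1 x), ← PhiStarF_coe]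
    have h1 := map_smul (ipSL (val Sg x)) (1 / √2 : ℝ) (val (d1 Sg ξ.1) x -
      val (d2s Sg (PhiStarF Sg ξ.1)) x)
    have h2 := map_sub (ipSL (val Sg x)) (val (d1 Sg ξ.1) x) (val (d2s Sg (PhiStarF Sg ξ.1)) x)
    rw [h2] at h1
    exact congrArg (fun l : Trip →ₗ[ℝ] ℝ => l fun i => (s i).1 x) h1
  have e2 : ip1 (val Sg x) (ξ.1 x) (dt1s Sg (fun i => (s i).1) x) = (1 / √2) *
      (ip1 (val Sg x) (ξ.1 x) (d1s Sg (fun i => (s i).1) x) -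
        ipA (val Sg x) (val (d2 Sg fun i => (s i).1) x) (fun i => (PhiStarS hSg ξ i).1 x)) := by
    have h3 : (fun i => (PhiStarS hSg ξ i).1 x) = PhiStar (val Sg x) (ξ.1 x) :=
      funext fun i => (congrFun (congrFun (PhiStarF_coe hSg ξ) i) x).symm
    rw [h3, hP.ipA_PhiStar, hP.ip1_comm (Phi _ _)]
    have h1 := map_smul (ip1L (val Sg x) (ξ.1 x)) (1 / √2 : ℝ) (d1s Sg (fun i => (s i).1) x -
      PhiF Sg (d2 Sg fun i => (s i).1) x)
    have h2 := map_sub (ip1L (val Sg x) (ξ.1 x)) (d1s Sg (fun i => (s i).1) x)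
      (PhiF Sg (d2 Sg fun i => (s i).1) x)
    rw [h2] at h1
    exact h1
  rw [e1, e2]
  ring

lemma null_dt3 (a : Fin 3 → Sm1 M) {χ : M → Fin 3 → ℝ}
    (hχ : ∀ i, SmoothFn (fun x => χ x i) Set.univ)
    (h0 : ∀ x ∉ K, (∀ i, (a i).1 x = 0) ∨ χ x = 0) :
    Null Sg x₀ fun x => ipE (dt3 Sg (fun i => (a i).1) x) (χ x) -
      ipA (val Sg x) (fun i => (a i).1 x) (val (dt3s Sg χ) x) := by
  have n := (null_d3 hSg (J1S hSg a) hχ hK hKs fun x hx =>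
    (h0 x hx).imp_left (J1S_zero hSg)).const_mul (1 / √2)
  refine (congrArg (Null Sg x₀) (funext fun x => ?_)).mp n
  have hP := hSg.perfect x
  have e1 : ipE (dt3 Sg (fun i => (a i).1) x) (χ x) = (1 / √2) *
      ipE (d3 Sg (fun i => (J1S hSg a i).1) x) (χ x) := by
    rw [← J1F_coe hSg]
    simp only [ipE, Finset.mul_sum, ← mul_assoc]
    rfl
  have e2 : ipA (val Sg x) (fun i => (a i).1 x) (val (dt3s Sg χ) x) = (1 / √2) *
      ipA (val Sg x) (fun i => (J1S hSg a i).1 x) (val (d3s χ) x) := by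
    have h1 : (fun i => (J1S hSg a i).1 x) = J1 (val Sg x) (fun i => (a i).1 x) :=
      funext fun i => (congrFun (congrFun (J1F_eq hSg a) i) x).symm
    have h2 : val (dt3s Sg χ) x = (1 / √2 : ℝ) • J1 (val Sg x) (val (d3s χ) x) := rfl
    rw [h1, h2, hP.ipA_J1, hP.ipA_smul_right]
  rw [e1, e2]
  ring

lemma null_dt4 {χ : M → Fin 3 → ℝ} (hχ : ∀ i, SmoothFn (fun x => χ x i) Set.univ)
    (ξ : Sm1 M) (h0 : ∀ x ∉ K, ξ.1 x = 0 ∨ χ x = 0) :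
    Null Sg x₀ fun x => ip1 (val Sg x) (dt4 Sg χ x) (ξ.1 x) - ipE (χ x) (dt4s Sg ξ.1 x) := by
  have n := null_d3 hSg (PhiStarS hSg ξ) hχ hK hKs fun x hx =>
    (h0 x hx).imp_left (PhiStarS_zero hSg)
  refine (congrArg (Null Sg x₀) (funext fun x => ?_)).mp n
  have hP := hSg.perfect x
  have e1 : ipE (χ x) (dt4s Sg ξ.1 x) =
      -ipE (d3 Sg (fun i => (PhiStarS hSg ξ i).1) x) (χ x) := by
    rw [← PhiStarF_coe hSg]
    simp only [ipE, ← Finset.sum_neg_distrib]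
    refine Finset.sum_congr rfl fun i _ => ?_
    have h : dt4s Sg ξ.1 x i = -d3 Sg (PhiStarF Sg ξ.1) x i := rfl
    rw [h]
    ring
  have e2 : ip1 (val Sg x) (dt4 Sg χ x) (ξ.1 x) =
      -ipA (val Sg x) (fun i => (PhiStarS hSg ξ i).1 x) (val (d3s χ) x) := by
    have h3 : (fun i => (PhiStarS hSg ξ i).1 x) = PhiStar (val Sg x) (ξ.1 x) :=
      funext fun i => (congrFun (congrFun (PhiStarF_coe hSg ξ) i) x).symm
    rw [h3, hP.ipA_comm, hP.ipA_PhiStar]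
    exact (ip1L (val Sg x)).map_neg₂ (Phi (val Sg x) (val (d3s χ) x)) (ξ.1 x)
  rw [e1, e2]
  ring

end Adjoint

theorem isFormalAdjoint_d1 : IsFormalAdjoint Sg (secT Sg) (secS Sg) (d1 Sg) (d1s Sg) := by
  refine ⟨fun ξ hξ _ => memS_d1 hSg ⟨ξ, hξ⟩, fun _ _ _ => trivial,
    fun x₀ K hK hKs ξ s hξ _ hs _ h0 => chartInt_eq_of_null ?_⟩
  exact null_d1 hSg ⟨ξ, hξ⟩ (fun i => ⟨s i, hs i⟩) hK hKs fun x hx => Or.inl (h0 x hx)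

theorem isFormalAdjoint_d2 : IsFormalAdjoint Sg (secS Sg) (secA Sg) (d2 Sg) (d2s Sg) := by
  refine ⟨fun _ _ _ => trivial, fun a _ _ => memS_d2s hSg a,
    fun x₀ K hK hKs s a hs hm ha _ h0 => chartInt_eq_of_null ?_⟩
  exact null_d2 hSg (s := fun i => ⟨s i, hs i⟩) hm (fun i => ⟨a i, ha i⟩) hK hKs
    fun x hx => Or.inr (h0 x hx)

theorem isFormalAdjoint_d3 : IsFormalAdjoint Sg (secA Sg) (secE M) (d3 Sg) d3s := by
  refine ⟨fun _ _ _ => trivial, fun _ _ _ => trivial,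
    fun x₀ K hK hKs a χ ha _ hχ _ h0 => chartInt_eq_of_null ?_⟩
  exact null_d3 hSg (fun i => ⟨a i, ha i⟩) ((contMDiff_pi_iff χ).mp hχ) hK hKs
    fun x hx => Or.inl (h0 x hx)

theorem isFormalAdjoint_dt1 : IsFormalAdjoint Sg (secT Sg) (secS Sg) (dt1 Sg) (dt1s Sg) := by
  refine ⟨fun ξ hξ _ => memS_dt1 hSg ⟨ξ, hξ⟩, fun _ _ _ => trivial,
    fun x₀ K hK hKs ξ s hξ _ hs hm h0 => chartInt_eq_of_null ?_⟩
  exact null_dt1 hSg hK hKs ⟨ξ, hξ⟩ (s := fun i => ⟨s i, hs i⟩) hm fun x hx => Or.inl (h0 x hx)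

theorem isFormalAdjoint_dt3 : IsFormalAdjoint Sg (secA Sg) (secE M) (dt3 Sg) (dt3s Sg) := by
  refine ⟨fun _ _ _ => trivial, fun _ _ _ => trivial,
    fun x₀ K hK hKs a χ ha _ hχ _ h0 => chartInt_eq_of_null ?_⟩
  exact null_dt3 hSg hK hKs (fun i => ⟨a i, ha i⟩) ((contMDiff_pi_iff χ).mp hχ)
    fun x hx => Or.inl (h0 x hx)

theorem isFormalAdjoint_dt4 : IsFormalAdjoint Sg (secE M) (secT Sg) (dt4 Sg) (dt4s Sg) := by
  refine ⟨fun _ _ _ => trivial, fun _ _ _ => trivial,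
    fun x₀ K hK hKs χ ξ hχ _ hξ _ h0 => chartInt_eq_of_null ?_⟩
  exact null_dt4 hSg hK hKs ((contMDiff_pi_iff χ).mp hχ) ⟨ξ, hξ⟩ fun x hx => Or.inr (h0 x hx)

theorem isFormalAdjoint_Dt : IsFormalAdjoint Sg ((secS Sg).prod (secE M))
    ((secT Sg).prod (secA Sg)) (Dt Sg) (Dts Sg) := by
  refine ⟨fun _ _ _ => ⟨trivial, trivial⟩, fun p hp _ => ⟨fun x =>
    (hSg.perfect x).memS_add (memS_dt1 hSg ⟨p.1, hp.1⟩ x) (memS_d2s hSg p.2 x), trivial⟩, ?_⟩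
  rintro x₀ K hK hKs ⟨s, χ⟩ ⟨ξ, a⟩ ⟨hs, hχ⟩ ⟨hm, -⟩ ⟨hξ, ha⟩ - h0
  refine chartInt_eq_of_null ?_
  have hχ' := (contMDiff_pi_iff χ).mp hχ
  have n1 := null_dt1 hSg hK hKs ⟨ξ, hξ⟩ (s := fun i => ⟨s i, hs i⟩) hm
    fun x hx => Or.inr (h0 x hx).1
  have n2 := null_d2 hSg (s := fun i => ⟨s i, hs i⟩) hm (fun i => ⟨a i, ha i⟩) hK hKs
    fun x hx => Or.inr (h0 x hx).1
  have n3 := null_dt3 hSg hK hKs (fun i => ⟨a i, ha i⟩) hχ' fun x hx => Or.inr (h0 x hx).2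
  have n4 := null_dt4 hSg hK hKs hχ' ⟨ξ, hξ⟩ fun x hx => Or.inr (h0 x hx).2
  have n := ((n2.add n4).add (n1.const_mul (-1))).add (n3.const_mul (-1))
  refine (congrArg (Null Sg x₀) (funext fun x => ?_)).mp n
  have hP := hSg.perfect x
  have e1 : ((secT Sg).prod (secA Sg)).ip (Dt Sg (s, χ)) (ξ, a) x =
      (ip1 (val Sg x) (ξ x) (dt1s Sg s x) + ip1 (val Sg x) (dt4 Sg χ x) (ξ x)) +
        (ipA (val Sg x) (val (d2 Sg s) x) (val a x) +
          ipA (val Sg x) (val a x) (val (dt3s Sg χ) x)) := by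
    have h1 : ip1 (val Sg x) (dt1s Sg s x + dt4 Sg χ x) (ξ x) =
        ip1 (val Sg x) (ξ x) (dt1s Sg s x) + ip1 (val Sg x) (dt4 Sg χ x) (ξ x) :=
      ((ip1L (val Sg x)).map_add₂ (dt1s Sg s x) (dt4 Sg χ x) (ξ x)).trans
        (congrArg (· + ip1 (val Sg x) (dt4 Sg χ x) (ξ x)) (hP.ip1_comm _ _))
    have h2 : ipA (val Sg x) (val (d2 Sg s) x + val (dt3s Sg χ) x) (val a x) =
        ipA (val Sg x) (val (d2 Sg s) x) (val a x) +
          ipA (val Sg x) (val a x) (val (dt3s Sg χ) x) := by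
      rw [hP.ipA_comm _ (val a x), hP.ipA_add_right, hP.ipA_comm (val a x)]
    exact congrArg₂ (· + ·) h1 h2
  have e2 : ((secS Sg).prod (secE M)).ip (s, χ) (Dts Sg (ξ, a)) x =
      (ipS (val Sg x) (val (dt1 Sg ξ) x) (val s x) +
        ipS (val Sg x) (val s x) (val (d2s Sg a) x)) +
        (ipE (χ x) (dt4s Sg ξ x) + ipE (dt3 Sg a x) (χ x)) := by
    rw [hP.ipS_comm (val (dt1 Sg ξ) x)]
    have h1 : ipS (val Sg x) (val s x) (val (dt1 Sg ξ + d2s Sg a) x) =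
        ipS (val Sg x) (val s x) (val (dt1 Sg ξ) x) +
          ipS (val Sg x) (val s x) (val (d2s Sg a) x) :=
      map_add (ipSL (val Sg x) (val s x)) (val (dt1 Sg ξ) x) (val (d2s Sg a) x)
    have h2 : ipE (χ x) ((dt4s Sg ξ + dt3 Sg a) x) =
        ipE (χ x) (dt4s Sg ξ x) + ipE (dt3 Sg a x) (χ x) := by
      simp only [ipE, Fin.sum_univ_three, Pi.add_apply]
      ring
    exact congrArg₂ (· + ·) h1 h2
  refine Eq.trans ?_ (congrArg₂ (· - ·) e1 e2).symm
  change (ipA (val Sg x) (val (d2 Sg s) x) (val a x) -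
      ipS (val Sg x) (val s x) (val (d2s Sg a) x) +
    (ip1 (val Sg x) (dt4 Sg χ x) (ξ x) - ipE (χ x) (dt4s Sg ξ x)) +
    -1 * (ipS (val Sg x) (val (dt1 Sg ξ) x) (val s x) - ip1 (val Sg x) (ξ x) (dt1s Sg s x)) +
    -1 * (ipE (dt3 Sg a x) (χ x) - ipA (val Sg x) (val a x) (val (dt3s Sg χ) x))) = _
  ring

end Fields

/-! ### Smoothness of the components -/

section Fields

variable {M : Type*} [TopologicalSpace M] [ChartedSpace V4 M]

lemma contDiffOn_of_kmat {b : V4 → Bil} {U : Set V4} (h : SmoothMat U fun z => kmat (b z)) :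
    ContDiffOn ℝ ∞ b U := by
  refine contDiffOn_clm_apply.2 fun v => contDiffOn_clm_apply.2 fun w => ?_
  simp only [bil_apply]
  exact ContDiffOn.sum fun μ _ => ContDiffOn.sum fun ν _ => contDiffOn_const.mul (h μ ν)

lemma compK_pb {A : V4 →L[ℝ] V4} (hA : (lmat A).det ≠ 0) (S s : Trip) :
    compK (pbT A S) (pbT A s) = pbB A (compK S s) := by
  refine bil_ext ?_
  have e : ∀ i, asd (pbT A S) (pb A (s i)) = pb A (asd S (s i)) := fun i => by
    rw [asd_apply, asd_apply, star2_pb hA]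
    rfl
  rw [kmat_pbB, compK, compK, kmat_mkBil, kmat_mkBil]
  simp only [e, m2_pb, gi_pb hA, Matrix.mul_smul, Matrix.smul_mul, Finset.mul_sum, Finset.sum_mul]
  congr 1
  refine Finset.sum_congr rfl fun i _ => ?_
  have h1 : lmat A * (lmat A)⁻¹ = 1 := lmat_mul_inv hA
  have h2 := lmat_transpose_inv_mul hA
  calc _ = (lmat A)ᵀ * m2 (asd S (s i)) * (lmat A * (lmat A)⁻¹) * gi S *
        ((lmat A)ᵀ⁻¹ * (lmat A)ᵀ) * m2 (S i) * lmat A := by simp only [mul_assoc]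
    _ = _ := by rw [h1, h2, mul_one, mul_one]; simp only [mul_assoc]

variable [IsManifold (𝓡 4) ∞ M] {Sg : Fin 3 → Form M 2} (hSg : IsHyperkahlerTriple Sg)
include hSg

lemma smoothTen_compK {s : Fin 3 → Form M 2} (hs : ∀ i, SmoothForm (s i) Set.univ) :
    SmoothTen (M := M) fun x => compK (val Sg x) (val s x) := by
  intro x₀
  refine contDiffOn_of_kmat ?_
  rw [← dom_univ]
  have h := fun i => smoothA_two_iff.1 (hSg.smooth_asd (hs i)) x₀
  have h' := SmoothMat.smul (f := fun _ => -(1 / 4)) contDiffOn_const (SmoothMat.sum fun i =>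
    ((h i).mul ((hSg.smoothMat_gi x₀).restrict _)).mul ((hSg.smoothMat_m2 x₀ i).restrict _))
  refine h'.congr fun z hz => ?_
  have hA := det_chartD hz.1
  have e : pullTen (fun x => compK (val Sg x) (val s x)) x₀ z =
      compK (pullT Sg x₀ z) fun i => coord (s i) x₀ z := (compK_pb hA _ _).symm
  have e2 : ∀ i, coord (fun x => asd (val Sg x) (s i x)) x₀ z =
      asd (pullT Sg x₀ z) (coord (s i) x₀ z) := fun i => by
    rw [asd_apply, ← coord_star2 hz.1 (s i)]
    rfl
  rw [e, compK, kmat_mkBil]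
  simp only [e2]

/-- Every smooth section of `S ⊕ E` has smooth components. -/
theorem exists_smooth_components {s : Fin 3 → Form M 2} {χ : M → Fin 3 → ℝ}
    (hs : ∀ i, SmoothForm (s i) Set.univ) (hm : ∀ x, MemS (val Sg x) (val s x))
    (hχ : ContMDiff (𝓡 4) 𝓘(ℝ, Fin 3 → ℝ) ∞ χ) :
    ∃ (h : M → ℝ) (u w : M → Fin 3 → ℝ) (k : Ten2 M), ContMDiff (𝓡 4) 𝓘(ℝ, ℝ) ∞ h ∧
      ContMDiff (𝓡 4) 𝓘(ℝ, Fin 3 → ℝ) ∞ u ∧ ContMDiff (𝓡 4) 𝓘(ℝ, Fin 3 → ℝ) ∞ w ∧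
      SmoothTen k ∧ (∀ x, IsSym0 (val Sg x) (k x)) ∧ quadField Sg h u w k = (s, χ) := by
  have hχ' := (contMDiff_pi_iff χ).mp hχ
  have hU : ∀ l, SmoothFn (fun x => compU (val Sg x) (val s x) l) Set.univ := fun l =>
    (SmoothFn.sum fun i => SmoothFn.sum fun j =>
      (hSg.smooth_contr2 (hSg.smoothA j) (hs i)).const_mul _).const_mul _
  refine ⟨fun x => compH (val Sg x) (val s x),
    fun x => (2 : ℝ) • compU (val Sg x) (val s x) + (√2 / 2) • χ x,
    fun x => (2 : ℝ) • compU (val Sg x) (val s x) + (-(√2 / 2)) • χ x,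
    fun x => compK (val Sg x) (val s x),
    (contMDiff_iff_smoothFn _).2 ((SmoothFn.sum fun i =>
      hSg.smooth_contr2 (hSg.smoothA i) (hs i)).const_mul _),
    (contMDiff_pi_iff _).2 fun i => ((hU i).const_mul _).add ((hχ' i).const_mul _),
    (contMDiff_pi_iff _).2 fun i => ((hU i).const_mul _).add ((hχ' i).const_mul _),
    smoothTen_compK hSg hs, fun x => (hSg.perfect x).isSym0_compK _, ?_⟩
  have e : ∀ x, T1 (compH (val Sg x) (val s x),
      (2 : ℝ) • compU (val Sg x) (val s x) + (√2 / 2) • χ x,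
      (2 : ℝ) • compU (val Sg x) (val s x) + (-(√2 / 2)) • χ x, compK (val Sg x) (val s x)) =
      (compH (val Sg x) (val s x), compU (val Sg x) (val s x), χ x,
        compK (val Sg x) (val s x)) := fun x => by
    have h2 := sqrt_two_sq
    have h0 : √(2 : ℝ) ≠ 0 := by positivity
    refine Prod.ext rfl (Prod.ext ?_ (Prod.ext ?_ rfl))
    · simp only [T1]
      module
    · ext i
      simp [T1]
      field_simp
      ring
  have e2 : ∀ x, iota (val Sg x) (T1 (compH (val Sg x) (val s x),
      (2 : ℝ) • compU (val Sg x) (val s x) + (√2 / 2) • χ x,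
      (2 : ℝ) • compU (val Sg x) (val s x) + (-(√2 / 2)) • χ x, compK (val Sg x) (val s x))) =
      (val s x, χ x) := fun x => by
    rw [e, iota, (hSg.perfect x).param_comp (hm x)]
  exact Prod.ext (funext fun i => funext fun x => congrFun (congrArg Prod.fst (e2 x)) i)
    (funext fun x => congrArg Prod.snd (e2 x))

end Fields

/-! ### Spinors: the isomorphisms -/

section Spinors

open Complex

lemma cl_zero : cl 0 = 1 := rfl

lemma cl_succ (i : Fin 3) : cl i.succ = I • pauli i := rfl

lemma cl_eq : cl = ![1, !![0, I; I, 0], !![0, 1; -1, 0], !![I, 0; 0, -I]] := by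
  funext a
  refine Fin.cases rfl (fun k => ?_) a
  rw [cl_succ]
  fin_cases k <;> ext i j <;> fin_cases i <;> fin_cases j <;> simp [pauli]

lemma clBar_eq : clBar = ![1, !![0, -I; -I, 0], !![0, -1; 1, 0], !![-I, 0; 0, I]] := by
  funext a
  rw [clBar, cl_eq]
  fin_cases a <;> ext i j <;> fin_cases i <;> fin_cases j <;>
    simp [Matrix.conjTranspose_apply]

lemma spinE_eq (u : Fin 3 → ℂ) :
    spinE u = !![-I * u 0 - u 1, I * u 2; I * u 2, I * u 0 - u 1] := by
  ext i j
  fin_cases i <;> fin_cases j <;>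
    simp [spinE, Fin.sum_univ_three, pauli, epsS] <;> ring

lemma spin4_eq (p : ℂ × (Fin 3 → ℂ)) : spin4 p =
    !![-I * p.2 0 - p.2 1, p.1 + I * p.2 2; -p.1 + I * p.2 2, I * p.2 0 - p.2 1] := by
  rw [spin4, spinE_eq]
  ext i j
  fin_cases i <;> fin_cases j <;> simp [epsS]

lemma spinV_eq (α : Fin 4 → ℂ) : spinV α =
    !![I * α 1 + α 2, α 0 - I * α 3; -α 0 - I * α 3, -I * α 1 + α 2] := by
  rw [spinV, clBar_eq]
  ext i j
  fin_cases i <;> fin_cases j <;>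
    simp [Fin.sum_univ_four, epsS] <;> ring

lemma spin12_apply (p : (Fin 3 → ℂ) × Matrix (Fin 4) (Fin 4) ℂ) (A B C D : Fin 2) :
    spin12 p A (B, C, D) = epsS A B * spinE p.1 C D -
      spinV (fun a => spinV (p.2 a) B D) A C := by
  simp only [spin12, Matrix.of_apply, spinV, Matrix.sum_apply, Matrix.smul_apply, smul_eq_mul,
    Finset.sum_mul]
  congr 1
  refine Finset.sum_congr rfl fun a _ => Finset.sum_congr rfl fun b _ => by ring

lemma spinA_apply (O : Fin 3 → Fin 4 → ℂ) (A B C D : Fin 2) : spinA O A (B, C, D) =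
    spinE (fun i => spin4 (O i 0, fun j => O i j.succ) A B) C D := by
  simp only [spinA, Matrix.of_apply, spinE, spin4, Matrix.sum_apply, Matrix.smul_apply,
    Matrix.add_apply, smul_eq_mul, Fin.sum_univ_succ, cl_zero, cl_succ, one_mul]
  simp
  ring

/-- The inverse of `spin4`. -/
def unspin4 (M : Matrix (Fin 2) (Fin 2) ℂ) : ℂ × (Fin 3 → ℂ) :=
  ((M 0 1 - M 1 0) / 2, ![I * (M 0 0 - M 1 1) / 2, -(M 0 0 + M 1 1) / 2, -I * (M 0 1 + M 1 0) / 2])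

/-- The inverse of `spinV`. -/
def unspinV (M : Matrix (Fin 2) (Fin 2) ℂ) : Fin 4 → ℂ :=
  ![(M 0 1 - M 1 0) / 2, -I * (M 0 0 - M 1 1) / 2, (M 0 0 + M 1 1) / 2, I * (M 0 1 + M 1 0) / 2]

lemma unspin4_spin4 (p : ℂ × (Fin 3 → ℂ)) : unspin4 (spin4 p) = p := by
  rw [spin4_eq]
  refine Prod.ext ?_ (funext fun i => ?_)
  · simp [unspin4]
  · fin_cases i <;> simp [unspin4] <;> ring_nf <;> simp

lemma spin4_unspin4 (M : Matrix (Fin 2) (Fin 2) ℂ) : spin4 (unspin4 M) = M := by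
  rw [spin4_eq]
  ext i j
  fin_cases i <;> fin_cases j <;> simp [unspin4] <;> ring_nf <;> simp <;> ring

lemma unspinV_spinV (α : Fin 4 → ℂ) : unspinV (spinV α) = α := by
  rw [spinV_eq]
  funext i
  fin_cases i <;> simp [unspinV] <;> ring_nf <;> simp

lemma spinV_unspinV (M : Matrix (Fin 2) (Fin 2) ℂ) : spinV (unspinV M) = M := by
  rw [spinV_eq]
  ext i j
  fin_cases i <;> fin_cases j <;> simp [unspinV] <;> ring_nf <;> simp <;> ring

theorem bijective_spin4 : Function.Bijective spin4 :=
  Function.bijective_iff_has_inverse.mpr ⟨unspin4, unspin4_spin4, spin4_unspin4⟩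

theorem bijective_spinV : Function.Bijective spinV :=
  Function.bijective_iff_has_inverse.mpr ⟨unspinV, unspinV_spinV, spinV_unspinV⟩

lemma spinE_symm (u : Fin 3 → ℂ) (C D : Fin 2) : spinE u C D = spinE u D C := by
  rw [spinE_eq]
  fin_cases C <;> fin_cases D <;> simp

lemma spin4_zero (u : Fin 3 → ℂ) : spin4 (0, u) = spinE u := by simp [spin4]

lemma spinE_unspin4 {M : Matrix (Fin 2) (Fin 2) ℂ} (hM : M 0 1 = M 1 0) :
    spinE (unspin4 M).2 = M := by
  have h := spin4_unspin4 M
  have e : unspin4 M = (0, (unspin4 M).2) := Prod.ext (by simp [unspin4, hM]) rfl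
  rwa [e, spin4_zero] at h

lemma unspin4_spinE (u : Fin 3 → ℂ) : (unspin4 (spinE u)).2 = u := by
  rw [← spin4_zero, unspin4_spin4]

/-- `spinA` is `spin4` on the first two indices, tensored with `spinE` on the last two. -/
theorem bijOn_spinA : Set.BijOn spinA Set.univ SymLast := by
  refine ⟨fun O _ A B C D => ?_, fun O _ O' _ h => ?_, fun Ψ hΨ => ?_⟩
  · rw [spinA_apply, spinA_apply, spinE_symm]
  · have h1 : ∀ i, spin4 (O i 0, fun j => O i j.succ) = spin4 (O' i 0, fun j => O' i j.succ) := by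
      intro i
      ext A B
      have h2 : spinE (fun i => spin4 (O i 0, fun j => O i j.succ) A B) =
          spinE (fun i => spin4 (O' i 0, fun j => O' i j.succ) A B) := by
        ext C D
        rw [← spinA_apply, ← spinA_apply, h]
      have h3 := congrArg (fun M => (unspin4 M).2) h2
      simp only [unspin4_spinE] at h3
      exact congrFun h3 i
    funext i a
    have h2 := bijective_spin4.1 (h1 i)
    refine Fin.cases (congrArg Prod.fst h2) (fun j => congrFun (congrArg Prod.snd h2) j) a
  · let N : Fin 3 → Matrix (Fin 2) (Fin 2) ℂ := fun i =>
      Matrix.of fun A B => (unspin4 (Matrix.of fun C D => Ψ A (B, C, D))).2 i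
    refine ⟨fun i => Fin.cons (unspin4 (N i)).1 (unspin4 (N i)).2, trivial, ?_⟩
    ext A ⟨B, C, D⟩
    rw [spinA_apply]
    simp only [Fin.cons_zero, Fin.cons_succ, Prod.mk.eta, spin4_unspin4]
    have h := spinE_unspin4 (M := Matrix.of fun C D => Ψ A (B, C, D)) (hΨ A B 0 1)
    exact congrFun (congrFun h C) D

/-- The part of `Ψ^{ABCD}` antisymmetric in `AB` gives the component in `E`; the rest is symmetric
in `AB` and in `CD`, hence a symmetric traceless tensor. -/
theorem bijOn_spin12 : Set.BijOn spin12 {p | p.2.IsSymm ∧ p.2.trace = 0} SymLast := by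
  have hE : ∀ p : (Fin 3 → ℂ) × Matrix (Fin 4) (Fin 4) ℂ, p.2.IsSymm → ∀ C D,
      spin12 p 0 (1, C, D) + spin12 p 0 (1, D, C) - spin12 p 1 (0, C, D) - spin12 p 1 (0, D, C) =
        4 * spinE p.1 C D := by
    intro p hp C D
    have h := fun a b => hp.apply a b
    have h01 := h 0 1; have h02 := h 0 2; have h03 := h 0 3
    have h12 := h 1 2; have h13 := h 1 3; have h23 := h 2 3
    simp only [spin12_apply, spinV_eq]
    fin_cases C <;> fin_cases D <;> simp [epsS, h01, h02, h03, h12, h13, h23, spinE_eq] <;> ring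
  refine ⟨fun p hp A B C D => ?_, fun p hp q hq h => ?_, fun Ψ hΨ => ?_⟩
  · have h := fun a b => hp.1.apply a b
    have h01 := h 0 1; have h02 := h 0 2; have h03 := h 0 3
    have h12 := h 1 2; have h13 := h 1 3; have h23 := h 2 3
    have ht : p.2 3 3 = -p.2 0 0 - p.2 1 1 - p.2 2 2 := by
      have := hp.2
      rw [Matrix.trace, Fin.sum_univ_four] at this
      simp only [Matrix.diag_apply] at this
      linear_combination this
    rw [spin12_apply, spin12_apply, spinE_symm]
    simp only [spinV_eq]
    fin_cases A <;> fin_cases B <;> fin_cases C <;> fin_cases D <;>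
      simp [h01, h02, h03, h12, h13, h23, ht] <;> ring_nf <;> simp <;> ring
  · have h1 : spinE p.1 = spinE q.1 := by
      ext C D
      have e1 := hE p hp.1 C D
      have e2 := hE q hq.1 C D
      rw [h] at e1
      have := e1.symm.trans e2
      exact mul_left_cancel₀ (by norm_num) this
    have h2 : p.1 = q.1 := by rw [← unspin4_spinE p.1, h1, unspin4_spinE]
    refine Prod.ext h2 (funext fun a => ?_)
    refine bijective_spinV.1 ?_
    ext B D
    have h3 : spinV (fun a => spinV (p.2 a) B D) = spinV (fun a => spinV (q.2 a) B D) := by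
      ext A C
      have := congrFun (congrFun h A) (B, C, D)
      rw [spin12_apply, spin12_apply, h1] at this
      exact sub_right_injective this
    exact congrFun (bijective_spinV.1 h3) a
  -- `spinE u` is half the contraction of `Ψ` over its first two indices, and `K` is the tensor of
  -- the remainder `X`, with the pairs of indices `AC` and `BD` converted to vector indices.
  · let u : Fin 3 → ℂ := (unspin4 (Matrix.of fun C D => (Ψ 0 (1, C, D) - Ψ 1 (0, C, D)) / 2)).2
    have hu : ∀ C D, spinE u C D = (Ψ 0 (1, C, D) - Ψ 1 (0, C, D)) / 2 := fun C D => by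
      have h := spinE_unspin4 (M := Matrix.of fun C D => (Ψ 0 (1, C, D) - Ψ 1 (0, C, D)) / 2)
        (by simp only [Matrix.of_apply]; rw [hΨ 0 1 0 1, hΨ 1 0 0 1])
      exact congrFun (congrFun h C) D
    let X : Fin 2 → Fin 2 → Fin 2 → Fin 2 → ℂ := fun A B C D =>
      epsS A B * spinE u C D - Ψ A (B, C, D)
    let K : Matrix (Fin 4) (Fin 4) ℂ := Matrix.of fun a b =>
      unspinV (Matrix.of fun A C => unspinV (Matrix.of fun B D => X A B C D) b) a
    have hX : ∀ A B C D, X A B C D = X A B D C := fun A B C D => by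
      simp only [X]
      rw [spinE_symm, hΨ]
    -- Symmetry in the first pair and in the last pair makes `K` symmetric and traceless.
    have hX2 : ∀ C D, X 0 1 C D = X 1 0 C D := fun C D => by
      simp only [X, hu]
      simp [epsS]
      ring
    have a1 := hX 0 0 0 1; have a2 := hX 1 1 0 1; have a3 := hX 1 0 0 1
    refine ⟨(u, K), ⟨?_, ?_⟩, ?_⟩
    · ext a b
      simp only [Matrix.transpose_apply]
      simp only [K, Matrix.of_apply, unspinV]
      fin_cases a <;> fin_cases b <;> simp [a1, a2, a3, hX2] <;> ring
    · simp only [K, Matrix.trace, Fin.sum_univ_four, Matrix.diag_apply, Matrix.of_apply, unspinV]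
      simp [a1, a2, a3, hX2]
      ring_nf
      simp
    · ext A ⟨B, C, D⟩
      have e : ∀ B D A C, spinV (fun a => spinV (K a) B D) A C = X A B C D := by
        intro B D A C
        have e1 : ∀ a, K a = unspinV (Matrix.of fun B D =>
            unspinV (Matrix.of fun A C => X A B C D) a) := by
          intro a
          funext b
          simp only [K, Matrix.of_apply, unspinV]
          fin_cases a <;> fin_cases b <;> simp <;> ring
        simp only [e1, spinV_unspinV, Matrix.of_apply]
      rw [spin12_apply]
      simp only [e]
      simp only [X]
      ring

end Spinors

/-! ### Adapted frames -/

/-- The coframe `(α, -J₁α, -J₂α, -J₃α)`, where `J_i` is the endomorphism `Σ^i` of `Λ¹`. -/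
def quatFrame (S : Trip) (α : Alt 1) : Fin 4 → Alt 1 :=
  ![α, -Jl S 0 α, -Jl S 1 α, -Jl S 2 α]

/-- For a unit 1-form, `quatFrame` is orthonormal and in standard position with respect to the
triple. -/
lemma IsPerfect.quatFrame_table {S : Trip} (hS : IsPerfect S) {α : Alt 1} (h1 : ip1 S α α = 1) :
    (∀ a b, ip1 S (quatFrame S α a) (quatFrame S α b) = if a = b then 1 else 0) ∧
    ∀ i a b, ip1 S (quatFrame S α a) (Jl S i (quatFrame S α b)) = eta i a b := by
  have h0 : ∀ i, ip1 S α (Jl S i α) = 0 := fun i => by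
    have h := hS.ip1_Jl i α α
    rw [hS.ip1_comm] at h
    linarith
  have hJ : ∀ i β, ip1 S (Jl S i α) β = -ip1 S α (Jl S i β) := fun i β => hS.ip1_Jl i α β
  have hn : ∀ β, ip1 S α (-β) = -ip1 S α β := fun β => map_neg (ip1L S α) β
  have hn' : ∀ β γ, ip1 S (-β) γ = -ip1 S β γ := fun β γ => (ip1L S).map_neg₂ β γ
  have hn2 : ∀ β γ, ip1 S β (-γ) = -ip1 S β γ := fun β γ => map_neg (ip1L S β) γ
  have t0 := fun α => hS.Jl_self 0 α
  have t1 := fun α => hS.Jl_self 1 α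
  have t2 := fun α => hS.Jl_self 2 α
  have t := hS.Jl_table
  have ta := fun α => (t α).1
  have tb := fun α => (t α).2.1
  have tc := fun α => (t α).2.2.1
  have td := fun α => (t α).2.2.2.1
  have te := fun α => (t α).2.2.2.2.1
  have tf := fun α => (t α).2.2.2.2.2
  constructor
  · intro a b
    fin_cases a <;> fin_cases b <;>
      simp [quatFrame, hJ, hn2, hn', h0, h1, t0, t1, t2, ta, tb, tc, td, te, tf]
  · intro i a b
    fin_cases i <;> fin_cases a <;> fin_cases b <;>
      simp [quatFrame, hJ, hn2, hn', h0, h1, t0, t1, t2, ta, tb, tc, td, te, tf, eta]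

/-- The vector which corresponds to a 1-form under the metric. -/
def sharp (S : Trip) (α : Alt 1) : V4 := WithLp.toLp 2 (gi S *ᵥ c1 α)

lemma sharp_apply (S : Trip) (α : Alt 1) (μ : Fin 4) : sharp S α μ = (gi S *ᵥ c1 α) μ := rfl

lemma apply_sharp (S : Trip) (α β : Alt 1) : α ![sharp S β] = ip1 S α β := by
  rw [ip1_eq, alt1_apply]
  exact Finset.sum_congr rfl fun μ _ => mul_comm _ _

lemma IsPerfect.apply_sharp_sharp {S : Trip} (hS : IsPerfect S) (i : Fin 3) (α β : Alt 1) :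
    S i ![sharp S α, sharp S β] = ip1 S α (Jl S i β) := by
  rw [ip1_eq, c1_Jl, alt2_apply, sgEnd, ← Matrix.mulVec_mulVec, Matrix.dotProduct_mulVec,
    ← Matrix.mulVec_transpose, hS.gi_transpose]
  simp only [sharp_apply]
  generalize gi S *ᵥ c1 α = u
  generalize gi S *ᵥ c1 β = v
  simp only [dotProduct, Matrix.mulVec, Finset.mul_sum, Matrix.of_apply]
  exact Finset.sum_congr rfl fun μ _ => Finset.sum_congr rfl fun ν _ => by ring

section Fields

variable {M : Type*} [TopologicalSpace M] [ChartedSpace V4 M] [IsManifold (𝓡 4) ∞ M]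
  {Sg : Fin 3 → Form M 2} (hSg : IsHyperkahlerTriple Sg)

/-- The first coordinate function of the chart at `x`. -/
def coordFn (x y : M) : ℝ := extChartAt (𝓡 4) x y 0

lemma smoothFn_coordFn (x : M) : SmoothFn (coordFn x) (extChartAt (𝓡 4) x).source := fun x₀ z hz =>
  ((dx 0).contDiff.contDiffAt.comp z (contDiffAt_trans (x₀ := x) (x₁ := x₀) hz)).contDiffWithinAt

lemma dfA_coordFn_ne_zero {x y : M} (hy : y ∈ (extChartAt (𝓡 4) x).source) :
    dfA (coordFn x) y ≠ 0 := by
  intro h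
  have hz : extChartAt (𝓡 4) x y ∈ dom x (extChartAt (𝓡 4) x).source :=
    ⟨(extChartAt (𝓡 4) x).map_source hy, by
      rw [Set.mem_preimage, (extChartAt (𝓡 4) x).left_inv hy]; exact hy⟩
  have h1 := pull_extFun (smoothFn_coordFn x) (isOpen_extChartAt_source x) hz
  have h2 : (fun z => coordFn x ((extChartAt (𝓡 4) x).symm z)) =ᶠ[𝓝 (extChartAt (𝓡 4) x y)]
      dx 0 := by
    filter_upwards [(isOpen_extChartAt_target x).mem_nhds hz.1] with z hz
    rw [coordFn, (extChartAt (𝓡 4) x).right_inv hz]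
    rfl
  rw [h2.fderiv_eq, ContinuousLinearMap.fderiv] at h1
  have h3 : pull (extFun (coordFn x)) x (extChartAt (𝓡 4) x y) =
      pb (chartD x (extChartAt (𝓡 4) x y)) (dfA (coordFn x)
        ((extChartAt (𝓡 4) x).symm (extChartAt (𝓡 4) x y))) := rfl
  rw [(extChartAt (𝓡 4) x).left_inv hy, h] at h3
  have h4 := congrFun (congrArg c1 (h1.symm.trans h3)) 0
  rw [c1_ofLin] at h4
  simp [c1] at h4

lemma IsHyperkahlerTriple.smooth_ip1 (hSg : IsHyperkahlerTriple Sg) {α β : M → Alt 1} {W : Set M}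
    (hα : SmoothA α W) (hβ : SmoothA β W) :
    SmoothFn (fun x => ip1 (val Sg x) (α x) (β x)) W := fun x₀ =>
  ((smoothA_one_iff.1 hα x₀).dotProduct
    (((hSg.smoothMat_gi x₀).restrict W).mulVec (smoothA_one_iff.1 hβ x₀))).congr fun z hz => by
      have e := ip1_pb (S := val Sg ((extChartAt (𝓡 4) x₀).symm z)) (det_chartD hz.1)
        (α ((extChartAt (𝓡 4) x₀).symm z)) (β ((extChartAt (𝓡 4) x₀).symm z))
      exact e.symm.trans (ip1_eq _ _ _)

include hSg

/-- Around each point there is an adapted frame: normalise the differential of a coordinate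
function to a unit 1-form `θ⁰`, and let the three complex structures act on it. -/
theorem exists_adaptedFrame (x : M) : ∃ W : Set M, x ∈ W ∧ Nonempty (AdaptedFrame Sg W) := by
  set W := (extChartAt (𝓡 4) x).source with hWdef
  have hW : IsOpen W := isOpen_extChartAt_source x
  set α : M → Alt 1 := dfA (coordFn x) with hα
  have hαs : SmoothA α W := (smoothFn_coordFn x).extFun hW
  have hpos : ∀ y ∈ W, 0 < ip1 (val Sg y) (α y) (α y) := fun y hy =>
    (hSg.perfect y).ip1_pos (dfA_coordFn_ne_zero hy)
  have hr : SmoothFn (fun y => 1 / √(ip1 (val Sg y) (α y) (α y))) W := fun x₀ => by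
    refine contDiffOn_const.div ((hSg.smooth_ip1 hαs hαs x₀).sqrt fun z hz => ?_) fun z hz => ?_
    · exact (hpos _ hz.2).ne'
    · exact (Real.sqrt_pos.2 (hpos _ hz.2)).ne'
  set β : M → Alt 1 := fun y => (1 / √(ip1 (val Sg y) (α y) (α y))) • α y with hβ
  have hβs : SmoothA β W := hαs.smul hr
  have hβ1 : ∀ y ∈ W, ip1 (val Sg y) (β y) (β y) = 1 := fun y hy => by
    have h := hpos y hy
    have h2 := Real.mul_self_sqrt h.le
    have h3 := (Real.sqrt_pos.2 h).ne'
    simp only [hβ, ← ip1L_apply, map_smul, LinearMap.smul_apply, smul_eq_mul]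
    simp only [ip1L_apply]
    field_simp
    rw [pow_two, h2]
  have hJs : ∀ i, SmoothA (-fun y => Jl (val Sg y) i (β y)) W := fun i => (hSg.smooth_Jl hβs i).neg
  refine ⟨W, mem_extChartAt_source x, ⟨{
    e := fun a y => sharp (val Sg y) (quatFrame (val Sg y) (β y) a)
    θ := fun a y => quatFrame (val Sg y) (β y) a
    isOpen := hW
    smooth := fun a => ?_
    dual := fun y hy a b => ?_
    std := fun y hy i a b => ?_ }⟩⟩
  · fin_cases a
    · exact hβs
    · exact hJs 0
    · exact hJs 1
    · exact hJs 2
  · exact (apply_sharp _ _ _).trans (((hSg.perfect y).quatFrame_table (hβ1 y hy)).1 a b)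
  · exact ((hSg.perfect y).apply_sharp_sharp i _ _).trans
      (((hSg.perfect y).quatFrame_table (hβ1 y hy)).2 i a b)

end Fields

/-! ### Calculus in an adapted frame -/

/-- The standard triple on `V4`. -/
def stdT : Trip := fun i => mk2 (eta i)

lemma eta_eq_asm : eta = ![asm 1 0 0 0 0 (-1), asm 0 1 0 0 1 0, asm 0 0 1 (-1) 0 0] := by
  funext i
  fin_cases i <;> simp [eta, asm]

lemma eta_transpose (i : Fin 3) : (eta i)ᵀ = -eta i := by
  rw [eta_eq_asm]
  fin_cases i <;> exact asm_transpose _ _ _ _ _ _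

lemma m2_stdT (i : Fin 3) : m2 (stdT i) = eta i := m2_mk2 _ (eta_transpose i)

lemma vol_stdT : vol stdT = -1 := by
  simp only [vol, wedge22_eq, m2_stdT, Fin.sum_univ_three, eta_eq_asm]
  simp [wd_asm]
  norm_num

/-- The standard metric; positivity of the standard triple is not needed separately, as it is
inherited from the triple on the manifold through a frame. -/
lemma gm_stdT (h : IsPerfect stdT) : gm stdT = 1 := by
  rw [h.gm_eq, vol_stdT, m2_stdT, m2_stdT, m2_stdT, eta_eq_asm]
  simp only [Matrix.cons_val_zero, Matrix.cons_val_one, Matrix.cons_val, til_asm]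
  ext i j
  fin_cases i <;> fin_cases j <;> simp [asm]

lemma gi_stdT (h : IsPerfect stdT) : gi stdT = 1 := by rw [gi, gm_stdT h, inv_one]

/-- A 2-form, as a bilinear map. -/
def alt2L (η : Alt 2) : V4 →ₗ[ℝ] V4 →ₗ[ℝ] ℝ := LinearMap.mk₂ ℝ (fun v w => η ![v, w])
  (fun _ _ _ => by simp [alt2_apply, add_mul, Finset.sum_add_distrib])
  (fun _ _ _ => by simp [alt2_apply, Finset.mul_sum, mul_assoc])
  (fun _ _ _ => by simp [alt2_apply, mul_add, add_mul, Finset.sum_add_distrib])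
  (fun _ _ _ => by simp [alt2_apply, Finset.mul_sum, mul_assoc, mul_left_comm])

lemma alt2L_apply (η : Alt 2) (v w : V4) : alt2L η v w = η ![v, w] := rfl

lemma pb_one_apply (A : V4 →L[ℝ] V4) (α : Alt 1) (v : V4) : pb A α ![v] = α ![A v] := by
  rw [ContinuousAlternatingMap.compContinuousLinearMap_apply]
  congr 1
  ext i
  fin_cases i
  rfl

lemma pb_two_apply (A : V4 →L[ℝ] V4) (η : Alt 2) (v w : V4) :
    pb A η ![v, w] = η ![A v, A w] := by
  rw [ContinuousAlternatingMap.compContinuousLinearMap_apply]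
  congr 1
  ext i
  fin_cases i <;> rfl

lemma pb_three_apply (A : V4 →L[ℝ] V4) (η : Alt 3) (u v w : V4) :
    pb A η ![u, v, w] = η ![A u, A v, A w] := by
  rw [ContinuousAlternatingMap.compContinuousLinearMap_apply]
  congr 1
  ext i
  fin_cases i <;> rfl

lemma apply_eq_lmat_mulVec (A : V4 →L[ℝ] V4) (v : V4) (μ : Fin 4) :
    A v μ = (lmat A *ᵥ fun ν => v ν) μ := by
  conv_lhs => rw [sum_bv v]
  simp only [map_sum, map_smul, Matrix.mulVec, dotProduct, lmat, Matrix.of_apply]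
  rw [WithLp.ofLp_sum, Finset.sum_apply]
  exact Finset.sum_congr rfl fun ν _ => mul_comm _ _

lemma sharp_pb {A : V4 →L[ℝ] V4} (hA : (lmat A).det ≠ 0) (S : Trip) (α : Alt 1) :
    A (sharp (pbT A S) (pb A α)) = sharp S α := by
  ext μ
  have e : (fun ν => sharp (pbT A S) (pb A α) ν) = gi (pbT A S) *ᵥ c1 (pb A α) := rfl
  have h1 : lmat A * (lmat A)⁻¹ = 1 := lmat_mul_inv hA
  have h2 := lmat_transpose_inv_mul hA
  rw [apply_eq_lmat_mulVec, e, gi_pb hA, c1_pb, Matrix.mulVec_mulVec, Matrix.mulVec_mulVec,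
    sharp_apply]
  congr 1
  calc _ = lmat A * (lmat A)⁻¹ * gi S * ((lmat A)ᵀ⁻¹ * (lmat A)ᵀ) := by simp only [mul_assoc]
    _ = _ := by rw [h1, h2, one_mul, mul_one]

section Fields

variable {M : Type*} [TopologicalSpace M] [ChartedSpace V4 M]
  {Sg : Fin 3 → Form M 2} {W : Set M}

namespace AdaptedFrame

variable (F : AdaptedFrame Sg W)

/-- The frame vectors, as vectors of the model space. -/
def vec (a : Fin 4) (x : M) : V4 := F.e a x

/-- The coframe, as forms on the model space. -/
def cof (a : Fin 4) : M → Alt 1 := F.θ a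

/-- The linear isomorphism from `V4` which the frame defines. -/
def map (x : M) : V4 →L[ℝ] V4 := ∑ a, (dx a).smulRight (F.vec a x)

lemma map_bv (x : M) (a : Fin 4) : F.map x (bv a) = F.vec a x := by
  simp [map]

variable {x : M}

lemma cof_vec (hx : x ∈ W) (a b : Fin 4) :
    F.cof a x ![F.vec b x] = if a = b then 1 else 0 := F.dual x hx a b

lemma pbT_map (hx : x ∈ W) : pbT (F.map x) (val Sg x) = stdT := by
  funext i
  refine alt2_ext ?_
  rw [m2_stdT]
  ext a b
  rw [m2_apply, c2, pb_two_apply, F.map_bv, F.map_bv]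
  exact F.std x hx i a b

lemma cof_mul_map (hx : x ∈ W) :
    (Matrix.of fun a => c1 (F.cof a x)) * lmat (F.map x) = 1 := by
  ext a b
  rw [Matrix.one_apply, ← F.cof_vec hx a b, alt1_apply, Matrix.mul_apply]
  refine Finset.sum_congr rfl fun μ _ => ?_
  rw [Matrix.of_apply, lmat, Matrix.of_apply, F.map_bv, mul_comm]
  rfl

lemma det_map (hx : x ∈ W) : (lmat (F.map x)).det ≠ 0 := by
  intro h
  have := congrArg Matrix.det (F.cof_mul_map hx)
  rw [Matrix.det_mul, h, mul_zero, Matrix.det_one] at this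
  exact zero_ne_one this

lemma sum_vec (hx : x ∈ W) (v : V4) : v = ∑ a, F.cof a x ![v] • F.vec a x := by
  have h := mul_eq_one_comm.mp (F.cof_mul_map hx)
  have e : ∑ a, F.cof a x ![v] • F.vec a x = F.map x (WithLp.toLp 2 fun a => F.cof a x ![v]) := by
    simp only [map, sum_apply, ContinuousLinearMap.smulRight_apply]
    rfl
  have e2 : (fun a => F.cof a x ![v]) = (Matrix.of fun a => c1 (F.cof a x)) *ᵥ fun μ => v μ := by
    funext a
    rw [alt1_apply]
    exact Finset.sum_congr rfl fun μ _ => mul_comm _ _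
  ext μ
  rw [e, apply_eq_lmat_mulVec]
  change v μ = (lmat (F.map x) *ᵥ fun a => F.cof a x ![v]) μ
  rw [e2, Matrix.mulVec_mulVec, h, Matrix.one_mulVec]

lemma alt2_expand (hx : x ∈ W) (η : Alt 2) (v w : V4) : η ![v, w] =
    ∑ a, ∑ b, η ![F.vec a x, F.vec b x] * F.cof a x ![v] * F.cof b x ![w] := by
  have h := congrArg₂ (fun v w => alt2L η v w) (F.sum_vec hx v) (F.sum_vec hx w)
  refine h.trans ?_
  simp only [map_sum, map_smul, LinearMap.sum_apply, LinearMap.smul_apply, smul_eq_mul,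
    alt2L_apply, Finset.mul_sum]
  rw [Finset.sum_comm]
  exact Finset.sum_congr rfl fun a _ => Finset.sum_congr rfl fun b _ => by ring

include F in
lemma isPerfect_stdT (hP : IsPerfect (val Sg x)) (hx : x ∈ W) : IsPerfect stdT := by
  rw [← F.pbT_map hx]
  exact isPerfect_pb (F.det_map hx) hP

lemma vec_eq_sharp (hP : IsPerfect (val Sg x)) (hx : x ∈ W) (a : Fin 4) :
    F.vec a x = sharp (val Sg x) (F.cof a x) := by
  rw [← sharp_pb (F.det_map hx), ← F.map_bv, F.pbT_map hx]
  congr 1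
  ext b
  rw [sharp_apply, gi_stdT (F.isPerfect_stdT hP hx), Matrix.one_mulVec, c1, pb_one_apply,
    F.map_bv, F.cof_vec hx, bv_apply]

end AdaptedFrame

end Fields

section Fields

variable {M : Type*} [TopologicalSpace M] [ChartedSpace V4 M] [IsManifold (𝓡 4) ∞ M]
  {Sg : Fin 3 → Form M 2} {W : Set M}

/-- A 2-tensor, typed as a map to the bilinear forms on the model space. -/
def tenB (k : Ten2 M) : M → Bil := k

lemma SmoothA.smoothVec_sharp (hSg : IsHyperkahlerTriple Sg) {α : M → Alt 1} (hα : SmoothA α W)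
    (x₀ : M) : SmoothVec (dom x₀ W) fun z μ => sharp (pullT Sg x₀ z) (coord α x₀ z) μ :=
  ((hSg.smoothMat_gi x₀).restrict W).mulVec (smoothA_one_iff.1 hα x₀)

lemma chartD_sharp {α : M → Alt 1} {x₀ : M} {z : V4} (hz : z ∈ dom x₀ W) :
    chartD x₀ z (sharp (pullT Sg x₀ z) (coord α x₀ z)) =
      sharp (val Sg ((extChartAt (𝓡 4) x₀).symm z)) (α ((extChartAt (𝓡 4) x₀).symm z)) :=
  sharp_pb (det_chartD hz.1) _ _

lemma SmoothA.apply_sharp_sharp (hSg : IsHyperkahlerTriple Sg) {η : M → Alt 2} {α β : M → Alt 1}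
    (hη : SmoothA η W) (hα : SmoothA α W) (hβ : SmoothA β W) :
    SmoothFn (fun y => η y ![sharp (val Sg y) (α y), sharp (val Sg y) (β y)]) W := fun x₀ => by
  refine ContDiffOn.congr (f := fun z => ∑ μ, ∑ ν, sharp (pullT Sg x₀ z) (coord α x₀ z) μ *
    sharp (pullT Sg x₀ z) (coord β x₀ z) ν * c2 (coord η x₀ z) μ ν) ?_ fun z hz => ?_
  · exact ContDiffOn.sum fun μ _ => ContDiffOn.sum fun ν _ =>
      ((hα.smoothVec_sharp hSg x₀ μ).mul (hβ.smoothVec_sharp hSg x₀ ν)).mul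
        (smoothA_two_iff.1 hη x₀ μ ν)
  · rw [← alt2_apply, coord, pb_two_apply, chartD_sharp hz, chartD_sharp hz]

lemma SmoothTen.apply_sharp_sharp (hSg : IsHyperkahlerTriple Sg) {k : Ten2 M} {α β : M → Alt 1}
    (hk : SmoothTen k) (hα : SmoothA α W) (hβ : SmoothA β W) :
    SmoothFn (fun y => tenB k y (sharp (val Sg y) (α y)) (sharp (val Sg y) (β y))) W :=
  fun x₀ => by
  refine ContDiffOn.congr (f := fun z => ∑ μ, ∑ ν, sharp (pullT Sg x₀ z) (coord α x₀ z) μ *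
    sharp (pullT Sg x₀ z) (coord β x₀ z) ν * kmat (pullTen k x₀ z) μ ν) ?_ fun z hz => ?_
  · exact ContDiffOn.sum fun μ _ => ContDiffOn.sum fun ν _ =>
      ((hα.smoothVec_sharp hSg x₀ μ).mul (hβ.smoothVec_sharp hSg x₀ ν)).mul
        ((((hk x₀).clm_apply contDiffOn_const).clm_apply contDiffOn_const).mono fun _ hz => hz.1)
  · have e : pullTen k x₀ z = (tenB k ((extChartAt (𝓡 4) x₀).symm z)).bilinearComp
        (chartD x₀ z) (chartD x₀ z) := rfl
    rw [← bil_apply, e, ContinuousLinearMap.bilinearComp_apply, chartD_sharp hz,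
      chartD_sharp hz]

namespace AdaptedFrame

variable (F : AdaptedFrame Sg W)

omit [IsManifold (𝓡 4) ∞ M] in
lemma smooth_cof (a : Fin 4) : SmoothA (F.cof a) W := F.smooth a

lemma smoothFn_alt2 (hSg : IsHyperkahlerTriple Sg) {η : M → Alt 2} (hη : SmoothA η W)
    (a b : Fin 4) : SmoothFn (fun y => η y ![F.vec a y, F.vec b y]) W := fun x₀ =>
  (hη.apply_sharp_sharp hSg (F.smooth_cof a) (F.smooth_cof b) x₀).congr fun z hz => by
    beta_reduce
    rw [F.vec_eq_sharp (hSg.perfect _) hz.2, F.vec_eq_sharp (hSg.perfect _) hz.2]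

lemma smoothFn_ten (hSg : IsHyperkahlerTriple Sg) {k : Ten2 M} (hk : SmoothTen k)
    (a b : Fin 4) : SmoothFn (fun y => tenB k y (F.vec a y) (F.vec b y)) W := fun x₀ =>
  (hk.apply_sharp_sharp hSg (F.smooth_cof a) (F.smooth_cof b) x₀).congr fun z hz => by
    beta_reduce
    rw [F.vec_eq_sharp (hSg.perfect _) hz.2, F.vec_eq_sharp (hSg.perfect _) hz.2]

/-- The derivative of a function along the frame vector `e_a`. -/
def D (f : M → ℝ) (x : M) (a : Fin 4) : ℝ := dfA f x ![F.vec a x]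

lemma D_eq {f : M → ℝ} (hf : SmoothFn f W) {x : M} (hx : x ∈ W) (a : Fin 4) : F.D f x a =
    fderiv ℝ (fun z => f ((extChartAt (𝓡 4) x).symm z)) (extChartAt (𝓡 4) x x) (F.vec a x) := by
  have h := pull_extFun hf F.isOpen (center_mem_dom hx)
  rw [pull_self] at h
  have h2 : dfA f x = ofLin (fderiv ℝ (fun z => f ((extChartAt (𝓡 4) x).symm z))
      (extChartAt (𝓡 4) x x)) := h
  rw [D, h2]
  rfl

variable {x : M}

omit [IsManifold (𝓡 4) ∞ M] in
lemma str_eq (hx : x ∈ W) (d a b : Fin 4) : F.str x d a b =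
    fderiv ℝ (fun z => coord (F.cof d) x z ![F.vec b x]) (extChartAt (𝓡 4) x x) (F.vec a x) -
      fderiv ℝ (fun z => coord (F.cof d) x z ![F.vec a x]) (extChartAt (𝓡 4) x x) (F.vec b x) :=
  extDeriv_apply_one ((F.smooth d).differentiableAt F.isOpen (center_mem_dom hx)) _ _

omit [IsManifold (𝓡 4) ∞ M] in
lemma str_swap (x : M) (d a b : Fin 4) : F.str x d a b = -F.str x d b a :=
  alt2_swap (ext (F.θ d) x) (F.e a x) (F.e b x)

/-- The derivative along `u` of the components of a 2-form in the chart, evaluated on two frame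
vectors which are kept constant in the chart. -/
lemma fderiv_coord_two (hSg : IsHyperkahlerTriple Sg) {η : M → Alt 2} (hη : SmoothA η W)
    (hx : x ∈ W) (c a b : Fin 4) :
    fderiv ℝ (fun z => coord η x z ![F.vec a x, F.vec b x]) (extChartAt (𝓡 4) x x) (F.vec c x) =
      F.D (fun y => η y ![F.vec a y, F.vec b y]) x c +
        ∑ d, (η x ![F.vec d x, F.vec b x] *
          fderiv ℝ (fun z => coord (F.cof d) x z ![F.vec a x]) (extChartAt (𝓡 4) x x) (F.vec c x) +
        η x ![F.vec a x, F.vec d x] *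
          fderiv ℝ (fun z => coord (F.cof d) x z ![F.vec b x]) (extChartAt (𝓡 4) x x)
            (F.vec c x)) := by
  set z₀ := extChartAt (𝓡 4) x x with hz₀
  have hz := center_mem_dom hx
  set B : Fin 4 → Fin 4 → V4 → ℝ := fun d f z =>
    η ((extChartAt (𝓡 4) x).symm z) ![F.vec d ((extChartAt (𝓡 4) x).symm z),
      F.vec f ((extChartAt (𝓡 4) x).symm z)] with hB
  have hBd : ∀ d f, DifferentiableAt ℝ (B d f) z₀ := fun d f =>
    (F.smoothFn_alt2 hSg hη d f).differentiableAt F.isOpen hz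
  have hC : ∀ d (v : V4), DifferentiableAt ℝ (fun z => coord (F.cof d) x z ![v]) z₀ := fun d v =>
    ((ContinuousAlternatingMap.apply ℝ V4 ℝ ![v]).differentiableAt).comp z₀
      ((F.smooth d).differentiableAt F.isOpen hz)
  have e : (fun z => coord η x z ![F.vec a x, F.vec b x]) =ᶠ[𝓝 z₀] fun z => ∑ d, ∑ f,
      B d f z * coord (F.cof d) x z ![F.vec a x] * coord (F.cof f) x z ![F.vec b x] := by
    filter_upwards [(isOpen_dom x F.isOpen).mem_nhds hz] with z hz
    simp only [coord, pb_two_apply, pb_one_apply]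
    exact F.alt2_expand hz.2 _ _ _
  have e0 : ∀ d f, coord (F.cof d) x z₀ ![F.vec f x] = if d = f then 1 else 0 := fun d f => by
    rw [coord_self, F.cof_vec hx]
  have eB : ∀ d f, B d f z₀ = η x ![F.vec d x, F.vec f x] := fun d f => by
    simp only [hB, hz₀, extChartAt_to_inv]
  have eD : ∀ d f, fderiv ℝ (B d f) z₀ (F.vec c x) =
      F.D (fun y => η y ![F.vec d y, F.vec f y]) x c := fun d f =>
    (F.D_eq (F.smoothFn_alt2 hSg hη d f) hx c).symm
  have hT : ∀ d f, HasFDerivAt (fun z => B d f z * coord (F.cof d) x z ![F.vec a x] *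
      coord (F.cof f) x z ![F.vec b x]) _ z₀ := fun d f =>
    ((hBd d f).hasFDerivAt.mul (hC d _).hasFDerivAt).mul (hC f _).hasFDerivAt
  have hS := HasFDerivAt.fun_sum (u := Finset.univ) fun d _ =>
    HasFDerivAt.fun_sum (u := Finset.univ) fun f _ => hT d f
  rw [e.fderiv_eq, hS.fderiv]
  simp only [sum_apply, add_apply, smul_apply, smul_eq_mul, Pi.mul_apply, e0, eB, eD]
  simp only [mul_add, mul_ite, ite_mul, mul_one, mul_zero, zero_mul, Finset.sum_add_distrib,
    Finset.sum_ite_eq', Finset.mem_univ, if_true, one_mul]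
  rw [Finset.sum_comm]
  simp only [Finset.sum_ite_eq', Finset.mem_univ, if_true]
  rw [Finset.sum_comm (f := fun d f => if d = a then if f = b then
    F.D (fun y => η y ![F.vec d y, F.vec f y]) x c else 0 else 0)]
  simp only [Finset.sum_ite_eq', Finset.mem_univ, if_true]
  ring

/-- The exterior derivative of a 2-form, in terms of its components along the frame. -/
lemma ext_apply (hSg : IsHyperkahlerTriple Sg) {η : M → Alt 2} (hη : SmoothA η W)
    (hx : x ∈ W) (a b c : Fin 4) : extA η x ![F.vec a x, F.vec b x, F.vec c x] =
      F.D (fun y => η y ![F.vec b y, F.vec c y]) x a -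
        F.D (fun y => η y ![F.vec a y, F.vec c y]) x b +
        F.D (fun y => η y ![F.vec a y, F.vec b y]) x c +
        ∑ d, (η x ![F.vec d x, F.vec c x] * F.str x d a b +
          η x ![F.vec b x, F.vec d x] * F.str x d a c -
          η x ![F.vec a x, F.vec d x] * F.str x d b c) := by
  have h := extDeriv_apply_two (SmoothForm.differentiableAt (M := M) hη F.isOpen
    (center_mem_dom hx)) (F.vec a x) (F.vec b x) (F.vec c x)
  refine Eq.trans h ?_
  have e1 := F.fderiv_coord_two hSg hη hx a b c
  have e2 := F.fderiv_coord_two hSg hη hx b a c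
  have e3 := F.fderiv_coord_two hSg hη hx c a b
  refine (congrArg₂ (· + ·) (congrArg₂ (· - ·) e1 e2) e3).trans ?_
  have s : ∀ d, η x ![F.vec d x, F.vec b x] = -η x ![F.vec b x, F.vec d x] := fun d =>
    alt2_swap _ _ _
  simp only [F.str_eq hx, Fin.sum_univ_four, s]
  ring

end AdaptedFrame

end Fields

/-! ### The connection in an adapted frame -/

section Fields

variable {M : Type*} [TopologicalSpace M] [ChartedSpace V4 M]
  {Sg : Fin 3 → Form M 2} {W : Set M} (F : AdaptedFrame Sg W) {x : M}

namespace AdaptedFrame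

lemma D_def (f : M → ℝ) (x : M) (a : Fin 4) : F.D f x a =
    (show V4 →L[ℝ] ℝ from mfderiv (𝓡 4) 𝓘(ℝ, ℝ) f x) (F.vec a x) := rfl

lemma D_congr {f g : M → ℝ} (h : ∀ y ∈ W, f y = g y) (hx : x ∈ W) (a : Fin 4) :
    F.D f x a = F.D g x a := by
  have e : f =ᶠ[𝓝 x] g := by
    filter_upwards [F.isOpen.mem_nhds hx] with y hy using h y hy
  rw [D_def, D_def, e.mfderiv_eq]

lemma D_const (r : ℝ) (a : Fin 4) : F.D (fun _ => r) x a = 0 := by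
  rw [D_def, mfderiv_const]
  rfl

variable [IsManifold (𝓡 4) ∞ M]

/-- Derivatives along the frame commute with linear maps. -/
lemma mfderiv_clm {ι E : Type*} [Fintype ι] [NormedAddCommGroup E] [NormedSpace ℝ E]
    (l : (ι → ℝ) →L[ℝ] E) {f : ι → M → ℝ} (hf : ∀ j, SmoothFn (f j) W) (hx : x ∈ W) (a : Fin 4) :
    (show V4 →L[ℝ] E from mfderiv (𝓡 4) 𝓘(ℝ, E) (fun y => l fun j => f j y) x) (F.vec a x) =
      l fun j => F.D (f j) x a := by
  have hG : MDifferentiableAt (𝓡 4) 𝓘(ℝ, ι → ℝ) (fun y j => f j y) x :=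
    (mdifferentiableAt_iff _ _).2
      ⟨continuousAt_pi.2 fun j => ((hf j).mdifferentiableAt F.isOpen hx).continuousAt,
        differentiableWithinAt_pi.2 fun j =>
          ((mdifferentiableAt_iff _ _).1 ((hf j).mdifferentiableAt F.isOpen hx)).2⟩
  have h1 := mfderiv_comp x (l.differentiableAt.mdifferentiableAt (x := fun j => f j x)) hG
  have h2 : ∀ j, F.D (f j) x a = (show V4 →L[ℝ] (ι → ℝ) from
      mfderiv (𝓡 4) 𝓘(ℝ, ι → ℝ) (fun y j => f j y) x) (F.vec a x) j := fun j => by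
    have h := mfderiv_comp x ((ContinuousLinearMap.proj (R := ℝ) (φ := fun _ : ι => ℝ)
      j).differentiableAt.mdifferentiableAt (x := fun j => f j x)) hG
    rw [mfderiv_eq_fderiv, ContinuousLinearMap.fderiv] at h
    rw [D_def]
    exact congrArg (fun L : V4 →L[ℝ] ℝ => L (F.vec a x)) h
  simp only [h2]
  rw [mfderiv_eq_fderiv, ContinuousLinearMap.fderiv] at h1
  exact congrArg (fun L : V4 →L[ℝ] E => L (F.vec a x)) h1

/-- Derivatives of spinors along the frame commute with linear maps. -/
lemma deriv_linear {ι m n : Type} [Fintype ι] [DecidableEq ι]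
    (L : (ι → ℂ) →ₗ[ℂ] Matrix m n ℂ) {f : ι → M → ℝ} (hf : ∀ j, SmoothFn (f j) W) (hx : x ∈ W)
    (a : Fin 4) : F.deriv (fun y => L fun j => (f j y : ℂ)) x a =
      L fun j => (F.D (f j) x a : ℂ) := by
  ext p q
  let l : (ι → ℝ) →L[ℝ] ℂ := ∑ j, (ContinuousLinearMap.proj (R := ℝ) (φ := fun _ : ι => ℝ)
    j).smulRight (L (Pi.single j 1) p q)
  have hl : ∀ r : ι → ℝ, L (fun j => (r j : ℂ)) p q = l r := fun r => by
    have e : (fun j => (r j : ℂ)) = ∑ j, (r j : ℂ) • Pi.single j (1 : ℂ) := by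
      funext j
      simp [Finset.sum_apply, Pi.single_apply]
    rw [e, map_sum, Matrix.sum_apply]
    simp [l]
  rw [hl, deriv, Matrix.of_apply]
  have e : (fun y => L (fun j => (f j y : ℂ)) p q) = fun y => l fun j => f j y :=
    funext fun y => hl _
  change (show V4 →L[ℝ] ℂ from mfderiv (𝓡 4) 𝓘(ℝ, ℂ)
    (fun y => L (fun j => (f j y : ℂ)) p q) x) (F.vec a x) = _
  rw [e]
  exact F.mfderiv_clm l hf hx a

variable (hSg : IsHyperkahlerTriple Sg)

include hSg

/-- Closedness of the triple, in terms of the structure functions of the frame. -/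
lemma closed_str (hx : x ∈ W) (i : Fin 3) (a b c : Fin 4) :
    ∑ d, (eta i d c * F.str x d a b + eta i b d * F.str x d a c - eta i a d * F.str x d b c) =
      0 := by
  have h := F.ext_apply hSg ((hSg.smoothA i).mono W) hx a b c
  have h0 : extA (fun x => val Sg x i) x = 0 := hSg.extA_eq i x
  have hs : ∀ y ∈ W, ∀ a b, val Sg y i ![F.vec a y, F.vec b y] = eta i a b := fun y hy a b =>
    F.std y hy i a b
  have hD : ∀ a b c, F.D (fun y => val Sg y i ![F.vec a y, F.vec b y]) x c = 0 := fun a b c => by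
    rw [F.D_congr (fun y hy => hs y hy a b) hx, F.D_const]
  rw [h0, hD, hD, hD] at h
  simp only [hs x hx] at h
  simpa using h.symm

omit [IsManifold (𝓡 4) ∞ M] hSg in
lemma conn_swap (c a b : Fin 4) : F.conn x c a b = -F.conn x c b a := by
  simp only [conn, F.str_swap x c b a]
  ring

omit [IsManifold (𝓡 4) ∞ M] hSg in
lemma conn_self (c a : Fin 4) : F.conn x c a a = 0 := by
  have := F.conn_swap (x := x) c a a
  linarith

omit [IsManifold (𝓡 4) ∞ M] hSg in
/-- The connection has no torsion. -/
lemma str_eq_conn (d a b : Fin 4) : F.str x d a b = F.conn x b d a - F.conn x a d b := by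
  simp only [conn, F.str_swap x d b a, F.str_swap x b d a]
  ring

/-- The triple is parallel: the connection takes values in the anti-self-dual matrices. -/
lemma conn_asd (hx : x ∈ W) (c : Fin 4) : F.conn x c 0 1 = F.conn x c 2 3 ∧
    F.conn x c 0 2 = F.conn x c 3 1 ∧ F.conn x c 0 3 = F.conn x c 1 2 := by
  have h := F.closed_str hSg hx
  have s0 : ∀ a b, F.str x a b b = 0 := fun a b => by
    have := F.str_swap x a b b
    linarith
  have s1 := fun a => F.str_swap x a 1 0
  have s2 := fun a => F.str_swap x a 2 0
  have s3 := fun a => F.str_swap x a 3 0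
  have s4 := fun a => F.str_swap x a 2 1
  have s5 := fun a => F.str_swap x a 3 1
  have s6 := fun a => F.str_swap x a 3 2
  -- The components of `dΣ^i = 0` are linear relations among the structure functions, which imply
  -- those among the connection coefficients.
  have a0 := h 0 0 1 2; have a1 := h 0 0 1 3; have a2 := h 0 0 2 3; have a3 := h 0 1 2 3
  have b0 := h 1 0 1 2; have b1 := h 1 0 1 3; have b2 := h 1 0 2 3; have b3 := h 1 1 2 3
  have c0 := h 2 0 1 2; have c1 := h 2 0 1 3; have c2 := h 2 0 2 3; have c3 := h 2 1 2 3
  simp [Fin.sum_univ_four, eta] at a0 a1 a2 a3 b0 b1 b2 b3 c0 c1 c2 c3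
  simp only [conn]
  fin_cases c <;>
    simp only [Fin.zero_eta, Fin.mk_one, Fin.reduceFinMk, s0, s1, s2, s3, s4, s5, s6] <;>
    refine ⟨?_, ?_, ?_⟩ <;> linarith

/-- The spin connection on `S₊` vanishes: the matrices in the connection are anti-self-dual, and act
trivially on `S₊`. -/
lemma connP_eq_zero (hx : x ∈ W) (c : Fin 4) : F.connP x c = 0 := by
  obtain ⟨h1, h2, h3⟩ := F.conn_asd hSg hx c
  rw [F.conn_swap c 3 1] at h2
  have s1 := F.conn_swap (x := x) c 1 0
  have s2 := F.conn_swap (x := x) c 2 0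
  have s3 := F.conn_swap (x := x) c 3 0
  have s4 := F.conn_swap (x := x) c 2 1
  have s5 := F.conn_swap (x := x) c 3 1
  have s6 := F.conn_swap (x := x) c 3 2
  rw [h1] at s1
  rw [h2] at s2
  rw [h3] at s3
  rw [connP, cl_eq, clBar_eq]
  ext p q
  fin_cases p <;> fin_cases q <;>
    simp [Fin.sum_univ_four, F.conn_self, h1, h2, h3, s1, s2, s3, s4, s5, s6] <;> ring_nf

/-- The spin connection on `S₋`. -/
lemma connM_eq (hx : x ∈ W) (c : Fin 4) : F.connM x c =
    !![(F.conn x c 0 3 : ℂ) * Complex.I, F.conn x c 0 1 * Complex.I + F.conn x c 0 2;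
      F.conn x c 0 1 * Complex.I - F.conn x c 0 2, -(F.conn x c 0 3 * Complex.I)] := by
  obtain ⟨h1, h2, h3⟩ := F.conn_asd hSg hx c
  rw [F.conn_swap c 3 1] at h2
  have s1 := F.conn_swap (x := x) c 1 0
  have s2 := F.conn_swap (x := x) c 2 0
  have s3 := F.conn_swap (x := x) c 3 0
  have s4 := F.conn_swap (x := x) c 2 1
  have s5 := F.conn_swap (x := x) c 3 1
  have s6 := F.conn_swap (x := x) c 3 2
  rw [h1] at s1
  rw [h2] at s2
  rw [h3] at s3
  rw [connM, cl_eq, clBar_eq]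
  ext p q
  fin_cases p <;> fin_cases q <;>
    simp [Fin.sum_univ_four, F.conn_self, h1, h2, h3, s1, s2, s3, s4, s5, s6] <;> ring_nf

end AdaptedFrame

end Fields

/-! ### The block on `Λ⁰ ⊕ E` -/

open Complex in
/-- The symbol of `D₄`. -/
lemma spinV_symbol (p : Fin 4 → ℂ) (q : Fin 3 → Fin 4 → ℂ) :
    spinV (fun a => p a + ∑ i, ∑ b, (eta i a b : ℂ) * q i b) =
      ∑ a, clBar a * spin4 (p a, fun i => q i a) := by
  rw [clBar_eq]
  simp only [spinV_eq, spin4_eq]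
  ext A B
  fin_cases A <;> fin_cases B <;>
    simp [Fin.sum_univ_four, Fin.sum_univ_three, eta] <;> ring_nf <;> simp <;> ring

/-- `spin4`, as a linear map. -/
def spin4L : (Fin 4 → ℂ) →ₗ[ℂ] Matrix (Fin 2) (Fin 2) ℂ where
  toFun r := spin4 (r 0, fun i => r i.succ)
  map_add' r s := by
    simp only [spin4, spinE, Pi.add_apply, add_smul, Finset.sum_add_distrib]
    abel
  map_smul' c r := by
    simp only [spin4, spinE, Pi.smul_apply, smul_eq_mul, mul_smul, Finset.smul_sum, smul_add,
      RingHom.id_apply]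

lemma spin4L_apply (r : Fin 4 → ℂ) : spin4L r = spin4 (r 0, fun i => r i.succ) := rfl

section Fields

variable {M : Type*} [TopologicalSpace M] [ChartedSpace V4 M]
  {Sg : Fin 3 → Form M 2} {W : Set M} (F : AdaptedFrame Sg W) {x : M}

namespace AdaptedFrame

lemma pb_map_one (α : Alt 1) (a : Fin 4) : c1 (pb (F.map x) α) a = α ![F.vec a x] := by
  rw [c1, pb_one_apply, F.map_bv]

lemma Jl_vec (hP : IsPerfect (val Sg x)) (hx : x ∈ W) (i : Fin 3) (β : Alt 1) (a : Fin 4) :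
    Jl (val Sg x) i β ![F.vec a x] = ∑ b, eta i a b * β ![F.vec b x] := by
  have h := F.isPerfect_stdT hP hx
  rw [← F.pb_map_one, ← Jl_pb (F.det_map hx), F.pbT_map hx, c1_Jl, sgEnd, gi_stdT h, mul_one]
  change (m2 (stdT i) *ᵥ _) a = _
  rw [m2_stdT]
  simp only [Matrix.mulVec, dotProduct, F.pb_map_one]

variable [IsManifold (𝓡 4) ∞ M] (hSg : IsHyperkahlerTriple Sg)

include hSg

/-- `D₄` is carried to the Dirac operator on `S₊ ⊗ S₊`. -/
theorem spinV_D4 {h : M → ℝ} {u : M → Fin 3 → ℝ} (hh : SmoothFn h Set.univ)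
    (hu : ∀ i, SmoothFn (fun x => u x i) Set.univ) (hx : x ∈ W) :
    spinV (F.comp (D4 Sg h u) x) =
      (-(1 / √2) : ℂ) • F.diracP F.connP (spinField4 h ((-2 : ℝ) • u)) x := by
  have hP := hSg.perfect x
  have e1 : ∀ a, F.comp (D4 Sg h u) x a = (-(1 / √2) : ℂ) * ((F.D h x a : ℂ) +
      ∑ i, ∑ b, (eta i a b : ℂ) * ((-2 : ℝ) * F.D (fun y => u y i) x b : ℝ)) := fun a => by
    have e2 : D4 Sg h u x ![F.e a x] = (-(1 / √2)) * (dfA h x ![F.vec a x] -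
        2 * (∑ i, Jl (val Sg x) i (dfA (fun y => u y i) x)) ![F.vec a x]) := by
      rw [← Phi_eq (val Sg x) (fun i => dfA (fun y => u y i) x)]
      rfl
    rw [comp, e2]
    simp only [Fin.sum_univ_three, ContinuousAlternatingMap.add_apply, F.Jl_vec hP hx]
    push_cast
    simp only [Fin.sum_univ_four, D]
    ring
  let f : Fin 4 → M → ℝ := Fin.cons h fun i y => -2 * u y i
  have hf : ∀ j, SmoothFn (f j) W := fun j => by
    refine Fin.cases (hh.mono W) (fun i => ?_) j
    exact ((hu i).mono W).const_mul (-2)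
  have e3 : spinField4 h ((-2 : ℝ) • u) = fun y => spin4L fun j => (f j y : ℂ) := by
    funext y
    simp [spinField4, spin4L_apply, f]
  have e4 : ∀ i a, F.D (fun y => -2 * u y i) x a = -2 * F.D (fun y => u y i) x a := fun i a => by
    have h := F.mfderiv_clm ((-2 : ℝ) • ContinuousLinearMap.proj (R := ℝ) (φ := fun _ : Fin 1 => ℝ)
      0) (f := fun _ y => u y i) (fun _ => (hu i).mono W) hx a
    exact h
  have e5 : F.diracP F.connP (spinField4 h ((-2 : ℝ) • u)) x = ∑ a, clBar a *
      spin4 (F.D h x a, fun i => ((-2 * F.D (fun y => u y i) x a : ℝ) : ℂ)) := by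
    rw [diracP]
    refine Finset.sum_congr rfl fun a _ => ?_
    rw [F.connP_eq_zero hSg hx, zero_mul, Matrix.transpose_zero, mul_zero, add_zero, add_zero, e3,
      F.deriv_linear spin4L hf hx, spin4L_apply]
    simp only [f, Fin.cons_zero, Fin.cons_succ, e4]
  rw [e5, ← spinV_symbol, funext e1]
  simp only [spinV, Finset.smul_sum, mul_smul]

end AdaptedFrame

end Fields

/-! ### The block on `E ⊕ Sym²₀(Λ¹)`: algebra -/

open Complex

set_option maxHeartbeats 4000000 in
/-- The symbol of `D₁₂`. -/
lemma spinA_symbol (v : Fin 3 → Fin 4 → ℂ) (Q : Fin 4 → Matrix (Fin 4) (Fin 4) ℂ)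
    (hs : ∀ c a b, Q c a b = Q c b a) (ht : ∀ c, Q c 3 3 = -Q c 0 0 - Q c 1 1 - Q c 2 2) :
    spinA (fun i a => v i a + ∑ b, ∑ d, (Q b a d * (eta i d b : ℂ) + (eta i a d : ℂ) * Q b d b)) =
      ∑ c, cl c * spin12 (fun i => v i c, Q c) := by
  have h1 := fun c => hs c 1 0
  have h2 := fun c => hs c 2 0
  have h3 := fun c => hs c 3 0
  have h4 := fun c => hs c 2 1
  have h5 := fun c => hs c 3 1
  have h6 := fun c => hs c 3 2
  ext A ⟨B, C, D⟩
  rw [Matrix.sum_apply, spinA_apply, spinE_eq]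
  simp only [Matrix.mul_apply, Fin.sum_univ_two, spin12_apply, spinV_eq, spinE_eq, spin4_eq, cl_eq,
    Fin.sum_univ_four]
  fin_cases A <;> fin_cases B <;> fin_cases C <;> fin_cases D <;>
    simp [eta, epsS, h1, h2, h3, h4, h5, h6, ht] <;> ring_nf <;> simp <;> ring

/-- The matrix of the spin connection on `S₋`, for an anti-self-dual connection form with
components `r`. -/
def spinConn (r : Fin 3 → ℝ) : Matrix (Fin 2) (Fin 2) ℂ :=
  !![(r 2 : ℂ) * I, r 0 * I + r 1; r 0 * I - r 1, -(r 2 * I)]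

/-- The anti-self-dual matrix with components `r`. -/
def asdMat (r : Fin 3 → ℝ) : Matrix (Fin 4) (Fin 4) ℝ := asm (r 0) (r 1) (r 2) (r 2) (-r 1) (r 0)

set_option maxHeartbeats 4000000 in
/-- The spin connection acts on `spin12` through the connection of the tangent bundle. -/
lemma spin12_conn (r : Fin 3 → ℝ) (w : Fin 3 → ℂ) (K : Matrix (Fin 4) (Fin 4) ℂ) :
    spinConn r * spin12 (w, K) +
      spin12 (w, K) * (spinConn r ⊗ₖ (1 : Matrix (Fin 2 × Fin 2) (Fin 2 × Fin 2) ℂ))ᵀ =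
    spin12 (0, (asdMat r).map (↑) * K - K * (asdMat r).map (↑)) := by
  ext A ⟨B, C, D⟩
  have e : (spin12 (w, K) * (spinConn r ⊗ₖ (1 : Matrix (Fin 2 × Fin 2) (Fin 2 × Fin 2) ℂ))ᵀ) A
      (B, C, D) = ∑ B', spinConn r B B' * spin12 (w, K) A (B', C, D) := by
    rw [Matrix.mul_apply, Fintype.sum_prod_type]
    refine Finset.sum_congr rfl fun B' _ => ?_
    simp [Matrix.one_apply, mul_comm]
  rw [Matrix.add_apply, e, Matrix.mul_apply]
  simp only [Fin.sum_univ_two, spin12_apply, spinV_eq, spinE_eq, spinConn, asdMat, asm]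
  fin_cases A <;> fin_cases B <;> fin_cases C <;> fin_cases D <;>
    simp [epsS, Matrix.mul_apply, Fin.sum_univ_four] <;> ring_nf <;> simp <;> ring


lemma asdMat_transpose (r : Fin 3 → ℝ) : (asdMat r)ᵀ = -asdMat r := asm_transpose _ _ _ _ _ _

/-- Self-dual and anti-self-dual matrices commute. -/
lemma asdMat_comm (r : Fin 3 → ℝ) (i : Fin 3) : asdMat r * eta i = eta i * asdMat r := by
  ext a b
  fin_cases i <;> fin_cases a <;> fin_cases b <;>
    simp [asdMat, asm, eta, Matrix.mul_apply, Fin.sum_univ_four]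

/-- For symmetric traceless `Q_c`, the dual of the total antisymmetrization of `Q_c η + η Q_c` is
its contraction. -/
lemma vec_cyclic (Q : Fin 4 → Matrix (Fin 4) (Fin 4) ℝ) (hs : ∀ c a b, Q c a b = Q c b a)
    (ht : ∀ c, Q c 3 3 = -Q c 0 0 - Q c 1 1 - Q c 2 2) (i : Fin 3)
    {Ω : Fin 4 → Fin 4 → Fin 4 → ℝ}
    (hΩ : ∀ a b c, Ω a b c = (Q a * eta i + eta i * Q a) b c - (Q b * eta i + eta i * Q b) a c +
      (Q c * eta i + eta i * Q c) a b) (a : Fin 4) :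
    (![Ω 1 2 3, -Ω 0 2 3, Ω 0 1 3, -Ω 0 1 2] : Fin 4 → ℝ) a =
      ∑ b, ∑ d, (Q b a d * eta i d b + eta i a d * Q b d b) := by
  have g1 := fun c => hs c 1 0
  have g2 := fun c => hs c 2 0
  have g3 := fun c => hs c 3 0
  have g4 := fun c => hs c 2 1
  have g5 := fun c => hs c 3 1
  have g6 := fun c => hs c 3 2
  simp only [hΩ, Matrix.add_apply, Matrix.mul_apply]
  fin_cases i <;> fin_cases a <;>
    simp [eta, Fin.sum_univ_four, g1, g2, g3, g4, g5, g6, ht] <;> ring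

/-- The components `0`, …, `3` of `⋆d(k ⋄ Σ^i)` in terms of the covariant derivative of `k`. -/
lemma vec_diamond (r : Fin 4 → Fin 3 → ℝ) (K : Matrix (Fin 4) (Fin 4) ℝ)
    (dK : Fin 4 → Matrix (Fin 4) (Fin 4) ℝ) (hs : Kᵀ = K) (i : Fin 3)
    {Q : Fin 4 → Matrix (Fin 4) (Fin 4) ℝ}
    (hQ : ∀ c, Q c = dK c + (asdMat (r c) * K - K * asdMat (r c)))
    (hQs : ∀ c a b, Q c a b = Q c b a)
    (hQt : ∀ c, Q c 3 3 = -Q c 0 0 - Q c 1 1 - Q c 2 2)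
    {Ω : Fin 4 → Fin 4 → Fin 4 → ℝ}
    (hΩ : ∀ a b c, Ω a b c = (dK a * eta i + eta i * dK a) b c - (dK b * eta i + eta i * dK b) a c +
      (dK c * eta i + eta i * dK c) a b + ∑ d,
        ((K * eta i + eta i * K) d c * (asdMat (r b) d a - asdMat (r a) d b) +
          (K * eta i + eta i * K) b d * (asdMat (r c) d a - asdMat (r a) d c) -
          (K * eta i + eta i * K) a d * (asdMat (r c) d b - asdMat (r b) d c))) (a : Fin 4) :
    (![Ω 1 2 3, -Ω 0 2 3, Ω 0 1 3, -Ω 0 1 2] : Fin 4 → ℝ) a =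
      ∑ b, ∑ d, (Q b a d * eta i d b + eta i a d * Q b d b) := by
  refine vec_cyclic Q hQs hQt i (fun a b c => ?_) a
  set B := K * eta i + eta i * K with hB
  have hBt : Bᵀ = -B := by
    rw [hB, Matrix.transpose_add, Matrix.transpose_mul, Matrix.transpose_mul, hs, eta_transpose]
    simp [add_comm]
  -- As the connection commutes with `η`, the covariant derivative passes to `K η + η K`.
  have hG : ∀ c, Q c * eta i + eta i * Q c =
      dK c * eta i + eta i * dK c + (asdMat (r c) * B - B * asdMat (r c)) := fun c => by
    have h := asdMat_comm (r c) i
    have h1 : asdMat (r c) * (eta i * K) = eta i * (asdMat (r c) * K) := by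
      rw [← mul_assoc, h, mul_assoc]
    have h2 : K * asdMat (r c) * eta i = K * eta i * asdMat (r c) := by
      rw [mul_assoc, h, mul_assoc]
    rw [hQ, hB, mul_add, add_mul, mul_add, add_mul, mul_sub, sub_mul, h1, h2]
    simp only [mul_assoc]
    abel
  have hA : ∀ c a d, asdMat (r c) d a = -asdMat (r c) a d := fun c a d =>
    congrFun (congrFun (asdMat_transpose (r c)) a) d
  have hT : ∀ c a b, (B * asdMat (r c)) b a = (asdMat (r c) * B) a b := fun c a b => by
    have h : (B * asdMat (r c))ᵀ = asdMat (r c) * B := by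
      rw [Matrix.transpose_mul, hBt, asdMat_transpose, neg_mul_neg]
    rw [← h, Matrix.transpose_apply]
  have hS : ∑ d, (B d c * (asdMat (r b) d a - asdMat (r a) d b) +
      B b d * (asdMat (r c) d a - asdMat (r a) d c) -
      B a d * (asdMat (r c) d b - asdMat (r b) d c)) =
      -(asdMat (r b) * B) a c + (asdMat (r a) * B) b c + (B * asdMat (r c)) b a -
        (B * asdMat (r a)) b c - (B * asdMat (r c)) a b + (B * asdMat (r b)) a c := by
    simp only [Matrix.mul_apply, hA b a, hA a b, ← Finset.sum_neg_distrib,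
      ← Finset.sum_add_distrib, ← Finset.sum_sub_distrib]
    exact Finset.sum_congr rfl fun d _ => by ring
  rw [hΩ, hS, hG, hG, hG, hT c a b]
  simp only [Matrix.add_apply, Matrix.sub_apply]
  ring

/-! ### The block on `E ⊕ Sym²₀(Λ¹)`: fields -/

lemma spin12_add (p q : (Fin 3 → ℂ) × Matrix (Fin 4) (Fin 4) ℂ) :
    spin12 (p + q) = spin12 p + spin12 q := by
  ext A ⟨B, C, D⟩
  simp only [spin12, Matrix.of_apply, Matrix.add_apply, Prod.fst_add, Prod.snd_add, spinE,
    Pi.add_apply, add_smul, Finset.sum_add_distrib, add_mul, mul_add]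
  ring

lemma spin12_smul (c : ℂ) (p : (Fin 3 → ℂ) × Matrix (Fin 4) (Fin 4) ℂ) :
    spin12 (c • p) = c • spin12 p := by
  ext A ⟨B, C, D⟩
  simp only [spin12, Matrix.of_apply, Matrix.smul_apply, Prod.smul_fst, Prod.smul_snd, spinE,
    Pi.smul_apply, smul_eq_mul, mul_smul, ← Finset.smul_sum, mul_assoc, ← Finset.mul_sum]
  ring

/-- `spin12`, as a linear map. -/
def spin12L : (Fin 3 ⊕ Fin 4 × Fin 4 → ℂ) →ₗ[ℂ] Matrix (Fin 2) (Fin 2 × Fin 2 × Fin 2) ℂ where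
  toFun r := spin12 (fun i => r (.inl i), Matrix.of fun a b => r (.inr (a, b)))
  map_add' r s := spin12_add (fun i => r (.inl i), Matrix.of fun a b => r (.inr (a, b)))
    (fun i => s (.inl i), Matrix.of fun a b => s (.inr (a, b)))
  map_smul' c r := spin12_smul c (fun i => r (.inl i), Matrix.of fun a b => r (.inr (a, b)))

section Fields

variable {M : Type*} [TopologicalSpace M] [ChartedSpace V4 M]
  {Sg : Fin 3 → Form M 2} {W : Set M} (F : AdaptedFrame Sg W) {x : M}

namespace AdaptedFrame

/-- The components of a 2-tensor along the frame. -/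
def mat (k : Ten2 M) (y : M) : Matrix (Fin 4) (Fin 4) ℝ :=
  Matrix.of fun a b => tenB k y (F.vec a y) (F.vec b y)

/-- The derivative along `e_c` of the components of a 2-tensor. -/
def dmat (k : Ten2 M) (x : M) (c : Fin 4) : Matrix (Fin 4) (Fin 4) ℝ :=
  Matrix.of fun a b => F.D (fun y => F.mat k y a b) x c

/-- The components of the connection form along `e_c`, which is anti-self-dual. -/
def connR (x : M) (c : Fin 4) : Fin 3 → ℝ := ![F.conn x c 0 1, F.conn x c 0 2, F.conn x c 0 3]

/-- The components of the covariant derivative of a 2-tensor along `e_c`. -/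
def nmat (k : Ten2 M) (x : M) (c : Fin 4) : Matrix (Fin 4) (Fin 4) ℝ :=
  F.dmat k x c + (asdMat (F.connR x c) * F.mat k x - F.mat k x * asdMat (F.connR x c))

lemma kmat_map (k : Ten2 M) (y : M) : kmat (pbB (F.map y) (tenB k y)) = F.mat k y := by
  ext a b
  change tenB k y (F.map y (bv a)) (F.map y (bv b)) = tenB k y (F.vec a y) (F.vec b y)
  rw [F.map_bv, F.map_bv]

lemma mat_transpose {k : Ten2 M} {y : M} (h0 : IsSym0 (val Sg y) (tenB k y)) :
    (F.mat k y)ᵀ = F.mat k y :=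
  Matrix.ext fun _ _ => h0.1 _ _

lemma trace_mat (hP : IsPerfect (val Sg x)) (hx : x ∈ W) {k : Ten2 M}
    (h0 : IsSym0 (val Sg x) (tenB k x)) : (F.mat k x).trace = 0 := by
  have e : (1 : Matrix (Fin 4) (Fin 4) ℝ) = (lmat (F.map x))⁻¹ * gi (val Sg x) *
      (lmat (F.map x))ᵀ⁻¹ := by
    rw [← gi_pb (F.det_map hx), F.pbT_map hx, gi_stdT (F.isPerfect_stdT hP hx)]
  have h1 := lmat_mul_inv (F.det_map hx)
  have h2 := lmat_transpose_inv_mul (F.det_map hx)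
  set L := lmat (F.map x)
  calc (F.mat k x).trace = (1 * F.mat k x).trace := by rw [one_mul]
    _ = (L⁻¹ * (gi (val Sg x) * (Lᵀ⁻¹ * Lᵀ) * kmat (tenB k x) * L)).trace := by
      rw [← F.kmat_map, kmat_pbB, e]
      simp only [mul_assoc, L]
    _ = (gi (val Sg x) * kmat (tenB k x)).trace := by
      rw [h2, mul_one, Matrix.trace_mul_comm, mul_assoc, h1, mul_one]
    _ = 0 := by rw [Matrix.trace_mul_comm, trace_kmat h0]

lemma diamond_vec (hP : IsPerfect (val Sg x)) (hx : x ∈ W) {k : Ten2 M}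
    (h0 : IsSym0 (val Sg x) (tenB k x)) (i : Fin 3) (b c : Fin 4) :
    diamond (val Sg x) (tenB k x) i ![F.vec b x, F.vec c x] =
      (F.mat k x * eta i + eta i * F.mat k x) b c := by
  have e : diamond (val Sg x) (tenB k x) i ![F.vec b x, F.vec c x] =
      m2 (pb (F.map x) (diamond (val Sg x) (tenB k x) i)) b c := by
    rw [m2_apply, c2, pb_two_apply, F.map_bv, F.map_bv]
  rw [e, ← diamond_pb (F.det_map hx), F.pbT_map hx, m2_diamond, F.kmat_map,
    gi_stdT (F.isPerfect_stdT hP hx), mul_one, m2_stdT, Matrix.transpose_mul, eta_transpose,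
    F.mat_transpose h0, neg_mul, sub_neg_eq_add]

/-- The sign comes from the orientation: `v_Σ = -θ⁰ ∧ θ¹ ∧ θ² ∧ θ³` for an adapted frame. -/
lemma star3_vec (hP : IsPerfect (val Sg x)) (hx : x ∈ W) (Ω : Alt 3) (a : Fin 4) :
    star3 (val Sg x) Ω ![F.vec a x] = -vec3 (pb (F.map x) Ω) a := by
  rw [← F.pb_map_one, ← star3_pb (F.det_map hx), F.pbT_map hx, c1_star3, vol_stdT,
    gm_stdT (F.isPerfect_stdT hP hx), Matrix.one_mulVec]
  simp

lemma c3_pb_map (Ω : Alt 3) (a b c : Fin 4) :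
    c3 (pb (F.map x) Ω) a b c = Ω ![F.vec a x, F.vec b x, F.vec c x] := by
  rw [c3, pb_three_apply, F.map_bv, F.map_bv, F.map_bv]

lemma vec3_pb_map (Ω : Alt 3) : vec3 (pb (F.map x) Ω) =
    ![Ω ![F.vec 1 x, F.vec 2 x, F.vec 3 x], -Ω ![F.vec 0 x, F.vec 2 x, F.vec 3 x],
      Ω ![F.vec 0 x, F.vec 1 x, F.vec 3 x], -Ω ![F.vec 0 x, F.vec 1 x, F.vec 2 x]] := by
  obtain ⟨h0, h1, h2, h3⟩ := vec3_apply (pb (F.map x) Ω)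
  simp only [F.c3_pb_map] at h0 h1 h2 h3
  funext a
  fin_cases a
  exacts [h0, h1, h2, h3]

variable [IsManifold (𝓡 4) ∞ M] (hSg : IsHyperkahlerTriple Sg)

include hSg

omit [IsManifold (𝓡 4) ∞ M] hSg in
lemma dmat_symm {k : Ten2 M} (h0 : ∀ y, IsSym0 (val Sg y) (tenB k y)) (c a b : Fin 4) :
    F.dmat k x c a b = F.dmat k x c b a := by
  have e : (fun y => F.mat k y a b) = fun y => F.mat k y b a :=
    funext fun y => congrFun (congrFun (F.mat_transpose (h0 y)) b) a
  rw [dmat, Matrix.of_apply, e, Matrix.of_apply]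

lemma smoothFn_mat {k : Ten2 M} (hk : SmoothTen k) (a b : Fin 4) :
    SmoothFn (fun y => F.mat k y a b) W := F.smoothFn_ten hSg hk a b

lemma trace_dmat {k : Ten2 M} (hk : SmoothTen k) (h0 : ∀ y, IsSym0 (val Sg y) (tenB k y))
    (hx : x ∈ W) (c : Fin 4) : (F.dmat k x c).trace = 0 := by
  have h := F.mfderiv_clm (∑ a, ContinuousLinearMap.proj (R := ℝ) (φ := fun _ : Fin 4 => ℝ) a)
    (f := fun a y => F.mat k y a a) (fun a => F.smoothFn_mat hSg hk a a) hx c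
  simp only [sum_apply, ContinuousLinearMap.proj_apply] at h
  refine h.symm.trans ?_
  exact (F.D_congr (fun y hy => F.trace_mat (hSg.perfect y) hy (h0 y)) hx c).trans (F.D_const 0 c)

omit [IsManifold (𝓡 4) ∞ M] hSg in
lemma nmat_symm {k : Ten2 M} (h0 : ∀ y, IsSym0 (val Sg y) (tenB k y)) (c a b : Fin 4) :
    F.nmat k x c a b = F.nmat k x c b a := by
  have h : (F.nmat k x c)ᵀ = F.nmat k x c := by
    have h1 : (F.dmat k x c)ᵀ = F.dmat k x c := Matrix.ext fun a b => F.dmat_symm h0 c b a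
    rw [nmat, Matrix.transpose_add, h1, Matrix.transpose_sub, Matrix.transpose_mul,
      Matrix.transpose_mul, F.mat_transpose (h0 x), asdMat_transpose]
    congr 1
    rw [mul_neg, neg_mul, neg_sub_neg]
  exact congrFun (congrFun h b) a

lemma nmat_three {k : Ten2 M} (hk : SmoothTen k) (h0 : ∀ y, IsSym0 (val Sg y) (tenB k y))
    (hx : x ∈ W) (c : Fin 4) :
    F.nmat k x c 3 3 = -F.nmat k x c 0 0 - F.nmat k x c 1 1 - F.nmat k x c 2 2 := by
  have h : (F.nmat k x c).trace = 0 := by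
    rw [nmat, Matrix.trace_add, F.trace_dmat hSg hk h0 hx, Matrix.trace_sub, Matrix.trace_mul_comm,
      sub_self, add_zero]
  rw [Matrix.trace, Fin.sum_univ_four] at h
  simp only [Matrix.diag_apply] at h
  linarith

lemma conn_eq_asdMat (hx : x ∈ W) (c a b : Fin 4) : F.conn x c a b = asdMat (F.connR x c) a b := by
  obtain ⟨h1, h2, h3⟩ := F.conn_asd hSg hx c
  have s := fun a b => F.conn_swap (x := x) c a b
  rw [s 3 1] at h2
  fin_cases a <;> fin_cases b <;>
    simp [asdMat, asm, connR, F.conn_self, s 1 0, s 2 0, s 3 0, s 2 1, s 3 1, s 3 2, h1, h2, h3]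

lemma D_diamond {k : Ten2 M} (hk : SmoothTen k) (h0 : ∀ y, IsSym0 (val Sg y) (tenB k y))
    (hx : x ∈ W) (i : Fin 3) (c a b : Fin 4) :
    F.D (fun y => diamond (val Sg y) (tenB k y) i ![F.vec a y, F.vec b y]) x c =
      (F.dmat k x c * eta i + eta i * F.dmat k x c) a b := by
  have h := F.mfderiv_clm (∑ d, (eta i d b • ContinuousLinearMap.proj (R := ℝ)
    (φ := fun _ : Fin 4 × Fin 4 => ℝ) (a, d) + eta i a d • ContinuousLinearMap.proj (R := ℝ)
    (φ := fun _ : Fin 4 × Fin 4 => ℝ) (d, b))) (f := fun p y => F.mat k y p.1 p.2)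
    (fun p => F.smoothFn_mat hSg hk p.1 p.2) hx c
  simp only [sum_apply, add_apply, smul_apply, ContinuousLinearMap.proj_apply, smul_eq_mul] at h
  refine (F.D_congr (g := fun y => ∑ d, (eta i d b * F.mat k y a d + eta i a d * F.mat k y d b))
    (fun y hy => ?_) hx c).trans (h.trans ?_)
  · rw [F.diamond_vec (hSg.perfect y) hy (h0 y)]
    simp only [Matrix.add_apply, Matrix.mul_apply, ← Finset.sum_add_distrib, mul_comm]
  · simp only [Matrix.add_apply, Matrix.mul_apply, ← Finset.sum_add_distrib, mul_comm, dmat,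
      Matrix.of_apply]

/-- The codifferential of `k ⋄ Σ^i`, in terms of the covariant derivative of `k`. -/
lemma codiff_diamond {k : Ten2 M} (hk : SmoothTen k) (h0 : ∀ y, IsSym0 (val Sg y) (tenB k y))
    (hx : x ∈ W) (i : Fin 3) (a : Fin 4) :
    star3 (val Sg x) (extA (fun y => star2 (val Sg y) (diamond (val Sg y) (tenB k y) i)) x)
        ![F.vec a x] =
      ∑ b, ∑ d, (F.nmat k x b a d * eta i d b + eta i a d * F.nmat k x b d b) := by
  have hP := hSg.perfect x
  have hη : SmoothA (fun y => diamond (val Sg y) (tenB k y) i) W :=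
    (hSg.smooth_diamond hk i).mono W
  have hv := fun b c => F.diamond_vec hP hx (h0 x) i b c
  have e : (fun y => star2 (val Sg y) (diamond (val Sg y) (tenB k y) i)) =
      -fun y => diamond (val Sg y) (tenB k y) i :=
    funext fun y => (hSg.perfect y).star2_diamond (h0 y) i
  have e2 : star3 (val Sg x) ((-extA fun y => diamond (val Sg y) (tenB k y) i) x) =
      -star3 (val Sg x) (extA (fun y => diamond (val Sg y) (tenB k y) i) x) :=
    (star3L (val Sg x)).map_neg _
  rw [e, extA_neg, e2, ContinuousAlternatingMap.neg_apply, F.star3_vec hP hx, neg_neg,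
    F.vec3_pb_map]
  refine vec_diamond (F.connR x) (F.mat k x) (F.dmat k x) (F.mat_transpose (h0 x)) i (fun _ => rfl)
    (F.nmat_symm h0) (F.nmat_three hSg hk h0 hx)
    (Ω := fun a b c => extA (fun y => diamond (val Sg y) (tenB k y) i) x
      ![F.vec a x, F.vec b x, F.vec c x]) (fun a b c => ?_) a
  rw [F.ext_apply hSg hη hx]
  simp only [F.D_diamond hSg hk h0 hx, hv, F.str_eq_conn, F.conn_eq_asdMat hSg hx]

/-- `D₁₂` is carried to the Dirac operator on `S₋ ⊗ (S₋ ⊗ S₊²)`. -/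
theorem spinA_D12 {w : M → Fin 3 → ℝ} {k : Ten2 M} (hw : ∀ i, SmoothFn (fun x => w x i) Set.univ)
    (hk : SmoothTen k) (h0 : ∀ y, IsSym0 (val Sg y) (tenB k y)) (hx : x ∈ W) :
    spinA (fun i => F.comp (D12 Sg w k i) x) = F.diracM F.connW (F.spinField12 w k) x := by
  have e1 : (fun i => F.comp (D12 Sg w k i) x) = fun i a => (F.D (fun y => w y i) x a : ℂ) +
      ∑ b, ∑ d, (((F.nmat k x b).map (↑) : Matrix (Fin 4) (Fin 4) ℂ) a d * (eta i d b : ℂ) +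
        (eta i a d : ℂ) * ((F.nmat k x b).map (↑) : Matrix (Fin 4) (Fin 4) ℂ) d b) := by
    funext i a
    have e2 : D12 Sg w k i x ![F.e a x] = F.D (fun y => w y i) x a +
        star3 (val Sg x) (extA (fun y => star2 (val Sg y) (diamond (val Sg y) (tenB k y) i)) x)
          ![F.vec a x] := rfl
    rw [comp, e2, F.codiff_diamond hSg hk h0 hx]
    push_cast
    simp only [Matrix.map_apply]
  let f : Fin 3 ⊕ Fin 4 × Fin 4 → M → ℝ :=
    Sum.elim (fun i y => w y i) fun p y => F.mat k y p.1 p.2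
  have hf : ∀ j, SmoothFn (f j) W := by
    rintro (i | p)
    exacts [(hw i).mono W, F.smoothFn_mat hSg hk p.1 p.2]
  have e3 : F.spinField12 w k = fun y => spin12L fun j => (f j y : ℂ) := rfl
  have e4 : ∀ c, F.connM x c = spinConn (F.connR x c) := fun c => F.connM_eq hSg hx c
  -- On `S₋ ⊗ S₊²` only the connection of the factor `S₋` is left.
  have e5 : ∀ c, F.connW x c =
      spinConn (F.connR x c) ⊗ₖ (1 : Matrix (Fin 2 × Fin 2) (Fin 2 × Fin 2) ℂ) := fun c => by
    rw [connW, F.connP_eq_zero hSg hx, e4, Matrix.zero_kronecker, Matrix.kronecker_zero, add_zero,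
      Matrix.kronecker_zero, add_zero]
  rw [e1, diracM]
  refine (spinA_symbol _ (fun c => (F.nmat k x c).map Complex.ofReal)
    (fun c a b => congrArg Complex.ofReal (F.nmat_symm h0 c a b)) fun c => ?_).trans ?_
  · simp only [Matrix.map_apply, F.nmat_three hSg hk h0 hx c]
    push_cast
    rfl
  · refine Finset.sum_congr rfl fun c _ => ?_
    have e6 : F.deriv (F.spinField12 w k) x c =
        spin12 (fun i => (F.D (fun y => w y i) x c : ℂ), (F.dmat k x c).map (↑)) := by
      rw [e3, F.deriv_linear spin12L hf hx]
      rfl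
    have e7 : F.spinField12 w k x = spin12 (fun i => (w x i : ℂ), (F.mat k x).map (↑)) := rfl
    rw [e4, e5, add_assoc, e7, spin12_conn, e6, ← spin12_add]
    congr 2
    ext i j
    · simp
    · simp [nmat, Matrix.mul_apply]

end AdaptedFrame

end Fields

end Plebanski

end

theorem mainTheorem3 {M : Type*} [TopologicalSpace M] [T2Space M] [ChartedSpace Plebanski.V4 M]
    [IsManifold (𝓡 4) ∞ M] (Sg : Fin 3 → Plebanski.Form M 2)
    (hSg : Plebanski.IsHyperkahlerTriple Sg) :
    -- the form chosen on `S` is an inner product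
    (∀ x s, Plebanski.MemS (Plebanski.val Sg x) s → s ≠ 0 →
      0 < Plebanski.ipS (Plebanski.val Sg x) s s) ∧
    -- the operators and their formal adjoints
    Plebanski.IsFormalAdjoint Sg (Plebanski.secT Sg) (Plebanski.secS Sg)
      (Plebanski.d1 Sg) (Plebanski.d1s Sg) ∧
    Plebanski.IsFormalAdjoint Sg (Plebanski.secS Sg) (Plebanski.secA Sg)
      (Plebanski.d2 Sg) (Plebanski.d2s Sg) ∧
    Plebanski.IsFormalAdjoint Sg (Plebanski.secA Sg) (Plebanski.secE M)
      (Plebanski.d3 Sg) Plebanski.d3s ∧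
    Plebanski.IsFormalAdjoint Sg (Plebanski.secT Sg) (Plebanski.secS Sg)
      (Plebanski.dt1 Sg) (Plebanski.dt1s Sg) ∧
    Plebanski.IsFormalAdjoint Sg (Plebanski.secA Sg) (Plebanski.secE M)
      (Plebanski.dt3 Sg) (Plebanski.dt3s Sg) ∧
    Plebanski.IsFormalAdjoint Sg (Plebanski.secE M) (Plebanski.secT Sg)
      (Plebanski.dt4 Sg) (Plebanski.dt4s Sg) ∧
    Plebanski.IsFormalAdjoint Sg ((Plebanski.secS Sg).prod (Plebanski.secE M))
      ((Plebanski.secT Sg).prod (Plebanski.secA Sg)) (Plebanski.Dt Sg) (Plebanski.Dts Sg) ∧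
    -- the matrix form of the twisted operator
    (∀ (s : Fin 3 → Plebanski.Form M 2) (χ : M → Fin 3 → ℝ), Plebanski.Dt Sg (s, χ) =
      ((1 / √2 : ℝ) • (Plebanski.d1s Sg s - Plebanski.PhiF Sg (Plebanski.d2 Sg s))
          - Plebanski.PhiF Sg (Plebanski.d3s χ),
        Plebanski.d2 Sg s + (1 / √2 : ℝ) • Plebanski.J1F Sg (Plebanski.d3s χ))) ∧
    -- the linear maps `T₁`, `T₂` and the identification of the components with `S ⊕ E`
    (IsLinearMap ℝ Plebanski.T1 ∧ Function.Bijective Plebanski.T1) ∧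
    (∀ x, IsLinearMap ℝ (Plebanski.T2 (Plebanski.val Sg x)) ∧
      Function.Bijective (Plebanski.T2 (Plebanski.val Sg x))) ∧
    (∀ x, IsLinearMap ℝ (Plebanski.iota (Plebanski.val Sg x)) ∧
      Set.BijOn (Plebanski.iota (Plebanski.val Sg x))
        {q | Plebanski.IsSym0 (Plebanski.val Sg x) q.2.2.2}
        {p | Plebanski.MemS (Plebanski.val Sg x) p.1}) ∧
    -- every smooth section of `S ⊕ E` has smooth components
    (∀ (s : Fin 3 → Plebanski.Form M 2) (χ : M → Fin 3 → ℝ),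
      (∀ i, Plebanski.SmoothForm (s i) Set.univ) →
      (∀ x, Plebanski.MemS (Plebanski.val Sg x) (Plebanski.val s x)) →
      ContMDiff (𝓡 4) 𝓘(ℝ, Fin 3 → ℝ) ∞ χ →
      ∃ (h : M → ℝ) (u w : M → Fin 3 → ℝ) (k : Plebanski.Ten2 M),
        ContMDiff (𝓡 4) 𝓘(ℝ, ℝ) ∞ h ∧
        ContMDiff (𝓡 4) 𝓘(ℝ, Fin 3 → ℝ) ∞ u ∧ ContMDiff (𝓡 4) 𝓘(ℝ, Fin 3 → ℝ) ∞ w ∧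
        Plebanski.SmoothTen k ∧ (∀ x, Plebanski.IsSym0 (Plebanski.val Sg x) (k x)) ∧
        Plebanski.quadField Sg h u w k = (s, χ)) ∧
    -- the square of the twisted operator (it is `Δ` on the fields `T₁(h, u, 0, 0)` and `-Δ` on the
    -- fields `T₁(0, 0, w, k)`), and its splitting
    (∀ (h : M → ℝ) (u w : M → Fin 3 → ℝ) (k : Plebanski.Ten2 M),
      ContMDiff (𝓡 4) 𝓘(ℝ, ℝ) ∞ h →
      ContMDiff (𝓡 4) 𝓘(ℝ, Fin 3 → ℝ) ∞ u → ContMDiff (𝓡 4) 𝓘(ℝ, Fin 3 → ℝ) ∞ w →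
      Plebanski.SmoothTen k → (∀ x, Plebanski.IsSym0 (Plebanski.val Sg x) (k x)) →
      Plebanski.Dts Sg (Plebanski.Dt Sg (Plebanski.quadField Sg h u w k)) =
          Plebanski.Lap Sg (Plebanski.quadField Sg h u (-w) (-k)) ∧
      Plebanski.T2F Sg (Plebanski.Dt Sg (Plebanski.quadField Sg h u w k)) =
          (Plebanski.D4 Sg h u, Plebanski.D12 Sg w k)) ∧
    -- the two blocks are twisted Dirac operators
    Function.Bijective Plebanski.spin4 ∧ Function.Bijective Plebanski.spinV ∧
    Set.BijOn Plebanski.spin12 {p | p.2.IsSymm ∧ p.2.trace = 0} Plebanski.SymLast ∧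
    Set.BijOn Plebanski.spinA Set.univ Plebanski.SymLast ∧
    (∀ x, ∃ W : Set M, x ∈ W ∧ Nonempty (Plebanski.AdaptedFrame Sg W)) ∧
    (∀ (W : Set M) (F : Plebanski.AdaptedFrame Sg W)
      (h : M → ℝ) (u w : M → Fin 3 → ℝ) (k : Plebanski.Ten2 M),
      ContMDiff (𝓡 4) 𝓘(ℝ, ℝ) ∞ h →
      ContMDiff (𝓡 4) 𝓘(ℝ, Fin 3 → ℝ) ∞ u → ContMDiff (𝓡 4) 𝓘(ℝ, Fin 3 → ℝ) ∞ w →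
      Plebanski.SmoothTen k → (∀ x, Plebanski.IsSym0 (Plebanski.val Sg x) (k x)) →
      ∀ x ∈ W,
        Plebanski.spinV (F.comp (Plebanski.D4 Sg h u) x) =
          (-(1 / √2) : ℂ) • F.diracP F.connP (Plebanski.spinField4 h ((-2 : ℝ) • u)) x ∧
        Plebanski.spinA (fun i => F.comp (Plebanski.D12 Sg w k i) x) =
          F.diracM F.connW (F.spinField12 w k) x) := by
  have hs : ∀ {f : M → ℝ}, ContMDiff (𝓡 4) 𝓘(ℝ, ℝ) ∞ f → Plebanski.SmoothFn f Set.univ :=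
    fun hf => (Plebanski.contMDiff_iff_smoothFn _).mp hf
  have hv : ∀ {f : M → Fin 3 → ℝ}, ContMDiff (𝓡 4) 𝓘(ℝ, Fin 3 → ℝ) ∞ f →
      ∀ i, Plebanski.SmoothFn (fun x => f x i) Set.univ :=
    fun hf => (Plebanski.contMDiff_pi_iff _).mp hf
  refine ⟨fun x s _ h0 => (hSg.perfect x).ipS_pos h0, Plebanski.isFormalAdjoint_d1 hSg,
    Plebanski.isFormalAdjoint_d2 hSg, Plebanski.isFormalAdjoint_d3 hSg,
    Plebanski.isFormalAdjoint_dt1 hSg, Plebanski.isFormalAdjoint_dt3 hSg,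
    Plebanski.isFormalAdjoint_dt4 hSg, Plebanski.isFormalAdjoint_Dt hSg,
    fun s χ => Prod.ext (sub_eq_add_neg _ _).symm rfl,
    ⟨Plebanski.isLinearMap_T1, Plebanski.bijective_T1⟩,
    fun x => ⟨Plebanski.isLinearMap_T2 _, (hSg.perfect x).bijective_T2⟩,
    fun x => ⟨Plebanski.isLinearMap_iota _, (hSg.perfect x).bijOn_iota⟩,
    fun s χ => Plebanski.exists_smooth_components hSg,
    fun h u w k hh hu hw hk h0 => ⟨Plebanski.Dts_Dt hSg (hs hh) (hv hu) (hv hw) hk h0,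
      Plebanski.T2F_Dt hSg (hs hh) (hv hu) (hv hw) hk h0⟩,
    Plebanski.bijective_spin4, Plebanski.bijective_spinV, Plebanski.bijOn_spin12,
    Plebanski.bijOn_spinA, Plebanski.exists_adaptedFrame hSg,
    fun W F h u w k hh hu hw hk h0 x hx => ⟨F.spinV_D4 hSg (hs hh) (hv hu) hx,
      F.spinA_D12 hSg (hv hw) hk h0 hx⟩⟩
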